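/- \textbf{Setting.} Let $M$ be a closed (compact, without boundary) smooth 3-manifold with a global frame of smooth vector fields $L_1,L_2,L_3$. Let $\Omega=[0,\infty)\times M$ with coordinate $\tau$ and vector field $\partial_0=\partial_\tau$ along the first factor, $C^\infty=C^\infty(\Omega,\mathbb R)$, and view $C^\infty(M)\subset C^\infty$ as the functions independent of $\tau$. Let $W$ be the free $C^\infty$-module with basis $\theta_0,\dots,\theta_3$, with $\langle\theta_a,\theta_b\rangle=\eta_{ab}$, $\eta=\mathrm{diag}(-1,1,1,1)$. The Lie algebra $\mathrm{CDer}(W)$ of derivations preserving $\langle\cdot,\cdot\rangle$ up to a conformal factor is free with basis $\sigma_0$, $\sigma_i=\sigma_{0i}$, $\sigma_{23},\sigma_{31},\sigma_{12}$ ($C^\infty$-linear, $\sigma_0\theta_a=\theta_a$, $\sigma_{ab}\theta_c=\eta_{bc}\theta_a-\eta_{ac}\theta_b$) and $\partial_0,L_1,L_2,L_3$ (annihilating all $\theta_a$). Below $(i,j,k)$ is always a cyclic permutation of $(1,2,3)$, and $\mathrm{Der}$ is the span of $\partial_0,L_1,L_2,L_3$. Let $\mathcal L=\wedge W\otimes_{C^\infty}\mathrm{CDer}(W)$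 with the bracket $[\omega\delta,\omega'\delta']=\omega\omega'[\delta,\delta']+\omega\delta(\omega')\delta'-\delta'(\omega)\omega'\delta$, and let $\mathcal I\subset\mathcal L$ be the ideal generated over $\wedge W$ by all $\mathrm{Re}\sum_{i,l}(\theta_0\theta_i+\sqrt{-1}\,\theta_j\theta_k)\,S_{il}\,s_l$, where $s_1=\sigma_1+\sqrt{-1}\sigma_{23}$, $s_2=\sigma_2+\sqrt{-1}\sigma_{31}$, $s_3=\sigma_3+\sqrt{-1}\sigma_{12}$ and $S$ is a symmetric traceless complex $3\times3$ matrix. Let $\Phi^1=W$, $\Phi^2=\wedge^2W\oplus\wedge^4W$, $\Phi^3=\wedge^3W$, $\Phi^4=\wedge^4W$; this is a $\wedge W$-module by exterior multiplication, except that $w\in W$ maps $\varphi\in\Phi^1$ to $w\varphi\oplus w\varphi^*$, where $\theta_a\theta_b^*=-\eta_{ab}\theta_0\theta_1\theta_2\theta_3$, and kills the summand $\wedge^4W$ of $\Phi^2$. Write $\underline\omega$ for $\omega\in\wedge W$ viewed in $\Phi$. Then $\mathcal E_\Phi=\mathcal L/\mathcal I\oplus\Phi$ is the graded Lie algebra whose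 bracket is the given one on $\mathcal L/\mathcal I$; the natural action of $\mathrm{CDer}(W)$ on $\Phi^1=W$, extended by $[x,\omega\varphi]=\rho(x)(\omega)\varphi+(-1)^{|x||\omega|}\omega[x,\varphi]$, on $\mathcal L/\mathcal I\times\Phi$, where $\rho$ is the natural action of $\mathcal L/\mathcal I$ on $\wedge W$; and on $\Phi\times\Phi$ the extension, by $[\varphi,\omega\psi]=(-1)^{|\varphi||\omega|}\omega[\varphi,\psi]$ and graded antisymmetry, of $[\varphi,\varphi]=(-6a^pa^q+\eta_{bc}a^ba^c\eta^{pq})\eta^{ij}\theta_i\theta_p\sigma_{jq}$ for $\varphi=a^i\underline{\theta_i}$ (summation over $0,\dots,3$ in this formula only). \textbf{The graded Lie algebra $\mathcal A$.} $\mathcal E_\Phi$ has an $\mathbb N^3$-grading $\bigoplus_\alpha G_\alpha$: each $G_\alpha$ is the free $C^\infty$-module with basis the following elements $e$ and their multiples $\theta_0e$. \begin{itemize} \item $\alpha=000$: $\mathrm{Der}$, $\sigma_0$, $\theta_0\sigma_0+\theta_i\sigma_i$ $(i=1,2,3)$, $\sum_i(\theta_j\theta_k\sigma_{jk}+2\theta_0\theta_i\sigma_i)$,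 $\underline{\theta_0}$. \item $\alpha=2e_i$ ($e_i$ the $i$-th unit vector): $-\theta_i\sigma_{jk}+\theta_j\sigma_{ki}+\theta_k\sigma_{ij}$. \item $\alpha=e_j+e_k$: $\sigma_i$, $\sigma_{jk}$, $\theta_i\mathrm{Der}$, $\theta_0\sigma_i+\theta_i\sigma_0$, $\theta_j\sigma_k+\theta_k\sigma_j$, $\theta_k\sigma_{ki}$, $\theta_j\sigma_{ij}$, $\theta_0\theta_j\sigma_{ij}+\theta_i\theta_j\sigma_j$, $\underline{\theta_i}$. \item $\alpha=2e_i+e_j+e_k$: $\theta_j\sigma_k-\theta_k\sigma_j$, $\theta_j\theta_k\mathrm{Der}$, $\theta_0\theta_j\sigma_k-\theta_0\theta_k\sigma_j-2\theta_j\theta_k\sigma_0$, $\theta_0\theta_j\sigma_k+\theta_0\theta_k\sigma_j-2\theta_i\theta_j\sigma_{ki}$, $\underline{\theta_j\theta_k}$. \item $\alpha=222$: $\sum_i(\theta_0\theta_i\sigma_{jk}-2\theta_j\theta_k\sigma_i)$, $\theta_1\theta_2\theta_3\mathrm{Der}$, $\sum_i\theta_0\theta_j\theta_k\sigma_i+3\theta_1\theta_2\theta_3\sigma_0$,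 $\underline{\theta_1\theta_2\theta_3}$. \end{itemize} The submodules $F_\alpha=\bigoplus_{\beta\le\alpha}G_\beta$ form a graded Lie algebra filtration, $[F_\alpha,F_\beta]\subset F_{\alpha+\beta}$. Let $\mathcal A=\bigoplus_\alpha\mathcal A_\alpha$ be the associated graded algebra: $\mathcal A_\alpha\simeq G_\alpha$ as a module, and the bracket of $x\in\mathcal A_\alpha$ and $y\in\mathcal A_\beta$ is the component in $G_{\alpha+\beta}$ of their bracket in $\mathcal E_\Phi$. Let $\mathcal A^i$ be the part of homological degree $i$ and $\mathcal A_{>0}=\bigoplus_{\alpha\ne0}\mathcal A_\alpha$. For a graded Lie algebra $\mathfrak g$ let $\mathrm{MC}(\mathfrak g)=\{u\in\mathfrak g^1\mid[u,u]=0\}$. Let $\mathcal A_{\mathrm{gauge}}\subset\mathcal A^1$ be the $C^\infty$-submodule of rank 28 spanned by $\underline{\theta_0}$ and, for $i=1,2,3$, by $\theta_0\sigma_0+\theta_i\sigma_i$, $-\theta_i\sigma_{jk}+\theta_j\sigma_{ki}+\theta_k\sigma_{ij}$, $\theta_iL_1,\theta_iL_2,\theta_iL_3$, $\theta_0\sigma_i+\theta_i\sigma_0$,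 $\theta_k\sigma_{ki}$, $\theta_j\sigma_{ij}$, $\underline{\theta_i}$. \textbf{Lemma.} Let $p_0,p_1,p_2,p_3\in C^\infty(M)$ satisfy $3p_0^2=p_2p_3+p_3p_1+p_1p_2$ and let $p_1,p_2,p_3$ be pairwise different at every point of $M$. Set $$\gamma_0=\theta_0\partial_0+p_0\underline{\theta_0}+\sum_{i=1}^3p_i(\theta_0\sigma_0+\theta_i\sigma_i).$$ Let $t=(t_1,\dots,t_m)$ be formal parameters ($m=1$ being the main case), let $n\ge0$, and set $\mathcal A[[t]]^\times=\mathcal A_{>0}+(t)\mathcal A[[t]]$, $\mathcal A_{\mathrm{gauge}}[[t]]^\times=\mathcal A[[t]]^\times\cap\mathcal A_{\mathrm{gauge}}[[t]]$ and $I_n=(t)^{n+1}\mathcal A[[t]]$. Let $\exp(a)$, $a\in\mathcal A^0[[t]]^\times/I_n$, act on $\mathcal A[[t]]/I_n$ as $\sum_r\frac1{r!}[a,-]^r$, a finite sum. Then: \begin{enumerate} \item The transformations $\exp(a)$, $a\in\mathcal A^0[[t]]^\times/I_n$, form a group (Baker--Campbell--Hausdorff), which preserves $\mathrm{MC}(\mathcal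 A[[t]]/I_n)\cap(\gamma_0+\mathcal A[[t]]^\times)/I_n$, and the canonical map $$\mathrm{MC}(\mathcal A[[t]]/I_n)\cap(\gamma_0+\mathcal A_{\mathrm{gauge}}[[t]]^\times)/I_n\;\to\;\frac{\mathrm{MC}(\mathcal A[[t]]/I_n)\cap(\gamma_0+\mathcal A[[t]]^\times)/I_n}{\exp(\mathcal A^0[[t]]^\times/I_n)}$$ is surjective. \item If $n\ge1$ and $x\in\mathrm{MC}(\mathcal A[[t]]/I_n)\cap(\gamma_0+\mathcal A[[t]]^\times)/I_n$ is such that its truncation to terms of order less than $n$ in $t$ lies in $\gamma_0+\mathcal A_{\mathrm{gauge}}[[t]]^\times$, then there is an $a\in(t)^n\mathcal A^0[[t]]/I_n$ such that $\exp(a)$ maps $x$ into $\mathrm{MC}(\mathcal A[[t]]/I_n)\cap(\gamma_0+\mathcal A_{\mathrm{gauge}}[[t]]^\times)/I_n$. \end{enumerate} -/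

import Mathlib

open scoped Manifold ContDiff

namespace BKL

/-! ## The exterior algebra `⋀W` of the free module `W = R θ₀ ⊕ R θ₁ ⊕ R θ₂ ⊕ R θ₃`

`R` plays the role of the ring of smooth functions.  An element of `⋀W` is given by its
coefficients with respect to the basis `θ_S = θ_{i₁} ⋯ θ_{iₘ}`, `S = {i₁ < ⋯ < iₘ}`. -/

section Algebra

variable {R : Type*} [CommRing R] [Algebra ℝ R]

/-- Elements of `⋀W`, as families of coefficients. -/
abbrev Wedge (R : Type*) : Type _ := Finset (Fin 4) → R

/-- The diagonal entries of the conformal inner product `diag(-1,1,1,1)`. -/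
def eta (a : Fin 4) : ℤ := if a = 0 then -1 else 1

/-- The entries `η_{ab}` of the conformal inner product. -/
def eta₂ (a b : Fin 4) : ℤ := if a = b then eta a else 0

/-- The sign with `θ_S θ_T = ± θ_{S ∪ T}` for disjoint `S`, `T`. -/
def shuffleSign (S T : Finset (Fin 4)) : ℤ :=
  (-1) ^ ((S ×ˢ T).filter fun q => q.2 < q.1).card

/-- The product of `⋀W`. -/
def wedge (x y : Wedge R) : Wedge R := fun U =>
  ∑ S ∈ U.powerset, shuffleSign S (U \ S) • (x S * y (U \ S))

/-- The basis element `θ_S`. -/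
def thetaS (S : Finset (Fin 4)) : Wedge R := Pi.single S 1

/-- The generator `θ_a`. -/
def theta (a : Fin 4) : Wedge R := thetaS {a}

/-- The `R`-linear odd derivation of `⋀W` with `θ_b ↦ 1` and `θ_a ↦ 0` for `a ≠ b`. -/
def contract (b : Fin 4) (x : Wedge R) : Wedge R := fun S =>
  if b ∈ S then 0 else ((-1 : ℤ) ^ (S.filter fun i => i < b).card) • x (insert b S)

/-! ## The Lie algebra of conformal derivations

`CDer(W)` is free with basis `σ₀`, `σ_i = σ_{0i}`, `σ_{23}, σ_{31}, σ_{12}` (these are `R`-linear)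
and a basis `D₀, D₁, D₂, D₃` of the derivations of `R`.
The index set `Fin 3 = {0,1,2}` stands for the spatial indices `1,2,3`; the successors
`i + 1`, `i + 2` in `Fin 3` are cyclic. -/

/-- The basis of `CDer(W)`: `scale` is `σ₀`, `boost i` is `σ_{0i}`, `rot i` is `σ_{jk}` for
`(i,j,k)` cyclic, and `vec μ` is `D_μ`. -/
inductive Gen : Type
  | scale : Gen
  | boost (i : Fin 3) : Gen
  | rot (i : Fin 3) : Gen
  | vec (μ : Fin 4) : Gen
  deriving DecidableEq, Fintype

/-- `boost` and `rot` generators are of the form `σ_{ab}`; this is the pair `(a,b)`.  The other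
generators get the dummy value `(0,0)`, with `σ_{00} = 0`. -/
def Gen.pair : Gen → Fin 4 × Fin 4
  | .boost i => (0, i.succ)
  | .rot i => ((i + 1).succ, (i + 2).succ)
  | _ => (0, 0)

/-- `σ_{ab} = -σ_{ba}` for all `a`, `b`, as a combination of the basis. -/
def sigma (a b : Fin 4) : Gen → ℤ
  | .boost i => (if (a, b) = (0, i.succ) then 1 else 0) - (if (b, a) = (0, i.succ) then 1 else 0)
  | .rot i => (if (a, b) = ((i + 1).succ, (i + 2).succ) then 1 else 0)
      - (if (b, a) = ((i + 1).succ, (i + 2).succ) then 1 else 0)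
  | _ => 0

/-- Derivations `D₀, …, D₃` of the ring `R` together with functions `c` that are to satisfy
`[D_μ, D_ν] = ∑ c_{μν}^ρ D_ρ`; see `frame4` for the only instance that is used. -/
structure FrameData (R : Type*) [CommRing R] [Algebra ℝ R] where
  D : Fin 4 → Derivation ℝ R R
  c : Fin 4 → Fin 4 → Fin 4 → R

/-- The action of a basis element of `CDer(W)` on `⋀W` as a derivation of degree zero, with
`σ₀ θ_c = θ_c`, `σ_{ab} θ_c = η_{bc} θ_a - η_{ac} θ_b` and `D_μ θ_c = 0`. -/
def Gen.act (F : FrameData R) : Gen → Wedge R → Wedge R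
  | .scale, x => fun S => S.card • x S
  | .vec μ, x => fun S => F.D μ (x S)
  | g, x => eta g.pair.2 • wedge (theta g.pair.1) (contract g.pair.2 x)
      - eta g.pair.1 • wedge (theta g.pair.2) (contract g.pair.1 x)

/-- The commutator of two basis elements of `CDer(W)`, with
`[σ_{ab}, σ_{cd}] = η_{bc} σ_{ad} - η_{ac} σ_{bd} - η_{bd} σ_{ac} + η_{ad} σ_{bc}`. -/
def Gen.comm (F : FrameData R) : Gen → Gen → Gen → R
  | .vec μ, .vec ν, .vec ρ => F.c μ ν ρ
  | .vec _, _, _ => 0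
  | _, .vec _, _ => 0
  | g, h, k =>
      ((eta₂ g.pair.2 h.pair.1 * sigma g.pair.1 h.pair.2 k
        - eta₂ g.pair.1 h.pair.1 * sigma g.pair.2 h.pair.2 k
        - eta₂ g.pair.2 h.pair.2 * sigma g.pair.1 h.pair.1 k
        + eta₂ g.pair.1 h.pair.2 * sigma g.pair.2 h.pair.1 k : ℤ) : R)

/-! ## The graded Lie algebra `𝓛 = ⋀W ⊗ CDer(W)` -/

/-- Elements `∑_g ω_g g` of `⋀W ⊗ CDer(W)`, given by the coefficients `ω_g ∈ ⋀W`. -/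
abbrev Lie (R : Type*) : Type _ := Gen → Wedge R

/-- The element `ω g` of `⋀W ⊗ CDer(W)`. -/
def mon (x : Wedge R) (g : Gen) : Lie R := Pi.single g x

/-- The bracket
`[ω δ, ω' δ'] = ω ω' [δ, δ'] + ω δ(ω') δ' - δ'(ω) ω' δ`. -/
def lieBr (F : FrameData R) (X Y : Lie R) : Lie R := fun k =>
  (∑ g, ∑ h, g.comm F h k • wedge (X g) (Y h))
    + (∑ g, wedge (X g) (g.act F (Y k)))
    - ∑ h, wedge (h.act F (X k)) (Y h)

/-- `Re (aᵀ S s)` with `a_i = θ₀ θ_i + √-1 θ_j θ_k`, `s_i = σ_i + √-1 σ_{jk}`, `(i,j,k)` cyclic. -/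
noncomputable def weyl (S : Matrix (Fin 3) (Fin 3) ℂ) : Lie R :=
  ∑ i : Fin 3, ∑ l : Fin 3,
    ((S i l).re • (mon (wedge (theta 0) (theta i.succ)) (.boost l)
        - mon (wedge (theta (i + 1).succ) (theta (i + 2).succ)) (.rot l))
      - (S i l).im • (mon (wedge (theta 0) (theta i.succ)) (.rot l)
        + mon (wedge (theta (i + 1).succ) (theta (i + 2).succ)) (.boost l)))

/-! ## The scalar field module `Φ`

`Φ¹ = W`, `Φ² = ⋀²W ⊕ ⋀⁴W`, `Φ³ = ⋀³W`, `Φ⁴ = ⋀⁴W`. -/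

/-- An element of `Φ`: the coefficients of the basis `θ_S`, `S ≠ ∅`, of `⋀¹W, …, ⋀⁴W`, and
the coefficient of the basis element of the additional summand `⋀⁴W` of `Φ²`. -/
abbrev Phi (R : Type*) : Type _ := ({S : Finset (Fin 4) // S.Nonempty} → R) × R

/-- The part of an element of `Φ` in `⋀¹W ⊕ ⋯ ⊕ ⋀⁴W`. -/
def Phi.main (f : Phi R) : Wedge R := fun S => if h : S.Nonempty then f.1 ⟨S, h⟩ else 0

/-- Multiplication `⋀W × Φ → Φ`.  A one-form `w` maps `φ ∈ Φ¹` to `wφ ⊕ wφ*`, where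
`θ_a θ_b* = -η_{ab} θ₀θ₁θ₂θ₃`, and it annihilates the additional summand of `Φ²`. -/
def Phi.smul (x : Wedge R) (f : Phi R) : Phi R :=
  (fun S => wedge x f.main S,
    x ∅ * f.2 - ∑ a, eta a • (x {a} * f.main {a}))

/-- The action of a basis element of `CDer(W)` on `Φ`; `σ₀` acts on the additional summand of
`Φ²` as multiplication by `2`. -/
def Gen.actPhi (F : FrameData R) (g : Gen) (f : Phi R) : Phi R :=
  (fun S => g.act F f.main S,
    match g with
    | .scale => 2 * f.2
    | .vec μ => F.D μ f.2
    | _ => 0)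

/-- The action of `⋀W ⊗ CDer(W)` on `Φ`. -/
def lieAct (F : FrameData R) (X : Lie R) (f : Phi R) : Phi R :=
  ∑ g, Phi.smul (X g) (g.actPhi F f)

/-- The symmetric bilinear map `Φ¹ × Φ¹ → 𝓛²` with
`[φ, φ] = (-6 a^p a^q + η_{bc} a^b a^c η^{pq}) η^{ij} θ_i θ_p σ_{jq}` for `φ = a^i θ_i`. -/
def phiBr₁₁ (a b : Fin 4 → R) : Lie R := fun g =>
  ∑ i, ∑ p, ∑ q, (eta i * sigma i q g) •
    ((-3 * (a p * b q + a q * b p) + eta₂ p q • ∑ r, eta r • (a r * b r))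
      • wedge (theta i) (theta p))

/-- The map `Φ¹ × Φ² → 𝓛³`, determined by `[φ, wψ] = -w [φ, ψ]` for `w ∈ W` and `φ, ψ ∈ Φ¹`;
note that `θ_b · θ_c = θ_b θ_c ⊕ 0` for `b ≠ c`, and that `θ₀ · θ₀` is the basis element of the
additional summand of `Φ²`. -/
def phiBr₁₂ (a : Fin 4 → R) (f : Phi R) : Lie R := fun g =>
  - (∑ b, ∑ c, if b < c then
      f.main {b, c} • wedge (theta b) (phiBr₁₁ a (Pi.single c 1) g) else 0)
    - f.2 • wedge (theta 0) (phiBr₁₁ a (Pi.single 0 1) g)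

/-- The component of an element of `Φ` in `Φ¹ = W`. -/
def Phi.one (f : Phi R) : Fin 4 → R := fun a => f.main {a}

/-- The bracket `Φ × Φ → 𝓛`; only `Φ¹ × Φ¹`, `Φ¹ × Φ²` and `Φ² × Φ¹` contribute. -/
def phiBr (f h : Phi R) : Lie R :=
  phiBr₁₁ f.one h.one + phiBr₁₂ f.one h - phiBr₁₂ h.one f

/-! ## The graded Lie algebra `𝓔_Φ = 𝓛 / 𝓘 ⊕ Φ` -/

/-- `𝓛 ⊕ Φ`; the graded Lie algebra `𝓔_Φ` is the quotient of this by `ideal`. -/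
abbrev V (R : Type*) : Type _ := Lie R × Phi R

/-- The element `(-1)^{|X|} X`. -/
def Lie.parity (X : Lie R) : Lie R := fun g S => ((-1 : ℤ) ^ S.card) • X g S

/-- The part of even degree. -/
def Phi.even (f : Phi R) : Phi R := (fun S => if Even S.1.card then f.1 S else 0, f.2)

/-- The part of odd degree. -/
def Phi.odd (f : Phi R) : Phi R := (fun S => if Even S.1.card then 0 else f.1 S, 0)

/-- The bracket, where `[φ, X] = -(-1)^{|φ||X|} [X, φ]` for `φ ∈ Φ` and `X ∈ 𝓛`. -/
def vBr (F : FrameData R) (x y : V R) : V R :=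
  (lieBr F x.1 y.1 + phiBr x.2 y.2,
    lieAct F x.1 y.2 - lieAct F y.1 x.2.even - lieAct F y.1.parity x.2.odd)

/-- Multiplication by elements of `⋀W`. -/
def vSMul (x : Wedge R) (v : V R) : V R := (fun g => wedge x (v.1 g), Phi.smul x v.2)

variable (R) in
/-- The ideal `𝓘 = (⋀W) 𝓘²`, where `𝓘²` is generated by the `weyl S`, for symmetric traceless
complex matrices `S`. -/
noncomputable def ideal : Submodule R (V R) :=
  Submodule.span R {v | ∃ (T : Finset (Fin 4)) (S : Matrix (Fin 3) (Fin 3) ℂ),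
    S.IsSymm ∧ S.trace = 0 ∧ v = vSMul (thetaS T) (weyl S, 0)}

/-! ## The `ℕ³`-grading

`𝓔_Φ` is free with basis the elements `e` and `θ₀ e`, where `e` runs over the table below. -/

/-- Names of the elements of the table.  For `i : Fin 3`, the triple `(i,j,k)` is cyclic. -/
inductive Row : Type
  /-- `θ_S D_μ` for `S ⊆ {1,2,3}` -/
  | vec (S : Finset (Fin 3)) (μ : Fin 4) : Row
  /-- `σ₀` -/
  | scale : Row
  /-- `θ₀σ₀ + θ_iσ_i` -/
  | kasner (i : Fin 3) : Row
  /-- `θ₂θ₃σ₂₃ + θ₃θ₁σ₃₁ + θ₁θ₂σ₁₂ + 2θ₀θ₁σ₁ + 2θ₀θ₂σ₂ + 2θ₀θ₃σ₃` -/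
  | curv : Row
  /-- `-θ_iσ_{jk} + θ_jσ_{ki} + θ_kσ_{ij}` -/
  | bianchi (i : Fin 3) : Row
  /-- `σ_i` -/
  | boost (i : Fin 3) : Row
  /-- `σ_{jk}` -/
  | rot (i : Fin 3) : Row
  /-- `θ₀σ_i + θ_iσ₀` -/
  | mix (i : Fin 3) : Row
  /-- `θ_jσ_k + θ_kσ_j` -/
  | sym (i : Fin 3) : Row
  /-- `θ_kσ_{ki}` -/
  | rotA (i : Fin 3) : Row
  /-- `θ_jσ_{ij}` -/
  | rotB (i : Fin 3) : Row
  /-- `θ₀θ_jσ_{ij} + θ_iθ_jσ_j` -/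
  | curvA (i : Fin 3) : Row
  /-- `θ_jσ_k - θ_kσ_j` -/
  | asym (i : Fin 3) : Row
  /-- `θ₀θ_jσ_k - θ₀θ_kσ_j - 2θ_jθ_kσ₀` -/
  | curvB (i : Fin 3) : Row
  /-- `θ₀θ_jσ_k + θ₀θ_kσ_j - 2θ_iθ_jσ_{ki}` -/
  | curvC (i : Fin 3) : Row
  /-- `θ₀θ₁σ₂₃ + θ₀θ₂σ₃₁ + θ₀θ₃σ₁₂ - 2θ₂θ₃σ₁ - 2θ₃θ₁σ₂ - 2θ₁θ₂σ₃` -/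
  | curvD : Row
  /-- `θ₀θ₂θ₃σ₁ + θ₀θ₃θ₁σ₂ + θ₀θ₁θ₂σ₃ + 3θ₁θ₂θ₃σ₀` -/
  | top : Row
  /-- The element `θ_S` of `Φ` for nonempty `S ⊆ {1,2,3}`, and the element `θ₀` of `Φ` for
  `S = ∅` -/
  | scalar (S : Finset (Fin 3)) : Row
  deriving DecidableEq, Fintype

/-- The spatial generators `θ_i`. -/
def th (i : Fin 3) : Wedge R := theta i.succ

/-- The elements of the table. -/
def Row.elt : Row → V R
  | .vec S μ => (mon (thetaS (S.map (Fin.succEmb 3))) (.vec μ), 0)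
  | .scale => (mon (thetaS ∅) .scale, 0)
  | .kasner i => (mon (theta 0) .scale + mon (th i) (.boost i), 0)
  | .curv => (∑ i : Fin 3, (mon (wedge (th (i + 1)) (th (i + 2))) (.rot i)
      + 2 • mon (wedge (theta 0) (th i)) (.boost i)), 0)
  | .bianchi i => (- mon (th i) (.rot i) + mon (th (i + 1)) (.rot (i + 1))
      + mon (th (i + 2)) (.rot (i + 2)), 0)
  | .boost i => (mon (thetaS ∅) (.boost i), 0)
  | .rot i => (mon (thetaS ∅) (.rot i), 0)
  | .mix i => (mon (theta 0) (.boost i) + mon (th i) .scale, 0)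
  | .sym i => (mon (th (i + 1)) (.boost (i + 2)) + mon (th (i + 2)) (.boost (i + 1)), 0)
  | .rotA i => (mon (th (i + 2)) (.rot (i + 1)), 0)
  | .rotB i => (mon (th (i + 1)) (.rot (i + 2)), 0)
  | .curvA i => (mon (wedge (theta 0) (th (i + 1))) (.rot (i + 2))
      + mon (wedge (th i) (th (i + 1))) (.boost (i + 1)), 0)
  | .asym i => (mon (th (i + 1)) (.boost (i + 2)) - mon (th (i + 2)) (.boost (i + 1)), 0)
  | .curvB i => (mon (wedge (theta 0) (th (i + 1))) (.boost (i + 2))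
      - mon (wedge (theta 0) (th (i + 2))) (.boost (i + 1))
      - 2 • mon (wedge (th (i + 1)) (th (i + 2))) .scale, 0)
  | .curvC i => (mon (wedge (theta 0) (th (i + 1))) (.boost (i + 2))
      + mon (wedge (theta 0) (th (i + 2))) (.boost (i + 1))
      - 2 • mon (wedge (th i) (th (i + 1))) (.rot (i + 1)), 0)
  | .curvD => (∑ i : Fin 3, (mon (wedge (theta 0) (th i)) (.rot i)
      - 2 • mon (wedge (th (i + 1)) (th (i + 2))) (.boost i)), 0)
  | .top => ((∑ i : Fin 3, mon (wedge (theta 0) (wedge (th (i + 1)) (th (i + 2)))) (.boost i))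
      + 3 • mon (thetaS {1, 2, 3}) .scale, 0)
  | .scalar S => (0, (fun T =>
      if T.1 = (if S = ∅ then {0} else S.map (Fin.succEmb 3)) then 1 else 0, 0))

/-- The degrees `011, 101, 110` for `i = 1, 2, 3`. -/
def edge (i : Fin 3) : Fin 3 → ℕ := fun l => if l = i then 0 else 1

/-- The `ℕ³`-degree of the elements of the table. -/
def Row.deg : Row → Fin 3 → ℕ
  | .vec S _ => ∑ i ∈ S, edge i
  | .scalar S => ∑ i ∈ S, edge i
  | .scale => 0
  | .kasner _ => 0
  | .curv => 0
  | .bianchi i => Pi.single i 2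
  | .boost i => edge i
  | .rot i => edge i
  | .mix i => edge i
  | .sym i => edge i
  | .rotA i => edge i
  | .rotB i => edge i
  | .curvA i => edge i
  | .asym i => edge (i + 1) + edge (i + 2)
  | .curvB i => edge (i + 1) + edge (i + 2)
  | .curvC i => edge (i + 1) + edge (i + 2)
  | .curvD => fun _ => 2
  | .top => fun _ => 2

/-- The homological degree of the elements of the table. -/
def Row.hdeg : Row → ℕ
  | .vec S _ => S.card
  | .scalar S => if S = ∅ then 1 else S.card
  | .scale => 0
  | .boost _ => 0
  | .rot _ => 0
  | .kasner _ => 1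
  | .bianchi _ => 1
  | .mix _ => 1
  | .sym _ => 1
  | .rotA _ => 1
  | .rotB _ => 1
  | .asym _ => 1
  | .curv => 2
  | .curvA _ => 2
  | .curvB _ => 2
  | .curvC _ => 2
  | .curvD => 2
  | .top => 3

/-- Index set of the basis of `𝓔_Φ`: `(false, r)` stands for the table element `e` with name `r`,
and `(true, r)` stands for `θ₀ e`. -/
abbrev Idx : Type := Bool × Row

/-- The basis of `𝓔_Φ`, as elements of `𝓛 ⊕ Φ`. -/
def Idx.elt (b : Idx) : V R := if b.1 then vSMul (theta 0) b.2.elt else b.2.elt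

/-- The `ℕ³`-degree. -/
def Idx.deg (b : Idx) : Fin 3 → ℕ := b.2.deg

/-- The homological degree. -/
def Idx.hdeg (b : Idx) : ℕ := b.2.hdeg + (if b.1 then 1 else 0)

/-- The coefficients of an element of `𝓔_Φ = (𝓛 ⊕ Φ) / 𝓘` with respect to the basis: they are
determined by `v - ∑ c_b b ∈ 𝓘`. -/
noncomputable def coords (v : V R) : Idx → R :=
  Classical.epsilon fun c => v - ∑ b, c b • (b.elt : V R) ∈ ideal R

/-! ## The associated graded algebra `𝓐` of the filtration

The filtration is `F_α = ⨁_{β ≤ α} G_β`, where `G_β` is spanned by the basis elements of degree `β`.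
It satisfies `[F_α, F_β] ⊆ F_{α+β}`.
Hence the associated graded algebra is `𝓐 = ⨁_α G_α` as a module, and the bracket of `x ∈ G_α` and
`y ∈ G_β` in `𝓐` is the component in `G_{α+β}` of their bracket in `𝓔_Φ`. -/

/-- The elements of `𝓐`, given by their coefficients with respect to the basis. -/
abbrev A (R : Type*) : Type _ := Idx → R

/-- The component in `G_α`, as an element of `𝓛 ⊕ Φ`. -/
def component (α : Fin 3 → ℕ) (x : A R) : V R :=
  ∑ b : Idx, if b.deg = α then x b • (b.elt : V R) else 0

/-- The bracket of `𝓐`. -/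
noncomputable def aBr (F : FrameData R) (x y : A R) : A R := fun b =>
  ∑ α ∈ Finset.Iic b.deg, coords (vBr F (component α x) (component (b.deg - α) y)) b

/-- `x ∈ 𝓐^i`. -/
def IsHomological (i : ℕ) (x : A R) : Prop := ∀ b : Idx, b.hdeg ≠ i → x b = 0

/-- `x ∈ 𝓐_{>0} = ⨁_{α ≠ 0} 𝓐_α`. -/
def IsPositive (x : A R) : Prop := ∀ b : Idx, b.deg = 0 → x b = 0

/-- The basis of the submodule `𝓐_gauge` of `𝓐¹`. -/
def Row.IsGauge : Row → Prop
  | .kasner _ => True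
  | .scalar S => S.card ≤ 1
  | .bianchi _ => True
  | .vec S μ => S.card = 1 ∧ μ ≠ 0
  | .mix _ => True
  | .rotA _ => True
  | .rotB _ => True
  | _ => False

/-- `x ∈ 𝓐_gauge`. -/
def IsGauge (x : A R) : Prop := ∀ b : Idx, ¬ (b.1 = false ∧ b.2.IsGauge) → x b = 0

/-! ## Truncated formal power series `𝓐[[t]]/I_n` in `m` parameters

`t = (t₁, …, t_m)` and `I_n = (t)^{n+1} 𝓐[[t]]`. -/

/-- The elements of `𝓐[[t]]/I_n`, given by the coefficients of `t^k`, `|k| ≤ n`. -/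
abbrev Ser (R : Type*) (m n : ℕ) : Type _ := {k : Fin m →₀ ℕ // k.degree ≤ n} → A R

variable {m n : ℕ}

/-- The coefficient of `t^k`. -/
noncomputable def Ser.coeff (x : Ser R m n) (k : Fin m →₀ ℕ) : A R := if h : k.degree ≤ n then x ⟨k, h⟩ else 0

/-- The bracket of `𝓐[[t]]/I_n`. -/
noncomputable def serBr (F : FrameData R) (x y : Ser R m n) : Ser R m n := fun k =>
  ∑ q ∈ Finset.HasAntidiagonal.antidiagonal k.1, aBr F (x.coeff q.1) (y.coeff q.2)

/-- The Maurer-Cartan elements: `x` has homological degree one and `[x, x] = 0`. -/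
def IsMC (F : FrameData R) (x : Ser R m n) : Prop :=
  (∀ k, IsHomological 1 (x k)) ∧ serBr F x x = 0

/-- `exp(a)` acts as `x ↦ ∑_j (1/j!) [a, [a, …, [a, x]]]`.  For `a ∈ 𝓐[[t]]^×/I_n` only finitely
many terms are nonzero. -/
noncomputable def serExp (F : FrameData R) (a x : Ser R m n) : Ser R m n :=
  ∑ᶠ j : ℕ, ((j.factorial : ℝ)⁻¹) • (serBr F a)^[j] x

/-- `x ∈ 𝓐[[t]]^×/I_n`, where `𝓐[[t]]^× = 𝓐_{>0} + t 𝓐[[t]]`. -/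
def Ser.IsNil (x : Ser R m n) : Prop := IsPositive (x.coeff 0)

/-- `a ∈ 𝓐⁰[[t]]^×/I_n`. -/
def Ser.IsGaugeParameter (a : Ser R m n) : Prop := (∀ k, IsHomological 0 (a k)) ∧ a.IsNil

/-- `a ∈ (t)^n 𝓐⁰[[t]]/I_n`. -/
def Ser.IsTopGaugeParameter (a : Ser R m n) : Prop :=
  (∀ k, IsHomological 0 (a k)) ∧ ∀ k, k.1.degree < n → a k = 0

/-- An element of `𝓐` as a constant power series. -/
def Ser.const (x : A R) : Ser R m n := fun k => if k.1 = 0 then x else 0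

/-- The set `MC(𝓐[[t]]/I_n) ∩ (γ₀ + 𝓐[[t]]^×)/I_n`. -/
def mcSet (F : FrameData R) (γ₀ : A R) (m n : ℕ) : Set (Ser R m n) :=
  {x | IsMC F x ∧ (x - Ser.const γ₀).IsNil}

/-- The set `MC(𝓐[[t]]/I_n) ∩ (γ₀ + 𝓐_gauge[[t]]^×)/I_n`, where
`𝓐_gauge[[t]]^× = 𝓐[[t]]^× ∩ 𝓐_gauge[[t]]`. -/
def gaugedSet (F : FrameData R) (γ₀ : A R) (m n : ℕ) : Set (Ser R m n) :=
  {x | x ∈ mcSet F γ₀ m n ∧ ∀ k, IsGauge ((x - Ser.const γ₀ : Ser R m n) k)}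

/-- The element `γ₀ = θ₀D₀ + p₀ θ₀ + ∑ p_i (θ₀σ₀ + θ_iσ_i)` of `𝓐`; the second summand is in
`Φ`. -/
def gamma0 (p₀ : R) (p : Fin 3 → R) : A R
  | (true, .vec S μ) => if S = ∅ ∧ μ = 0 then 1 else 0
  | (false, .scalar S) => if S = ∅ then p₀ else 0
  | (false, .kasner i) => p i
  | _ => 0

end Algebra

/-! ## The smooth functions on `Ω = [0,∞) × M` and the frame `∂₀, L₁, L₂, L₃` -/

section Geometry

/-- The Euclidean model space of a three dimensional manifold. -/
abbrev E3 : Type := EuclideanSpace ℝ (Fin 3)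

/-- The half line `[0,∞)`, with its structure of a manifold with boundary. -/
abbrev HalfLine : Type := EuclideanHalfSpace 1

/-- The model with corners of `Ω = [0,∞) × M`. -/
noncomputable abbrev IΩ :
    ModelWithCorners ℝ (EuclideanSpace ℝ (Fin 1) × E3) (ModelProd HalfLine E3) :=
  (𝓡∂ 1).prod (𝓡 3)

variable (M : Type*) [TopologicalSpace M] [ChartedSpace E3 M]

/-- The ring `C^∞(M)`. -/
abbrev SmoothM : Type _ := C^∞⟮𝓡 3, M; ℝ⟯

/-- The ring `C^∞(Ω)`, `Ω = [0,∞) × M`. -/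
abbrev SmoothΩ : Type _ := C^∞⟮IΩ, HalfLine × M; ℝ⟯

variable [IsManifold (𝓡 3) ∞ M]

/-- A frame of smooth vector fields `L₁, L₂, L₃` on `M`. -/
structure Frame where
  L : Fin 3 → (x : M) → TangentSpace (𝓡 3) x
  smooth : ∀ i, ContMDiff (𝓡 3) (𝓡 3).tangent ∞ fun x => (⟨x, L i x⟩ : TangentBundle (𝓡 3) M)
  linearIndependent : ∀ x, LinearIndependent ℝ fun i => L i x

variable {M}

/-- The injection `C^∞(M) → C^∞(Ω)`. -/
noncomputable def pullback (f : SmoothM M) : SmoothΩ M := f.comp ⟨Prod.snd, contMDiff_snd⟩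

/-- The derivative of a smooth function along a smooth vector field on `Ω`. -/
noncomputable def lieDeriv (X : (q : HalfLine × M) → TangentSpace IΩ q)
    (hX : ContMDiff IΩ IΩ.tangent ∞ fun q => (⟨q, X q⟩ : TangentBundle IΩ (HalfLine × M)))
    (f : SmoothΩ M) : SmoothΩ M :=
  ⟨fun q => mvfderiv IΩ f q (X q), by
    have h := (f.contMDiff.contMDiff_tangentMap (m := ∞) (by simp)).comp hX
    exact (contMDiff_snd_tangentBundle_modelSpace ℝ 𝓘(ℝ, ℝ)).comp h⟩

/-- The derivation of `C^∞(Ω)` given by a smooth vector field on `Ω`. -/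
noncomputable def vectorFieldDerivation (X : (q : HalfLine × M) → TangentSpace IΩ q)
    (hX : ContMDiff IΩ IΩ.tangent ∞ fun q => (⟨q, X q⟩ : TangentBundle IΩ (HalfLine × M))) :
    Derivation ℝ (SmoothΩ M) (SmoothΩ M) :=
  Derivation.mk'
    { toFun := lieDeriv X hX
      map_add' := fun f g => by
        ext q
        have hf := f.contMDiff.mdifferentiableAt (x := q) (by simp)
        have hg := g.contMDiff.mdifferentiableAt (x := q) (by simp)
        have := congrArg (fun T => T (X q)) (mvfderiv_add hf hg)
        exact this
      map_smul' := fun r f => by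
        ext q
        have hf := f.contMDiff.mdifferentiableAt (x := q) (by simp)
        have h := mvfderiv_smul (I := IΩ) (a := fun _ : HalfLine × M => r) (x := q)
          mdifferentiableAt_const hf
        rw [mvfderiv_const] at h
        have h' := congrArg (fun T => T (X q)) h
        have h'' : mvfderiv IΩ ((fun _ : HalfLine × M => r) • ⇑f) q (X q)
            = r • mvfderiv IΩ f q (X q) := by
          refine h'.trans ?_
          simp
        exact h'' }
    fun f g => by
      ext q
      have hf := f.contMDiff.mdifferentiableAt (x := q) (by simp)
      have hg := g.contMDiff.mdifferentiableAt (x := q) (by simp)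
      have := congrArg (fun T => T (X q)) (mvfderiv_mul hf hg)
      exact this

/-- The vector field `∂₀` along the first factor of `Ω`. -/
noncomputable def timeField (q : HalfLine × M) : TangentSpace IΩ q :=
  ((EuclideanSpace.single 0 1 : EuclideanSpace ℝ (Fin 1)), (0 : E3))

/-- A vector field on `M`, viewed as a vector field on `Ω`. -/
noncomputable def spaceField (X : (x : M) → TangentSpace (𝓡 3) x) (q : HalfLine × M) :
    TangentSpace IΩ q :=
  ((0 : EuclideanSpace ℝ (Fin 1)), (X q.2 : E3))

theorem contMDiff_timeField :
    ContMDiff IΩ IΩ.tangent ∞ fun q => (⟨q, timeField q⟩ : TangentBundle IΩ (HalfLine × M)) := by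
  have h1 : ContMDiff (𝓡∂ 1) (𝓡∂ 1).tangent ∞ fun s : HalfLine =>
      (⟨s, (EuclideanSpace.single 0 1 : EuclideanSpace ℝ (Fin 1))⟩ : TangentBundle (𝓡∂ 1) HalfLine) := by
    intro s
    apply Bundle.contMDiffAt_totalSpace.2
    refine ⟨contMDiffAt_id, ?_⟩
    convert! contMDiffAt_const (c := (EuclideanSpace.single 0 1 : EuclideanSpace ℝ (Fin 1))) with y
    simp
  have h2 : ContMDiff (𝓡 3) (𝓡 3).tangent ∞ fun x : M =>
      (⟨x, 0⟩ : TangentBundle (𝓡 3) M) := Bundle.contMDiff_zeroSection ℝ _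
  exact (contMDiff_equivTangentBundleProd_symm (I := 𝓡∂ 1) (I' := 𝓡 3)).comp
    ((h1.comp contMDiff_fst).prodMk (h2.comp contMDiff_snd))

theorem contMDiff_spaceField {X : (x : M) → TangentSpace (𝓡 3) x}
    (hX : ContMDiff (𝓡 3) (𝓡 3).tangent ∞ fun x => (⟨x, X x⟩ : TangentBundle (𝓡 3) M)) :
    ContMDiff IΩ IΩ.tangent ∞
      fun q => (⟨q, spaceField X q⟩ : TangentBundle IΩ (HalfLine × M)) := by
  have h1 : ContMDiff (𝓡∂ 1) (𝓡∂ 1).tangent ∞ fun s : HalfLine =>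
      (⟨s, 0⟩ : TangentBundle (𝓡∂ 1) HalfLine) := Bundle.contMDiff_zeroSection ℝ _
  exact (contMDiff_equivTangentBundleProd_symm (I := 𝓡∂ 1) (I' := 𝓡 3)).comp
    ((h1.comp contMDiff_fst).prodMk (hX.comp contMDiff_snd))

/-- The basis `L₁(x), L₂(x), L₃(x)` of a tangent space. -/
noncomputable def Frame.basis (L : Frame M) (x : M) :
    Module.Basis (Fin 3) ℝ (TangentSpace (𝓡 3) x) :=
  haveI : FiniteDimensional ℝ (TangentSpace (𝓡 3) x) := inferInstanceAs (FiniteDimensional ℝ E3)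
  basisOfLinearIndependentOfCardEqFinrank (L.linearIndependent x)
    (by rw [show Module.finrank ℝ (TangentSpace (𝓡 3) x) = Module.finrank ℝ E3 from rfl]; simp)

theorem Frame.contMDiff_coord (L : Frame M) {X : (x : M) → TangentSpace (𝓡 3) x}
    (hX : ContMDiff (𝓡 3) (𝓡 3).tangent ∞ fun x => (⟨x, X x⟩ : TangentBundle (𝓡 3) M))
    (k : Fin 3) : ContMDiff (𝓡 3) 𝓘(ℝ, ℝ) ∞ fun x => (L.basis x).repr (X x) k := by
  intro x₀
  let e := trivializationAt E3 (TangentSpace (𝓡 3) : M → Type _) x₀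
  have hx₀ : x₀ ∈ e.baseSet := FiberBundle.mem_baseSet_trivializationAt' x₀
  have key : ∀ {Y : (x : M) → TangentSpace (𝓡 3) x},
      (ContMDiff (𝓡 3) (𝓡 3).tangent ∞ fun x => (⟨x, Y x⟩ : TangentBundle (𝓡 3) M)) →
      ∀ i : Fin 3, ContMDiffAt (𝓡 3) 𝓘(ℝ, ℝ) ∞ (fun x => (e ⟨x, Y x⟩).2 i) x₀ := by
    intro Y hY i
    have h := (Bundle.contMDiffAt_totalSpace.1 (hY x₀)).2
    exact ((EuclideanSpace.proj (𝕜 := ℝ) i).contMDiff.contMDiffAt).comp x₀ h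
  let S : M → Matrix (Fin 3) (Fin 3) ℝ := fun x i j => (e ⟨x, L.L j x⟩).2 i
  let T : M → Fin 3 → ℝ := fun x i => (e ⟨x, X x⟩).2 i
  have hdet : ∀ N : M → Matrix (Fin 3) (Fin 3) ℝ,
      (∀ i j, ContMDiffAt (𝓡 3) 𝓘(ℝ, ℝ) ∞ (fun x => N x i j) x₀) →
      ContMDiffAt (𝓡 3) 𝓘(ℝ, ℝ) ∞ (fun x => (N x).det) x₀ := by
    intro N hN
    simp only [Matrix.det_fin_three]
    have := hN
    exact ((((((hN 0 0).mul (hN 1 1)).mul (hN 2 2)).sub (((hN 0 0).mul (hN 1 2)).mul (hN 2 1))).sub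
      (((hN 0 1).mul (hN 1 0)).mul (hN 2 2))).add (((hN 0 1).mul (hN 1 2)).mul (hN 2 0))).add
      (((hN 0 2).mul (hN 1 0)).mul (hN 2 1)) |>.sub (((hN 0 2).mul (hN 1 1)).mul (hN 2 0))
  have hS : ∀ i j, ContMDiffAt (𝓡 3) 𝓘(ℝ, ℝ) ∞ (fun x => S x i j) x₀ := fun i j =>
    key (L.smooth j) i
  have hT : ∀ i, ContMDiffAt (𝓡 3) 𝓘(ℝ, ℝ) ∞ (fun x => T x i) x₀ := key hX
  have hcr : ContMDiffAt (𝓡 3) 𝓘(ℝ, ℝ) ∞ (fun x => ((S x).updateCol k (T x)).det) x₀ := by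
    refine hdet (fun x => (S x).updateCol k (T x)) fun i j => ?_
    by_cases h : j = k
    · subst h; simpa using hT i
    · simpa [Matrix.updateCol_apply, h] using hS i j
  have hmul : ∀ x ∈ e.baseSet, T x = (S x).mulVec fun j => (L.basis x).repr (X x) j := by
    intro x hx
    have h1 := (L.basis x).sum_repr (X x)
    funext i
    have h2 : (e ⟨x, X x⟩).2 = e.linearEquivAt ℝ x hx (X x) := rfl
    change (e ⟨x, X x⟩).2 i = _
    rw [h2]
    nth_rewrite 1 [← h1]
    rw [map_sum]
    simp only [map_smul, Matrix.mulVec, dotProduct]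
    rw [show (∑ j, (L.basis x).repr (X x) j • (e.linearEquivAt ℝ x hx) ((L.basis x) j)) i =
      ∑ j, ((L.basis x).repr (X x) j • (e.linearEquivAt ℝ x hx) ((L.basis x) j)) i from
      by simp]
    refine Finset.sum_congr rfl fun j _ => ?_
    have h3 : (L.basis x) j = L.L j x := by simp [Frame.basis]
    rw [h3]
    change _ * (e ⟨x, L.L j x⟩).2 i = (e ⟨x, L.L j x⟩).2 i * _
    ring
  have hunit : ∀ x ∈ e.baseSet, (S x).det ≠ 0 := by
    intro x hx
    let b' : Module.Basis (Fin 3) ℝ E3 := (L.basis x).map (e.linearEquivAt ℝ x hx)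
    have h4 : S x = (EuclideanSpace.basisFun (Fin 3) ℝ).toBasis.toMatrix b' := by
      ext i j
      simp only [Module.Basis.toMatrix_apply, b', Module.Basis.map_apply]
      have h3 : (L.basis x) j = L.L j x := by simp [Frame.basis]
      rw [h3]
      simp [S]
    rw [h4]
    exact ((EuclideanSpace.basisFun (Fin 3) ℝ).toBasis.isUnit_det b').ne_zero
  have hq := hcr.div₀ (hdet S hS) (hunit x₀ hx₀)
  refine hq.congr_of_eventuallyEq ?_
  filter_upwards [e.open_baseSet.mem_nhds hx₀] with x hx
  have h5 : (S x).cramer (T x) = (S x).det • fun j => (L.basis x).repr (X x) j := by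
    rw [Matrix.cramer_eq_adjugate_mulVec, hmul x hx, Matrix.mulVec_mulVec,
      Matrix.adjugate_mul, Matrix.smul_mulVec, Matrix.one_mulVec]
  have h6 := congrFun h5 k
  rw [Matrix.cramer_apply] at h6
  simp only [Pi.smul_apply, smul_eq_mul] at h6
  rw [Pi.div_apply, h6, mul_div_cancel_left₀ _ (hunit x hx)]

/-- The structure functions `c_{ij}^k` of a frame, `[L_i, L_j] = ∑ c_{ij}^k L_k`. -/
noncomputable def Frame.structureFun (L : Frame M) (i j k : Fin 3) : SmoothM M :=
  ⟨fun x => (L.basis x).repr (VectorField.mlieBracket (𝓡 3) (L.L i) (L.L j) x) k,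
    L.contMDiff_coord (by
      have : IsManifold (𝓡 3) (((⊤ : ℕ∞) : ℕ∞ω) + 1) M := by simpa
      have : IsManifold (𝓡 3) (minSmoothness ℝ 2) M :=
        IsManifold.of_le (n := ∞) (by simpa using (WithTop.coe_le_coe.2 (le_top : (2 : ℕ∞) ≤ ⊤)))
      exact ContDiff.mlieBracket_vectorField (n := ⊤) (m := ⊤) (L.smooth i) (L.smooth j)
        (by simp)) k⟩

/-- The frame `D₀ = ∂₀`, `D_i = L_i` of `Ω`, with its structure functions: `[L_i, L_j] = ∑ c_{ij}^k L_k`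
and `[∂₀, L_i] = 0`. -/
noncomputable def frame4 (L : Frame M) : FrameData (SmoothΩ M) where
  D := Fin.cases (vectorFieldDerivation timeField contMDiff_timeField)
    fun i => vectorFieldDerivation (spaceField (L.L i)) (contMDiff_spaceField (L.smooth i))
  c := Fin.cases 0 fun i => Fin.cases 0 fun j => Fin.cases 0 fun k =>
    pullback (L.structureFun i j k)

end Geometry

end BKL

/-! Gauge fixing proceeds order by order in t. In 𝓐¹, of rank 48, the submodule 𝓐_gauge of rank 28
has the complement spanned by θ₀σ₀, θ₀D_μ, θ_iD₀, θ_jσ_k + θ_kσ_j (rank 11) and by θ₀σ_i, θ_jσ_k −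
θ_kσ_j, θ₀σ_{jk} (rank 9); γ₀ lies in θ₀D₀ + 𝓐_gauge. The rank 11 part is removed by the 11 gauge
parameters, the rank 9 part then vanishes by the Maurer-Cartan equation.

Gauge parameters (`exists_lorentz`, `exists_reduced`). Let the constant term of x agree with γ₀ in
ℕ³-degree zero. Bracketing it with fσ_{jk} changes the component along θ_jσ_k + θ_kσ_j by (p_k −
p_j) f, and p_k − p_j is invertible because the p_i are pairwise different. Bracketing with fσ_i
changes the component along θ_iD₀ by f. Bracketing with sσ₀ + ∑ u_μD_μ changes the component along
θ₀D_μ by δ_{μ0} s − ∂₀u_μ and, when the component along θ₀σ₀ of the constant term is zero, the one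
along θ₀σ₀ by −∂₀s. So the system is triangular, and what it needs is that ∂₀ is surjective on
C^∞(Ω), which is integration in τ. In order zero the components of ℕ³-degree zero are those of γ₀
from the start, so boosts and rotations suffice there. In order k ≥ 1 a parameter a concentrated in
order k leaves the lower orders alone and adds [a, x₀] to the terms of order k
(`exists_gauge_step`).

Maurer-Cartan equation (`isNormal_of_mem`). After this reduction the components of [x, x] along
θ₀θ_iD₀ and θ_jθ_kD₀ are nonzero multiples of those of x along θ₀σ_i and θ_jσ_k − θ_kσ_j, because
the coefficient of θ₀D₀ is the constant 1. Once these vanish, the component along θ₀(θ_jσ_k +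
θ_kσ_j) is 2 (p_k − p_j) times the component of x along θ₀σ_{jk}, if the lower orders are already
gauged.

Group property (`NilpotentAction.exists_group`). The Baker-Campbell-Hausdorff series is not written
down. Let E multiply by the weight, which is the order in t plus the sum of the ℕ³-degree.
Exponentials of gauge parameters are automorphisms P with P − 1 raising the weight and with PE = EP
− ad(c)P for a gauge parameter c. These properties are stable under products, and conversely they
imply that P is an exponential: its logarithm is found weight by weight, by dividing c by the
weight.

Structure constants. The bracket of 𝓐 is defined by choosing coordinates modulo 𝓘 and projecting to
a degree. Everything is translated into integer tables for monomials and for the basis, and finite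
identities are evaluated by the kernel. The tables contain no functions: the dependence on
coefficients is split off by the product rule for vector fields. Of the Jacobi identity only the
case is used where ad a acts as a derivation with a of homological degree zero (`isDerivOn`), on
pairs whose first entry has degree zero or whose entries both have degree one.

Analysis. The abstract part works over any commutative ℝ-algebra satisfying `GaugeFixable`. For
C^∞(Ω) this requires that smooth functions separate tangent vectors, that mlieBracket computes
commutators of derivations, that parametric integrals are smooth up to the boundary τ = 0, and that
nowhere vanishing functions are invertible. -/

namespace BKL

/-! ## Sparse integer combinations -/

/-- A formal integer combination of symbols, the symbols being encoded by natural numbers. -/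
abbrev Comb : Type := List (ℤ × ℕ)

namespace Comb

section
variable {E E' : Type*} [AddCommGroup E] [AddCommGroup E']

/-- The value of a combination. -/
def eval (l : Comb) (v : ℕ → E) : E := (l.map fun p => p.1 • v p.2).sum

@[simp] theorem eval_nil (v : ℕ → E) : eval [] v = 0 := rfl

@[simp] theorem eval_cons (p : ℤ × ℕ) (l : Comb) (v : ℕ → E) :
    eval (p :: l) v = p.1 • v p.2 + eval l v := by simp [eval]

@[simp] theorem eval_append (l l' : Comb) (v : ℕ → E) :
    eval (l ++ l') v = eval l v + eval l' v := by simp [eval]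

/-- Multiplication by an integer. -/
def scale (c : ℤ) (l : Comb) : Comb := l.map fun p => (c * p.1, p.2)

@[simp] theorem eval_scale (c : ℤ) (l : Comb) (v : ℕ → E) : eval (scale c l) v = c • eval l v := by
  induction l with
  | nil => simp [scale]
  | cons p l ih =>
    simp only [scale, List.map_cons, eval_cons, smul_add, mul_smul] at ih ⊢
    rw [ih]

/-- The linear extension of a map from symbols to combinations. -/
def bind (l : Comb) (f : ℕ → Comb) : Comb := l.flatMap fun p => scale p.1 (f p.2)

@[simp] theorem eval_bind (l : Comb) (f : ℕ → Comb) (v : ℕ → E) :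
    eval (bind l f) v = eval l fun c => eval (f c) v := by
  induction l with
  | nil => simp [bind]
  | cons p l ih => simp only [bind, List.flatMap_cons, eval_append, eval_cons, eval_scale] at ih ⊢
                   rw [ih]

theorem map_eval {F : Type*} [FunLike F E E'] [AddMonoidHomClass F E E'] (φ : F) (l : Comb)
    (v : ℕ → E) : φ (eval l v) = eval l fun c => φ (v c) := by
  induction l with
  | nil => simp
  | cons p l ih => simp [ih]

theorem eval_congr {l : Comb} {v w : ℕ → E} (h : ∀ p ∈ l, v p.2 = w p.2) : eval l v = eval l w := by
  induction l with
  | nil => simp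
  | cons p l ih =>
    rw [eval_cons, eval_cons, h p (by simp), ih fun q hq => h q (by simp [hq])]

theorem eval_smul {S : Type*} [Monoid S] [DistribMulAction S E] (s : S) (l : Comb) (v : ℕ → E) :
    s • eval l v = eval l fun c => s • v c :=
  map_eval (DistribSMul.toAddMonoidHom E s) l v

theorem eval_add (l : Comb) (v w : ℕ → E) : eval l (fun c => v c + w c) = eval l v + eval l w := by
  induction l with
  | nil => simp
  | cons p l ih => simp only [eval_cons, ih, smul_add]; abel

theorem eval_zero (l : Comb) : eval l (fun _ => (0 : E)) = 0 := by
  induction l with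
  | nil => simp
  | cons p l ih => simp [ih]

theorem eval_apply {ι : Type*} {G : ι → Type*} [∀ i, AddCommGroup (G i)] (l : Comb)
    (v : ℕ → ∀ i, G i) (i : ι) : eval l v i = eval l fun c => v c i :=
  map_eval (Pi.evalAddMonoidHom G i) l v

/-- Insertion of a term, merging equal symbols. -/
def insert (p : ℤ × ℕ) : Comb → Comb
  | [] => [p]
  | q :: l => bif q.2.beq p.2 then (q.1 + p.1, q.2) :: l else q :: insert p l

@[simp] theorem eval_insert (p : ℤ × ℕ) (l : Comb) (v : ℕ → E) :
    eval (insert p l) v = p.1 • v p.2 + eval l v := by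
  induction l with
  | nil => simp [insert]
  | cons q l ih =>
    rw [insert]
    cases h : q.2.beq p.2
    · simp only [cond_false, eval_cons, ih]; abel
    · have h' : q.2 = p.2 := Nat.eq_of_beq_eq_true h
      simp only [cond_true, eval_cons, h', add_smul]; abel

/-- Collection of equal symbols, and removal of zeros. -/
def norm (l : Comb) : Comb := (l.foldr insert []).filter fun p => p.1 != 0

theorem eval_filter_ne_zero (l : Comb) (v : ℕ → E) :
    eval (l.filter fun p => p.1 != 0) v = eval l v := by
  induction l with
  | nil => simp
  | cons p l ih =>
    by_cases h : p.1 = 0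
    · simp [h, ih]
    · simp [h, ih]

@[simp] theorem eval_norm (l : Comb) (v : ℕ → E) : eval (norm l) v = eval l v := by
  rw [norm, eval_filter_ne_zero]
  induction l with
  | nil => simp
  | cons p l ih => simp [ih]

/-- A test for equality. -/
def same (l l' : Comb) : Bool := (norm (l ++ scale (-1) l')).isEmpty

/-- The difference of the two combinations normalizes to the empty list. Hence one kernel
computation with integers gives an identity in every abelian group and for every choice of symbols.
-/
theorem eval_eq_of_same {l l' : Comb} (h : same l l' = true) (v : ℕ → E) : eval l v = eval l' v := by
  have h1 := eval_norm (l ++ scale (-1) l') v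
  rw [List.isEmpty_iff.1 h] at h1
  simp only [eval_nil, eval_append, eval_scale, neg_smul, one_smul] at h1
  exact (sub_eq_zero.1 (by rw [sub_eq_add_neg]; exact h1.symm))

end

end Comb

/-! ## Monomials of the exterior algebra, encoded by bit masks -/

/-- The number of elements of the set with a given bit mask. -/
def popc (m : ℕ) : ℕ := m % 2 + m / 2 % 2 + m / 4 % 2 + m / 8 % 2

/-- The subset of `Fin 4` with a given bit mask. -/
def mset (m : ℕ) : Finset (Fin 4) := Finset.univ.filter fun i => m.testBit i

/-- The sign of the product of two monomials. -/
def sgnM (S T : ℕ) : ℤ :=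
  bif ((S / 2 % 2 * popc (T % 2) + S / 4 % 2 * popc (T % 4) + S / 8 % 2 * popc (T % 8)) % 2).beq 0
  then 1 else -1

/-- The product of two monomials. -/
def mulM (S T : ℕ) : Comb := bif (S.land T).beq 0 then [(sgnM S T, S + T)] else []

/-- The contraction of a monomial. -/
def contrM (b T : ℕ) : Comb :=
  bif (T / 2 ^ b % 2).beq 1 then [(bif (popc (T % 2 ^ b) % 2).beq 0 then 1 else -1, T - 2 ^ b)]
  else []

section
variable {R : Type*} [CommRing R]

/-- The monomial with a given bit mask. -/
def tm (R : Type*) [CommRing R] (m : ℕ) : Wedge R := thetaS (mset m)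

theorem wedge_thetaS (S T : Finset (Fin 4)) :
    wedge (thetaS S : Wedge R) (thetaS T)
      = if Disjoint S T then shuffleSign S T • thetaS (S ∪ T) else 0 := by
  funext U
  unfold wedge thetaS
  by_cases hU : Disjoint S T ∧ U = S ∪ T
  · obtain ⟨hd, rfl⟩ := hU
    -- The sum runs over all ways to split U; only the splitting into S and T meets both basis
    -- elements.
    rw [if_pos hd, Finset.sum_eq_single S]
    · have : (S ∪ T) \ S = T := by
        rw [Finset.union_sdiff_left, Finset.sdiff_eq_self_iff_disjoint.2 hd.symm]
      simp [this]
    · intro S' _ hS'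
      simp [Pi.single_apply, hS']
    · intro h
      exact absurd (Finset.mem_powerset.2 Finset.subset_union_left) h
  · rw [Finset.sum_eq_zero]
    · split_ifs with hd
      · have : U ≠ S ∪ T := fun h => hU ⟨hd, h⟩
        simp [this]
      · rfl
    · intro S' hS'
      by_cases h1 : S' = S
      · by_cases h2 : U \ S' = T
        · exfalso
          subst h1 h2
          exact hU ⟨Finset.disjoint_sdiff, (Finset.union_sdiff_of_subset
            (Finset.mem_powerset.1 hS')).symm⟩
        · simp [Pi.single_apply, h2]
      · simp [Pi.single_apply, h1]

/-- All 256 pairs of masks are checked. For disjoint sets the sum of the masks has no carries and is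
therefore the mask of the union. -/
theorem mset_mul : ∀ S : Fin 16, ∀ T : Fin 16,
    (Disjoint (mset S) (mset T) ↔ (Nat.land S T).beq 0 = true) ∧
    ((Nat.land S T).beq 0 = true →
      shuffleSign (mset S) (mset T) = sgnM S T ∧ mset S ∪ mset T = mset (S + T)) := by
  decide +kernel

theorem wedge_tm {S T : ℕ} (hS : S < 16) (hT : T < 16) :
    wedge (tm R S) (tm R T) = (mulM S T).eval (tm R) := by
  obtain ⟨h1, h2⟩ := mset_mul ⟨S, hS⟩ ⟨T, hT⟩
  simp only at h1 h2
  rw [tm, tm, wedge_thetaS, mulM]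
  by_cases h : (Nat.land S T).beq 0 = true
  · rw [if_pos (h1.2 h), h, (h2 h).1, (h2 h).2]
    simp [tm]
  · rw [if_neg (fun h' => h (h1.1 h')), (Bool.not_eq_true _).mp h]
    simp

theorem contract_thetaS (b : Fin 4) (T : Finset (Fin 4)) :
    contract b (thetaS T : Wedge R)
      = if b ∈ T then ((-1 : ℤ) ^ (T.filter fun i => i < b).card) • thetaS (T.erase b) else 0 := by
  funext S
  unfold contract thetaS
  by_cases hb : b ∈ S
  · rw [if_pos hb]
    split_ifs with h
    · have : S ≠ T.erase b := fun h' => by simp [h'] at hb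
      simp [this]
    · rfl
  · rw [if_neg hb]
    by_cases hS : insert b S = T
    · subst hS
      have h1 : (insert b S).erase b = S := Finset.erase_insert hb
      have h2 : (insert b S).filter (fun i => i < b) = S.filter fun i => i < b := by
        rw [Finset.filter_insert]; simp
      simp [h1, h2]
    · have h3 : ¬ (b ∈ T ∧ S = T.erase b) := by
        rintro ⟨h, rfl⟩
        exact hS (Finset.insert_erase h)
      split_ifs with h
      · have : S ≠ T.erase b := fun h' => h3 ⟨h, h'⟩
        simp [hS, this]
      · simp [hS]

theorem mset_contr : ∀ b : Fin 4, ∀ T : Fin 16,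
    (b ∈ mset T ↔ (T.1 / 2 ^ b.1 % 2).beq 1 = true) ∧
    (b ∈ mset T →
      (-1 : ℤ) ^ ((mset T).filter fun i => i < b).card
        = (bif (popc (T % 2 ^ b.1) % 2).beq 0 then 1 else -1) ∧
      (mset T).erase b = mset (T - 2 ^ b.1)) := by
  decide +kernel

theorem contract_tm (b : Fin 4) {T : ℕ} (hT : T < 16) :
    contract b (tm R T) = (contrM b T).eval (tm R) := by
  obtain ⟨h1, h2⟩ := mset_contr b ⟨T, hT⟩
  simp only at h1 h2
  rw [tm, contract_thetaS, contrM]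
  by_cases h : b ∈ mset T
  · rw [if_pos h, h1.1 h, (h2 h).1, (h2 h).2]
    simp [tm]
  · have : (T / 2 ^ b.1 % 2).beq 1 = false := by
      rw [← Bool.not_eq_true]; exact fun h' => h (h1.2 h')
    rw [if_neg h, this]
    simp

theorem theta_eq_tm : ∀ a : Fin 4, (theta a : Wedge R) = tm R (2 ^ a.1) := by
  intro a
  have : ∀ a : Fin 4, ({a} : Finset (Fin 4)) = mset (2 ^ a.1) := by decide +kernel
  rw [theta, this, tm]

theorem wedge_add_left (x y z : Wedge R) : wedge (x + y) z = wedge x z + wedge y z := by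
  funext U; simp [wedge, add_mul, Finset.sum_add_distrib]

theorem wedge_add_right (x y z : Wedge R) : wedge x (y + z) = wedge x y + wedge x z := by
  funext U; simp [wedge, mul_add, Finset.sum_add_distrib]

theorem wedge_smul_left (f : R) (x z : Wedge R) : wedge (f • x) z = f • wedge x z := by
  funext U
  simp only [wedge, Pi.smul_apply, smul_eq_mul, Finset.mul_sum]
  refine Finset.sum_congr rfl fun S _ => ?_
  rw [mul_assoc, mul_smul_comm]

theorem wedge_smul_right (f : R) (x z : Wedge R) : wedge x (f • z) = f • wedge x z := by
  funext U
  simp only [wedge, Pi.smul_apply, smul_eq_mul, Finset.mul_sum]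
  refine Finset.sum_congr rfl fun S _ => ?_
  rw [mul_left_comm, mul_smul_comm]

/-- The product of `⋀W` as a bilinear map. -/
def wedgeₗ : Wedge R →ₗ[R] Wedge R →ₗ[R] Wedge R :=
  LinearMap.mk₂ R wedge wedge_add_left wedge_smul_left wedge_add_right wedge_smul_right

@[simp] theorem wedgeₗ_apply (x y : Wedge R) : wedgeₗ x y = wedge x y := rfl

@[simp] theorem wedge_zero_left (x : Wedge R) : wedge 0 x = 0 := by
  rw [← wedgeₗ_apply, map_zero, LinearMap.zero_apply]

@[simp] theorem wedge_zero_right (x : Wedge R) : wedge x 0 = 0 := by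
  rw [← wedgeₗ_apply, map_zero]

theorem wedge_eval_right (x : Wedge R) (l : Comb) (v : ℕ → Wedge R) :
    wedge x (l.eval v) = l.eval fun c => wedge x (v c) := Comb.map_eval (wedgeₗ x) l v

theorem wedge_eval_left (x : Wedge R) (l : Comb) (v : ℕ → Wedge R) :
    wedge (l.eval v) x = l.eval fun c => wedge (v c) x := Comb.map_eval (wedgeₗ.flip x) l v

/-- Contraction as a linear map. -/
def contractₗ (b : Fin 4) : Wedge R →ₗ[R] Wedge R where
  toFun := contract b
  map_add' x y := by funext S; simp only [contract, Pi.add_apply]; split_ifs <;> simp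
  map_smul' f x := by
    funext S
    simp only [contract, Pi.smul_apply, RingHom.id_apply, smul_eq_mul]
    split_ifs
    · simp
    · rw [mul_smul_comm]

@[simp] theorem contractₗ_apply (b : Fin 4) (x : Wedge R) : contractₗ b x = contract b x := rfl

/-! ## Generators, encoded by numbers -/

/-- The generator with a given code. -/
def gen (μ : Fin 4) : ℕ → Gen
  | 0 => .scale
  | 1 => .boost 0
  | 2 => .boost 1
  | 3 => .boost 2
  | 4 => .rot 0
  | 5 => .rot 1
  | 6 => .rot 2
  | _ => .vec μ

/-- First index of `σ_{ab}`. -/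
def pairA (g : ℕ) : ℕ := bif Nat.ble g 3 then 0 else (g - 3) % 3 + 1

/-- Second index of `σ_{ab}`. -/
def pairB (g : ℕ) : ℕ := bif Nat.ble g 3 then g else (g - 2) % 3 + 1

/-- `η_{aa}`. -/
def etaM (a : ℕ) : ℤ := bif a.beq 0 then -1 else 1

/-- `η_{ab}`. -/
def etaM₂ (a b : ℕ) : ℤ := bif a.beq b then etaM a else 0

/-- The action of a generator on a monomial of `⋀W`. -/
def actM (g T : ℕ) : Comb :=
  bif g.beq 0 then [(popc T, T)] else
  bif Nat.ble 7 g then [] else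
    ((contrM (pairB g) T).bind (mulM (2 ^ pairA g))).scale (etaM (pairB g)) ++
    ((contrM (pairA g) T).bind (mulM (2 ^ pairB g))).scale (- etaM (pairA g))

/-- `σ_{ab}` in terms of generators. -/
def sigM (a b : ℕ) : Comb :=
  bif a.beq b then [] else
  bif a.beq 0 then [(1, b)] else
  bif b.beq 0 then [(-1, a)] else
    [(bif ((b + 3 - a) % 3).beq 1 then 1 else -1, 9 - a - b)]

/-- The commutator of two generators. -/
def commM (g h : ℕ) : Comb :=
  bif g.beq 0 || h.beq 0 || Nat.ble 7 g || Nat.ble 7 h then [] else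
    (sigM (pairA g) (pairB h)).scale (etaM₂ (pairB g) (pairA h)) ++
    (sigM (pairB g) (pairB h)).scale (- etaM₂ (pairA g) (pairA h)) ++
    (sigM (pairA g) (pairA h)).scale (- etaM₂ (pairB g) (pairB h)) ++
    (sigM (pairB g) (pairA h)).scale (etaM₂ (pairA g) (pairB h))

variable [Algebra ℝ R]

/-- The six σ_{ab} are treated uniformly from here on; the definition of the action only unfolds for
concrete generators, so the case distinction is made here once. -/
theorem gen_act_pair (F : FrameData R) (μ : Fin 4) (x : Wedge R) : ∀ g, 1 ≤ g → g < 7 →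
    ∃ a b : Fin 4, a.1 = pairA g ∧ b.1 = pairB g ∧ eta a = etaM (pairA g) ∧
      eta b = etaM (pairB g) ∧
      (gen μ g).act F x = eta b • wedge (theta a) (contract b x)
        - eta a • wedge (theta b) (contract a x) := by
  intro g h1 h2
  interval_cases g
  · exact ⟨0, 1, rfl, rfl, rfl, rfl, rfl⟩
  · exact ⟨0, 2, rfl, rfl, rfl, rfl, rfl⟩
  · exact ⟨0, 3, rfl, rfl, rfl, rfl, rfl⟩
  · exact ⟨2, 3, rfl, rfl, rfl, rfl, rfl⟩
  · exact ⟨3, 1, rfl, rfl, rfl, rfl, rfl⟩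
  · exact ⟨1, 2, rfl, rfl, rfl, rfl, rfl⟩

theorem contrM_lt : ∀ b : Fin 4, ∀ T : Fin 16, ∀ p ∈ contrM b T, p.2 < 16 := by decide +kernel

theorem popc_eq : ∀ T : Fin 16, popc T = (mset T).card := by decide +kernel

theorem gen_act_tm (F : FrameData R) (μ : Fin 4) {g T : ℕ} (hg : g < 7) (hT : T < 16) :
    (gen μ g).act F (tm R T) = (actM g T).eval (tm R) := by
  rcases Nat.eq_zero_or_pos g with rfl | h1
  · have h2 := popc_eq ⟨T, hT⟩
    simp only at h2
    funext S
    have h3 : actM 0 T = [((popc T : ℤ), T)] := rfl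
    simp only [gen, Gen.act, h3, Comb.eval_cons, Comb.eval_nil,
      add_zero, h2, tm, thetaS, Pi.smul_apply, Pi.single_apply]
    split_ifs with h
    · subst h; simp
    · simp
  · obtain ⟨a, b, ha, hb, ea, eb, h⟩ := gen_act_pair F μ (tm R T) g h1 hg
    have e0 : g.beq 0 = false := by
      rw [← Bool.not_eq_true]; intro h; have := Nat.eq_of_beq_eq_true h; omega
    have e7 : Nat.ble 7 g = false := by
      rw [← Bool.not_eq_true]; intro h; have := Nat.le_of_ble_eq_true h; omega
    rw [h, actM, e0, e7, ea, eb, ← ha, ← hb]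
    simp only [cond_false, Comb.eval_append, Comb.eval_scale, Comb.eval_bind, neg_smul,
      sub_eq_add_neg, theta_eq_tm, contract_tm _ hT, wedge_eval_right]
    have hw : ∀ a b : Fin 4, ((contrM b T).eval fun c => wedge (tm R (2 ^ a.1)) (tm R c))
        = (contrM b T).eval fun c => (mulM (2 ^ a.1) c).eval (tm R) := fun a b =>
      Comb.eval_congr fun p hp => wedge_tm (Nat.pow_lt_pow_right (by norm_num) a.2)
        (contrM_lt b ⟨T, hT⟩ p hp)
    rw [hw, hw]

theorem gen_act_smul (F : FrameData R) (μ : Fin 4) {g : ℕ} (hg : g < 7) (f : R) (x : Wedge R) :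
    (gen μ g).act F (f • x) = f • (gen μ g).act F x := by
  rcases Nat.eq_zero_or_pos g with rfl | h1
  · funext S
    simp [gen, Gen.act, mul_left_comm]
  · obtain ⟨a, b, ha, hb, ea, eb, h⟩ := gen_act_pair F μ (f • x) g h1 hg
    obtain ⟨a', b', ha', hb', ea', eb', h'⟩ := gen_act_pair F μ x g h1 hg
    obtain rfl : a = a' := Fin.ext (ha.trans ha'.symm)
    obtain rfl : b = b' := Fin.ext (hb.trans hb'.symm)
    rw [h, h']
    simp only [← wedgeₗ_apply, ← contractₗ_apply, map_smul, smul_sub]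
    rw [smul_comm f, smul_comm f]

theorem vec_act_smul_tm (F : FrameData R) (μ : Fin 4) (f : R) (T : ℕ) :
    (Gen.vec μ).act F (f • tm R T) = F.D μ f • tm R T := by
  funext S
  simp only [Gen.act, tm, thetaS, Pi.smul_apply, Pi.single_apply]
  split_ifs <;> simp

/-- Commutators of the seven C^∞-linear generators do not involve the frame, so their coefficients
are integers and can be tabulated. -/
theorem gen_comm_int (F : FrameData R) (μ : Fin 4) :
    ∀ g < 7, ∀ h < 7, ∀ k, (gen μ g).comm F (gen μ h) k
      = (((commM g h).eval fun c => if gen 0 c = k then (1 : ℤ) else 0 : ℤ) : R) := by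
  have key : ∀ g : Fin 7, ∀ h : Fin 7, ∀ k : Gen,
      (eta₂ (gen 0 g).pair.2 (gen 0 h).pair.1 * sigma (gen 0 g).pair.1 (gen 0 h).pair.2 k
        - eta₂ (gen 0 g).pair.1 (gen 0 h).pair.1 * sigma (gen 0 g).pair.2 (gen 0 h).pair.2 k
        - eta₂ (gen 0 g).pair.2 (gen 0 h).pair.2 * sigma (gen 0 g).pair.1 (gen 0 h).pair.1 k
        + eta₂ (gen 0 g).pair.1 (gen 0 h).pair.2 * sigma (gen 0 g).pair.2 (gen 0 h).pair.1 k : ℤ)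
      = (commM g h).eval fun c => if gen 0 c = k then (1 : ℤ) else 0 := by
    decide +kernel
  intro g hg h hh k
  rw [← key ⟨g, hg⟩ ⟨h, hh⟩ k]
  interval_cases g <;> interval_cases h <;> rfl

theorem commM_lt : ∀ g : Fin 7, ∀ h : Fin 7, ∀ p ∈ commM g h, p.2 < 7 := by decide +kernel

theorem gen_comm_mon (F : FrameData R) (μ : Fin 4) {g h : ℕ} (hg : g < 7) (hh : h < 7)
    (z : Wedge R) :
    (fun k => (gen μ g).comm F (gen μ h) k • z) = (commM g h).eval fun c => mon z (gen μ c) := by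
  funext k
  have hz : (commM g h).eval (fun c => mon z (gen μ c))
      = (commM g h).eval (fun c => mon z (gen 0 c)) := by
    refine Comb.eval_congr fun p hp => ?_
    have := commM_lt ⟨g, hg⟩ ⟨h, hh⟩ p hp
    obtain ⟨p1, p2⟩ := p
    simp only at this
    interval_cases p2 <;> rfl
  rw [gen_comm_int F μ g hg h hh k, hz, Comb.eval_apply]
  have := Comb.map_eval (((smulAddHom R (Wedge R)).flip z).comp (Int.castAddHom R)) (commM g h)
    fun c => if gen 0 c = k then (1 : ℤ) else 0
  simp only [AddMonoidHom.coe_comp, Function.comp_apply, Int.coe_castAddHom,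
    AddMonoidHom.flip_apply, smulAddHom_apply] at this
  rw [this]
  refine Comb.eval_congr fun p _ => ?_
  simp only [mon, Pi.single_apply, eq_comm (a := k)]
  split_ifs <;> simp

theorem gen_act_zero (F : FrameData R) (g : Gen) : g.act F 0 = 0 := by
  have h : ∀ b, contract b (0 : Wedge R) = 0 := fun b => map_zero (contractₗ b)
  cases g <;> funext S <;> simp [Gen.act, h]

theorem mon_apply (x : Wedge R) (g k : Gen) : mon x g k = if k = g then x else 0 := by
  simp [mon, Pi.single_apply]

theorem lieBr_mon (F : FrameData R) (x y : Wedge R) (g h : Gen) :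
    lieBr F (mon x g) (mon y h) = (fun k => g.comm F h k • wedge x y)
      + mon (wedge x (g.act F y)) h - mon (wedge (h.act F x) y) g := by
  funext k
  simp only [lieBr, Pi.sub_apply, Pi.add_apply]
  congr 1
  · congr 1
    · rw [Finset.sum_eq_single g, Finset.sum_eq_single h]
      · simp [mon]
      · intro h' _ hh; simp [mon, hh]
      · simp
      · intro g' _ hg; simp [mon, hg]
      · simp
    · rw [Finset.sum_eq_single g]
      · rw [mon_apply, mon_apply, mon_apply, if_pos rfl]
        split_ifs
        · rfl
        · rw [gen_act_zero, wedge_zero_right]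
      · intro g' _ hg; simp [mon, hg]
      · simp
  · rw [Finset.sum_eq_single h]
    · rw [mon_apply, mon_apply, mon_apply, if_pos rfl]
      split_ifs
      · rfl
      · rw [gen_act_zero, wedge_zero_left]
    · intro g' _ hg; simp [mon, hg]
    · simp

end

namespace Comb

/-- Translation of the symbols. -/
def shift (k : ℕ) (l : Comb) : Comb := l.map fun p => (p.1, k + p.2)

@[simp] theorem eval_shift {E : Type*} [AddCommGroup E] (k : ℕ) (l : Comb) (v : ℕ → E) :
    eval (shift k l) v = eval l fun c => v (k + c) := by
  induction l with
  | nil => simp [shift]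
  | cons p l ih => simp only [shift, List.map_cons, eval_cons] at ih ⊢; rw [ih]

end Comb

/-! ## Integer structure constants of `𝓛 ⊕ Φ`

A monomial is encoded as `16 g + m`, where `m` is a bit mask and `g` is the code of a generator
or `g = 7` for `Φ`; the code `112` is the additional basis element of `Φ²`. -/

/-- Multiplication `⋀W × Φ → Φ`. -/
def smulPhiM (S m : ℕ) : Comb :=
  bif m.beq 0 then (bif S.beq 0 then [(1, 0)] else []) else
    mulM S m ++ bif S.beq m && (popc S).beq 1 then [(bif S.beq 1 then 1 else -1, 0)] else []

/-- Action of a generator on `Φ`. -/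
def actPhiM (g m : ℕ) : Comb :=
  bif m.beq 0 then (bif g.beq 0 then [(2, 0)] else []) else actM g m

/-- The bracket of two monomials of `𝓛`. -/
def lieM (v w : ℕ) : Comb :=
  ((commM (v / 16) (w / 16)).bind fun k => (mulM (v % 16) (w % 16)).shift (16 * k)) ++
  ((actM (v / 16) (w % 16)).bind fun U => (mulM (v % 16) U).shift (16 * (w / 16))) ++
  ((actM (w / 16) (v % 16)).bind fun U => (mulM U (w % 16)).shift (16 * (v / 16))).scale (-1)

/-- The action of a monomial of `𝓛` on a monomial of `Φ`. -/
def lieActM (v m : ℕ) : Comb :=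
  ((actPhiM (v / 16) m).bind (smulPhiM (v % 16))).shift 112

/-- The element `θ_i θ_p σ_{jq}`. -/
def curvM (i p j q : ℕ) : Comb :=
  (sigM j q).bind fun g => (mulM (2 ^ i) (2 ^ p)).shift (16 * g)

/-- The bracket of `θ_a, θ_b ∈ Φ¹`. -/
def phiM₁₁ (a b : ℕ) : Comb :=
  [0, 1, 2, 3].flatMap fun i =>
    (curvM i a i b ++ curvM i b i a).scale (-3 * etaM i) ++
    bif a.beq b then
      [0, 1, 2, 3].flatMap fun p => (curvM i p i p).scale (etaM a * etaM p * etaM i)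
    else []

/-- The bracket of two monomials; for `Φ × Φ`, only `Φ¹ × Φ¹` is considered. -/
def brM (v w : ℕ) : Comb :=
  bif (v / 16).beq 7 then
    bif (w / 16).beq 7 then phiM₁₁ (Nat.log2 (v % 16)) (Nat.log2 (w % 16))
    else (lieActM w (v % 16)).scale
      (bif (popc (v % 16) * popc (w % 16) % 2).beq 0 then -1 else 1)
  else
    bif (w / 16).beq 7 then lieActM v (w % 16) else lieM v w

/-- Multiplication of a monomial by an element of `⋀W`. -/
def smulM (S v : ℕ) : Comb :=
  bif (v / 16).beq 7 then (smulPhiM S (v % 16)).shift 112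
  else (mulM S (v % 16)).shift (16 * (v / 16))

section
variable {R : Type*} [CommRing R]

variable (R) in
/-- The monomials of `Φ`. -/
def phiMono (m : ℕ) : Phi R := if m = 0 then (0, 1) else (fun S => tm R m S.1, 0)

variable (R) in
/-- The monomials of `𝓛 ⊕ Φ`. -/
def vm (μ : Fin 4) (c : ℕ) : V R :=
  if c / 16 = 7 then (0, phiMono R (c % 16)) else (mon (tm R (c % 16)) (gen μ (c / 16)), 0)

theorem mulM_lt : ∀ S : Fin 16, ∀ T : Fin 16, ∀ p ∈ mulM S T, p.2 < 16 := by decide +kernel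

theorem actM_lt : ∀ g : Fin 9, ∀ T : Fin 16, ∀ p ∈ actM g T, p.2 < 16 := by decide +kernel

theorem vm_lie (μ : Fin 4) (g : ℕ) (hg : g ≠ 7) {m : ℕ} (hm : m < 16) :
    vm R μ (16 * g + m) = (mon (tm R m) (gen μ g), 0) := by
  have h1 : (16 * g + m) / 16 = g := by omega
  have h2 : (16 * g + m) % 16 = m := by omega
  rw [vm, h1, h2, if_neg hg]

theorem vm_phi (μ : Fin 4) {m : ℕ} (hm : m < 16) : vm R μ (112 + m) = (0, phiMono R m) := by
  have h1 : (112 + m) / 16 = 7 := by omega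
  have h2 : (112 + m) % 16 = m := by omega
  rw [vm, h1, h2, if_pos rfl]

theorem mset_empty_iff : ∀ m : Fin 16, mset m = ∅ ↔ m.1 = 0 := by decide +kernel

theorem tm_apply (m : ℕ) (S : Finset (Fin 4)) : tm R m S = if S = mset m then 1 else 0 := by
  simp [tm, thetaS, Pi.single_apply]

theorem main_phiMono {m : ℕ} (hm : m < 16) :
    (phiMono R m).main = if m = 0 then 0 else tm R m := by
  funext S
  rw [Phi.main, phiMono]
  split_ifs with h1 h2 h2
  · rfl
  · rfl
  · rfl
  · rw [Finset.not_nonempty_iff_eq_empty] at h1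
    rw [tm_apply, if_neg]
    rw [h1]
    exact fun h => h2 ((mset_empty_iff ⟨m, hm⟩).1 h.symm)

theorem main_add (f h : Phi R) : (f + h).main = f.main + h.main := by
  funext S; simp only [Phi.main, Pi.add_apply]; split_ifs <;> simp

theorem main_smul {S : Type*} [DistribSMul S R] (r : S) (f : Phi R) : (r • f).main = r • f.main := by
  funext S; simp only [Phi.main, Pi.smul_apply]; split_ifs <;> simp

theorem phi_smul_add_right (x : Wedge R) (f h : Phi R) :
    Phi.smul x (f + h) = Phi.smul x f + Phi.smul x h := by
  ext S
  · simp [Phi.smul, main_add, wedge_add_right]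
  · simp only [Phi.smul, main_add, Prod.snd_add, Pi.add_apply, mul_add, smul_add,
      Finset.sum_add_distrib]
    ring

theorem phi_smul_add_left (x y : Wedge R) (f : Phi R) :
    Phi.smul (x + y) f = Phi.smul x f + Phi.smul y f := by
  ext S
  · simp [Phi.smul, wedge_add_left]
  · simp only [Phi.smul, Prod.snd_add, Pi.add_apply, add_mul, smul_add,
      Finset.sum_add_distrib]
    ring

theorem phi_smul_smul_right (r : R) (x : Wedge R) (f : Phi R) :
    Phi.smul x (r • f) = r • Phi.smul x f := by
  ext S
  · simp [Phi.smul, main_smul, wedge_smul_right]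
  · simp only [Phi.smul, main_smul, Prod.smul_snd, Pi.smul_apply, smul_eq_mul, mul_sub,
      Finset.mul_sum]
    congr 1
    · ring
    · refine Finset.sum_congr rfl fun a _ => ?_
      rw [mul_left_comm, mul_smul_comm]

theorem phi_smul_smul_left (r : R) (x : Wedge R) (f : Phi R) :
    Phi.smul (r • x) f = r • Phi.smul x f := by
  ext S
  · simp [Phi.smul, wedge_smul_left]
  · simp only [Phi.smul, Prod.smul_snd, Pi.smul_apply, smul_eq_mul, mul_sub,
      Finset.mul_sum]
    congr 1
    · ring
    · refine Finset.sum_congr rfl fun a _ => ?_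
      rw [mul_assoc, mul_smul_comm]

/-- Multiplication `⋀W × Φ → Φ` as a bilinear map. -/
def phiSmulₗ : Wedge R →ₗ[R] Phi R →ₗ[R] Phi R :=
  LinearMap.mk₂ R Phi.smul phi_smul_add_left phi_smul_smul_left phi_smul_add_right
    fun r x f => phi_smul_smul_right r x f

@[simp] theorem phiSmulₗ_apply (x : Wedge R) (f : Phi R) : phiSmulₗ x f = Phi.smul x f := rfl

/-- This is the φ* part of the product: θ_a θ_a* is −η_{aa} times the volume element, which is 1 for
the mask of θ₀ and −1 for the other three. -/
theorem star_int : ∀ S : Fin 16, ∀ m : Fin 16, m.1 ≠ 0 →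
    (∑ a : Fin 4, eta a * ((if {a} = mset S then 1 else 0) * (if {a} = mset m then 1 else 0)) : ℤ)
      = - (bif S.1.beq m && (popc S).beq 1 then (bif S.1.beq 1 then 1 else -1) else 0) := by
  decide +kernel

theorem mulM_ne_zero : ∀ S : Fin 16, ∀ T : Fin 16, T.1 ≠ 0 → ∀ p ∈ mulM S T, p.2 ≠ 0 := by
  decide +kernel

theorem fst_eval {E E' : Type*} [AddCommGroup E] [AddCommGroup E'] (l : Comb) (v : ℕ → E × E') :
    (l.eval v).1 = l.eval fun c => (v c).1 := Comb.map_eval (AddMonoidHom.fst E E') l v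

theorem snd_eval {E E' : Type*} [AddCommGroup E] [AddCommGroup E'] (l : Comb) (v : ℕ → E × E') :
    (l.eval v).2 = l.eval fun c => (v c).2 := Comb.map_eval (AddMonoidHom.snd E E') l v

theorem phi_smul_mono {S m : ℕ} (hS : S < 16) (hm : m < 16) :
    Phi.smul (tm R S) (phiMono R m) = (smulPhiM S m).eval (phiMono R) := by
  -- Mask 0 does not stand for the empty product here but for the additional basis element of Φ²,
  -- which is annihilated by everything except scalars.
  rcases Nat.eq_zero_or_pos m with rfl | h0
  · have h1 : tm R S ∅ = if S = 0 then 1 else 0 := by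
      rw [tm_apply]
      refine if_congr ?_ rfl rfl
      rw [eq_comm, ← mset_empty_iff ⟨S, hS⟩]
    have hs : smulPhiM S 0 = if S = 0 then [(1, 0)] else [] := by
      rw [smulPhiM]
      rcases Nat.eq_zero_or_pos S with rfl | hS0
      · rfl
      · have : S.beq 0 = false := by
          rw [← Bool.not_eq_true]; intro h; have := Nat.eq_of_beq_eq_true h; omega
        rw [this, if_neg hS0.ne']; rfl
    rw [Phi.smul, main_phiMono hm, if_pos rfl, hs, h1]
    ext T
    · split_ifs <;> simp [phiMono]
    · split_ifs <;> simp [phiMono]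
  · have hs : smulPhiM S m = mulM S m ++
        bif S.beq m && (popc S).beq 1 then [(bif S.beq 1 then 1 else -1, 0)] else [] := by
      have : m.beq 0 = false := by
        rw [← Bool.not_eq_true]; intro h; have := Nat.eq_of_beq_eq_true h; omega
      rw [smulPhiM, this]; rfl
    have hmul : (mulM S m).eval (phiMono R) = (mulM S m).eval fun c => (fun T => tm R c T.1, 0) :=
      Comb.eval_congr fun p hp => by
        rw [phiMono, if_neg (mulM_ne_zero ⟨S, hS⟩ ⟨m, hm⟩ h0.ne' p hp)]
    have hm0 : m ≠ 0 := h0.ne'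
    rw [Phi.smul, main_phiMono hm, if_neg hm0, hs, Comb.eval_append, hmul]
    ext T
    · rw [wedge_tm hS hm, Prod.fst_add, fst_eval, Pi.add_apply]
      change (mulM S m).eval (tm R) T.1 = _
      rw [Comb.eval_apply, Comb.eval_apply]
      cases S.beq m && (popc S).beq 1 <;> simp [phiMono]
    · rw [Prod.snd_add, snd_eval, Comb.eval_zero, zero_add]
      have := congrArg (Int.cast : ℤ → R) (star_int ⟨S, hS⟩ ⟨m, hm⟩ hm0)
      push_cast at this
      simp only [tm_apply, zsmul_eq_mul]
      rw [this, phiMono, if_neg hm0]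
      cases S.beq m && (popc S).beq 1
      · simp
      · cases S.beq 1 <;> simp [phiMono]

variable [Algebra ℝ R]

theorem gen_act_add (F : FrameData R) (g : Gen) (x y : Wedge R) :
    g.act F (x + y) = g.act F x + g.act F y := by
  have h : ∀ b, contract b (x + y) = contract b x + contract b y :=
    fun b => map_add (contractₗ b) x y
  cases g <;> funext S <;> simp [Gen.act, h, wedge_add_right] <;> ring

theorem actM_ne_zero : ∀ g : Fin 7, ∀ T : Fin 16, T.1 ≠ 0 → ∀ p ∈ actM g T, p.2 ≠ 0 := by
  decide +kernel

theorem actPhi_fst (F : FrameData R) (g : Gen) (f : Phi R) (T : {S : Finset (Fin 4) // S.Nonempty}) :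
    (g.actPhi F f).1 T = g.act F f.main T.1 := rfl

theorem actPhi_snd_eq_zero (F : FrameData R) (g : Gen) {f : Phi R} (h : f.2 = 0) :
    (g.actPhi F f).2 = 0 := by
  cases g <;> simp [Gen.actPhi, h]

theorem actPhi_mono (F : FrameData R) (μ : Fin 4) {g m : ℕ} (hg : g < 7) (hm : m < 16) (f : R) :
    (gen μ g).actPhi F (f • phiMono R m) = f • (actPhiM g m).eval (phiMono R) := by
  rcases Nat.eq_zero_or_pos m with rfl | h0
  · have hs : actPhiM g 0 = if g = 0 then [(2, 0)] else [] := by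
      rw [actPhiM]
      rcases Nat.eq_zero_or_pos g with rfl | hS0
      · rfl
      · have : g.beq 0 = false := by
          rw [← Bool.not_eq_true]; intro h; have := Nat.eq_of_beq_eq_true h; omega
        rw [this, if_neg hS0.ne']; rfl
    have hmain : (f • phiMono R 0).main = 0 := by
      rw [main_smul, main_phiMono hm, if_pos rfl, smul_zero]
    rw [hs]
    ext T
    · rw [actPhi_fst, hmain, gen_act_zero]
      split_ifs <;> simp [phiMono]
    · interval_cases g <;> simp [Gen.actPhi, gen, phiMono, mul_comm]
  · have hm0 : m ≠ 0 := h0.ne'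
    have hs : actPhiM g m = actM g m := by
      have : m.beq 0 = false := by
        rw [← Bool.not_eq_true]; intro h; have := Nat.eq_of_beq_eq_true h; omega
      rw [actPhiM, this]; rfl
    have hmul : (actM g m).eval (phiMono R) = (actM g m).eval fun c => (fun T => tm R c T.1, 0) :=
      Comb.eval_congr fun p hp => by
        rw [phiMono, if_neg (actM_ne_zero ⟨g, hg⟩ ⟨m, hm⟩ hm0 p hp)]
    rw [hs, hmul]
    ext T
    · rw [actPhi_fst, main_smul, main_phiMono hm, if_neg hm0, gen_act_smul F μ hg,
        gen_act_tm F μ hg hm]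
      simp [fst_eval, Comb.eval_apply]
    · rw [actPhi_snd_eq_zero]
      · simp only [Prod.smul_snd, snd_eval, Comb.eval_zero, smul_zero]
      · simp [phiMono, hm0]

theorem actPhi_vec (F : FrameData R) (μ : Fin 4) {m : ℕ} (hm : m < 16) (f : R) :
    (Gen.vec μ).actPhi F (f • phiMono R m) = F.D μ f • phiMono R m := by
  ext T
  · rw [actPhi_fst, main_smul, main_phiMono hm]
    by_cases h : m = 0
    · simp [phiMono, h, gen_act_zero]
    · rw [if_neg h, vec_act_smul_tm]
      simp [phiMono, h]
  · simp only [Gen.actPhi, phiMono]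
    split_ifs with h <;> simp

theorem lieAct_mon (F : FrameData R) (x : Wedge R) (g : Gen) (f : Phi R) :
    lieAct F (mon x g) f = Phi.smul x (g.actPhi F f) := by
  rw [lieAct, Finset.sum_eq_single g]
  · rw [mon_apply, if_pos rfl]
  · intro h _ hh
    rw [mon_apply, if_neg hh, ← phiSmulₗ_apply, map_zero, LinearMap.zero_apply]
  · simp

theorem smulPhiM_lt : ∀ S : Fin 16, ∀ T : Fin 16, ∀ p ∈ smulPhiM S T, p.2 < 16 := by decide +kernel

theorem actPhiM_lt : ∀ g : Fin 9, ∀ T : Fin 16, ∀ p ∈ actPhiM g T, p.2 < 16 := by decide +kernel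

end

section
variable {R : Type*} [CommRing R] [Algebra ℝ R]

/-! ## Bilinearity of the bracket -/

/-- Brackets are only ℝ-bilinear, since vector fields differentiate coefficients. Real scalars act
through constants of R, so R-linear statements about the products can be reused for them. -/
theorem rsmul_eq {ι : Type*} (r : ℝ) (x : ι → R) : r • x = algebraMap ℝ R r • x := by
  funext i; simp [Algebra.smul_def]

theorem wedge_rsmul_left (r : ℝ) (x y : Wedge R) : wedge (r • x) y = r • wedge x y := by
  rw [rsmul_eq, rsmul_eq, wedge_smul_left]

theorem wedge_rsmul_right (r : ℝ) (x y : Wedge R) : wedge x (r • y) = r • wedge x y := by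
  rw [rsmul_eq, rsmul_eq, wedge_smul_right]

theorem gen_act_rsmul (F : FrameData R) (g : Gen) (r : ℝ) (x : Wedge R) :
    g.act F (r • x) = r • g.act F x := by
  have h : ∀ b, contract b (r • x) = r • contract b x := fun b => by
    rw [rsmul_eq, rsmul_eq]; exact map_smul (contractₗ b) _ x
  cases g <;> funext S <;>
    simp [Gen.act, h, wedge_rsmul_right, smul_sub]

theorem lieBr_add_left (F : FrameData R) (X X' Y : Lie R) :
    lieBr F (X + X') Y = lieBr F X Y + lieBr F X' Y := by
  funext k
  simp only [lieBr, Pi.add_apply, wedge_add_left, gen_act_add, smul_add, Finset.sum_add_distrib]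
  abel

theorem lieBr_add_right (F : FrameData R) (X Y Y' : Lie R) :
    lieBr F X (Y + Y') = lieBr F X Y + lieBr F X Y' := by
  funext k
  simp only [lieBr, Pi.add_apply, wedge_add_right, gen_act_add, smul_add, Finset.sum_add_distrib]
  abel

theorem lieBr_rsmul_left (F : FrameData R) (r : ℝ) (X Y : Lie R) :
    lieBr F (r • X) Y = r • lieBr F X Y := by
  funext k
  simp only [lieBr, Pi.smul_apply, wedge_rsmul_left, gen_act_rsmul, smul_sub, smul_add,
    Finset.smul_sum, smul_comm r]

theorem lieBr_rsmul_right (F : FrameData R) (r : ℝ) (X Y : Lie R) :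
    lieBr F X (r • Y) = r • lieBr F X Y := by
  funext k
  simp only [lieBr, Pi.smul_apply, wedge_rsmul_right, gen_act_rsmul, smul_sub, smul_add,
    Finset.smul_sum, smul_comm r]

theorem phi_smul_rsmul_left (r : ℝ) (x : Wedge R) (f : Phi R) :
    Phi.smul (r • x) f = r • Phi.smul x f := by
  rw [rsmul_eq, phi_smul_smul_left]
  ext <;> simp [Algebra.smul_def]

theorem phi_smul_rsmul_right (r : ℝ) (x : Wedge R) (f : Phi R) :
    Phi.smul x (r • f) = r • Phi.smul x f := by
  have h : ∀ f : Phi R, r • f = algebraMap ℝ R r • f := fun f => by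
    ext <;> simp [Algebra.smul_def]
  rw [h, h, phi_smul_smul_right]

theorem actPhi_add (F : FrameData R) (g : Gen) (f h : Phi R) :
    g.actPhi F (f + h) = g.actPhi F f + g.actPhi F h := by
  ext T
  · simp [actPhi_fst, main_add, gen_act_add]
  · cases g <;> simp [Gen.actPhi, mul_add]

theorem actPhi_rsmul (F : FrameData R) (g : Gen) (r : ℝ) (f : Phi R) :
    g.actPhi F (r • f) = r • g.actPhi F f := by
  ext T
  · simp [actPhi_fst, main_smul, gen_act_rsmul]
  · cases g <;> simp [Gen.actPhi]

theorem lieAct_add_left (F : FrameData R) (X Y : Lie R) (f : Phi R) :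
    lieAct F (X + Y) f = lieAct F X f + lieAct F Y f := by
  simp [lieAct, phi_smul_add_left, Finset.sum_add_distrib]

theorem lieAct_add_right (F : FrameData R) (X : Lie R) (f h : Phi R) :
    lieAct F X (f + h) = lieAct F X f + lieAct F X h := by
  simp [lieAct, actPhi_add, phi_smul_add_right, Finset.sum_add_distrib]

theorem lieAct_rsmul_left (F : FrameData R) (r : ℝ) (X : Lie R) (f : Phi R) :
    lieAct F (r • X) f = r • lieAct F X f := by
  simp [lieAct, phi_smul_rsmul_left, Finset.smul_sum]

theorem lieAct_rsmul_right (F : FrameData R) (r : ℝ) (X : Lie R) (f : Phi R) :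
    lieAct F X (r • f) = r • lieAct F X f := by
  simp [lieAct, actPhi_rsmul, phi_smul_rsmul_right, Finset.smul_sum]

theorem one_add (f h : Phi R) : (f + h).one = f.one + h.one := by
  funext a; simp [Phi.one, main_add]

theorem one_rsmul (r : ℝ) (f : Phi R) : (r • f).one = r • f.one := by
  funext a; simp [Phi.one, main_smul]

theorem phiBr₁₁_add_left (a a' b : Fin 4 → R) :
    phiBr₁₁ (a + a') b = phiBr₁₁ a b + phiBr₁₁ a' b := by
  funext g
  simp only [phiBr₁₁, Pi.add_apply, ← Finset.sum_add_distrib, ← smul_add, ← add_smul]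
  refine Finset.sum_congr rfl fun i _ => Finset.sum_congr rfl fun p _ =>
    Finset.sum_congr rfl fun q _ => ?_
  congr 2
  simp only [add_mul, mul_add, smul_add, Finset.sum_add_distrib]
  ring

theorem phiBr₁₁_comm (a b : Fin 4 → R) : phiBr₁₁ a b = phiBr₁₁ b a := by
  funext g
  simp only [phiBr₁₁]
  refine Finset.sum_congr rfl fun i _ => Finset.sum_congr rfl fun p _ =>
    Finset.sum_congr rfl fun q _ => ?_
  congr 2
  simp only [mul_comm (a _), add_comm]

theorem phiBr₁₁_add_right (a b b' : Fin 4 → R) :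
    phiBr₁₁ a (b + b') = phiBr₁₁ a b + phiBr₁₁ a b' := by
  rw [phiBr₁₁_comm, phiBr₁₁_add_left, phiBr₁₁_comm b, phiBr₁₁_comm b']

theorem phiBr₁₁_rsmul_left (r : ℝ) (a b : Fin 4 → R) :
    phiBr₁₁ (r • a) b = r • phiBr₁₁ a b := by
  funext g
  simp only [phiBr₁₁, Pi.smul_apply, Finset.smul_sum]
  refine Finset.sum_congr rfl fun i _ => Finset.sum_congr rfl fun p _ =>
    Finset.sum_congr rfl fun q _ => ?_
  rw [rsmul_eq, smul_comm (algebraMap ℝ R r), smul_smul (algebraMap ℝ R r)]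
  congr 2
  simp only [Algebra.smul_def, mul_add, Finset.mul_sum, mul_assoc]
  congr 1
  · ring
  · exact Finset.sum_congr rfl fun x _ => by ring

theorem phiBr₁₁_rsmul_right (r : ℝ) (a b : Fin 4 → R) :
    phiBr₁₁ a (r • b) = r • phiBr₁₁ a b := by
  rw [phiBr₁₁_comm, phiBr₁₁_rsmul_left, phiBr₁₁_comm]

theorem phiBr₁₂_add_left (a a' : Fin 4 → R) (f : Phi R) :
    phiBr₁₂ (a + a') f = phiBr₁₂ a f + phiBr₁₂ a' f := by
  funext g
  have h : ∀ b c : Fin 4, (if b < c then f.main {b, c} •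
      wedge (theta b) (phiBr₁₁ (a + a') (Pi.single c 1) g) else 0)
      = (if b < c then f.main {b, c} • wedge (theta b) (phiBr₁₁ a (Pi.single c 1) g) else 0)
        + (if b < c then f.main {b, c} • wedge (theta b) (phiBr₁₁ a' (Pi.single c 1) g) else 0) := by
    intro b c
    split_ifs
    · rw [phiBr₁₁_add_left, Pi.add_apply, wedge_add_right, smul_add]
    · simp
  simp only [phiBr₁₂, Pi.add_apply, h, Finset.sum_add_distrib]
  rw [phiBr₁₁_add_left, Pi.add_apply, wedge_add_right, smul_add]
  abel

theorem phiBr₁₂_add_right (a : Fin 4 → R) (f f' : Phi R) :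
    phiBr₁₂ a (f + f') = phiBr₁₂ a f + phiBr₁₂ a f' := by
  funext g
  have h : ∀ b c : Fin 4, (if b < c then (f + f').main {b, c} •
      wedge (theta b) (phiBr₁₁ a (Pi.single c 1) g) else 0)
      = (if b < c then f.main {b, c} • wedge (theta b) (phiBr₁₁ a (Pi.single c 1) g) else 0)
        + (if b < c then f'.main {b, c} • wedge (theta b) (phiBr₁₁ a (Pi.single c 1) g) else 0) := by
    intro b c
    split_ifs
    · rw [main_add, Pi.add_apply, add_smul]
    · simp
  simp only [phiBr₁₂, Pi.add_apply, h, Finset.sum_add_distrib, Prod.snd_add, add_smul]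
  abel

theorem phiBr₁₂_rsmul_left (r : ℝ) (a : Fin 4 → R) (f : Phi R) :
    phiBr₁₂ (r • a) f = r • phiBr₁₂ a f := by
  funext g
  simp only [phiBr₁₂, Pi.smul_apply, smul_sub, smul_neg, Finset.smul_sum, smul_ite, smul_zero,
    phiBr₁₁_rsmul_left, wedge_rsmul_right]
  simp only [smul_comm r]

theorem phiBr₁₂_rsmul_right (r : ℝ) (a : Fin 4 → R) (f : Phi R) :
    phiBr₁₂ a (r • f) = r • phiBr₁₂ a f := by
  funext g
  simp only [phiBr₁₂, Pi.smul_apply, smul_sub, smul_neg, Finset.smul_sum, smul_ite, smul_zero,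
    main_smul, Prod.smul_snd, smul_assoc]

theorem phiBr_add_left (f f' h : Phi R) : phiBr (f + f') h = phiBr f h + phiBr f' h := by
  simp only [phiBr, one_add, phiBr₁₁_add_left, phiBr₁₂_add_left, phiBr₁₂_add_right]; abel

theorem phiBr_add_right (f h h' : Phi R) : phiBr f (h + h') = phiBr f h + phiBr f h' := by
  simp only [phiBr, one_add, phiBr₁₁_add_right, phiBr₁₂_add_left, phiBr₁₂_add_right]; abel

theorem phiBr_rsmul_left (r : ℝ) (f h : Phi R) : phiBr (r • f) h = r • phiBr f h := by
  simp only [phiBr, one_rsmul, phiBr₁₁_rsmul_left, phiBr₁₂_rsmul_left, phiBr₁₂_rsmul_right,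
    smul_sub, smul_add]

theorem phiBr_rsmul_right (r : ℝ) (f h : Phi R) : phiBr f (r • h) = r • phiBr f h := by
  simp only [phiBr, one_rsmul, phiBr₁₁_rsmul_right, phiBr₁₂_rsmul_left, phiBr₁₂_rsmul_right,
    smul_sub, smul_add]

theorem even_add (f h : Phi R) : (f + h).even = f.even + h.even := by
  ext T
  · simp only [Phi.even, Prod.fst_add, Pi.add_apply]; split_ifs <;> simp
  · simp [Phi.even]

theorem even_smul {S : Type*} [DistribSMul S R] (r : S) (f : Phi R) :
    (r • f).even = r • f.even := by
  ext T
  · simp only [Phi.even, Prod.smul_fst, Pi.smul_apply]; split_ifs <;> simp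
  · simp [Phi.even]

theorem odd_add (f h : Phi R) : (f + h).odd = f.odd + h.odd := by
  ext T
  · simp only [Phi.odd, Prod.fst_add, Pi.add_apply]; split_ifs <;> simp
  · simp [Phi.odd]

theorem odd_smul {S : Type*} [DistribSMul S R] (r : S) (f : Phi R) : (r • f).odd = r • f.odd := by
  ext T
  · simp only [Phi.odd, Prod.smul_fst, Pi.smul_apply]; split_ifs <;> simp
  · simp [Phi.odd]

theorem parity_add (X Y : Lie R) : (X + Y).parity = X.parity + Y.parity := by
  funext g S; simp [Lie.parity]

theorem parity_rsmul (r : ℝ) (X : Lie R) : (r • X).parity = r • X.parity := by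
  funext g S; simp [Lie.parity]

/-- The bracket of `𝓛 ⊕ Φ` as a bilinear map. -/
noncomputable def vBrₗ (F : FrameData R) : V R →ₗ[ℝ] V R →ₗ[ℝ] V R :=
  LinearMap.mk₂ ℝ (vBr F)
    (fun x x' y => by
      simp only [vBr, Prod.fst_add, Prod.snd_add, lieBr_add_left, phiBr_add_left, lieAct_add_left,
        even_add, odd_add, lieAct_add_right, Prod.mk_add_mk]
      congr 1 <;> abel)
    (fun r x y => by
      simp only [vBr, Prod.smul_fst, Prod.smul_snd, lieBr_rsmul_left, phiBr_rsmul_left,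
        lieAct_rsmul_left, even_smul, odd_smul, lieAct_rsmul_right, Prod.smul_mk, smul_add,
        smul_sub])
    (fun x y y' => by
      simp only [vBr, Prod.fst_add, Prod.snd_add, lieBr_add_right, phiBr_add_right, lieAct_add_left,
        parity_add, lieAct_add_right, Prod.mk_add_mk]
      congr 1 <;> abel)
    fun r x y => by
      simp only [vBr, Prod.smul_fst, Prod.smul_snd, lieBr_rsmul_right, phiBr_rsmul_right,
        lieAct_rsmul_left, parity_rsmul, lieAct_rsmul_right, Prod.smul_mk, smul_add,
        smul_sub]

@[simp] theorem vBrₗ_apply (F : FrameData R) (x y : V R) : vBrₗ F x y = vBr F x y := rfl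

/-! ## Brackets of monomials -/

theorem vBr_lie_lie (F : FrameData R) (X Y : Lie R) : vBr F (X, 0) (Y, 0) = (lieBr F X Y, 0) := by
  have h1 := (vBrₗ F).map_zero₂ (0 : V R)
  have h2 : lieAct F X 0 = 0 := by simpa using lieAct_rsmul_right F 0 X 0
  have h3 : lieAct F Y 0 = 0 := by simpa using lieAct_rsmul_right F 0 Y 0
  have h4 : lieAct F Y.parity 0 = 0 := by simpa using lieAct_rsmul_right F 0 Y.parity 0
  have h5 : (0 : Phi R).even = 0 := by simpa using even_smul (0 : ℝ) (0 : Phi R)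
  have h6 : (0 : Phi R).odd = 0 := by simpa using odd_smul (0 : ℝ) (0 : Phi R)
  have h7 : phiBr (0 : Phi R) 0 = 0 := by simpa using phiBr_rsmul_left 0 (0 : Phi R) 0
  simp [vBr, h2, h3, h4, h5, h6, h7]

theorem vBr_lie_phi (F : FrameData R) (X : Lie R) (f : Phi R) :
    vBr F (X, 0) (0, f) = (0, lieAct F X f) := by
  have h1 : lieBr F X 0 = 0 := by simpa using lieBr_rsmul_right F 0 X 0
  have h2 : phiBr 0 f = 0 := by simpa using phiBr_rsmul_left 0 0 f
  have h5 : (0 : Phi R).even = 0 := by simpa using even_smul (0 : ℝ) (0 : Phi R)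
  have h6 : (0 : Phi R).odd = 0 := by simpa using odd_smul (0 : ℝ) (0 : Phi R)
  have h3 : ∀ Y, lieAct F Y 0 = 0 := fun Y => by simpa using lieAct_rsmul_right F 0 Y 0
  simp [vBr, h1, h2, h5, h6, h3]

theorem vBr_phi_lie (F : FrameData R) (X : Lie R) (f : Phi R) :
    vBr F (0, f) (X, 0) = (0, - lieAct F X f.even - lieAct F X.parity f.odd) := by
  have h1 : lieBr F 0 X = 0 := by simpa using lieBr_rsmul_left F 0 0 X
  have h2 : phiBr f 0 = 0 := by simpa using phiBr_rsmul_right 0 f 0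
  have h3 : ∀ Y, lieAct F Y 0 = 0 := fun Y => by simpa using lieAct_rsmul_right F 0 Y 0
  simp [vBr, h1, h2, h3]

theorem vBr_phi_phi (F : FrameData R) (f h : Phi R) : vBr F (0, f) (0, h) = (phiBr f h, 0) := by
  have h1 : lieBr F 0 0 = 0 := by simpa using lieBr_rsmul_left F 0 0 0
  have h3 : ∀ f, lieAct F 0 f = 0 := fun f => by simpa using lieAct_rsmul_left F 0 0 f
  have h4 : (0 : Lie R).parity = 0 := by simpa using parity_rsmul 0 (0 : Lie R)
  simp [vBr, h1, h3, h4]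

theorem mon_smul (f : R) (x : Wedge R) (g : Gen) : mon (f • x) g = f • mon x g := by
  rw [mon, mon, ← Pi.single_smul']

theorem mon_eval (l : Comb) (v : ℕ → Wedge R) (g : Gen) :
    mon (l.eval v) g = l.eval fun c => mon (v c) g :=
  Comb.map_eval (LinearMap.single R (fun _ => Wedge R) g) l v

theorem eval_pair_lie (l : Comb) (v : ℕ → Lie R) :
    ((l.eval v, 0) : V R) = l.eval fun c => (v c, 0) :=
  Comb.map_eval (LinearMap.inl R (Lie R) (Phi R)) l v

theorem eval_pair_phi (l : Comb) (v : ℕ → Phi R) :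
    ((0, l.eval v) : V R) = l.eval fun c => (0, v c) :=
  Comb.map_eval (LinearMap.inr R (Lie R) (Phi R)) l v

theorem vm_of_lie (μ : Fin 4) {v : ℕ} (hv : v / 16 ≠ 7) :
    vm R μ v = (mon (tm R (v % 16)) (gen μ (v / 16)), 0) := if_neg hv

theorem vm_of_phi (μ : Fin 4) {v : ℕ} (hv : v / 16 = 7) :
    vm R μ v = (0, phiMono R (v % 16)) := if_pos hv

theorem smul_lie (f : R) (X : Lie R) : f • ((X, 0) : V R) = (f • X, 0) := by simp

theorem smul_phi (f : R) (X : Phi R) : f • ((0, X) : V R) = (0, f • X) := by simp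

/-- Brackets in `⋀W ⊗ CDer(W)` of elements that are `C^∞`-linear. -/
theorem vBr_lie_mono (F : FrameData R) (μ : Fin 4) {v w : ℕ} (hv : v / 16 < 7) (hw : w / 16 < 7)
    (f h : R) : vBr F (f • vm R μ v) (h • vm R μ w) = (f * h) • (brM v w).eval (vm R μ) := by
  have hS : v % 16 < 16 := Nat.mod_lt _ (by norm_num)
  have hT : w % 16 < 16 := Nat.mod_lt _ (by norm_num)
  have e1 : (v / 16).beq 7 = false := by
    rw [← Bool.not_eq_true]; intro h; have := Nat.eq_of_beq_eq_true h; omega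
  have e2 : (w / 16).beq 7 = false := by
    rw [← Bool.not_eq_true]; intro h; have := Nat.eq_of_beq_eq_true h; omega
  have hbr : brM v w = lieM v w := by rw [brM, e1, e2]; rfl
  rw [vm_of_lie μ (by omega : v / 16 ≠ 7), vm_of_lie μ (by omega : w / 16 ≠ 7), smul_lie, smul_lie,
    vBr_lie_lie, ← mon_smul, ← mon_smul, lieBr_mon, hbr, lieM, gen_comm_mon F μ hv hw,
    gen_act_smul F μ hv, gen_act_smul F μ hw]
  generalize v % 16 = S at *
  generalize w % 16 = T at *
  generalize v / 16 = g at *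
  generalize w / 16 = k at *
  have a1 := actM_lt ⟨g, by omega⟩ ⟨T, hT⟩
  have a2 := actM_lt ⟨k, by omega⟩ ⟨S, hS⟩
  simp only at a1 a2
  rw [gen_act_tm F μ hv hT, gen_act_tm F μ hw hS]
  simp only [wedge_smul_left, wedge_smul_right, mon_smul, ← Comb.eval_smul]
  rw [smul_comm h f]
  simp only [← smul_sub, ← smul_add, ← smul_lie, mul_smul, smul_comm h f]
  congr 2
  simp only [Comb.eval_append, Comb.eval_scale, Comb.eval_bind, Comb.eval_shift, neg_smul, one_smul,
    sub_eq_add_neg]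
  have hadd : ∀ X Y Z : Lie R, ((X + Y + - Z, 0) : V R) = (X, 0) + (Y, 0) + - (Z, 0) := by
    intro X Y Z; simp
  rw [hadd]
  congr 1
  · congr 1
    · rw [eval_pair_lie]
      refine Comb.eval_congr fun p hp => ?_
      rw [wedge_tm hS hT, mon_eval, eval_pair_lie]
      refine Comb.eval_congr fun q hq => ?_
      have := commM_lt ⟨g, hv⟩ ⟨k, hw⟩ p hp
      rw [vm_lie μ p.2 (by omega) (mulM_lt ⟨S, hS⟩ ⟨T, hT⟩ q hq)]
    · rw [wedge_eval_right, mon_eval, eval_pair_lie]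
      refine Comb.eval_congr fun p hp => ?_
      rw [wedge_tm hS (a1 p hp), mon_eval, eval_pair_lie]
      refine Comb.eval_congr fun q hq => ?_
      rw [vm_lie μ k (by omega) (mulM_lt ⟨S, hS⟩ ⟨p.2, a1 p hp⟩ q hq)]
  · rw [wedge_eval_left, mon_eval, eval_pair_lie]
    congr 1
    refine Comb.eval_congr fun p hp => ?_
    rw [wedge_tm (a2 p hp) hT, mon_eval, eval_pair_lie]
    refine Comb.eval_congr fun q hq => ?_
    rw [vm_lie μ g (by omega) (mulM_lt ⟨p.2, a2 p hp⟩ ⟨T, hT⟩ q hq)]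

end

section
variable {R : Type*} [CommRing R] [Algebra ℝ R]

theorem lieAct_mono (F : FrameData R) (μ : Fin 4) {v m : ℕ} (hv : v / 16 < 7) (hm : m < 16)
    (f h : R) : lieAct F (mon (f • tm R (v % 16)) (gen μ (v / 16))) (h • phiMono R m)
      = (f * h) • (lieActM v m).eval fun c => phiMono R (c - 112) := by
  have hS : v % 16 < 16 := Nat.mod_lt _ (by norm_num)
  rw [lieAct_mon, actPhi_mono F μ hv hm, phi_smul_smul_left, phi_smul_smul_right, smul_smul, lieActM,
    Comb.eval_shift, Comb.eval_bind, ← phiSmulₗ_apply, Comb.map_eval]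
  congr 1
  refine Comb.eval_congr fun p hp => ?_
  rw [phiSmulₗ_apply, phi_smul_mono hS (actPhiM_lt ⟨v / 16, by omega⟩ ⟨m, hm⟩ p hp)]
  refine Comb.eval_congr fun q _ => ?_
  rw [Nat.add_sub_cancel_left]

theorem lieActM_mem {v m : ℕ} (hv : v / 16 < 7) (hm : m < 16) :
    ∀ p ∈ lieActM v m, ∃ k < 16, p.2 = 112 + k := by
  have : ∀ v : Fin 112, ∀ m : Fin 16, ∀ p ∈ lieActM v m, 112 ≤ p.2 ∧ p.2 < 128 := by
    decide +kernel
  intro p hp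
  have := this ⟨v, by omega⟩ ⟨m, hm⟩ p hp
  exact ⟨p.2 - 112, by omega, by omega⟩

theorem eval_lieActM (μ : Fin 4) {v m : ℕ} (hv : v / 16 < 7) (hm : m < 16) :
    ((0, (lieActM v m).eval fun c => phiMono R (c - 112)) : V R) = (lieActM v m).eval (vm R μ) := by
  rw [eval_pair_phi]
  refine Comb.eval_congr fun p hp => ?_
  obtain ⟨k, hk, h⟩ := lieActM_mem hv hm p hp
  rw [h, vm_phi μ hk, Nat.add_sub_cancel_left]

theorem beq_seven {a : ℕ} (h : a ≠ 7) : a.beq 7 = false := by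
  rw [← Bool.not_eq_true]; exact fun h' => h (Nat.eq_of_beq_eq_true h')

theorem vBr_lie_phi_mono (F : FrameData R) (μ : Fin 4) {v w : ℕ} (hv : v / 16 < 7)
    (hw : w / 16 = 7) (f h : R) :
    vBr F (f • vm R μ v) (h • vm R μ w) = (f * h) • (brM v w).eval (vm R μ) := by
  have hT : w % 16 < 16 := Nat.mod_lt _ (by norm_num)
  have hbr : brM v w = lieActM v (w % 16) := by rw [brM, beq_seven hv.ne, hw]; rfl
  rw [vm_of_lie μ hv.ne, vm_of_phi μ hw, smul_lie, smul_phi, vBr_lie_phi, ← mon_smul,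
    lieAct_mono F μ hv hT, hbr, ← eval_lieActM μ hv hT, smul_phi]

theorem even_phiMono {m : ℕ} (hm : m < 16) :
    (phiMono R m).even = if popc m % 2 = 0 then phiMono R m else 0 := by
  have key : ∀ m : Fin 16, Even (mset m).card ↔ popc m % 2 = 0 := by decide +kernel
  by_cases h : m = 0
  · subst h
    ext <;> simp [Phi.even, phiMono, popc]
  · have hk := key ⟨m, hm⟩
    simp only at hk
    ext T
    · simp only [Phi.even, phiMono, h, if_false, tm_apply]
      by_cases hT : T.1 = mset m
      · simp only [hT, hk, if_true]; split_ifs <;> simp [hT]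
      · split_ifs <;> simp [hT]
    · simp only [Phi.even, phiMono, h, if_false]; split_ifs <;> simp

theorem odd_phiMono {m : ℕ} (hm : m < 16) :
    (phiMono R m).odd = if popc m % 2 = 0 then 0 else phiMono R m := by
  have h1 : (phiMono R m).odd = phiMono R m - (phiMono R m).even := by
    ext T
    · simp only [Phi.odd, Phi.even, Prod.fst_sub, Pi.sub_apply]; split_ifs <;> simp
    · simp [Phi.odd, Phi.even]
  rw [h1, even_phiMono hm]
  split_ifs <;> simp

theorem parity_mon {m : ℕ} (hm : m < 16) (f : R) (g : Gen) :
    (mon (f • tm R m) g).parity = ((-1 : ℤ) ^ popc m) • mon (f • tm R m) g := by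
  have hp := popc_eq ⟨m, hm⟩
  simp only at hp
  funext k S
  simp only [Lie.parity, mon_apply, Pi.smul_apply]
  split_ifs
  · simp only [Pi.smul_apply, tm_apply]
    split_ifs with h
    · rw [h, hp]
    · simp
  · simp

theorem vBr_phi_lie_mono (F : FrameData R) (μ : Fin 4) {v w : ℕ} (hv : v / 16 = 7)
    (hw : w / 16 < 7) (f h : R) :
    vBr F (f • vm R μ v) (h • vm R μ w) = (f * h) • (brM v w).eval (vm R μ) := by
  have hS : v % 16 < 16 := Nat.mod_lt _ (by norm_num)
  have hT : w % 16 < 16 := Nat.mod_lt _ (by norm_num)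
  have hbr : brM v w = (lieActM w (v % 16)).scale
      (bif (popc (v % 16) * popc (w % 16) % 2).beq 0 then -1 else 1) := by
    rw [brM, beq_seven hw.ne, hv]; rfl
  rw [vm_of_lie μ hw.ne, vm_of_phi μ hv, smul_lie, smul_phi, vBr_phi_lie, ← mon_smul,
    even_smul, odd_smul, even_phiMono hS, odd_phiMono hS, parity_mon hT, hbr, Comb.eval_scale,
    ← eval_lieActM μ hw hS, smul_comm (f * h), smul_phi, mul_comm f h, ← lieAct_mono F μ hw hS]
  have z1 : ∀ X, lieAct F X (f • (0 : Phi R)) = 0 := fun X => by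
    simpa using lieAct_rsmul_right F 0 X 0
  have z2 : ∀ (n : ℕ) X (f : Phi R), lieAct F (((-1 : ℤ) ^ n) • X) f
      = (if n % 2 = 0 then (1 : ℤ) else -1) • lieAct F X f := by
    intro n X f
    rcases Nat.even_or_odd n with hn | hn
    · rw [hn.neg_one_pow, if_pos (Nat.even_iff.1 hn), one_smul, one_smul]
    · rw [hn.neg_one_pow, if_neg (by rw [Nat.odd_iff.1 hn]; norm_num)]
      have := lieAct_rsmul_left F (-1) X f
      simpa using this
  -- An even φ enters only through its even part, always with sign −1. An odd φ enters only through
  -- its odd part, where the parity operator on 𝓛 supplies the second sign.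
  by_cases hp : popc (v % 16) % 2 = 0
  · have e : (popc (v % 16) * popc (w % 16) % 2) = 0 := by rw [Nat.mul_mod, hp]; simp
    rw [if_pos hp, if_pos hp, z1, e]
    simp
  · have hp1 : popc (v % 16) % 2 = 1 := by omega
    rw [if_neg hp, if_neg hp, z1, z2]
    rcases Nat.mod_two_eq_zero_or_one (popc (w % 16)) with hq | hq
    · have e : (popc (v % 16) * popc (w % 16) % 2) = 0 := by rw [Nat.mul_mod, hq]; simp
      rw [e, hq]; simp
    · have e : (popc (v % 16) * popc (w % 16) % 2) = 1 := by rw [Nat.mul_mod, hp1, hq]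
      have e1 : (bif Nat.beq 1 0 then (-1 : ℤ) else 1) = 1 := rfl
      rw [e, hq, e1]; simp

theorem sigma_eval : ∀ a b : Fin 4, ∀ g : Gen,
    sigma a b g = (sigM a b).eval fun c => if gen 0 c = g then (1 : ℤ) else 0 := by
  decide +kernel

theorem sigM_lt : ∀ a b : Fin 4, ∀ p ∈ sigM a b, p.2 < 7 := by decide +kernel

theorem gen_eq (μ ν : Fin 4) {g : ℕ} (hg : g < 7) : gen μ g = gen ν g := by
  interval_cases g <;> rfl

theorem eval_sigM (μ : Fin 4) (a b : Fin 4) (z : Wedge R) :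
    (sigM a b).eval (fun c => mon z (gen μ c)) = fun g => sigma a b g • z := by
  funext g
  rw [Comb.eval_apply, sigma_eval]
  have := Comb.map_eval ((smulAddHom ℤ (Wedge R)).flip z) (sigM a b)
    fun c => if gen 0 c = g then (1 : ℤ) else 0
  simp only [AddMonoidHom.flip_apply, smulAddHom_apply] at this
  rw [this]
  refine Comb.eval_congr fun p hp => ?_
  rw [gen_eq μ 0 (sigM_lt a b p hp), mon_apply]
  simp only [eq_comm (a := g)]
  split_ifs <;> simp

theorem eval_curvM (μ i p j q : Fin 4) :
    (curvM i p j q).eval (vm R μ)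
      = ((fun g => sigma j q g • wedge (theta i) (theta p), 0) : V R) := by
  have h16 : ∀ a : Fin 4, 2 ^ a.1 < 16 := fun a =>
    Nat.pow_lt_pow_right (n := 4) (by norm_num) a.2
  rw [curvM, Comb.eval_bind, ← eval_sigM μ, eval_pair_lie]
  refine Comb.eval_congr fun r hr => ?_
  rw [Comb.eval_shift, theta_eq_tm, theta_eq_tm, wedge_tm (h16 i) (h16 p), mon_eval, eval_pair_lie]
  refine Comb.eval_congr fun s hs => ?_
  rw [vm_lie μ r.2 (by have := sigM_lt j q r hr; omega)
    (mulM_lt ⟨_, h16 i⟩ ⟨_, h16 p⟩ s hs)]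

theorem phiBr₁₁_single (μ a b : Fin 4) :
    ((phiBr₁₁ (Pi.single a 1) (Pi.single b 1), 0) : V R) = (phiM₁₁ a b).eval (vm R μ) := by
  have hfl : ∀ f : ℕ → Comb, Comb.eval ([0, 1, 2, 3].flatMap f) (vm R μ)
      = ∑ i : Fin 4, (f i).eval (vm R μ) := by
    intro f
    simp [Fin.sum_univ_four, add_assoc]
  have hη : ∀ i : Fin 4, etaM i = eta i := by decide
  rw [phiM₁₁, hfl]
  have hp : ∀ i : Fin 4, Comb.eval (bif a.1.beq b.1 then
      [0, 1, 2, 3].flatMap fun p => (curvM i p i p).scale (etaM a * etaM p * etaM i)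
      else []) (vm R μ) = if a = b then ∑ p : Fin 4, (eta a * eta p * eta i) •
        ((fun g => sigma i p g • wedge (theta i) (theta p), 0) : V R) else 0 := by
    intro i
    by_cases hab : a = b
    · subst hab
      simp only [Nat.beq_refl, cond_true, if_true, hfl, Comb.eval_scale,
        eval_curvM, hη]
    · have : a.1.beq b.1 = false := by
        rw [← Bool.not_eq_true]; exact fun h' => hab (Fin.ext (Nat.eq_of_beq_eq_true h'))
      rw [this, if_neg hab]; rfl
  simp only [Comb.eval_append, hp, Comb.eval_scale, eval_curvM]
  simp only [hη]
  have hE : ∑ r, eta r • ((Pi.single a 1 : Fin 4 → R) r * (Pi.single b 1 : Fin 4 → R) r)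
      = if a = b then ((eta a : ℤ) : R) else 0 := by
    rw [Finset.sum_eq_single a]
    · by_cases hab : a = b
      · subst hab; simp
      · simp [hab]
    · intro r _ hr; simp [hr]
    · simp
  refine Prod.ext ?_ ?_
  · rw [Prod.fst_sum]
    funext g
    rw [Finset.sum_apply]
    simp only [phiBr₁₁, hE]
    refine Finset.sum_congr rfl fun i _ => ?_
    have t1 : ∀ a b : Fin 4, ∑ p, ∑ q, (eta i * sigma i q g) •
        ((Pi.single a 1 : Fin 4 → R) p * (Pi.single b 1 : Fin 4 → R) q) • wedge (theta i) (theta p)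
        = (eta i * sigma i b g) • wedge (theta i) (theta a : Wedge R) := by
      intro a b
      rw [Finset.sum_eq_single a, Finset.sum_eq_single b]
      · simp
      · intro q _ hq; simp [hq]
      · simp
      · intro q _ hq; simp [hq]
      · simp
    have t2 : ∀ E : R, ∑ p, ∑ q, (eta i * sigma i q g) • (eta₂ p q • E) •
          wedge (theta i) (theta p : Wedge R)
        = ∑ p, (eta i * sigma i p g * eta p) • E • wedge (theta i) (theta p) := by
      intro E
      refine Finset.sum_congr rfl fun p _ => ?_
      rw [Finset.sum_eq_single p]
      · simp only [eta₂, if_true, mul_smul, smul_assoc]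
      · intro q _ hq
        simp [eta₂, hq.symm]
      · simp
    -- The polarized quadratic form is split into the two mixed terms and the trace term, each of
    -- which collapses to few indices on basis vectors.
    have t3 : ∀ p q, (eta i * sigma i q g) •
        (-3 * ((Pi.single a 1 : Fin 4 → R) p * (Pi.single b 1 : Fin 4 → R) q
            + (Pi.single a 1 : Fin 4 → R) q * (Pi.single b 1 : Fin 4 → R) p)
          + eta₂ p q • if a = b then ((eta a : ℤ) : R) else 0) • wedge (theta i) (theta p : Wedge R)
        = (-3 : R) • ((eta i * sigma i q g) •
        ((Pi.single a 1 : Fin 4 → R) p * (Pi.single b 1 : Fin 4 → R) q) • wedge (theta i) (theta p))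
        + (-3 : R) • ((eta i * sigma i q g) •
        ((Pi.single b 1 : Fin 4 → R) p * (Pi.single a 1 : Fin 4 → R) q) • wedge (theta i) (theta p))
        + (eta i * sigma i q g) • (eta₂ p q • if a = b then ((eta a : ℤ) : R) else 0) •
          wedge (theta i) (theta p : Wedge R) := by
      intro p q
      module
    simp only [t3, Finset.sum_add_distrib, ← Finset.smul_sum, t1, t2]
    by_cases hab : a = b
    · subst hab
      simp only [if_true, Prod.fst_add, Prod.smul_fst, Pi.add_apply, Pi.smul_apply, Prod.fst_sum,
        Finset.sum_apply, smul_add]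
      congr 1
      · module
      · refine Finset.sum_congr rfl fun p _ => ?_
        module
    · simp only [hab, if_false, Prod.fst_add, Prod.smul_fst, Pi.add_apply, Pi.smul_apply, zero_smul,
        smul_zero, Finset.sum_const_zero, smul_add, add_zero]
      module
  · rw [Prod.snd_sum]
    symm
    refine Finset.sum_eq_zero fun i _ => ?_
    split_ifs <;> simp [Prod.snd_sum]

/-- The codes of the basis of `Φ¹`. -/
def isPhiOne (v : ℕ) : Bool := v.beq 113 || v.beq 114 || v.beq 116 || v.beq 120

theorem phiBr₁₁_smul_left (r : R) (a b : Fin 4 → R) :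
    phiBr₁₁ (r • a) b = r • phiBr₁₁ a b := by
  funext g
  simp only [phiBr₁₁, Pi.smul_apply, Finset.smul_sum]
  refine Finset.sum_congr rfl fun i _ => Finset.sum_congr rfl fun p _ =>
    Finset.sum_congr rfl fun q _ => ?_
  rw [smul_comm r, smul_smul r]
  congr 2
  simp only [smul_eq_mul, mul_add, mul_smul_comm, Finset.mul_sum, mul_assoc]
  congr 1
  ring

theorem phi_one_mono (a : Fin 4) : (phiMono R (2 ^ a.1)).one = Pi.single a 1 := by
  have h16 : 2 ^ a.1 < 16 := Nat.pow_lt_pow_right (n := 4) (by norm_num) a.2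
  have h : ∀ a : Fin 4, mset (2 ^ a.1) = {a} := by decide +kernel
  funext b
  rw [Phi.one, main_phiMono h16, if_neg (by positivity), tm_apply, h]
  simp [Pi.single_apply]

/-- An element of Φ¹ has no two-form part and no part in the additional summand. So only the
symmetric map on Φ¹ × Φ¹ survives in brackets of such elements. -/
theorem phiBr₁₂_mono (r : R) (c : Fin 4 → R) (b : Fin 4) :
    phiBr₁₂ c (r • phiMono R (2 ^ b.1)) = 0 := by
  have h16 : 2 ^ b.1 < 16 := Nat.pow_lt_pow_right (n := 4) (by norm_num) b.2
  have h : ∀ a : Fin 4, mset (2 ^ a.1) = {a} := by decide +kernel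
  have h0 : (2 ^ b.1) ≠ 0 := by positivity
  funext g
  have e : ∀ i j : Fin 4, i < j → (r • phiMono R (2 ^ b.1)).main {i, j} = 0 := by
    intro i j hij
    rw [main_smul, main_phiMono h16, if_neg h0, Pi.smul_apply, tm_apply, h, if_neg, smul_zero]
    intro h'
    have := congrArg Finset.card h'
    rw [Finset.card_pair hij.ne, Finset.card_singleton] at this
    omega
  have e2 : (r • phiMono R (2 ^ b.1)).2 = 0 := by simp [phiMono]
  simp only [phiBr₁₂, e2, zero_smul, sub_zero]
  rw [Finset.sum_eq_zero, neg_zero]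
  · rfl
  intro i _
  refine Finset.sum_eq_zero fun j _ => ?_
  split_ifs with hij
  · rw [e i j hij, zero_smul]
  · rfl

theorem isPhiOne_iff {v : ℕ} (h : isPhiOne v = true) : ∃ a : Fin 4, v = 112 + 2 ^ a.1 := by
  simp only [isPhiOne, Bool.or_eq_true] at h
  rcases h with ((h | h) | h) | h
  · exact ⟨0, Nat.eq_of_beq_eq_true h⟩
  · exact ⟨1, Nat.eq_of_beq_eq_true h⟩
  · exact ⟨2, Nat.eq_of_beq_eq_true h⟩
  · exact ⟨3, Nat.eq_of_beq_eq_true h⟩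

theorem vBr_phi_phi_mono (F : FrameData R) (μ : Fin 4) {v w : ℕ} (hv : isPhiOne v = true)
    (hw : isPhiOne w = true) (f h : R) :
    vBr F (f • vm R μ v) (h • vm R μ w) = (f * h) • (brM v w).eval (vm R μ) := by
  obtain ⟨a, rfl⟩ := isPhiOne_iff hv
  obtain ⟨b, rfl⟩ := isPhiOne_iff hw
  have h16 : ∀ b : Fin 4, 2 ^ b.1 < 16 := fun b => Nat.pow_lt_pow_right (n := 4) (by norm_num) b.2
  have hbr : ∀ a b : Fin 4, brM (112 + 2 ^ a.1) (112 + 2 ^ b.1) = phiM₁₁ a b := by decide +kernel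
  rw [vm_phi μ (h16 a), vm_phi μ (h16 b), smul_phi, smul_phi, vBr_phi_phi, phiBr, phiBr₁₂_mono,
    phiBr₁₂_mono, add_zero, sub_zero, hbr, ← phiBr₁₁_single, smul_lie]
  have h1 : ∀ (r : R) (c : Fin 4), (r • phiMono R (2 ^ c.1)).one = r • Pi.single c 1 := by
    intro r c
    rw [← phi_one_mono]
    funext d; simp [Phi.one, main_smul]
  rw [h1, h1, phiBr₁₁_smul_left, phiBr₁₁_comm, phiBr₁₁_smul_left, phiBr₁₁_comm, smul_smul]

/-- Pairs of monomials for which the structure constants `brM` are those of the bracket. -/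
def okM (v w : ℕ) : Bool :=
  Nat.blt v 128 && Nat.blt w 128 && (Nat.blt v 112 || Nat.blt w 112 || isPhiOne v && isPhiOne w)

/-- Brackets Φ¹ × Φ² are left out on purpose: Φ begins in homological degree one, so they do not
occur for pairs of degrees (0, ·) or (1, 1), the only ones needed. -/
theorem vBr_mono (F : FrameData R) (μ : Fin 4) {v w : ℕ} (hvw : okM v w = true) (f h : R) :
    vBr F (f • vm R μ v) (h • vm R μ w) = (f * h) • (brM v w).eval (vm R μ) := by
  have blt : ∀ a b : ℕ, Nat.blt a b = true ↔ a < b := fun a b => by rw [Nat.blt_eq]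
  simp only [okM, Bool.and_eq_true, Bool.or_eq_true, blt] at hvw
  obtain ⟨⟨h1, h2⟩, h3⟩ := hvw
  by_cases hv : v / 16 = 7
  · by_cases hw : w / 16 = 7
    · rcases h3 with (h3 | h3) | h3
      · omega
      · omega
      · exact vBr_phi_phi_mono F μ h3.1 h3.2 f h
    · exact vBr_phi_lie_mono F μ hv (by omega) f h
  · by_cases hw : w / 16 = 7
    · exact vBr_lie_phi_mono F μ (by omega) hw f h
    · exact vBr_lie_mono F μ (by omega) (by omega) f h

end

/-! ### Brackets with vector fields -/

/-- Multiplication from the right by an element of `⋀W`, up to a sign. -/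
def smulRM (v T : ℕ) : Comb :=
  (smulM T v).scale (bif (popc (v % 16) * popc T % 2).beq 0 then -1 else 1)

section
variable {R : Type*} [CommRing R] [Algebra ℝ R]

/-- The derivative along the vector field `∑ u_μ D_μ`. -/
def dir (F : FrameData R) (u : Fin 4 → R) (f : R) : R := ∑ μ, u μ * F.D μ f

/-- The Lie bracket of the vector fields `∑ u_μ D_μ` and `∑ w_μ D_μ`. -/
def vecBr (F : FrameData R) (u w : Fin 4 → R) : Fin 4 → R := fun ρ =>
  dir F u (w ρ) - dir F w (u ρ) + ∑ μ, ∑ ν, F.c μ ν ρ * (u μ * w ν)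

/-- The element `θ_S ∑ u_μ D_μ` with code `c = 128 + S`. -/
def ve (u : Fin 4 → R) (c : ℕ) : V R := ∑ μ, u μ • vm R μ c

theorem vm_vec (μ : Fin 4) {S : ℕ} (hS : S < 16) :
    vm R μ (128 + S) = (mon (tm R S) (.vec μ), 0) := by
  have := vm_lie (R := R) μ 8 (by norm_num) hS
  exact this

theorem vec_act_tm_smul (F : FrameData R) (μ : Fin 4) (f : R) (T : ℕ) :
    (Gen.vec μ).act F (f • tm R T) = F.D μ f • tm R T := vec_act_smul_tm F μ f T

theorem vm_lt (μ ν : Fin 4) {c : ℕ} (hc : c < 128) : vm R μ c = vm R ν c := by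
  by_cases h : c / 16 = 7
  · rw [vm_of_phi μ h, vm_of_phi ν h]
  · rw [vm_of_lie μ h, vm_of_lie ν h, gen_eq μ ν (by omega : c / 16 < 7)]

/-- A vector field commutes with the σ's and annihilates all monomials of ⋀W. Of the three terms of
the bracket only the action of the other factor on θ_S remains. -/
theorem lieM_vec {S w : ℕ} (hS : S < 16) (hw : w / 16 < 7) :
    lieM (128 + S) w = ((actM (w / 16) S).bind fun U => (mulM U (w % 16)).shift 128).scale (-1) := by
  have h1 : (128 + S) / 16 = 8 := by omega
  have h2 : (128 + S) % 16 = S := by omega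
  rw [lieM, h1, h2]
  have h3 : ∀ k, commM 8 k = [] := by
    intro k; rw [commM]; have : Nat.ble 7 8 = true := rfl
    simp [this]
  have h4 : ∀ T, actM 8 T = [] := fun T => rfl
  rw [h3, h4]
  rfl

theorem lieM_vec_right {S w : ℕ} (hS : S < 16) (hw : w / 16 < 7) :
    lieM w (128 + S) = (actM (w / 16) S).bind fun U => (mulM (w % 16) U).shift 128 := by
  have h1 : (128 + S) / 16 = 8 := by omega
  have h2 : (128 + S) % 16 = S := by omega
  rw [lieM, h1, h2]
  have h3 : ∀ k, commM k 8 = [] := by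
    intro k; rw [commM]; have : Nat.ble 7 8 = true := rfl
    simp [this]
  have h4 : ∀ T, actM 8 T = [] := fun T => rfl
  rw [h3, h4]
  simp [Comb.bind, Comb.scale]

theorem gen_comm_vec_left (F : FrameData R) (μ : Fin 4) {g : ℕ} (hg : g < 7) (k : Gen) :
    (Gen.vec μ).comm F (gen μ g) k = 0 := by interval_cases g <;> rfl

theorem gen_comm_vec_right (F : FrameData R) (μ : Fin 4) {g : ℕ} (hg : g < 7) (k : Gen) :
    (gen μ g).comm F (.vec μ) k = 0 := by interval_cases g <;> rfl

/-- The bracket consists of a tensorial term, where the other factor acts on θ_S, and a term where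
the vector field differentiates the coefficient h. These two kinds of structure constants are kept
apart throughout. -/
theorem vBr_vec_lie (F : FrameData R) (μ : Fin 4) {S w : ℕ} (hS : S < 16) (hw : w / 16 < 7)
    (f h : R) : vBr F (f • vm R μ (128 + S)) (h • vm R μ w)
      = (f * h) • (brM (128 + S) w).eval (vm R μ) + (f * F.D μ h) • (smulM S w).eval (vm R μ) := by
  have hT : w % 16 < 16 := Nat.mod_lt _ (by norm_num)
  have e1 : ((128 + S) / 16).beq 7 = false := beq_seven (by omega)
  have hbr : brM (128 + S) w = lieM (128 + S) w := by rw [brM, e1, beq_seven hw.ne]; rfl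
  have hsm : smulM S w = (mulM S (w % 16)).shift (16 * (w / 16)) := by
    rw [smulM, beq_seven hw.ne]; rfl
  have a2 := actM_lt ⟨w / 16, by omega⟩ ⟨S, hS⟩
  simp only at a2
  rw [vm_vec μ hS, vm_of_lie μ hw.ne, smul_lie, smul_lie, vBr_lie_lie, ← mon_smul, ← mon_smul,
    lieBr_mon, hbr, lieM_vec hS hw, hsm, vec_act_tm_smul, gen_act_smul F μ hw, gen_act_tm F μ hw hS]
  simp only [gen_comm_vec_left F μ hw, zero_smul, wedge_smul_left, wedge_smul_right, mon_smul]
  rw [show ((fun _ => 0 : Lie R)) = 0 from rfl, zero_add]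
  have hadd : ∀ X Y : Lie R, ((X - Y, 0) : V R) = - (Y, 0) + (X, 0) := by
    intro X Y; ext <;> simp [sub_eq_neg_add]
  rw [hadd, wedge_tm hS hT, wedge_eval_left, mon_eval, mon_eval]
  simp only [smul_smul, ← smul_lie, mul_comm h f, eval_pair_lie]
  rw [Comb.eval_scale, neg_one_zsmul, smul_neg, Comb.eval_bind, Comb.eval_shift]
  congr 1
  · refine congrArg (fun z => -((f * h) • z)) ?_
    refine Comb.eval_congr (E := V R) fun p hp => ?_
    rw [wedge_tm (a2 p hp) hT, mon_eval, eval_pair_lie, Comb.eval_shift]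
    refine Comb.eval_congr fun q hq => ?_
    rw [vm_vec μ (mulM_lt ⟨p.2, a2 p hp⟩ ⟨_, hT⟩ q hq)]
  · rw [mul_comm (F.D μ h)]
    refine congrArg (fun z : V R => (f * F.D μ h) • z) ?_
    refine Comb.eval_congr (E := V R) fun q hq => ?_
    rw [vm_lie μ _ hw.ne (mulM_lt ⟨S, hS⟩ ⟨_, hT⟩ q hq)]

theorem vBr_lie_vec (F : FrameData R) (μ : Fin 4) {S w : ℕ} (hS : S < 16) (hw : w / 16 < 7)
    (f h : R) : vBr F (h • vm R μ w) (f • vm R μ (128 + S))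
      = (f * h) • (brM w (128 + S)).eval (vm R μ) + (f * F.D μ h) • (smulRM w S).eval (vm R μ) := by
  have hT : w % 16 < 16 := Nat.mod_lt _ (by norm_num)
  have e1 : ((128 + S) / 16).beq 7 = false := beq_seven (by omega)
  have hbr : brM w (128 + S) = lieM w (128 + S) := by rw [brM, e1, beq_seven hw.ne]; rfl
  have hsm : (smulRM w S).eval (vm R μ)
      = - ((mulM (w % 16) S).shift (16 * (w / 16))).eval (vm R μ) := by
    -- Graded commutativity turns left multiplication into right multiplication; the remaining −1 is
    -- the sign of the third term of the bracket.
    have key : ∀ S T : Fin 16, Comb.same ((mulM T S).scale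
        (bif (popc S * popc T % 2).beq 0 then -1 else 1)) ((mulM S T).scale (-1)) = true := by
      decide +kernel
    have := Comb.eval_eq_of_same (key ⟨w % 16, hT⟩ ⟨S, hS⟩) fun c => vm R μ (16 * (w / 16) + c)
    simp only [Comb.eval_scale] at this
    rw [smulRM, smulM, beq_seven hw.ne]
    simp only [cond_false, Comb.eval_scale, Comb.eval_shift, this, neg_one_zsmul]
  have a2 := actM_lt ⟨w / 16, by omega⟩ ⟨S, hS⟩
  simp only at a2
  rw [vm_vec μ hS, vm_of_lie μ hw.ne, smul_lie, smul_lie, vBr_lie_lie, ← mon_smul, ← mon_smul,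
    lieBr_mon, hbr, lieM_vec_right hS hw, hsm, vec_act_tm_smul, gen_act_smul F μ hw,
    gen_act_tm F μ hw hS]
  simp only [gen_comm_vec_right F μ hw, zero_smul, wedge_smul_left, wedge_smul_right, mon_smul]
  rw [show ((fun _ => 0 : Lie R)) = 0 from rfl, zero_add]
  have hadd : ∀ X Y : Lie R, ((X - Y, 0) : V R) = (X, 0) + - (Y, 0) := by
    intro X Y; ext <;> simp [sub_eq_add_neg]
  rw [hadd, wedge_tm hT hS, wedge_eval_right, mon_eval, mon_eval]
  simp only [smul_smul, ← smul_lie, eval_pair_lie]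
  rw [smul_neg, Comb.eval_bind, Comb.eval_shift]
  congr 1
  · congr 1
    refine Comb.eval_congr fun p hp => ?_
    rw [wedge_tm hT (a2 p hp), mon_eval, eval_pair_lie, Comb.eval_shift]
    refine Comb.eval_congr fun q hq => ?_
    rw [vm_vec μ (mulM_lt ⟨_, hT⟩ ⟨p.2, a2 p hp⟩ q hq)]
  · refine congrArg (fun z => -((f * F.D μ h) • z)) ?_
    refine Comb.eval_congr fun q hq => ?_
    rw [vm_lie μ _ hw.ne (mulM_lt ⟨_, hT⟩ ⟨S, hS⟩ q hq)]

theorem lieAct_vec (F : FrameData R) (μ : Fin 4) {S m : ℕ} (hS : S < 16) (hm : m < 16) (f h : R) :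
    ((0, lieAct F (mon (f • tm R S) (.vec μ)) (h • phiMono R m)) : V R)
      = (f * F.D μ h) • ((smulPhiM S m).shift 112).eval (vm R μ) := by
  rw [lieAct_mon, actPhi_vec F μ hm, phi_smul_smul_left, phi_smul_smul_right, smul_smul,
    phi_smul_mono hS hm, ← smul_phi, eval_pair_phi, Comb.eval_shift]
  congr 1
  refine Comb.eval_congr fun q hq => ?_
  rw [vm_phi μ (smulPhiM_lt ⟨S, hS⟩ ⟨m, hm⟩ q hq)]

theorem lieActM_vec {S m : ℕ} (hS : S < 16) (hm : m < 16) : lieActM (128 + S) m = [] := by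
  have : ∀ m : Fin 16, actPhiM 8 m = [] := by decide +kernel
  have h1 : (128 + S) / 16 = 8 := by omega
  rw [lieActM, h1, this ⟨m, hm⟩]
  rfl

theorem vBr_vec_phi (F : FrameData R) (μ : Fin 4) {S w : ℕ} (hS : S < 16) (hw : w / 16 = 7)
    (f h : R) : vBr F (f • vm R μ (128 + S)) (h • vm R μ w)
      = (f * h) • (brM (128 + S) w).eval (vm R μ) + (f * F.D μ h) • (smulM S w).eval (vm R μ) := by
  have hT : w % 16 < 16 := Nat.mod_lt _ (by norm_num)
  have e1 : ((128 + S) / 16).beq 7 = false := beq_seven (by omega)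
  have hbr : brM (128 + S) w = [] := by rw [brM, e1, hw, lieActM_vec hS hT]; rfl
  have hsm : smulM S w = (smulPhiM S (w % 16)).shift 112 := by rw [smulM, hw]; rfl
  rw [vm_vec μ hS, vm_of_phi μ hw, smul_lie, smul_phi, vBr_lie_phi, ← mon_smul, hbr, hsm,
    lieAct_vec F μ hS hT, Comb.eval_nil, smul_zero, zero_add]

theorem vBr_phi_vec (F : FrameData R) (μ : Fin 4) {S w : ℕ} (hS : S < 16) (hw : w / 16 = 7)
    (f h : R) : vBr F (h • vm R μ w) (f • vm R μ (128 + S))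
      = (f * h) • (brM w (128 + S)).eval (vm R μ) + (f * F.D μ h) • (smulRM w S).eval (vm R μ) := by
  have hT : w % 16 < 16 := Nat.mod_lt _ (by norm_num)
  have e1 : ((128 + S) / 16).beq 7 = false := beq_seven (by omega)
  have hbr : brM w (128 + S) = [] := by rw [brM, e1, hw, lieActM_vec hS hT]; rfl
  have hsm : smulM S w = (smulPhiM S (w % 16)).shift 112 := by rw [smulM, hw]; rfl
  rw [vm_vec μ hS, vm_of_phi μ hw, smul_lie, smul_phi, vBr_phi_lie, ← mon_smul, hbr, smulRM, hsm,
    even_smul, odd_smul, even_phiMono hT, odd_phiMono hT, parity_mon hS,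
    Comb.eval_nil, smul_zero, zero_add, Comb.eval_scale, smul_comm, ← lieAct_vec F μ hS hT]
  have z1 : ∀ X, lieAct F X (h • (0 : Phi R)) = 0 := fun X => by
    simpa using lieAct_rsmul_right F 0 X 0
  have z2 : ∀ (n : ℕ) X (f : Phi R), lieAct F (((-1 : ℤ) ^ n) • X) f
      = (if n % 2 = 0 then (1 : ℤ) else -1) • lieAct F X f := by
    intro n X f
    rcases Nat.even_or_odd n with hn | hn
    · rw [hn.neg_one_pow, if_pos (Nat.even_iff.1 hn), one_smul, one_smul]
    · rw [hn.neg_one_pow, if_neg (by rw [Nat.odd_iff.1 hn]; norm_num)]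
      have := lieAct_rsmul_left F (-1) X f
      simpa using this
  by_cases hp : popc (w % 16) % 2 = 0
  · have e : (popc (w % 16) * popc S % 2) = 0 := by rw [Nat.mul_mod, hp]; simp
    rw [if_pos hp, if_pos hp, z1, e]
    simp
  · have hp1 : popc (w % 16) % 2 = 1 := by omega
    rw [if_neg hp, if_neg hp, z1, z2]
    rcases Nat.mod_two_eq_zero_or_one (popc S) with hq | hq
    · have e : (popc (w % 16) * popc S % 2) = 0 := by rw [Nat.mul_mod, hq]; simp
      rw [e, hq]; simp
    · have e : (popc (w % 16) * popc S % 2) = 1 := by rw [Nat.mul_mod, hp1, hq]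
      have e1 : (bif Nat.beq 1 0 then (-1 : ℤ) else 1) = 1 := rfl
      rw [e, hq, e1]; simp

theorem brM_vec_mem {S w : ℕ} (hS : S < 16) (hw : w < 128) :
    ∀ p ∈ brM (128 + S) w, 128 ≤ p.2 ∧ p.2 < 144 := by
  have : ∀ S : Fin 16, ∀ w : Fin 128, ∀ p ∈ brM (128 + S) w, 128 ≤ p.2 ∧ p.2 < 144 := by
    decide +kernel
  exact this ⟨S, hS⟩ ⟨w, hw⟩

theorem brM_vec_right_mem {S w : ℕ} (hS : S < 16) (hw : w < 128) :
    ∀ p ∈ brM w (128 + S), 128 ≤ p.2 ∧ p.2 < 144 := by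
  have : ∀ S : Fin 16, ∀ w : Fin 128, ∀ p ∈ brM w (128 + S), 128 ≤ p.2 ∧ p.2 < 144 := by
    decide +kernel
  exact this ⟨S, hS⟩ ⟨w, hw⟩

theorem smulM_lt {S w : ℕ} (hS : S < 16) (hw : w < 128) : ∀ p ∈ smulM S w, p.2 < 128 := by
  have : ∀ S : Fin 16, ∀ w : Fin 128, ∀ p ∈ smulM S w, p.2 < 128 := by decide +kernel
  exact this ⟨S, hS⟩ ⟨w, hw⟩

theorem smulRM_lt {S w : ℕ} (hS : S < 16) (hw : w < 128) : ∀ p ∈ smulRM w S, p.2 < 128 := by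
  have : ∀ S : Fin 16, ∀ w : Fin 128, ∀ p ∈ smulRM w S, p.2 < 128 := by decide +kernel
  exact this ⟨S, hS⟩ ⟨w, hw⟩

theorem eval_vm {l : Comb} (h : ∀ p ∈ l, p.2 < 128) (μ ν : Fin 4) :
    l.eval (vm R μ) = l.eval (vm R ν) := Comb.eval_congr fun p hp => vm_lt μ ν (h p hp)

theorem sum_smul_eval (u : Fin 4 → R) (l : Comb) :
    ∑ μ, u μ • l.eval (vm R μ) = l.eval (ve u) := by
  simp only [Comb.eval_smul]
  induction l with
  | nil => simp
  | cons p l ih =>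
    simp only [Comb.eval_cons, Finset.sum_add_distrib, ih, ve, Finset.smul_sum]

/-- The monomial w contains no vector field, so the tensorial terms for the four directions
recombine to the vector field with components h u_μ, while the derivatives recombine to the
directional derivative of h. -/
theorem vBr_ve_mono (F : FrameData R) (ν : Fin 4) {S w : ℕ} (hS : S < 16) (hw : w < 128)
    (u : Fin 4 → R) (h : R) : vBr F (ve u (128 + S)) (h • vm R ν w)
      = (brM (128 + S) w).eval (ve (h • u)) + dir F u h • (smulM S w).eval (vm R ν) := by
  have key : ∀ μ, vBr F (u μ • vm R μ (128 + S)) (h • vm R ν w)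
      = (u μ * h) • (brM (128 + S) w).eval (vm R μ)
        + (u μ * F.D μ h) • (smulM S w).eval (vm R ν) := by
    intro μ
    rw [vm_lt ν μ hw, eval_vm (smulM_lt hS hw) ν μ]
    by_cases h7 : w / 16 = 7
    · exact vBr_vec_phi F μ hS h7 _ _
    · exact vBr_vec_lie F μ hS (by omega) _ _
  rw [ve, ← vBrₗ_apply, map_sum, LinearMap.sum_apply]
  simp only [vBrₗ_apply, key, Finset.sum_add_distrib, ← Finset.sum_smul, dir]
  rw [← sum_smul_eval]
  simp only [Pi.smul_apply, smul_eq_mul, mul_comm h]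

theorem vBr_mono_ve (F : FrameData R) (ν : Fin 4) {S w : ℕ} (hS : S < 16) (hw : w < 128)
    (u : Fin 4 → R) (h : R) : vBr F (h • vm R ν w) (ve u (128 + S))
      = (brM w (128 + S)).eval (ve (h • u)) + dir F u h • (smulRM w S).eval (vm R ν) := by
  have key : ∀ μ, vBr F (h • vm R ν w) (u μ • vm R μ (128 + S))
      = (u μ * h) • (brM w (128 + S)).eval (vm R μ)
        + (u μ * F.D μ h) • (smulRM w S).eval (vm R ν) := by
    intro μ
    rw [vm_lt ν μ hw, eval_vm (smulRM_lt hS hw) ν μ]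
    by_cases h7 : w / 16 = 7
    · exact vBr_phi_vec F μ hS h7 _ _
    · exact vBr_lie_vec F μ hS (by omega) _ _
  rw [ve, ← vBrₗ_apply, map_sum]
  simp only [vBrₗ_apply, key, Finset.sum_add_distrib, ← Finset.sum_smul, dir]
  rw [← sum_smul_eval]
  simp only [Pi.smul_apply, smul_eq_mul, mul_comm h]

theorem gen_comm_vec_vec (F : FrameData R) (μ ν : Fin 4) (z : Wedge R) :
    (fun k => (Gen.vec μ).comm F (.vec ν) k • z) = ∑ ρ, F.c μ ν ρ • mon z (.vec ρ) := by
  funext k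
  rw [Finset.sum_apply]
  cases k with
  | vec ρ =>
    rw [Finset.sum_eq_single ρ]
    · simp [Gen.comm, mon_apply]
    · intro σ _ hσ; simp [mon_apply, hσ.symm]
    · simp
  | _ => simp [Gen.comm, mon_apply]

/-- Since vector fields annihilate θ_S and θ_T, all three terms of the bracket carry the same
product θ_Sθ_T, and their coefficients add up to the bracket of the two vector fields. -/
theorem vBr_ve_ve (F : FrameData R) {S T : ℕ} (hS : S < 16) (hT : T < 16) (u w : Fin 4 → R) :
    vBr F (ve u (128 + S)) (ve w (128 + T))
      = (mulM S T).eval fun m => ve (vecBr F u w) (128 + m) := by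
  have key : ∀ μ ν, vBr F (u μ • vm R μ (128 + S)) (w ν • vm R ν (128 + T))
      = (mulM S T).eval fun m => (∑ ρ, (F.c μ ν ρ * (u μ * w ν)) • vm R ρ (128 + m))
          + (u μ * F.D μ (w ν)) • vm R ν (128 + m) - (w ν * F.D ν (u μ)) • vm R μ (128 + m) := by
    intro μ ν
    have hr : ((mulM S T).eval fun m => (∑ ρ, (F.c μ ν ρ * (u μ * w ν)) • vm R ρ (128 + m))
          + (u μ * F.D μ (w ν)) • vm R ν (128 + m) - (w ν * F.D ν (u μ)) • vm R μ (128 + m))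
        = (mulM S T).eval fun m => (∑ ρ, (F.c μ ν ρ * (u μ * w ν)) •
              ((mon (tm R m) (.vec ρ), 0) : V R))
          + (u μ * F.D μ (w ν)) • ((mon (tm R m) (.vec ν), 0) : V R)
          - (w ν * F.D ν (u μ)) • ((mon (tm R m) (.vec μ), 0) : V R) := by
      refine Comb.eval_congr fun p hp => ?_
      have := mulM_lt ⟨S, hS⟩ ⟨T, hT⟩ p hp
      simp only [vm_vec _ this]
    have hpair : ∀ m, (∑ ρ, (F.c μ ν ρ * (u μ * w ν)) • ((mon (tm R m) (.vec ρ), 0) : V R))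
          + (u μ * F.D μ (w ν)) • ((mon (tm R m) (.vec ν), 0) : V R)
          - (w ν * F.D ν (u μ)) • ((mon (tm R m) (.vec μ), 0) : V R)
        = ((∑ ρ, (F.c μ ν ρ * (u μ * w ν)) • mon (tm R m) (.vec ρ))
          + (u μ * F.D μ (w ν)) • mon (tm R m) (.vec ν)
          - (w ν * F.D ν (u μ)) • mon (tm R m) (.vec μ), 0) := by
      intro m
      ext <;> simp [Prod.fst_sum, Prod.snd_sum]
    rw [hr]
    simp only [hpair]
    rw [← eval_pair_lie, vm_vec μ hS, vm_vec ν hT, smul_lie, smul_lie, vBr_lie_lie, ← mon_smul,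
      ← mon_smul, lieBr_mon, gen_comm_vec_vec, vec_act_tm_smul, vec_act_tm_smul]
    congr 1
    have hz : ∀ (r s : R) (g : Gen), mon (wedge (r • tm R S) (s • tm R T)) g
        = (mulM S T).eval fun m => (r * s) • mon (tm R m) g := by
      intro r s g
      rw [wedge_smul_left, wedge_smul_right, wedge_tm hS hT, mon_smul, mon_smul, smul_smul, mon_eval,
        Comb.eval_smul]
    simp only [hz]
    simp only [Comb.eval_smul, smul_smul]
    generalize mulM S T = l
    induction l with
    | nil => simp
    | cons p l ih =>
      simp only [Comb.eval_cons, smul_add, smul_sub, Finset.sum_add_distrib,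
        mul_comm (F.D ν (u μ))] at ih ⊢
      rw [← ih, Finset.smul_sum]
      abel
  rw [ve, ve, ← vBrₗ_apply]
  simp only [map_sum, LinearMap.sum_apply, vBrₗ_apply, key]
  generalize mulM S T = l
  induction l with
  | nil => simp
  | cons p l ih =>
    simp only [Comb.eval_cons, Finset.sum_add_distrib, ih]
    congr 1
    simp only [← Finset.smul_sum]
    congr 1
    simp only [ve, vecBr, dir, add_smul, sub_smul, Finset.sum_add_distrib, Finset.sum_sub_distrib,
      Finset.sum_smul]
    have t1 : ∑ ν, ∑ μ, ∑ ρ, (F.c μ ν ρ * (u μ * w ν)) • vm R ρ (128 + p.2)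
        = ∑ ρ, ∑ μ, ∑ ν, (F.c μ ν ρ * (u μ * w ν)) • vm R ρ (128 + p.2) := by
      refine (Finset.sum_congr rfl fun ν _ => Finset.sum_comm).trans ?_
      refine Finset.sum_comm.trans (Finset.sum_congr rfl fun ρ _ => Finset.sum_comm)
    rw [t1, Finset.sum_comm (f := fun ν μ => (w ν * F.D ν (u μ)) • vm R μ (128 + p.2))]
    abel

end

/-! ## The basis of `𝓔_Φ`, encoded by numbers

The table element with code `3 * n + i`, `n < 12`, is the `n`-th of `kasner`, `bianchi`, `boost`,
`rot`, `mix`, `sym`, `rotA`, `rotB`, `curvA`, `asym`, `curvB`, `curvC`, with index `i`.  The codes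
`36, …, 39` are `scale`, `curv`, `curvD`, `top`, the codes `40 + S` are scalars and the codes
`48 + S` are vector fields.  Multiplication by `θ₀` adds `64`. -/

/-- The subset of `Fin 3` with a given bit mask. -/
def mset3 (m : ℕ) : Finset (Fin 3) := Finset.univ.filter fun i => m.testBit i

/-- The index set of the basis in terms of codes. -/
def rowOf (μ : Fin 4) (c : ℕ) : Row :=
  if c < 36 then
    ([Row.kasner, Row.bianchi, Row.boost, Row.rot, Row.mix, Row.sym, Row.rotA, Row.rotB, Row.curvA,
      Row.asym, Row.curvB, Row.curvC].getD (c / 3) Row.kasner) (Fin.ofNat 3 c)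
  else if c < 40 then [Row.scale, Row.curv, Row.curvD, Row.top].getD (c - 36) Row.scale
  else if c < 48 then .scalar (mset3 (c - 40))
  else .vec (mset3 (c - 48)) μ

/-- The basis element with a given code. -/
def idxOf (μ : Fin 4) (c : ℕ) : Idx := (!c.blt 64, rowOf μ (c % 64))

/-- `e θ_a θ_b g` as a combination of monomials. -/
def quadM (e : ℤ) (a b g : ℕ) : Comb := ((mulM (2 ^ a) (2 ^ b)).shift (16 * g)).scale e

/-- `e θ_a g` as a combination of monomials. -/
def linM (e : ℤ) (a g : ℕ) : Comb := [(e, 16 * g + 2 ^ a)]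

/-- The table elements as combinations of monomials. -/
def tableM (c : ℕ) : Comb :=
  let i := c % 3
  let j := (c + 1) % 3
  let k := (c + 2) % 3
  bif c.blt 36 then
    [linM 1 0 0 ++ linM 1 (i + 1) (i + 1),
      linM (-1) (i + 1) (i + 4) ++ linM 1 (j + 1) (j + 4) ++ linM 1 (k + 1) (k + 4),
      [(1, 16 * (i + 1))],
      [(1, 16 * (i + 4))],
      linM 1 0 (i + 1) ++ linM 1 (i + 1) 0,
      linM 1 (j + 1) (k + 1) ++ linM 1 (k + 1) (j + 1),
      linM 1 (k + 1) (j + 4),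
      linM 1 (j + 1) (k + 4),
      quadM 1 0 (j + 1) (k + 4) ++ quadM 1 (i + 1) (j + 1) (j + 1),
      linM 1 (j + 1) (k + 1) ++ linM (-1) (k + 1) (j + 1),
      quadM 1 0 (j + 1) (k + 1) ++ quadM (-1) 0 (k + 1) (j + 1) ++ quadM (-2) (j + 1) (k + 1) 0,
      quadM 1 0 (j + 1) (k + 1) ++ quadM 1 0 (k + 1) (j + 1) ++
        quadM (-2) (i + 1) (j + 1) (j + 4)].getD (c / 3) []
  else bif c.blt 40 then
    [[(1, 0)],
      [0, 1, 2].flatMap fun l => quadM 1 ((l + 1) % 3 + 1) ((l + 2) % 3 + 1) (l + 4) ++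
        quadM 2 0 (l + 1) (l + 1),
      [0, 1, 2].flatMap fun l => quadM 1 0 (l + 1) (l + 4) ++
        quadM (-2) ((l + 1) % 3 + 1) ((l + 2) % 3 + 1) (l + 1),
      [(1, 16 + 13), (-1, 32 + 11), (1, 48 + 7), (3, 14)]].getD (c - 36) []
  else bif c.blt 48 then [(1, 112 + (bif c.beq 40 then 1 else 2 * (c - 40)))]
  else [(1, 128 + 2 * (c - 48))]

/-- The basis elements as combinations of monomials. -/
def eltM (c : ℕ) : Comb := bif c.blt 64 then tableM c else (tableM (c - 64)).bind (smulM 1)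

/-- Six times the coordinates of the monomials without `θ₀`, modulo the ideal. -/
def spatialM (v : ℕ) : Comb :=
  let g := v / 16
  let m := v % 16
  let i := bif m.beq 2 || m.beq 6 then 0 else bif m.beq 4 || m.beq 12 then 1 else 2
  let j := (i + 1) % 3
  let k := (i + 2) % 3
  let d := (g + 2 - i) % 3
  bif g.beq 8 then [(6, 48 + m / 2)]
  else bif g.beq 7 then (bif m.beq 0 then [(6, 104)] else [(6, 40 + m / 2)])
  else bif m.beq 0 then (bif g.beq 0 then [(6, 36)]
    else [(6, 5 + g)])
  else bif m.beq 14 then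
    bif g.beq 0 then [(2, 39), (1, 102)]
    else bif g.blt 4 then [(3, 96 + g)] else [(6, 84 + g)]
  else bif (popc m).beq 1 then
    bif g.beq 0 then [(6, 12 + i), (-6, 70 + i)]
    else bif g.blt 4 then
      [[(6, i), (-6, 100)], [(3, 27 + k), (3, 15 + k)], [(-3, 27 + j), (3, 15 + j)]].getD d []
    else [[(3, 3 + j), (3, 3 + k)], [(6, 21 + k)], [(6, 18 + j)]].getD d []
  else Comb.scale (bif m.beq 10 then -1 else 1) (bif g.beq 0 then [(-3, 30 + k), (3, 91 + k)]
    else bif g.blt 4 then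
      [[(-6, 82 + j), (-6, 24 + j)], [(6, 24 + i), (-6, 85 + i)], [(3, 67 + k), (-1, 38)]].getD d []
    else [[(3, 79 + j), (3, 33 + j)], [(-3, 33 + i), (3, 79 + i)],
      [(-6, 64 + i), (-6, 64 + j), (2, 37)]].getD d [])

/-- Multiplication by `θ₀` in terms of codes of basis elements. -/
def timeM (c : ℕ) : Comb := bif c.blt 64 then [(1, c + 64)] else []

/-- Six times the coordinates of the monomials, modulo the ideal. -/
def coordM (v : ℕ) : Comb :=
  bif (v % 2).beq 0 then spatialM v
  else bif v.beq 113 then [(6, 40)]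
  else bif (v / 16).beq 7 then [(6, 104 + v % 16 / 2)]
  else (spatialM (v - 1)).bind timeM

/-- The ten basic symmetric traceless matrices: five real ones and their multiples by `√-1`. -/
def matM (k i l : ℕ) : ℤ :=
  bif (k % 5).blt 3 then
    bif i.beq (k % 5) && l.beq ((k % 5 + 1) % 3) || l.beq (k % 5) && i.beq ((k % 5 + 1) % 3) then 1
    else 0
  else bif !i.beq l then 0 else bif i.beq (k % 5 - 3) then 1 else bif i.beq (k % 5 - 2) then -1
  else 0

/-- The generators of the ideal for these matrices. -/
def weylM (k : ℕ) : Comb :=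
  [0, 1, 2].flatMap fun i => [0, 1, 2].flatMap fun l =>
    (bif k.blt 5 then quadM 1 0 (i + 1) (l + 1) ++
        quadM (-1) ((i + 1) % 3 + 1) ((i + 2) % 3 + 1) (l + 4)
      else quadM (-1) 0 (i + 1) (l + 4) ++
        quadM (-1) ((i + 1) % 3 + 1) ((i + 2) % 3 + 1) (l + 1)).scale (matM k i l)

/-- The multiple by `θ_T` of the `k`-th generator of the ideal, encoded as `16 k + T`. -/
def idealM (c : ℕ) : Comb := (weylM (c / 16)).bind (smulM (c % 16))

/-- The difference between six times a monomial without `θ₀` and the combination of basis elements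
given by its coordinates, in terms of generators of the ideal. -/
def certM (v : ℕ) : Comb :=
  bif v.beq 22 then [(-6, 112)] else bif v.beq 54 then [(2, 128), (4, 144)]
  else bif v.beq 70 then [(-6, 32)] else bif v.beq 102 then [(2, 48), (4, 64)]
  else bif v.beq 28 then [(-4, 128), (-2, 144)] else bif v.beq 44 then [(-6, 80)]
  else bif v.beq 76 then [(-4, 48), (-2, 64)] else bif v.beq 92 then [(-6, 0)]
  else bif v.beq 42 then [(-2, 128), (2, 144)] else bif v.beq 58 then [(6, 96)]
  else bif v.beq 90 then [(-2, 48), (2, 64)] else bif v.beq 106 then [(6, 16)]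
  else bif v.beq 30 then [(-6, 84)] else bif v.beq 46 then [(-6, 104)]
  else bif v.beq 62 then [(-6, 114)] else bif v.beq 78 then [(-6, 4)]
  else bif v.beq 94 then [(-6, 24)] else bif v.beq 110 then [(-6, 34)] else []

/-- The same for all monomials. -/
def certAllM (v : ℕ) : Comb :=
  bif (v % 2).beq 0 || Nat.ble 112 v then certM v
  else (certM (v - 1)).bind fun c => (mulM 1 (c % 16)).shift (16 * (c / 16))

/-- Together with `coordM_eltM` this gives uniqueness of coordinates: they vanish on the ideal and
are the expected ones on the basis. The factor 6 clears the denominators 2 and 3. -/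
theorem coordM_idealM : ∀ k : Fin 10, ∀ T : Fin 16,
    Comb.same ((idealM (16 * k + T)).bind coordM) [] = true := by decide +kernel

theorem coordM_eltM : ∀ c : Fin 56, ∀ b : Fin 2,
    Comb.same ((eltM (c + 64 * b)).bind coordM) [(6, c + 64 * b)] = true := by decide +kernel

/-- Existence of coordinates: each monomial, multiplied by 6, differs from its combination of basis
elements by an explicit combination of multiples of the ten ideal generators. The combination for
monomials with θ₀ is θ₀ times the one without. -/
theorem certAllM_spec : ∀ v : Fin 144,
    Comb.same ((6, v.1) :: ((coordM v).bind eltM).scale (-1)) ((certAllM v).bind idealM) = true := by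
  decide +kernel

theorem certAllM_lt : ∀ v : Fin 144, ∀ p ∈ certAllM v, p.2 < 160 := by decide +kernel

/-- Evaluation of a function at a number; in this form the kernel replaces the number by a literal
first. -/
def force {α : Type} (c : ℕ) (f : ℕ → α) : α := Nat.casesOn c (f 0) fun n => f (n + 1)

@[simp] theorem force_eq {α : Type} (c : ℕ) (f : ℕ → α) : force c f = f c := by cases c <;> rfl

/-! ## The structure constants of `𝓐` -/

/-- The code of the degree of `edge i`. -/
def edgeM (i : ℕ) : ℕ := 73 - 8 ^ (i % 3)

/-- The `ℕ³`-degree `(d₀, d₁, d₂)` of a basis element, encoded as `d₀ + 8 d₁ + 64 d₂`. -/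
def degM (c : ℕ) : ℕ :=
  let r := c % 64
  bif r.blt 36 then
    [0, 2 * 8 ^ (r % 3), edgeM r, edgeM r, edgeM r, edgeM r, edgeM r, edgeM r, edgeM r,
      edgeM (r + 1) + edgeM (r + 2), edgeM (r + 1) + edgeM (r + 2),
      edgeM (r + 1) + edgeM (r + 2)].getD (r / 3) 0
  else bif r.blt 38 then 0 else bif r.blt 40 then 146
  else r % 2 * edgeM 0 + r / 2 % 2 * edgeM 1 + r / 4 % 2 * edgeM 2

/-- The homological degree of a basis element. -/
def hdegM (c : ℕ) : ℕ :=
  let r := c % 64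
  c / 64 + bif r.blt 36 then [1, 1, 0, 0, 1, 1, 1, 1, 2, 1, 2, 2].getD (r / 3) 0
  else bif r.blt 40 then [0, 2, 2, 3].getD (r - 36) 0
  else bif r.beq 40 then 1 else popc (r % 8)

/-- Six times the component of a given degree of a combination of monomials, in terms of basis
elements. -/
def projM (d : ℕ) (l : Comb) : Comb :=
  Comb.norm ((l.bind fun v => force v coordM).filter fun p => (degM p.2).beq d)

/-- The mask of the set `S` for a basis element `θ_S D_μ`. -/
def maskM (s : ℕ) : ℕ := 2 * (s % 8) + s / 64

/-- Six times the structure constants of the bracket. -/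
def nbM (c e : ℕ) : Comb :=
  force c fun c => force e fun e => projM (degM c + degM e)
    ((eltM c).bind fun v => (eltM e).bind fun w => force v fun v => force w fun w => brM v w)

/-- Six times the structure constants for the derivative of the second factor along a vector
field. -/
def smM (s l : ℕ) : Comb :=
  force s fun s => force l fun l => projM (degM s + degM l) ((eltM l).bind (smulM (maskM s)))

/-- Six times the structure constants for the derivative of the first factor along a vector
field. -/
def rmM (l s : ℕ) : Comb :=
  force l fun l => force s fun s => projM (degM l + degM s)
    ((eltM l).bind fun v => smulRM v (maskM s))

/-- Six times the structure constants for the bracket of vector fields. -/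
def mlM (s t : ℕ) : Comb :=
  force s fun s => force t fun t => projM (degM s + degM t)
    ((mulM (maskM s) (maskM t)).shift 128)

/-- The codes of basis elements that do not contain vector fields. -/
def scalarCodes : List ℕ := List.range 48 ++ (List.range 48).map (64 + ·)

/-- The codes of basis elements `θ_S D_μ`. -/
def vecCodes : List ℕ := (List.range 8).map (48 + ·) ++ (List.range 8).map (112 + ·)

/-- The codes of `σ₀, σ_i, σ_{jk}`. -/
def sigmaCodes : List ℕ := [36, 6, 7, 8, 9, 10, 11]

/-- Either the first homological degree is zero, or both are one. -/
def okPair (k l : ℕ) : Bool := (hdegM k).beq 0 || (hdegM k).beq 1 && (hdegM l).beq 1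

/-- A property of all `σ` and all admissible pairs in two lists. -/
def allPairs (l l' : List ℕ) (P : ℕ → ℕ → ℕ → Bool) : Bool :=
  sigmaCodes.all fun σ => l.all fun x => l'.all fun y => !okPair x y || P σ x y

/-- `σ (x y) = (σ x) y + x (σ y)` for suitable products. -/
def leibnizM (m₁ m₂ m₃ m₄ m₅ m₆ : ℕ → ℕ → Comb) (σ x y : ℕ) : Bool :=
  Comb.same ((m₁ x y).bind (m₂ σ)) (((m₃ σ x).bind fun c => m₄ c y) ++ ((m₅ σ y).bind (m₆ x)))

/-- No product. -/
def noneM (_ _ : ℕ) : Comb := []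

/-- The Leibniz rule for the action of fσ on a bracket is a differential identity in the coefficient
functions. Sorting by which function is differentiated splits it into identities between integer
tables, namely this one and those that follow. Both sides involve two brackets, so the factor 36 is
common. -/
theorem nbM_scalar_scalar :
    allPairs scalarCodes scalarCodes (leibnizM nbM nbM nbM nbM nbM nbM) = true := by
  decide +kernel

theorem nbM_vec_scalar :
    allPairs vecCodes scalarCodes (leibnizM nbM nbM nbM nbM nbM nbM) = true := by decide +kernel

theorem nbM_scalar_vec :
    allPairs scalarCodes vecCodes (leibnizM nbM nbM nbM nbM nbM nbM) = true := by decide +kernel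

/-- For a vector field u this collects the terms in which the coefficient f of σ is differentiated
along u; `smM_vec_scalar` collects those in which the coefficient of the third factor is. -/
theorem rmM_vec_scalar :
    allPairs vecCodes scalarCodes (leibnizM nbM rmM rmM nbM nbM smM) = true := by decide +kernel

theorem smM_vec_scalar :
    allPairs vecCodes scalarCodes (leibnizM smM nbM nbM smM nbM smM) = true := by decide +kernel

theorem rmM_scalar_vec :
    allPairs scalarCodes vecCodes (leibnizM nbM rmM nbM rmM rmM nbM) = true := by decide +kernel

theorem smM_scalar_vec :
    allPairs scalarCodes vecCodes (leibnizM rmM nbM nbM rmM nbM rmM) = true := by decide +kernel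

theorem mlM_vec_vec :
    allPairs vecCodes vecCodes (leibnizM mlM nbM nbM mlM nbM mlM) = true := by decide +kernel

/-- With two vector fields u and w, the terms with one derivative of f are multiples of (w f) u and
of (u f) w. Here the former cancel; in `nbM_mlM_vec` the latter do. -/
theorem mlM_nbM_vec : allPairs vecCodes vecCodes (fun σ s t =>
    Comb.same ((nbM σ s).bind fun c => mlM c t) ((rmM σ t).bind (nbM s))) = true := by
  decide +kernel

theorem nbM_mlM_vec : allPairs vecCodes vecCodes
    (leibnizM noneM noneM rmM nbM nbM mlM) = true := by decide +kernel

/-- The second derivatives u(w f) and w(u f) have to match separately; the left-hand side of the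
Leibniz rule contributes their difference, which is the derivative of f along the bracket of u and
w. This is the first of them, `mlM_rmM_vec` the second. -/
theorem rmM_mlM_vec : allPairs vecCodes vecCodes (fun σ s t =>
    Comb.same ((mlM s t).bind (rmM σ)) ((rmM σ t).bind (smM s))) = true := by decide +kernel

theorem mlM_rmM_vec : allPairs vecCodes vecCodes (fun σ s t =>
    Comb.same (((mlM s t).bind (rmM σ)) ++ ((rmM σ s).bind fun c => rmM c t)) []) = true := by
  decide +kernel

/-- The code of the bit mask of a subset of `Fin 3`. -/
def maskOf3 (S : Finset (Fin 3)) : ℕ := ∑ i ∈ S, 2 ^ i.1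

/-- The code of a table element. -/
def Row.code : Row → ℕ
  | .kasner i => i
  | .bianchi i => 3 + i
  | .boost i => 6 + i
  | .rot i => 9 + i
  | .mix i => 12 + i
  | .sym i => 15 + i
  | .rotA i => 18 + i
  | .rotB i => 21 + i
  | .curvA i => 24 + i
  | .asym i => 27 + i
  | .curvB i => 30 + i
  | .curvC i => 33 + i
  | .scale => 36
  | .curv => 37
  | .curvD => 38
  | .top => 39
  | .scalar S => 40 + maskOf3 S
  | .vec S _ => 48 + maskOf3 S

/-- The index of a vector field. -/
def Row.dirn : Row → Fin 4
  | .vec _ μ => μ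
  | _ => 0

theorem maskOf3_lt : ∀ S : Finset (Fin 3), maskOf3 S < 8 := by decide +kernel

theorem rowOf_code : ∀ r : Row, rowOf r.dirn r.code = r := by decide +kernel

theorem code_lt : ∀ r : Row, r.code < 56 := by decide +kernel

theorem code_rowOf : ∀ μ, ∀ c : Fin 56, (rowOf μ c).code = c := by decide +kernel

theorem rowOf_lt : ∀ μ ν, ∀ c : Fin 48, rowOf μ c = rowOf ν c := by decide +kernel

section
variable {R : Type*} [CommRing R] [Algebra ℝ R]

theorem th_eq_tm : ∀ i : Fin 3, (th i : Wedge R) = tm R (2 ^ (i.1 + 1)) := by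
  intro i
  rw [th, theta_eq_tm]; rfl

theorem mon_tm (μ : Fin 4) {g m : ℕ} (hg : g < 7) (hm : m < 16) :
    ((mon (tm R m) (gen μ g), 0) : V R) = vm R μ (16 * g + m) := (vm_lie μ g (by omega) hm).symm

theorem eval_linM (μ : Fin 4) (e : ℤ) {a g : ℕ} (ha : a < 4) (hg : g < 7) :
    (linM e a g).eval (vm R μ) = e • ((mon (tm R (2 ^ a)) (gen μ g), 0) : V R) := by
  rw [linM, Comb.eval_cons, Comb.eval_nil, add_zero,
    mon_tm μ hg (by interval_cases a <;> norm_num)]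

theorem eval_quadM (μ : Fin 4) (e : ℤ) {a b g : ℕ} (ha : a < 4) (hb : b < 4) (hg : g < 7) :
    (quadM e a b g).eval (vm R μ)
      = e • ((mon (wedge (tm R (2 ^ a)) (tm R (2 ^ b))) (gen μ g), 0) : V R) := by
  have ha' : 2 ^ a < 16 := by interval_cases a <;> norm_num
  have hb' : 2 ^ b < 16 := by interval_cases b <;> norm_num
  rw [quadM, Comb.eval_scale, Comb.eval_shift, wedge_tm ha' hb', mon_eval, eval_pair_lie]
  congr 1
  refine Comb.eval_congr (E := V R) fun p hp => ?_
  rw [mon_tm μ hg (mulM_lt ⟨_, ha'⟩ ⟨_, hb'⟩ p hp)]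

theorem blt_eq_decide (a b : ℕ) : Nat.blt a b = decide (a < b) := by
  rw [Bool.eq_iff_iff]; simp

theorem beq_eq_decide (a b : ℕ) : Nat.beq a b = decide (a = b) := by
  rw [Bool.eq_iff_iff]; simp

theorem map_succEmb_eq : ∀ S : Finset (Fin 3), S.map (Fin.succEmb 3) = mset (2 * maskOf3 S) := by
  decide +kernel

theorem wedge_tm_eq {S T U : ℕ} {e : ℤ} (h : mulM S T = [(e, U)]) (hS : S < 16 := by norm_num)
    (hT : T < 16 := by norm_num) : wedge (tm R S) (tm R T) = e • tm R U := by
  rw [wedge_tm hS hT, h, Comb.eval_cons, Comb.eval_nil, add_zero]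

/-- This ties the numerical table to the table of the theorem, so that kernel computations with the
former are statements about the latter. -/
theorem row_elt (r : Row) : (r.elt : V R) = (tableM r.code).eval (vm R r.dirn) := by
  have t0 : (theta 0 : Wedge R) = tm R (2 ^ 0) := theta_eq_tm 0
  have tS : (thetaS ∅ : Wedge R) = tm R 0 := rfl
  have t123 : (thetaS {1, 2, 3} : Wedge R) = tm R 14 := by
    rw [tm]; congr 1
  cases r with
  | vec S μ =>
    have h := maskOf3_lt S
    have h1 : ∀ n, (n ≤ 48) → Nat.blt (48 + maskOf3 S) n = false := fun n hn => by
      rw [blt_eq_decide]; simp; omega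
    simp [Row.elt, Row.code, tableM, h1, Row.dirn]
    rw [vm_vec μ (by omega), tm, map_succEmb_eq]
  | scalar S =>
    have h := maskOf3_lt S
    have h1 : ∀ n, (n ≤ 40) → Nat.blt (40 + maskOf3 S) n = false := fun n hn => by
      rw [blt_eq_decide]; simp; omega
    have h2 : Nat.blt (40 + maskOf3 S) 48 = true := by rw [blt_eq_decide]; simp; omega
    have h3 : Nat.beq (40 + maskOf3 S) 40 = decide (S = ∅) := by
      rw [beq_eq_decide, Bool.eq_iff_iff]
      have : ∀ S, maskOf3 S = 0 ↔ S = ∅ := by decide +kernel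
      simp [this]
    simp only [Row.elt, Row.code, tableM, h1, h2, h3, le_refl, cond_false, cond_true,
      Comb.eval_cons, Comb.eval_nil, add_zero, one_smul, show 36 ≤ 40 by norm_num]
    by_cases hS : S = ∅
    · subst hS
      rw [if_pos rfl, decide_eq_true rfl, cond_true, vm_phi _ (by norm_num), phiMono, if_neg (by norm_num)]
      refine Prod.ext rfl (Prod.ext ?_ rfl)
      funext T
      simp only [tm_apply]
      rfl
    · have h4 : maskOf3 S ≠ 0 := by
        have : ∀ S, maskOf3 S = 0 ↔ S = ∅ := by decide +kernel
        rwa [Ne, this]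
      rw [if_neg hS, decide_eq_false hS, cond_false, Nat.add_sub_cancel_left,
        vm_phi _ (by omega), phiMono, if_neg (by omega)]
      refine Prod.ext rfl (Prod.ext ?_ rfl)
      funext T
      simp only [tm_apply, map_succEmb_eq]
  | kasner i =>
    fin_cases i <;>
    simp [Row.elt, Row.code, tableM, eval_linM, t0, th_eq_tm, gen, blt_eq_decide,
      beq_eq_decide, -nsmul_eq_mul, -zsmul_eq_mul]
  | bianchi i =>
    fin_cases i <;>
    simp [Row.elt, Row.code, tableM, eval_linM, th_eq_tm, gen, blt_eq_decide,
      beq_eq_decide, -nsmul_eq_mul, -zsmul_eq_mul, add_assoc]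
  | boost i =>
    fin_cases i <;>
    simp [Row.elt, Row.code, tableM, gen, tS, blt_eq_decide,
      beq_eq_decide, vm_of_lie, -nsmul_eq_mul, -zsmul_eq_mul]
  | rot i =>
    fin_cases i <;>
    simp [Row.elt, Row.code, tableM, gen, tS, blt_eq_decide,
      beq_eq_decide, vm_of_lie, -nsmul_eq_mul, -zsmul_eq_mul]
  | mix i =>
    fin_cases i <;>
    simp [Row.elt, Row.code, tableM, eval_linM, t0, th_eq_tm, gen, blt_eq_decide,
      beq_eq_decide, -nsmul_eq_mul, -zsmul_eq_mul]
  | sym i =>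
    fin_cases i <;>
    simp [Row.elt, Row.code, tableM, eval_linM, th_eq_tm, gen, blt_eq_decide,
      beq_eq_decide, -nsmul_eq_mul, -zsmul_eq_mul]
  | rotA i =>
    fin_cases i <;>
    simp [Row.elt, Row.code, tableM, eval_linM, th_eq_tm, gen, blt_eq_decide,
      beq_eq_decide, -nsmul_eq_mul, -zsmul_eq_mul]
  | rotB i =>
    fin_cases i <;>
    simp [Row.elt, Row.code, tableM, eval_linM, th_eq_tm, gen, blt_eq_decide,
      beq_eq_decide, -nsmul_eq_mul, -zsmul_eq_mul]
  | curvA i =>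
    fin_cases i <;>
    simp [Row.elt, Row.code, tableM, eval_quadM, t0, th_eq_tm, gen, blt_eq_decide,
      beq_eq_decide, -nsmul_eq_mul, -zsmul_eq_mul]
  | asym i =>
    fin_cases i <;>
    simp [Row.elt, Row.code, tableM, eval_linM, th_eq_tm, gen, blt_eq_decide,
      beq_eq_decide, -nsmul_eq_mul, -zsmul_eq_mul, sub_eq_add_neg]
  | curvB i =>
    fin_cases i <;>
    simp [Row.elt, Row.code, tableM, eval_quadM, t0, th_eq_tm, gen, blt_eq_decide,
      beq_eq_decide, -nsmul_eq_mul, -zsmul_eq_mul, sub_eq_add_neg, add_assoc] <;> abel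
  | curvC i =>
    fin_cases i <;>
    simp [Row.elt, Row.code, tableM, eval_quadM, t0, th_eq_tm, gen, blt_eq_decide,
      beq_eq_decide, -nsmul_eq_mul, -zsmul_eq_mul, sub_eq_add_neg, add_assoc] <;> abel
  | scale =>
    simp [Row.elt, Row.code, tableM, gen, tS, blt_eq_decide,
      beq_eq_decide, vm_of_lie, -nsmul_eq_mul, -zsmul_eq_mul]
  | curv =>
    simp [Row.elt, Row.code, tableM, eval_quadM, t0, th_eq_tm, gen, blt_eq_decide,
      beq_eq_decide, Fin.sum_univ_three, -nsmul_eq_mul, -zsmul_eq_mul, add_assoc]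
    abel
  | curvD =>
    simp [Row.elt, Row.code, tableM, eval_quadM, t0, th_eq_tm, gen, blt_eq_decide,
      beq_eq_decide, Fin.sum_univ_three, -nsmul_eq_mul, -zsmul_eq_mul, sub_eq_add_neg, add_assoc]
    abel
  | top =>
    have w1 : wedge (tm R 1) (wedge (tm R 4) (tm R 8)) = tm R 13 := by
      rw [wedge_tm_eq (e := 1) (U := 12) rfl, one_smul, wedge_tm_eq (e := 1) (U := 13) rfl, one_smul]
    -- The cyclic product θ₃θ₁ is minus the sorted one, in contrast to the other two cyclic
    -- products.
    have w2 : wedge (tm R 1) (wedge (tm R 8) (tm R 2)) = - tm R 11 := by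
      rw [wedge_tm_eq (e := -1) (U := 10) rfl, neg_one_zsmul, ← wedgeₗ_apply, map_neg, wedgeₗ_apply,
        wedge_tm_eq (e := 1) (U := 11) rfl, one_smul]
    have w3 : wedge (tm R 1) (wedge (tm R 2) (tm R 4)) = tm R 7 := by
      rw [wedge_tm_eq (e := 1) (U := 6) rfl, one_smul, wedge_tm_eq (e := 1) (U := 7) rfl, one_smul]
    have wn : mon (- tm R 11) (Gen.boost 1) = - mon (tm R 11) (Gen.boost 1) := by
      simpa using mon_smul (-1 : R) (tm R 11) (Gen.boost 1)
    simp [w1, w2, w3, wn, Row.elt, Row.code, tableM, t0, th_eq_tm, gen, t123, blt_eq_decide,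
      beq_eq_decide, vm_of_lie, Fin.sum_univ_three, -nsmul_eq_mul, -zsmul_eq_mul, add_assoc]
    abel

/-- The action of `θ_T` as a linear map. -/
def vSMulₗ (x : Wedge R) : V R →ₗ[R] V R where
  toFun := vSMul x
  map_add' v w := by
    refine Prod.ext (funext fun g => wedge_add_right _ _ _) (phi_smul_add_right _ _ _)
  map_smul' f v := by
    refine Prod.ext (funext fun g => wedge_smul_right _ _ _) (phi_smul_smul_right _ _ _)

@[simp] theorem vSMulₗ_apply (x : Wedge R) (v : V R) : vSMulₗ x v = vSMul x v := rfl

theorem vSMul_mon (x y : Wedge R) (g : Gen) : vSMul x (mon y g, 0) = (mon (wedge x y) g, 0) := by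
  refine Prod.ext (funext fun k => ?_) ?_
  · simp only [vSMul, mon_apply]
    split_ifs <;> simp
  · exact (by simpa using phi_smul_smul_right (0 : R) x 0 : Phi.smul x 0 = 0)

theorem vSMul_phi (x : Wedge R) (f : Phi R) : vSMul x (0, f) = (0, Phi.smul x f) := by
  refine Prod.ext (funext fun k => ?_) rfl
  simp [vSMul]

theorem vSMul_vm (μ : Fin 4) {T c : ℕ} (hT : T < 16) (hc : c < 144) :
    vSMul (tm R T) (vm R μ c) = (smulM T c).eval (vm R μ) := by
  have hm : c % 16 < 16 := Nat.mod_lt _ (by norm_num)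
  by_cases h : c / 16 = 7
  · rw [vm_of_phi μ h, vSMul_phi, phi_smul_mono hT hm, eval_pair_phi, smulM, h]
    rw [show Nat.beq 7 7 = true from rfl, cond_true, Comb.eval_shift]
    exact Comb.eval_congr (E := V R) fun p hp => (vm_phi μ (smulPhiM_lt ⟨T, hT⟩ ⟨_, hm⟩ p hp)).symm
  · rw [vm_of_lie μ h, vSMul_mon, wedge_tm hT hm, mon_eval, eval_pair_lie, smulM, beq_seven h,
      cond_false, Comb.eval_shift]
    exact Comb.eval_congr (E := V R) fun p hp =>
      (vm_lie μ _ h (mulM_lt ⟨T, hT⟩ ⟨_, hm⟩ p hp)).symm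

theorem tableM_lt : ∀ c : Fin 56, ∀ p ∈ tableM c, p.2 < 144 := by decide +kernel

theorem tableM_lt_of_lt : ∀ c : Fin 48, ∀ p ∈ tableM c, p.2 < 128 := by decide +kernel

theorem row_elt_rowOf (μ : Fin 4) {c : ℕ} (hc : c < 56) :
    ((rowOf μ c).elt : V R) = (tableM c).eval (vm R μ) := by
  rw [row_elt, code_rowOf μ ⟨c, hc⟩]
  by_cases h : c < 48
  · exact Comb.eval_congr (E := V R) fun p hp => vm_lt _ _ (tableM_lt_of_lt ⟨c, h⟩ p hp)
  · have : ∀ μ, ∀ c : Fin 56, 48 ≤ c.1 → (rowOf μ c).dirn = μ := by decide +kernel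
    rw [this μ ⟨c, hc⟩ (by simpa using h)]

theorem idx_elt (μ : Fin 4) {c : ℕ} (hc : c < 128) (hc' : c % 64 < 56) :
    ((idxOf μ c).elt : V R) = (eltM c).eval (vm R μ) := by
  by_cases h : c < 64
  · have e1 : Nat.blt c 64 = true := by rw [blt_eq_decide]; simpa using h
    rw [Nat.mod_eq_of_lt h] at hc'
    simp only [Idx.elt, idxOf, e1, eltM, cond_true, Nat.mod_eq_of_lt h]
    exact row_elt_rowOf μ hc'
  · have e1 : Nat.blt c 64 = false := by rw [blt_eq_decide]; simpa using h
    have e2 : c - 64 = c % 64 := by omega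
    simp only [Idx.elt, idxOf, e1, eltM, cond_false, Bool.not_false, if_true, e2,
      row_elt_rowOf μ hc', Comb.eval_bind, theta_eq_tm]
    rw [← vSMulₗ_apply, Comb.map_eval]
    refine Comb.eval_congr (E := V R) fun p hp => ?_
    rw [vSMulₗ_apply, ← vSMul_vm μ (by norm_num) (tableM_lt ⟨_, hc'⟩ p hp)]
    rfl

end

/-! ### Coordinates modulo the ideal -/

/-- The code of a generator. -/
def Gen.code : Gen → ℕ
  | .scale => 0
  | .boost i => 1 + i
  | .rot i => 4 + i
  | .vec _ => 8

/-- The index of a vector field. -/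
def Gen.dirn : Gen → Fin 4
  | .vec μ => μ
  | _ => 0

/-- The bit mask of a subset of `Fin 4`. -/
def maskOf4 (S : Finset (Fin 4)) : ℕ := ∑ i ∈ S, 2 ^ i.1

theorem gen_code : ∀ g : Gen, gen g.dirn g.code = g := by decide +kernel

theorem code_gen : ∀ μ : Fin 4, ∀ g : Fin 7, (gen μ g).code = g := by decide +kernel

theorem code_lt_nine : ∀ g : Gen, g.code < 9 ∧ g.code ≠ 7 := by decide +kernel

theorem mset_maskOf4 : ∀ S : Finset (Fin 4), mset (maskOf4 S) = S := by decide +kernel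

theorem maskOf4_mset : ∀ m : Fin 16, maskOf4 (mset m) = m := by decide +kernel

theorem maskOf4_lt : ∀ S : Finset (Fin 4), maskOf4 S < 16 := by decide +kernel

theorem coordM_scalar : ∀ v : Fin 128, ∀ p ∈ coordM v, p.2 < 128 ∧ p.2 % 64 < 48 := by
  decide +kernel

theorem coordM_lt : ∀ v : Fin 144, ∀ p ∈ coordM v, p.2 < 128 ∧ p.2 % 64 < 56 := by
  decide +kernel

section
variable {R : Type*} [CommRing R] [Algebra ℝ R]

variable (R) in
/-- The basis element of `𝓐` with a given code. -/
def am (μ : Fin 4) (c : ℕ) : A R := Pi.single (idxOf μ c) 1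

theorem am_lt (μ ν : Fin 4) {c : ℕ} (hc : c % 64 < 48) : am R μ c = am R ν c := by
  rw [am, am, idxOf, idxOf, rowOf_lt μ ν ⟨_, hc⟩]

/-- Six times the coordinates of an element of `𝓛 ⊕ Φ` modulo the ideal. -/
def sixCoords : V R →ₗ[R] A R where
  toFun v := ∑ g, ∑ S, v.1 g S • (coordM (16 * g.code + maskOf4 S)).eval (am R g.dirn)
    + ∑ S : {S : Finset (Fin 4) // S.Nonempty}, v.2.1 S • (coordM (112 + maskOf4 S)).eval (am R 0)
    + v.2.2 • (coordM 112).eval (am R 0)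
  map_add' v w := by
    simp only [Prod.fst_add, Prod.snd_add, Pi.add_apply, add_smul, Finset.sum_add_distrib]
    abel
  map_smul' f v := by
    simp only [Prod.smul_fst, Prod.smul_snd, Pi.smul_apply, smul_eq_mul, mul_smul,
      Finset.smul_sum, RingHom.id_apply, smul_add]

theorem sixCoords_apply (v : V R) : sixCoords v =
    ∑ g, ∑ S, v.1 g S • (coordM (16 * g.code + maskOf4 S)).eval (am R g.dirn)
    + ∑ S : {S : Finset (Fin 4) // S.Nonempty}, v.2.1 S • (coordM (112 + maskOf4 S)).eval (am R 0)
    + v.2.2 • (coordM 112).eval (am R 0) := rfl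

theorem sixCoords_vm (μ : Fin 4) {c : ℕ} (hc : c < 144) :
    sixCoords (vm R μ c) = (coordM c).eval (am R μ) := by
  have hm : c % 16 < 16 := Nat.mod_lt _ (by norm_num)
  by_cases h : c / 16 = 7
  · have h0 : (coordM c).eval (am R 0) = (coordM c).eval (am R μ) :=
      Comb.eval_congr fun p hp => am_lt _ _ (coordM_scalar ⟨c, by omega⟩ p hp).2
    rw [vm_of_phi μ h, sixCoords_apply, phiMono]
    by_cases h2 : c % 16 = 0
    · have : c = 112 := by omega
      subst this
      simp [← h0]
    · rw [if_neg h2, ← h0]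
      have hne : (mset (c % 16)).Nonempty := by
        rw [Finset.nonempty_iff_ne_empty, Ne, mset_empty_iff ⟨_, hm⟩]; exact h2
      have : ∑ S : {S : Finset (Fin 4) // S.Nonempty},
          (tm R (c % 16) S.1) • (coordM (112 + maskOf4 S)).eval (am R 0)
          = (coordM c).eval (am R 0) := by
        rw [Finset.sum_eq_single ⟨_, hne⟩]
        · rw [tm_apply, if_pos rfl, one_smul, maskOf4_mset ⟨_, hm⟩]
          congr 2
          simp only; omega
        · intro S _ hS
          rw [tm_apply, if_neg fun h => hS (Subtype.ext h), zero_smul]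
        · simp
      simp only [this]
      simp
  · rw [vm_of_lie μ h, sixCoords_apply]
    have hg : gen μ (c / 16) = Gen.vec μ ∧ c / 16 = 8 ∨ c / 16 < 7 := by
      by_cases h8 : c / 16 = 8
      · left; rw [h8]; exact ⟨rfl, rfl⟩
      · right; omega
    have h1 : (gen μ (c / 16)).code = c / 16 := by
      rcases hg with ⟨h1, h2⟩ | h1
      · rw [h1, h2]; rfl
      · exact code_gen μ ⟨_, h1⟩
    have h2 : (coordM c).eval (am R (gen μ (c / 16)).dirn) = (coordM c).eval (am R μ) := by
      rcases hg with ⟨h1, h2⟩ | h1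
      · rw [h1]; rfl
      · exact Comb.eval_congr fun p hp => am_lt _ _ (coordM_scalar ⟨c, by omega⟩ p hp).2
    rw [Finset.sum_eq_single (gen μ (c / 16)), Finset.sum_eq_single (mset (c % 16))]
    · simp only [mon_apply, if_true, tm_apply, one_smul, h1, maskOf4_mset ⟨_, hm⟩]
      rw [← h2, show 16 * (c / 16) + c % 16 = c by omega]
      simp
    · intro S _ hS
      simp only [mon_apply, if_true, tm_apply, if_neg hS, zero_smul]
    · simp
    · intro g _ hg
      simp [mon_apply, hg]
    · simp

/-- Allows linear statements about 𝓛 ⊕ Φ to be checked on monomials only. -/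
theorem decomp (v : V R) : v =
    ∑ g, ∑ S, v.1 g S • vm R g.dirn (16 * g.code + maskOf4 S)
    + ∑ S : {S : Finset (Fin 4) // S.Nonempty}, v.2.1 S • vm R 0 (112 + maskOf4 S)
    + v.2.2 • vm R 0 112 := by
  have h1 : ∀ (g : Gen) (S : Finset (Fin 4)), vm R g.dirn (16 * g.code + maskOf4 S)
      = (mon (thetaS S) g, 0) := by
    intro g S
    rw [vm_lie _ _ (code_lt_nine g).2 (maskOf4_lt S), gen_code, tm, mset_maskOf4]
  have h2 : ∀ S : {S : Finset (Fin 4) // S.Nonempty}, vm R 0 (112 + maskOf4 S)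
      = (0, ((fun T => if T = S then 1 else 0), 0)) := by
    intro S
    have : maskOf4 S.1 ≠ 0 := by
      have := mset_empty_iff ⟨_, maskOf4_lt S.1⟩
      simp only [mset_maskOf4] at this
      rw [Ne, ← this]
      exact S.2.ne_empty
    rw [vm_phi _ (maskOf4_lt S.1), phiMono, if_neg this]
    refine Prod.ext rfl (Prod.ext (funext fun T => ?_) rfl)
    simp only [tm_apply, mset_maskOf4, Subtype.ext_iff]
  have h3 : vm R 0 112 = (0, (0, 1)) := rfl
  simp only [h1, h2, h3]
  refine Prod.ext (funext fun g => funext fun S => ?_) (Prod.ext (funext fun S => ?_) ?_)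
  · simp [Prod.fst_sum, Finset.sum_apply, mon_apply, thetaS, Pi.single_apply, apply_ite]
  · simp [Prod.fst_sum, Prod.snd_sum, Finset.sum_apply]
  · simp [Prod.snd_sum]

/-- The real part of `(θ₀θ_i + √-1 θ_jθ_k) s_l`. -/
def quadRe (i l : ℕ) : Comb :=
  quadM 1 0 (i + 1) (l + 1) ++ quadM (-1) ((i + 1) % 3 + 1) ((i + 2) % 3 + 1) (l + 4)

/-- Minus the imaginary part of `(θ₀θ_i + √-1 θ_jθ_k) s_l`. -/
def quadIm (i l : ℕ) : Comb :=
  quadM (-1) 0 (i + 1) (l + 4) ++ quadM (-1) ((i + 1) % 3 + 1) ((i + 2) % 3 + 1) (l + 1)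

theorem weyl_eq (S : Matrix (Fin 3) (Fin 3) ℂ) : ((weyl S, 0) : V R) = ∑ i : Fin 3, ∑ l : Fin 3,
    ((S i l).re • (quadRe i l).eval (vm R 0) + (S i l).im • (quadIm i l).eval (vm R 0)) := by
  have hb : ∀ l : Fin 3, gen 0 (l.1 + 1) = Gen.boost l := by decide
  have hr : ∀ l : Fin 3, gen 0 (l.1 + 4) = Gen.rot l := by decide
  have h0 : (theta 0 : Wedge R) = tm R (2 ^ 0) := theta_eq_tm 0
  have h1 : ∀ i : Fin 3, (theta i.succ : Wedge R) = tm R (2 ^ (i.1 + 1)) := th_eq_tm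
  have h2 : ∀ i : Fin 3, (theta (i + 1).succ : Wedge R) = tm R (2 ^ ((i.1 + 1) % 3 + 1)) := by
    intro i; rw [h1]; fin_cases i <;> rfl
  have h3 : ∀ i : Fin 3, (theta (i + 2).succ : Wedge R) = tm R (2 ^ ((i.1 + 2) % 3 + 1)) := by
    intro i; rw [h1]; fin_cases i <;> rfl
  have hpair : ∀ X : Fin 3 → Fin 3 → Lie R, ((∑ i, ∑ l, X i l, 0) : V R) = ∑ i, ∑ l, (X i l, 0) := by
    intro X
    refine Prod.ext ?_ ?_
    · simp [Prod.fst_sum]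
    · simp [Prod.snd_sum]
  rw [weyl, hpair]
  refine Finset.sum_congr rfl fun i _ => Finset.sum_congr rfl fun l _ => ?_
  rw [quadRe, quadIm, Comb.eval_append, Comb.eval_append, eval_quadM, eval_quadM, eval_quadM,
    eval_quadM, hb, hr, h0, h1, h2, h3]
  any_goals omega
  refine Prod.ext ?_ ?_
  · simp only [Prod.fst_add, Prod.fst_neg, Prod.smul_fst, one_smul, neg_smul, smul_add, smul_sub,
      smul_neg]
    abel
  · simp

theorem eval_weylM (k : ℕ) : (weylM k).eval (vm R 0) = ∑ i : Fin 3, ∑ l : Fin 3,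
    matM k i l • (if k < 5 then (quadRe i l).eval (vm R 0) else (quadIm i l).eval (vm R 0)) := by
  have : Nat.blt k 5 = decide (k < 5) := blt_eq_decide k 5
  by_cases h : k < 5
  · simp only [weylM, this, h, decide_true, cond_true, if_true, Fin.sum_univ_three, quadRe,
      List.flatMap_cons, List.flatMap_nil, Comb.eval_append, Comb.eval_scale, Comb.eval_nil, add_zero]
    simp [add_assoc]
  · simp only [weylM, this, h, decide_false, cond_false, if_false, Fin.sum_univ_three, quadIm,
      List.flatMap_cons, List.flatMap_nil, Comb.eval_append, Comb.eval_scale, Comb.eval_nil, add_zero]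
    simp [add_assoc]

theorem matM_symm : ∀ k : Fin 10, ∀ i l : Fin 3, matM k i l = matM k l i := by decide +kernel

theorem matM_trace : ∀ k : Fin 10, matM k 0 0 + matM k 1 1 + matM k 2 2 = 0 := by decide +kernel

theorem weylM_mem {k T : ℕ} (hk : k < 10) (hT : T < 16) :
    (idealM (16 * k + T)).eval (vm R 0) ∈ ideal R := by
  have hlt : ∀ k : Fin 10, ∀ p ∈ weylM k, p.2 < 144 := by decide +kernel
  have h1 : (idealM (16 * k + T)).eval (vm R 0) = vSMul (tm R T) ((weylM k).eval (vm R 0)) := by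
    rw [← vSMulₗ_apply, Comb.map_eval, idealM, Comb.eval_bind]
    rw [show (16 * k + T) / 16 = k by omega, show (16 * k + T) % 16 = T by omega]
    exact Comb.eval_congr (E := V R) fun p hp => (vSMul_vm 0 hT (hlt ⟨k, hk⟩ p hp)).symm
  rw [h1]
  refine Submodule.subset_span ⟨mset T,
    Matrix.of fun i l => (matM k i l : ℂ) * (if k < 5 then 1 else Complex.I), ?_, ?_, ?_⟩
  · ext i l
    have := matM_symm ⟨k, hk⟩ i l
    simp only at this
    simp only [Matrix.transpose_apply, Matrix.of_apply, this]
  · have := matM_trace ⟨k, hk⟩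
    simp only [Matrix.trace, Matrix.diag, Fin.sum_univ_three, Matrix.of_apply, ← add_mul]
    norm_cast
    rw [show matM k (0 : Fin 3) (0 : Fin 3) + matM k (1 : Fin 3) (1 : Fin 3)
      + matM k (2 : Fin 3) (2 : Fin 3) = 0 from this]
    simp
  · congr 1
    rw [weyl_eq, eval_weylM]
    refine Finset.sum_congr rfl fun i _ => Finset.sum_congr rfl fun l _ => ?_
    by_cases h : k < 5
    · simp [h, Int.cast_smul_eq_zsmul, -zsmul_eq_mul]
    · simp [h, Int.cast_smul_eq_zsmul, -zsmul_eq_mul]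

theorem sixCoords_idealM {k T : ℕ} (hk : k < 10) (hT : T < 16) :
    sixCoords ((idealM (16 * k + T)).eval (vm R 0)) = 0 := by
  have hlt : ∀ k : Fin 10, ∀ T : Fin 16, ∀ p ∈ idealM (16 * k + T), p.2 < 144 := by decide +kernel
  have h1 : ((idealM (16 * k + T)).eval fun c => sixCoords (vm R 0 c))
      = (idealM (16 * k + T)).eval fun c => (coordM c).eval (am R 0) :=
    Comb.eval_congr fun p hp => sixCoords_vm 0 (hlt ⟨k, hk⟩ ⟨T, hT⟩ p hp)
  rw [Comb.map_eval, h1, ← Comb.eval_bind, Comb.eval_eq_of_same (coordM_idealM ⟨k, hk⟩ ⟨T, hT⟩), Comb.eval_nil]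

/-- Symmetric traceless complex 3 × 3 matrices form a real vector space of dimension ten, so ten
generators suffice for the ideal. -/
theorem weyl_decomp {S : Matrix (Fin 3) (Fin 3) ℂ} (h1 : S.IsSymm) (h2 : S.trace = 0) :
    ∃ r : Fin 10 → ℝ, ((weyl S, 0) : V R) = ∑ k, r k • (weylM k).eval (vm R 0) := by
  have s (i l : Fin 3) : S l i = S i l := h1.apply i l
  have ht : S 2 2 = - S 0 0 - S 1 1 := by
    have := h2
    simp only [Matrix.trace, Matrix.diag, Fin.sum_univ_three] at this
    linear_combination this
  -- The diagonal basis matrices are diag(1,−1,0) and diag(0,1,−1), which explains the partial sums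
  -- of the diagonal entries.
  refine ⟨![(S 0 1).re, (S 1 2).re, (S 2 0).re, (S 0 0).re, (S 0 0).re + (S 1 1).re,
    (S 0 1).im, (S 1 2).im, (S 2 0).im, (S 0 0).im, (S 0 0).im + (S 1 1).im], ?_⟩
  rw [weyl_eq]
  rw [show ∀ f : Fin 10 → V R, ∑ k, f k = f 0 + f 1 + f 2 + f 3 + f 4 + f 5 + f 6 + f 7 + f 8 + f 9
    from fun f => by simp only [Fin.sum_univ_succ, Fin.sum_univ_zero]; simp [add_assoc]]
  simp only [eval_weylM, Fin.sum_univ_three]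
  simp [matM, blt_eq_decide, beq_eq_decide, -zsmul_eq_mul, s 0 1, s 1 2, s 2 0, ht, neg_smul, smul_add, add_smul, sub_smul]
  abel

end

/-- The code of a basis element. -/
def Idx.code (b : Idx) : ℕ := b.2.code + bif b.1 then 64 else 0

theorem idxOf_code (b : Idx) : idxOf b.2.dirn b.code = b := by
  obtain ⟨b, r⟩ := b
  have h := code_lt r
  have hr := rowOf_code r
  cases b
  · have e1 : Nat.blt r.code 64 = true := by rw [blt_eq_decide]; simp; omega
    simp only [Idx.code, idxOf, cond_false, add_zero, e1, Nat.mod_eq_of_lt (by omega : r.code < 64),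
      hr, Bool.not_true]
  · have e1 : Nat.blt (r.code + 64) 64 = false := by rw [blt_eq_decide]; simp
    simp only [Idx.code, idxOf, cond_true, e1, Bool.not_false, Nat.add_mod_right,
      Nat.mod_eq_of_lt (by omega : r.code < 64), hr]

theorem idx_code_lt (b : Idx) : b.code < 128 ∧ b.code % 64 < 56 := by
  obtain ⟨b, r⟩ := b
  have h := code_lt r
  cases b <;> simp only [Idx.code, cond_true, cond_false] <;> omega

section
variable {R : Type*} [CommRing R] [Algebra ℝ R]

theorem eval_idealM {k T : ℕ} (hk : k < 10) (hT : T < 16) :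
    (idealM (16 * k + T)).eval (vm R 0) = vSMul (tm R T) ((weylM k).eval (vm R 0)) := by
  have hlt : ∀ k : Fin 10, ∀ p ∈ weylM k, p.2 < 144 := by decide +kernel
  rw [← vSMulₗ_apply, Comb.map_eval, idealM, Comb.eval_bind]
  rw [show (16 * k + T) / 16 = k by omega, show (16 * k + T) % 16 = T by omega]
  exact Comb.eval_congr (E := V R) fun p hp => (vSMul_vm 0 hT (hlt ⟨k, hk⟩ p hp)).symm

theorem sixCoords_ideal {v : V R} (hv : v ∈ ideal R) : sixCoords v = 0 := by
  have : ideal R ≤ LinearMap.ker (sixCoords (R := R)) := by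
    refine Submodule.span_le.2 ?_
    rintro _ ⟨T, S, h1, h2, rfl⟩
    obtain ⟨r, hr⟩ := weyl_decomp (R := R) h1 h2
    have hT : (thetaS T : Wedge R) = tm R (maskOf4 T) := by rw [tm, mset_maskOf4]
    rw [SetLike.mem_coe, LinearMap.mem_ker, hr, ← vSMulₗ_apply, map_sum, map_sum]
    refine Finset.sum_eq_zero fun k _ => ?_
    rw [LinearMap.map_smul_of_tower, LinearMap.map_smul_of_tower, vSMulₗ_apply, hT,
      ← eval_idealM k.2 (maskOf4_lt T), sixCoords_idealM k.2 (maskOf4_lt T), smul_zero]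
  exact this hv

/-- The element of `𝓛 ⊕ Φ` with given coefficients. -/
def combine : A R →ₗ[R] V R where
  toFun x := ∑ b, x b • (b.elt : V R)
  map_add' x y := by simp only [Pi.add_apply, add_smul, Finset.sum_add_distrib]
  map_smul' f x := by
    simp only [Pi.smul_apply, smul_eq_mul, mul_smul, Finset.smul_sum, RingHom.id_apply]

theorem combine_apply (x : A R) : combine x = ∑ b, x b • (b.elt : V R) := rfl

theorem combine_single (b : Idx) : combine (Pi.single b 1 : A R) = b.elt := by
  rw [combine_apply, Finset.sum_eq_single b]
  · simp
  · intro c _ hc; simp [hc]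
  · simp

theorem eltM_lt : ∀ c : Fin 128, c.1 % 64 < 56 → ∀ p ∈ eltM c, p.2 < 144 := by decide +kernel

theorem sixCoords_elt (b : Idx) : sixCoords (b.elt : V R) = (6 : ℤ) • (Pi.single b 1 : A R) := by
  obtain ⟨h1, h2⟩ := idx_code_lt b
  have h3 : ((eltM b.code).eval fun c => sixCoords (vm R b.2.dirn c))
      = (eltM b.code).eval fun c => (coordM c).eval (am R b.2.dirn) :=
    Comb.eval_congr fun p hp => sixCoords_vm _ (eltM_lt ⟨_, h1⟩ h2 p hp)
  have h4 : Comb.same ((eltM b.code).bind coordM) [(6, b.code)] = true := by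
    have := coordM_eltM ⟨b.code % 64, h2⟩ ⟨b.code / 64, by omega⟩
    simpa [Nat.mod_add_div] using this
  have h5 : (b.elt : V R) = (eltM b.code).eval (vm R b.2.dirn) := by
    rw [← idx_elt _ h1 h2, idxOf_code]
  rw [h5, Comb.map_eval, h3, ← Comb.eval_bind, Comb.eval_eq_of_same h4, Comb.eval_cons,
    Comb.eval_nil, add_zero, am, idxOf_code]

theorem sixCoords_combine (x : A R) : sixCoords (combine x) = (6 : ℤ) • x := by
  rw [combine_apply, map_sum]
  simp only [map_smul, sixCoords_elt]
  funext b
  simp [Finset.sum_apply, Pi.single_apply, mul_comm]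

theorem idealM_lt : ∀ k : Fin 160, ∀ p ∈ idealM k, p.2 < 112 := by decide +kernel

theorem combine_sixCoords_vm (μ : Fin 4) {c : ℕ} (hc : c < 144) :
    (6 : ℤ) • vm R μ c - combine (sixCoords (vm R μ c)) ∈ ideal R := by
  have h1 : combine ((coordM c).eval (am R μ)) = (coordM c).eval fun c => (eltM c).eval (vm R μ) := by
    rw [Comb.map_eval]
    refine Comb.eval_congr (E := V R) fun p hp => ?_
    obtain ⟨h1, h2⟩ := coordM_lt ⟨c, hc⟩ p hp
    rw [am, combine_single, idx_elt μ h1 h2]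
  have h2 := Comb.eval_eq_of_same (certAllM_spec ⟨c, hc⟩) (vm R μ)
  simp only [Comb.eval_cons, Comb.eval_scale, neg_one_zsmul, ← sub_eq_add_neg,
    Comb.eval_bind] at h2
  rw [sixCoords_vm μ hc, h1, h2]
  have hmem : ∀ l : Comb, (∀ p ∈ l, p.2 < 160) →
      (l.eval fun c => (idealM c).eval (vm R μ)) ∈ ideal R := by
    intro l hl
    induction l with
    | nil => exact Submodule.zero_mem _
    | cons p l ih =>
      rw [Comb.eval_cons]
      refine Submodule.add_mem _ ?_ (ih fun q hq => hl q (by simp [hq]))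
      have h160 := hl p (by simp)
      have e : (idealM p.2).eval (vm R μ) = (idealM (16 * (p.2 / 16) + p.2 % 16)).eval (vm R 0) := by
        rw [Nat.div_add_mod]
        exact Comb.eval_congr (E := V R) fun q hq =>
          vm_lt _ _ ((idealM_lt ⟨_, h160⟩ q hq).trans (by norm_num))
      rw [e]
      exact zsmul_mem (weylM_mem (by omega) (by omega)) _
  exact hmem _ (certAllM_lt ⟨c, hc⟩)

theorem combine_sixCoords (v : V R) : (6 : ℤ) • v - combine (sixCoords v) ∈ ideal R := by
  let Q : Submodule R (V R) :=
    (ideal R).comap ((6 : ℤ) • LinearMap.id - combine ∘ₗ sixCoords)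
  have hQ : ∀ μ c, c < 144 → vm R μ c ∈ Q := fun μ c hc => combine_sixCoords_vm μ hc
  change v ∈ Q
  rw [decomp v]
  refine Q.add_mem (Q.add_mem (Q.sum_mem fun g _ => Q.sum_mem fun S _ => Q.smul_mem _ (hQ _ _ ?_))
    (Q.sum_mem fun S _ => Q.smul_mem _ (hQ _ _ ?_))) (Q.smul_mem _ (hQ _ _ ?_))
  · have := code_lt_nine g
    have := maskOf4_lt S
    omega
  · have := maskOf4_lt S.1
    omega
  · norm_num

theorem smul_six {E : Type*} [AddCommGroup E] [Module ℝ E] (x : E) :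
    (6⁻¹ : ℝ) • ((6 : ℤ) • x) = x := by
  rw [← Int.cast_smul_eq_zsmul ℝ, smul_smul]
  norm_num

/-- The coordinates are an explicit linear map. -/
theorem coords_eq (v : V R) : coords v = (6⁻¹ : ℝ) • sixCoords v := by
  have h1 : v - ∑ b, coords v b • (b.elt : V R) ∈ ideal R := by
    -- Existence of coordinates shows that the chosen ones satisfy their defining property. Applying
    -- the explicit map, which kills the ideal, then determines them.
    refine Classical.epsilon_spec (p := fun c : Idx → R => v - ∑ b, c b • (b.elt : V R) ∈ ideal R)
      ⟨(6⁻¹ : ℝ) • sixCoords v, ?_⟩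
    rw [← combine_apply, LinearMap.map_smul_of_tower]
    have : v - (6⁻¹ : ℝ) • combine (sixCoords v)
        = (algebraMap ℝ R 6⁻¹) • ((6 : ℤ) • v - combine (sixCoords v)) := by
      rw [smul_sub, algebraMap_smul, algebraMap_smul, smul_six]
    rw [this]
    exact Submodule.smul_mem _ _ (combine_sixCoords v)
  have h2 := sixCoords_ideal h1
  rw [← combine_apply, map_sub, sub_eq_zero, sixCoords_combine] at h2
  rw [h2, smul_six]

/-! ## The bracket of `𝓐` on basis elements -/

/-- The component of an element of `𝓐` of a given degree. -/
def degPart (d : Fin 3 → ℕ) : A R →ₗ[R] A R where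
  toFun x b := if b.deg = d then x b else 0
  map_add' x y := by funext b; simp only [Pi.add_apply]; split_ifs <;> simp
  map_smul' f x := by
    funext b; simp only [Pi.smul_apply, RingHom.id_apply]; split_ifs <;> simp

theorem degPart_apply (d : Fin 3 → ℕ) (x : A R) (b : Idx) :
    degPart d x b = if b.deg = d then x b else 0 := rfl

theorem component_eq (α : Fin 3 → ℕ) (x : A R) : component α x = combine (degPart α x) := by
  rw [combine_apply, component]
  refine Finset.sum_congr rfl fun b _ => ?_
  rw [degPart_apply]
  split_ifs <;> simp

theorem aBr_apply (F : FrameData R) (x y : A R) (b : Idx) : aBr F x y b =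
    ∑ α ∈ Finset.Iic b.deg, ((6⁻¹ : ℝ) • sixCoords (vBrₗ F (combine (degPart α x))
      (combine (degPart (b.deg - α) y)))) b := by
  simp only [aBr, component_eq, coords_eq, vBrₗ_apply]

/-- The bracket of `𝓐` as a bilinear map. -/
noncomputable def aBrₗ (F : FrameData R) : A R →ₗ[ℝ] A R →ₗ[ℝ] A R :=
  LinearMap.mk₂ ℝ (aBr F)
    (fun x x' y => by
      funext b
      simp only [aBr_apply, Pi.add_apply, map_add, LinearMap.add_apply, smul_add,
        Finset.sum_add_distrib])
    (fun r x y => by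
      funext b
      simp only [aBr_apply, Pi.smul_apply, LinearMap.map_smul_of_tower, LinearMap.smul_apply,
        Finset.smul_sum, smul_comm r])
    (fun x y y' => by
      funext b
      simp only [aBr_apply, Pi.add_apply, map_add, smul_add, Finset.sum_add_distrib])
    (fun r x y => by
      funext b
      simp only [aBr_apply, Pi.smul_apply, LinearMap.map_smul_of_tower, 
        Finset.smul_sum, smul_comm r])

@[simp] theorem aBrₗ_apply (F : FrameData R) (x y : A R) : aBrₗ F x y = aBr F x y := rfl

/-- For homogeneous arguments at most one summand of the defining sum is nonzero, and it contributes
only to the components of the total degree. -/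
theorem aBr_of_degPart (F : FrameData R) {x y : A R} {d e : Fin 3 → ℕ}
    (hx : degPart d x = x) (hy : degPart e y = y) :
    aBr F x y = (6⁻¹ : ℝ) • degPart (d + e) (sixCoords (vBr F (combine x) (combine y))) := by
  have hne : ∀ {z : A R} {d α : Fin 3 → ℕ}, degPart d z = z → α ≠ d → degPart α z = 0 := by
    intro z d α hz hα
    funext b
    rw [← hz, degPart_apply, degPart_apply, Pi.zero_apply]
    split_ifs with h1 h2
    · exact absurd (h1.symm.trans h2) hα
    · rfl
    · rfl
  funext b
  rw [aBr_apply, Pi.smul_apply, degPart_apply]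
  by_cases hd : d ≤ b.deg
  · rw [Finset.sum_eq_single d]
    · rw [hx]
      by_cases he : b.deg = d + e
      · rw [if_pos he, he, add_tsub_cancel_left, hy]
        rfl
      · rw [if_neg he, hne hy fun h => he (by rw [← h, add_tsub_cancel_of_le hd])]
        simp only [map_zero, smul_zero, Pi.zero_apply]
    · intro α _ hα
      rw [hne hx hα]
      simp
    · intro h
      exact absurd (Finset.mem_Iic.2 hd) h
  · rw [Finset.sum_eq_zero, if_neg, smul_zero]
    · intro h; exact hd (h ▸ le_self_add)
    · intro α hα
      rw [hne hx fun h => hd (h ▸ Finset.mem_Iic.1 hα)]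
      simp

end

theorem degM_eq : ∀ μ : Fin 4, ∀ c : Fin 128, c.1 % 64 < 56 →
    degM c = (idxOf μ c).deg 0 + 8 * (idxOf μ c).deg 1 + 64 * (idxOf μ c).deg 2 ∧
    (idxOf μ c).deg 0 ≤ 2 ∧ (idxOf μ c).deg 1 ≤ 2 ∧ (idxOf μ c).deg 2 ≤ 2 := by decide +kernel

theorem hdegM_eq : ∀ μ : Fin 4, ∀ c : Fin 128, c.1 % 64 < 56 → hdegM c = (idxOf μ c).hdeg := by
  decide +kernel

/-- All degree components are at most 2. Hence the base-8 digits do not overflow when two degrees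
are added, and comparing codes is the same as comparing degrees. -/
theorem degM_add_iff {μ ν ρ : Fin 4} {c d e : ℕ} (hc : c < 128 ∧ c % 64 < 56)
    (hd : d < 128 ∧ d % 64 < 56) (he : e < 128 ∧ e % 64 < 56) :
    (idxOf μ c).deg = (idxOf ν d).deg + (idxOf ρ e).deg ↔ degM c = degM d + degM e := by
  have h1 := degM_eq μ ⟨c, hc.1⟩ hc.2
  have h2 := degM_eq ν ⟨d, hd.1⟩ hd.2
  have h3 := degM_eq ρ ⟨e, he.1⟩ he.2
  simp only at h1 h2 h3
  constructor
  · intro h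
    have h0 := congrFun h 0
    have h1' := congrFun h 1
    have h2' := congrFun h 2
    simp only [Pi.add_apply] at h0 h1' h2'
    omega
  · intro h
    funext i
    simp only [Pi.add_apply]
    fin_cases i <;> simp only [Fin.zero_eta, Fin.mk_one, Fin.reduceFinMk] <;> omega

theorem eltM_vec : ∀ s ∈ vecCodes, eltM s = [(1, 128 + maskM s)] ∧ maskM s < 16 ∧ s < 128 ∧
    s % 64 < 56 := by decide +kernel

theorem scalarCodes_lt : ∀ c ∈ scalarCodes, c < 128 ∧ c % 64 < 48 := by decide +kernel

theorem eltM_scalar : ∀ c ∈ scalarCodes, ∀ p ∈ eltM c, p.2 < 128 := by decide +kernel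

theorem okM_elt : ∀ c ∈ scalarCodes, ∀ e ∈ scalarCodes, okPair c e = true →
    ∀ p ∈ eltM c, ∀ q ∈ eltM e, okM p.2 q.2 = true := by decide +kernel

section
variable {R : Type*} [CommRing R] [Algebra ℝ R]

/-- The combination `∑ u_μ e_μ` of the basis elements `e_μ` with a given code. -/
def ae (u : Fin 4 → R) (c : ℕ) : A R := ∑ μ, u μ • am R μ c

theorem degPart_am (d : Fin 3 → ℕ) (μ : Fin 4) (c : ℕ) :
    degPart d (am R μ c) = if (idxOf μ c).deg = d then am R μ c else 0 := by
  funext b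
  rw [degPart_apply, am]
  by_cases hb : b = idxOf μ c
  · subst hb
    split_ifs <;> simp
  · split_ifs <;> simp [hb]

theorem deg_idxOf_eq : ∀ μ ν : Fin 4, ∀ c : Fin 128, c.1 % 64 < 56 →
    (idxOf μ c).deg = (idxOf ν c).deg := by decide +kernel

theorem degPart_ae (d : Fin 3 → ℕ) (ν : Fin 4) (u : Fin 4 → R) {c : ℕ} (hc : c < 128)
    (hc' : c % 64 < 56) :
    degPart d (ae u c) = if (idxOf ν c).deg = d then ae u c else 0 := by
  simp only [ae, map_sum, map_smul, degPart_am]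
  have : ∀ μ, (idxOf μ c).deg = (idxOf ν c).deg := fun μ => deg_idxOf_eq μ ν ⟨c, hc⟩ hc'
  simp only [this]
  split_ifs <;> simp

theorem sum_smul_eval_am (u : Fin 4 → R) (l : Comb) :
    ∑ μ, u μ • l.eval (am R μ) = l.eval (ae u) := by
  simp only [Comb.eval_smul]
  induction l with
  | nil => simp
  | cons p l ih =>
    simp only [Comb.eval_cons, Finset.sum_add_distrib, ih, ae, Finset.smul_sum]

theorem degPart_sixCoords_vm (μ ν ρ : Fin 4) {c e : ℕ} (hc : c < 128 ∧ c % 64 < 56)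
    (he : e < 128 ∧ e % 64 < 56) {l : Comb} (hl : ∀ p ∈ l, p.2 < 144) :
    degPart ((idxOf ν c).deg + (idxOf ρ e).deg) (sixCoords (l.eval (vm R μ)))
      = (projM (degM c + degM e) l).eval (am R μ) := by
  have h1 : (l.eval fun c => sixCoords (vm R μ c)) = l.eval fun c => (coordM c).eval (am R μ) :=
    Comb.eval_congr fun p hp => sixCoords_vm _ (hl p hp)
  rw [Comb.map_eval, h1, projM, Comb.eval_norm, ← Comb.eval_bind]
  have hb : (l.bind fun v => force v coordM) = l.bind coordM := by simp only [force_eq]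
  rw [hb]
  have hlt : ∀ p ∈ l.bind coordM, p.2 < 128 ∧ p.2 % 64 < 56 := by
    intro p hp
    simp only [Comb.bind, List.mem_flatMap, Comb.scale, List.mem_map] at hp
    obtain ⟨q, hq, r, hr, rfl⟩ := hp
    exact coordM_lt ⟨q.2, hl q hq⟩ r hr
  revert hlt
  generalize l.bind coordM = k
  intro hlt
  induction k with
  | nil => simp
  | cons p k ih =>
    have hp := hlt p (by simp)
    have := degM_add_iff (μ := μ) (ν := ν) (ρ := ρ) hp hc he
    rw [Comb.eval_cons, map_add, map_zsmul, degPart_am, ih fun q hq => hlt q (by simp [hq]),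
      List.filter_cons, beq_eq_decide]
    by_cases h : degM p.2 = degM c + degM e
    · rw [if_pos (this.2 h), if_pos (by simpa using h), Comb.eval_cons]
    · rw [if_neg fun h' => h (this.1 h'), if_neg (by simpa using h), smul_zero, zero_add]

theorem degPart_sixCoords_ve (u : Fin 4 → R) (ν ρ : Fin 4) {c e : ℕ} (hc : c < 128 ∧ c % 64 < 56)
    (he : e < 128 ∧ e % 64 < 56) {l : Comb} (hl : ∀ p ∈ l, p.2 < 144) :
    degPart ((idxOf ν c).deg + (idxOf ρ e).deg) (sixCoords (l.eval (ve u)))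
      = (projM (degM c + degM e) l).eval (ae u) := by
  rw [← sum_smul_eval, ← sum_smul_eval_am, map_sum, map_sum]
  refine Finset.sum_congr rfl fun μ _ => ?_
  rw [map_smul, map_smul, degPart_sixCoords_vm μ ν ρ hc he hl]

theorem combine_am (μ : Fin 4) {c : ℕ} (hc : c < 128 ∧ c % 64 < 56) :
    combine (am R μ c) = (eltM c).eval (vm R μ) := by
  rw [am, combine_single, idx_elt μ hc.1 hc.2]

theorem combine_ae (u : Fin 4 → R) {s : ℕ} (hs : s ∈ vecCodes) :
    combine (ae u s) = ve u (128 + maskM s) := by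
  obtain ⟨h1, -, h2⟩ := eltM_vec s hs
  rw [ae, map_sum, ve]
  refine Finset.sum_congr rfl fun μ _ => ?_
  rw [map_smul, combine_am μ h2, h1]
  simp

theorem am_degPart (μ : Fin 4) (c : ℕ) (f : R) :
    degPart (idxOf μ c).deg (f • am R μ c) = f • am R μ c := by
  rw [map_smul, degPart_am, if_pos rfl]

theorem ae_degPart (u : Fin 4 → R) {s : ℕ} (hs : s ∈ vecCodes) :
    degPart (idxOf 0 s).deg (ae u s) = ae u s := by
  obtain ⟨-, -, h1, h2⟩ := eltM_vec s hs
  rw [degPart_ae _ 0 u h1 h2, if_pos rfl]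

theorem brM_lt : ∀ v : Fin 128, ∀ w : Fin 128, okM v w = true → ∀ p ∈ brM v w, p.2 < 144 := by
  decide +kernel

theorem bind_lt {l : Comb} {f : ℕ → Comb} {n : ℕ} (h : ∀ p ∈ l, ∀ q ∈ f p.2, q.2 < n) :
    ∀ p ∈ l.bind f, p.2 < n := by
  intro p hp
  simp only [Comb.bind, List.mem_flatMap, Comb.scale, List.mem_map] at hp
  obtain ⟨q, hq, r, hr, rfl⟩ := hp
  exact h q hq r hr

theorem mod_lt_of_scalar {c : ℕ} (hc : c ∈ scalarCodes) : c < 128 ∧ c % 64 < 56 :=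
  ⟨(scalarCodes_lt c hc).1, (scalarCodes_lt c hc).2.trans (by norm_num)⟩

theorem aBr_am_am (F : FrameData R) (μ : Fin 4) {c e : ℕ} (hc : c ∈ scalarCodes)
    (he : e ∈ scalarCodes) (h : okPair c e = true) (f g : R) :
    aBr F (f • am R μ c) (g • am R μ e) = (6⁻¹ : ℝ) • (f * g) • (nbM c e).eval (am R μ) := by
  have hc' := mod_lt_of_scalar hc
  have he' := mod_lt_of_scalar he
  have hok := okM_elt c hc e he h
  rw [aBr_of_degPart F (am_degPart μ c f) (am_degPart μ e g), map_smul, map_smul,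
    combine_am μ hc', combine_am μ he']
  have : vBr F (f • (eltM c).eval (vm R μ)) (g • (eltM e).eval (vm R μ)) = (f * g) •
      ((eltM c).bind fun v => (eltM e).bind fun w => force v fun v => force w fun w =>
        brM v w).eval (vm R μ) := by
    rw [Comb.eval_smul, Comb.eval_smul, Comb.eval_smul, Comb.eval_bind, ← vBrₗ_apply,
      ← LinearMap.flip_apply, Comb.map_eval]
    refine Comb.eval_congr (E := V R) fun p hp => ?_
    rw [LinearMap.flip_apply, Comb.map_eval, ← Comb.eval_smul, Comb.eval_bind, Comb.eval_smul]
    refine Comb.eval_congr (E := V R) fun q hq => ?_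
    rw [vBrₗ_apply, vBr_mono F μ (hok p hp q hq)]
    simp only [force_eq]
  rw [this, map_smul, map_smul, degPart_sixCoords_vm μ μ μ hc' he']
  · simp only [nbM, force_eq]
  · refine bind_lt fun p hp => bind_lt fun q hq => ?_
    simp only [force_eq]
    exact brM_lt ⟨_, eltM_scalar c hc p hp⟩ ⟨_, eltM_scalar e he q hq⟩ (hok p hp q hq)

theorem nbM_vec_left {s l : ℕ} (hs : s ∈ vecCodes) : nbM s l = projM (degM s + degM l)
    ((eltM l).bind fun w => brM (128 + maskM s) w) := by
  simp only [nbM, force_eq, (eltM_vec s hs).1]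
  congr 1
  simp [Comb.bind, Comb.scale]

theorem nbM_vec_right {s l : ℕ} (hs : s ∈ vecCodes) : nbM l s = projM (degM l + degM s)
    ((eltM l).bind fun v => brM v (128 + maskM s)) := by
  simp only [nbM, force_eq, (eltM_vec s hs).1]
  congr 1
  simp [Comb.bind, Comb.scale]

theorem aBr_ae_am (F : FrameData R) (ν : Fin 4) {s l : ℕ} (hs : s ∈ vecCodes)
    (hl : l ∈ scalarCodes) (u : Fin 4 → R) (h : R) :
    aBr F (ae u s) (h • am R ν l) = (6⁻¹ : ℝ) •
      ((nbM s l).eval (ae (h • u)) + dir F u h • (smM s l).eval (am R ν)) := by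
  obtain ⟨h1, h2, h3⟩ := eltM_vec s hs
  have hl' := mod_lt_of_scalar hl
  rw [aBr_of_degPart F (ae_degPart u hs) (am_degPart ν l h), map_smul, combine_am ν hl',
    combine_ae u hs]
  have : vBr F (ve u (128 + maskM s)) (h • (eltM l).eval (vm R ν))
      = ((eltM l).bind fun w => brM (128 + maskM s) w).eval (ve (h • u))
        + dir F u h • ((eltM l).bind fun w => smulM (maskM s) w).eval (vm R ν) := by
    rw [Comb.eval_smul, ← vBrₗ_apply, Comb.map_eval, Comb.eval_bind, Comb.eval_bind,
      Comb.eval_smul, ← Comb.eval_add]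
    refine Comb.eval_congr (E := V R) fun q hq => ?_
    rw [vBrₗ_apply, vBr_ve_mono F ν h2 (eltM_scalar l hl q hq)]
  rw [this, map_add, map_add, map_smul, map_smul, degPart_sixCoords_vm ν 0 ν h3 hl',
    degPart_sixCoords_ve _ 0 ν h3 hl', nbM_vec_left hs]
  · simp only [smM, force_eq]
  · exact bind_lt fun q hq => fun r hr => (brM_vec_mem h2 (eltM_scalar l hl q hq) r hr).2
  · exact bind_lt fun q hq => fun r hr =>
      (smulM_lt h2 (eltM_scalar l hl q hq) r hr).trans (by norm_num)

theorem aBr_am_ae (F : FrameData R) (ν : Fin 4) {s l : ℕ} (hs : s ∈ vecCodes)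
    (hl : l ∈ scalarCodes) (u : Fin 4 → R) (h : R) :
    aBr F (h • am R ν l) (ae u s) = (6⁻¹ : ℝ) •
      ((nbM l s).eval (ae (h • u)) + dir F u h • (rmM l s).eval (am R ν)) := by
  obtain ⟨h1, h2, h3⟩ := eltM_vec s hs
  have hl' := mod_lt_of_scalar hl
  rw [aBr_of_degPart F (am_degPart ν l h) (ae_degPart u hs), map_smul, combine_am ν hl',
    combine_ae u hs]
  have : vBr F (h • (eltM l).eval (vm R ν)) (ve u (128 + maskM s))
      = ((eltM l).bind fun w => brM w (128 + maskM s)).eval (ve (h • u))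
        + dir F u h • ((eltM l).bind fun w => smulRM w (maskM s)).eval (vm R ν) := by
    rw [Comb.eval_smul, ← vBrₗ_apply, ← LinearMap.flip_apply, Comb.map_eval, Comb.eval_bind,
      Comb.eval_bind, Comb.eval_smul, ← Comb.eval_add]
    refine Comb.eval_congr (E := V R) fun q hq => ?_
    rw [LinearMap.flip_apply, vBrₗ_apply, vBr_mono_ve F ν h2 (eltM_scalar l hl q hq)]
  rw [this, map_add, map_add, map_smul, map_smul, degPart_sixCoords_vm ν ν 0 hl' h3,
    degPart_sixCoords_ve _ ν 0 hl' h3, nbM_vec_right hs]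
  · simp only [rmM, force_eq]
  · exact bind_lt fun q hq => fun r hr => (brM_vec_right_mem h2 (eltM_scalar l hl q hq) r hr).2
  · exact bind_lt fun q hq => fun r hr =>
      (smulRM_lt h2 (eltM_scalar l hl q hq) r hr).trans (by norm_num)

theorem aBr_ae_ae (F : FrameData R) {s t : ℕ} (hs : s ∈ vecCodes) (ht : t ∈ vecCodes)
    (u w : Fin 4 → R) :
    aBr F (ae u s) (ae w t) = (6⁻¹ : ℝ) • (mlM s t).eval (ae (vecBr F u w)) := by
  obtain ⟨h1, h2, h3⟩ := eltM_vec s hs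
  obtain ⟨h1', h2', h3'⟩ := eltM_vec t ht
  rw [aBr_of_degPart F (ae_degPart u hs) (ae_degPart w ht), combine_ae u hs, combine_ae w ht,
    vBr_ve_ve F h2 h2']
  have : ((mulM (maskM s) (maskM t)).eval fun m => ve (vecBr F u w) (128 + m))
      = ((mulM (maskM s) (maskM t)).shift 128).eval (ve (vecBr F u w)) := by
    rw [Comb.eval_shift]
  rw [this, degPart_sixCoords_ve _ 0 0 h3 h3']
  · simp only [mlM, force_eq]
  · intro p hp
    simp only [Comb.shift, List.mem_map] at hp
    obtain ⟨q, hq, rfl⟩ := hp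
    have := mulM_lt ⟨_, h2⟩ ⟨_, h2'⟩ q hq
    simp only
    omega

end

/-! ### Homological bookkeeping and calculus of vector fields -/

theorem allPairs_spec {l l' : List ℕ} {P : ℕ → ℕ → ℕ → Bool} (h : allPairs l l' P = true)
    {σ x y : ℕ} (hσ : σ ∈ sigmaCodes) (hx : x ∈ l) (hy : y ∈ l') (hxy : okPair x y = true) :
    P σ x y = true := by
  simp only [allPairs, List.all_eq_true] at h
  have := h σ hσ x hx y hy
  rwa [hxy, Bool.not_true, Bool.false_or] at this

/-- All symbols of a combination belong to a given list and have a given homological degree. -/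
def inCodes (L : List ℕ) (d : ℕ) (l : Comb) : Bool := l.all fun p => L.elem p.2 && (hdegM p.2).beq d

theorem inCodes_spec {L : List ℕ} {d : ℕ} {l : Comb} (h : inCodes L d l = true) :
    ∀ p ∈ l, p.2 ∈ L ∧ hdegM p.2 = d := by
  intro p hp
  simp only [inCodes, List.all_eq_true, Bool.and_eq_true, beq_eq_decide, decide_eq_true_eq] at h
  exact ⟨by simpa using (h p hp).1, (h p hp).2⟩

/-- A property of all admissible pairs in two lists. -/
def allOk (l l' : List ℕ) (P : ℕ → ℕ → Bool) : Bool :=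
  l.all fun x => l'.all fun y => !okPair x y || P x y

theorem allOk_spec {l l' : List ℕ} {P : ℕ → ℕ → Bool} (h : allOk l l' P = true)
    {x y : ℕ} (hx : x ∈ l) (hy : y ∈ l') (hxy : okPair x y = true) : P x y = true := by
  simp only [allOk, List.all_eq_true] at h
  have := h x hx y hy
  rwa [hxy, Bool.not_true, Bool.false_or] at this

theorem nbM_codes : allOk scalarCodes scalarCodes
    (fun x y => inCodes scalarCodes (hdegM x + hdegM y) (nbM x y)) = true := by decide +kernel

theorem nbM_codes_left : allOk vecCodes scalarCodes
    (fun x y => inCodes vecCodes (hdegM x + hdegM y) (nbM x y)) = true := by decide +kernel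

theorem nbM_codes_right : allOk scalarCodes vecCodes
    (fun x y => inCodes vecCodes (hdegM x + hdegM y) (nbM x y)) = true := by decide +kernel

theorem smM_codes : allOk vecCodes scalarCodes
    (fun x y => inCodes scalarCodes (hdegM x + hdegM y) (smM x y)) = true := by decide +kernel

theorem rmM_codes : allOk scalarCodes vecCodes
    (fun x y => inCodes scalarCodes (hdegM x + hdegM y) (rmM x y)) = true := by decide +kernel

theorem mlM_codes : allOk vecCodes vecCodes
    (fun x y => inCodes vecCodes (hdegM x + hdegM y) (mlM x y)) = true := by decide +kernel

theorem sigmaCodes_spec : ∀ σ ∈ sigmaCodes, σ ∈ scalarCodes ∧ hdegM σ = 0 := by decide +kernel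

theorem mem_sigmaCodes : ∀ c ∈ scalarCodes, hdegM c = 0 → c ∈ sigmaCodes := by decide +kernel

theorem vecCodes_zero : ∀ c ∈ vecCodes, hdegM c = 0 → c = 48 := by decide +kernel

/-- Code 48 is a vector field without factors θ: it acts on the basis elements that contain no
vector field purely by differentiating coefficients. -/
theorem nbM_vec_empty : ∀ c ∈ scalarCodes, nbM 48 c = [] ∧ smM 48 c = [(6, c)] := by decide +kernel

theorem mlM_vec_empty : ∀ c ∈ vecCodes, mlM 48 c = [(6, c)] := by decide +kernel

theorem okPair_zero {c : ℕ} (h : hdegM c = 0) (e : ℕ) : okPair c e = true := by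
  simp [okPair, beq_eq_decide, h]

theorem okPair_congr {c c' e e' : ℕ} (h : hdegM c = hdegM c') (h' : hdegM e = hdegM e') :
    okPair c e = okPair c' e' := by rw [okPair, okPair, h, h']

section
variable {R : Type*} [CommRing R] [Algebra ℝ R]

/-- `D₀, …, D₃` is a frame with structure functions `c`. -/
structure FrameData.IsFrame (F : FrameData R) : Prop where
  comm : ∀ μ ν f, F.D μ (F.D ν f) - F.D ν (F.D μ f) = ∑ ρ, F.c μ ν ρ * F.D ρ f
  indep : ∀ u, (∀ f, dir F u f = 0) → u = 0

theorem dir_mul (F : FrameData R) (u : Fin 4 → R) (f g : R) :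
    dir F u (f * g) = f * dir F u g + dir F u f * g := by
  simp only [dir, Derivation.leibniz, smul_eq_mul, Finset.mul_sum, Finset.sum_mul,
    ← Finset.sum_add_distrib]
  exact Finset.sum_congr rfl fun _ _ => by ring

theorem dir_sub_left (F : FrameData R) (u w : Fin 4 → R) (f : R) :
    dir F (u - w) f = dir F u f - dir F w f := by
  simp only [dir, Pi.sub_apply, sub_mul, Finset.sum_sub_distrib]

theorem dir_add_left (F : FrameData R) (u w : Fin 4 → R) (f : R) :
    dir F (u + w) f = dir F u f + dir F w f := by
  simp only [dir, Pi.add_apply, add_mul, Finset.sum_add_distrib]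

theorem dir_smul_left (F : FrameData R) (g : R) (u : Fin 4 → R) (f : R) :
    dir F (g • u) f = g * dir F u f := by
  simp only [dir, Pi.smul_apply, smul_eq_mul, mul_assoc, Finset.mul_sum]

theorem dir_sub (F : FrameData R) (u : Fin 4 → R) (f g : R) :
    dir F u (f - g) = dir F u f - dir F u g := by
  simp only [dir, map_sub, mul_sub, Finset.sum_sub_distrib]

/-- The second derivatives of f on the right combine to commutators of the D_μ, which the structure
functions turn into first derivatives. This is the only point where the commutation relations of the
frame enter. -/
theorem dir_vecBr {F : FrameData R} (hF : F.IsFrame) (u w : Fin 4 → R) (f : R) :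
    dir F (vecBr F u w) f = dir F u (dir F w f) - dir F w (dir F u f) := by
  have h1 : ∀ u w : Fin 4 → R, dir F u (dir F w f)
      = ∑ ρ, dir F u (w ρ) * F.D ρ f + ∑ μ, ∑ ν, u μ * w ν * F.D μ (F.D ν f) := by
    intro u w
    simp only [dir, map_sum, Derivation.leibniz, smul_eq_mul, mul_add, Finset.sum_add_distrib,
      Finset.mul_sum, Finset.sum_mul]
    rw [add_comm, Finset.sum_comm]
    congr 1
    · exact Finset.sum_congr rfl fun _ _ => Finset.sum_congr rfl fun _ _ => by ring
    · exact Finset.sum_congr rfl fun _ _ => Finset.sum_congr rfl fun _ _ => by ring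
  have h2 : ∑ ρ, (∑ μ, ∑ ν, F.c μ ν ρ * (u μ * w ν)) * F.D ρ f
      = ∑ μ, ∑ ν, u μ * w ν * (F.D μ (F.D ν f) - F.D ν (F.D μ f)) := by
    simp only [hF.comm, Finset.sum_mul, Finset.mul_sum]
    rw [Finset.sum_comm]
    refine Finset.sum_congr rfl fun μ _ => ?_
    rw [Finset.sum_comm]
    exact Finset.sum_congr rfl fun _ _ => Finset.sum_congr rfl fun _ _ => by ring
  have h3 : ∑ μ, ∑ ν, w μ * u ν * F.D μ (F.D ν f) = ∑ μ, ∑ ν, u μ * w ν * F.D ν (F.D μ f) := by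
    rw [Finset.sum_comm]
    exact Finset.sum_congr rfl fun _ _ => Finset.sum_congr rfl fun _ _ => by ring
  rw [h1 u w, h1 w u, h3]
  have h4 : dir F (vecBr F u w) f = ∑ ρ, dir F u (w ρ) * F.D ρ f - ∑ ρ, dir F w (u ρ) * F.D ρ f
      + ∑ ρ, (∑ μ, ∑ ν, F.c μ ν ρ * (u μ * w ν)) * F.D ρ f := by
    rw [← Finset.sum_sub_distrib, ← Finset.sum_add_distrib, dir]
    exact Finset.sum_congr rfl fun _ _ => by rw [vecBr]; ring
  rw [h4, h2]
  simp only [mul_sub, Finset.sum_sub_distrib]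
  ring

/-- Commutators of operators satisfy the Jacobi identity, and a vector field is determined by its
action on functions. -/
theorem vecBr_jacobi {F : FrameData R} (hF : F.IsFrame) (u v w : Fin 4 → R) :
    vecBr F u (vecBr F v w) = vecBr F (vecBr F u v) w + vecBr F v (vecBr F u w) := by
  rw [← sub_eq_zero]
  refine hF.indep _ fun f => ?_
  simp only [dir_sub_left, dir_add_left, dir_vecBr hF, dir_sub]
  ring

theorem vecBr_smul_left (F : FrameData R) (f : R) (u w : Fin 4 → R) :
    vecBr F (f • u) w = f • vecBr F u w - dir F w f • u := by
  funext ρ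
  simp only [vecBr, dir_smul_left, Pi.smul_apply, Pi.sub_apply, smul_eq_mul, dir_mul, mul_add,
    Finset.mul_sum]
  have : ∑ μ, ∑ ν, F.c μ ν ρ * (f * u μ * w ν) = ∑ μ, ∑ ν, f * (F.c μ ν ρ * (u μ * w ν)) :=
    Finset.sum_congr rfl fun _ _ => Finset.sum_congr rfl fun _ _ => by ring
  rw [this]
  ring

theorem vecBr_smul_right (F : FrameData R) (f : R) (u w : Fin 4 → R) :
    vecBr F u (f • w) = f • vecBr F u w + dir F u f • w := by
  funext ρ
  simp only [vecBr, dir_smul_left, Pi.smul_apply, Pi.add_apply, smul_eq_mul, dir_mul, mul_add,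
    Finset.mul_sum]
  have : ∑ μ, ∑ ν, F.c μ ν ρ * (u μ * (f * w ν)) = ∑ μ, ∑ ν, f * (F.c μ ν ρ * (u μ * w ν)) :=
    Finset.sum_congr rfl fun _ _ => Finset.sum_congr rfl fun _ _ => by ring
  rw [this]
  ring

theorem ae_add (u w : Fin 4 → R) (c : ℕ) : ae (u + w) c = ae u c + ae w c := by
  simp only [ae, Pi.add_apply, add_smul, Finset.sum_add_distrib]

theorem eval_ae_add (u w : Fin 4 → R) (l : Comb) :
    l.eval (ae (u + w)) = l.eval (ae u) + l.eval (ae w) := by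
  rw [← Comb.eval_add]
  exact Comb.eval_congr fun p _ => ae_add u w p.2

theorem eval_ae_sub (u w : Fin 4 → R) (l : Comb) :
    l.eval (ae (u - w)) = l.eval (ae u) - l.eval (ae w) := by
  have := eval_ae_add (u - w) w l
  rw [sub_add_cancel] at this
  rw [this, add_sub_cancel_right]

/-! ### Brackets with combinations of basis elements -/

theorem aBr_am_eval (F : FrameData R) (μ : Fin 4) {c : ℕ} {l : Comb} (hc : c ∈ scalarCodes)
    (hl : ∀ p ∈ l, p.2 ∈ scalarCodes ∧ okPair c p.2 = true) (f g : R) :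
    aBr F (f • am R μ c) (g • l.eval (am R μ))
      = (6⁻¹ : ℝ) • (f * g) • (l.bind (nbM c)).eval (am R μ) := by
  rw [Comb.eval_smul, ← aBrₗ_apply, Comb.map_eval, Comb.eval_bind, Comb.eval_smul, Comb.eval_smul]
  refine Comb.eval_congr (E := A R) fun p hp => ?_
  rw [aBrₗ_apply, aBr_am_am F μ hc (hl p hp).1 (hl p hp).2]

theorem aBr_eval_am (F : FrameData R) (μ : Fin 4) {e : ℕ} {l : Comb} (he : e ∈ scalarCodes)
    (hl : ∀ p ∈ l, p.2 ∈ scalarCodes ∧ okPair p.2 e = true) (f g : R) :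
    aBr F (f • l.eval (am R μ)) (g • am R μ e)
      = (6⁻¹ : ℝ) • (f * g) • (l.bind fun c => nbM c e).eval (am R μ) := by
  rw [Comb.eval_smul, ← aBrₗ_apply, ← LinearMap.flip_apply, Comb.map_eval, Comb.eval_bind,
    Comb.eval_smul, Comb.eval_smul]
  refine Comb.eval_congr (E := A R) fun p hp => ?_
  rw [LinearMap.flip_apply, aBrₗ_apply, aBr_am_am F μ (hl p hp).1 he (hl p hp).2]

theorem aBr_am_eval_ae (F : FrameData R) (μ : Fin 4) {c : ℕ} {l : Comb} (hc : c ∈ scalarCodes)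
    (hl : ∀ p ∈ l, p.2 ∈ vecCodes) (h : R) (u : Fin 4 → R) :
    aBr F (h • am R μ c) (l.eval (ae u)) = (6⁻¹ : ℝ) • ((l.bind (nbM c)).eval (ae (h • u))
      + dir F u h • (l.bind (rmM c)).eval (am R μ)) := by
  rw [← aBrₗ_apply, Comb.map_eval, Comb.eval_bind, Comb.eval_bind, Comb.eval_smul, ← Comb.eval_add,
    Comb.eval_smul]
  refine Comb.eval_congr (E := A R) fun p hp => ?_
  rw [aBrₗ_apply, aBr_am_ae F μ (hl p hp) hc]

theorem aBr_eval_ae_am (F : FrameData R) (μ : Fin 4) {e : ℕ} {l : Comb} (he : e ∈ scalarCodes)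
    (hl : ∀ p ∈ l, p.2 ∈ vecCodes) (h : R) (u : Fin 4 → R) :
    aBr F (l.eval (ae u)) (h • am R μ e) = (6⁻¹ : ℝ) •
      ((l.bind fun s => nbM s e).eval (ae (h • u))
        + dir F u h • (l.bind fun s => smM s e).eval (am R μ)) := by
  rw [← aBrₗ_apply, ← LinearMap.flip_apply, Comb.map_eval, Comb.eval_bind, Comb.eval_bind,
    Comb.eval_smul, ← Comb.eval_add, Comb.eval_smul]
  refine Comb.eval_congr (E := A R) fun p hp => ?_
  rw [LinearMap.flip_apply, aBrₗ_apply, aBr_ae_am F μ (hl p hp) he]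

theorem aBr_ae_eval (F : FrameData R) (μ : Fin 4) {s : ℕ} {l : Comb} (hs : s ∈ vecCodes)
    (hl : ∀ p ∈ l, p.2 ∈ scalarCodes) (h : R) (u : Fin 4 → R) :
    aBr F (ae u s) (h • l.eval (am R μ)) = (6⁻¹ : ℝ) • ((l.bind (nbM s)).eval (ae (h • u))
      + dir F u h • (l.bind (smM s)).eval (am R μ)) := by
  rw [Comb.eval_smul, ← aBrₗ_apply, Comb.map_eval, Comb.eval_bind, Comb.eval_bind, Comb.eval_smul,
    ← Comb.eval_add, Comb.eval_smul]
  refine Comb.eval_congr (E := A R) fun p hp => ?_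
  rw [aBrₗ_apply, aBr_ae_am F μ hs (hl p hp)]

theorem aBr_eval_ae (F : FrameData R) (μ : Fin 4) {s : ℕ} {l : Comb} (hs : s ∈ vecCodes)
    (hl : ∀ p ∈ l, p.2 ∈ scalarCodes) (h : R) (u : Fin 4 → R) :
    aBr F (h • l.eval (am R μ)) (ae u s) = (6⁻¹ : ℝ) •
      ((l.bind fun c => nbM c s).eval (ae (h • u))
        + dir F u h • (l.bind fun c => rmM c s).eval (am R μ)) := by
  rw [Comb.eval_smul, ← aBrₗ_apply, ← LinearMap.flip_apply, Comb.map_eval, Comb.eval_bind,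
    Comb.eval_bind, Comb.eval_smul, ← Comb.eval_add, Comb.eval_smul]
  refine Comb.eval_congr (E := A R) fun p hp => ?_
  rw [LinearMap.flip_apply, aBrₗ_apply, aBr_am_ae F μ hs (hl p hp)]

theorem aBr_ae_eval_ae (F : FrameData R) {s : ℕ} {l : Comb} (hs : s ∈ vecCodes)
    (hl : ∀ p ∈ l, p.2 ∈ vecCodes) (u w : Fin 4 → R) :
    aBr F (ae u s) (l.eval (ae w)) = (6⁻¹ : ℝ) • (l.bind (mlM s)).eval (ae (vecBr F u w)) := by
  rw [← aBrₗ_apply, Comb.map_eval, Comb.eval_bind, Comb.eval_smul]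
  refine Comb.eval_congr (E := A R) fun p hp => ?_
  rw [aBrₗ_apply, aBr_ae_ae F hs (hl p hp)]

theorem aBr_eval_ae_ae (F : FrameData R) {s : ℕ} {l : Comb} (hs : s ∈ vecCodes)
    (hl : ∀ p ∈ l, p.2 ∈ vecCodes) (u w : Fin 4 → R) :
    aBr F (l.eval (ae w)) (ae u s)
      = (6⁻¹ : ℝ) • (l.bind fun t => mlM t s).eval (ae (vecBr F w u)) := by
  rw [← aBrₗ_apply, ← LinearMap.flip_apply, Comb.map_eval, Comb.eval_bind, Comb.eval_smul]
  refine Comb.eval_congr (E := A R) fun p hp => ?_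
  rw [LinearMap.flip_apply, aBrₗ_apply, aBr_ae_ae F (hl p hp) hs]

end

/-! ### Elements of homological degree zero act as derivations -/

section
variable {R : Type*} [CommRing R] [Algebra ℝ R]

/-- `ad a` satisfies the Leibniz rule on `[x, y]`. -/
def IsDerivOn (F : FrameData R) (a x y : A R) : Prop :=
  aBr F a (aBr F x y) = aBr F (aBr F a x) y + aBr F x (aBr F a y)

theorem eval_leibniz {m₁ m₂ m₃ m₄ m₅ m₆ : ℕ → ℕ → Comb} {σ x y : ℕ}
    (h : leibnizM m₁ m₂ m₃ m₄ m₅ m₆ σ x y = true) (v : ℕ → A R) :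
    ((m₁ x y).bind (m₂ σ)).eval v
      = ((m₃ σ x).bind fun c => m₄ c y).eval v + ((m₅ σ y).bind (m₆ x)).eval v := by
  rw [Comb.eval_eq_of_same h, Comb.eval_append]

/-- Acting with σ preserves homological degrees, so all intermediate pairs stay among those for
which the tables are valid. After that the statement is a table identity times f g h. -/
theorem isDerivOn_am_am_am (F : FrameData R) {σ k l : ℕ} (hσ : σ ∈ sigmaCodes)
    (hk : k ∈ scalarCodes) (hl : l ∈ scalarCodes) (hkl : okPair k l = true) (f g h : R) :
    IsDerivOn F (f • am R 0 σ) (g • am R 0 k) (h • am R 0 l) := by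
  obtain ⟨hσ1, hσ2⟩ := sigmaCodes_spec σ hσ
  have ok := okPair_zero hσ2
  have c1 := inCodes_spec (allOk_spec nbM_codes hk hl hkl)
  have c2 := inCodes_spec (allOk_spec nbM_codes hσ1 hk (ok k))
  have c3 := inCodes_spec (allOk_spec nbM_codes hσ1 hl (ok l))
  rw [hσ2, zero_add] at c2 c3
  rw [IsDerivOn, aBr_am_am F 0 hk hl hkl, aBr_am_am F 0 hσ1 hk (ok k), aBr_am_am F 0 hσ1 hl (ok l)]
  simp only [← aBrₗ_apply, map_smul, LinearMap.smul_apply]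
  simp only [aBrₗ_apply]
  rw [aBr_am_eval F 0 hσ1 fun p hp => ⟨(c1 p hp).1, ok _⟩,
    aBr_eval_am F 0 hl fun p hp => ⟨(c2 p hp).1, (okPair_congr (c2 p hp).2 rfl).trans hkl⟩,
    aBr_am_eval F 0 hk fun p hp => ⟨(c3 p hp).1, (okPair_congr rfl (c3 p hp).2).trans hkl⟩,
    eval_leibniz (allPairs_spec nbM_scalar_scalar hσ hk hl hkl), ← smul_add, ← smul_add, smul_add]
  congr 3
  · ring_nf
  · ring_nf

theorem isDerivOn_am_ae_am (F : FrameData R) {σ s l : ℕ} (hσ : σ ∈ sigmaCodes)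
    (hs : s ∈ vecCodes) (hl : l ∈ scalarCodes) (hsl : okPair s l = true) (f h : R)
    (u : Fin 4 → R) : IsDerivOn F (f • am R 0 σ) (ae u s) (h • am R 0 l) := by
  obtain ⟨hσ1, hσ2⟩ := sigmaCodes_spec σ hσ
  have ok := okPair_zero hσ2
  have c1 := inCodes_spec (allOk_spec nbM_codes_left hs hl hsl)
  have c1' := inCodes_spec (allOk_spec smM_codes hs hl hsl)
  have c2 := inCodes_spec (allOk_spec nbM_codes_right hσ1 hs (ok s))
  have c2' := inCodes_spec (allOk_spec rmM_codes hσ1 hs (ok s))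
  have c3 := inCodes_spec (allOk_spec nbM_codes hσ1 hl (ok l))
  rw [hσ2, zero_add] at c2 c2' c3
  rw [IsDerivOn, aBr_ae_am F 0 hs hl, aBr_am_ae F 0 hs hσ1, aBr_am_am F 0 hσ1 hl (ok l)]
  simp only [← aBrₗ_apply, map_smul, map_add, LinearMap.smul_apply, LinearMap.add_apply]
  simp only [aBrₗ_apply]
  rw [aBr_am_eval_ae F 0 hσ1 fun p hp => (c1 p hp).1,
    aBr_am_eval F 0 hσ1 fun p hp => ⟨(c1' p hp).1, ok _⟩,
    aBr_eval_ae_am F 0 hl fun p hp => (c2 p hp).1,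
    aBr_eval_am F 0 hl fun p hp => ⟨(c2' p hp).1, (okPair_congr (c2' p hp).2 rfl).trans hsl⟩,
    aBr_ae_eval F 0 hs fun p hp => (c3 p hp).1,
    eval_leibniz (allPairs_spec nbM_vec_scalar hσ hs hl hsl),
    eval_leibniz (allPairs_spec rmM_vec_scalar hσ hs hl hsl),
    eval_leibniz (allPairs_spec smM_vec_scalar hσ hs hl hsl)]
  simp only [← smul_add]
  congr 2
  simp only [dir_smul_left, dir_mul, smul_smul, mul_comm h f]
  module

theorem isDerivOn_am_am_ae (F : FrameData R) {σ s l : ℕ} (hσ : σ ∈ sigmaCodes)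
    (hs : s ∈ vecCodes) (hl : l ∈ scalarCodes) (hsl : okPair l s = true) (f h : R)
    (u : Fin 4 → R) : IsDerivOn F (f • am R 0 σ) (h • am R 0 l) (ae u s) := by
  obtain ⟨hσ1, hσ2⟩ := sigmaCodes_spec σ hσ
  have ok := okPair_zero hσ2
  have c1 := inCodes_spec (allOk_spec nbM_codes_right hl hs hsl)
  have c1' := inCodes_spec (allOk_spec rmM_codes hl hs hsl)
  have c2 := inCodes_spec (allOk_spec nbM_codes_right hσ1 hs (ok s))
  have c2' := inCodes_spec (allOk_spec rmM_codes hσ1 hs (ok s))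
  have c3 := inCodes_spec (allOk_spec nbM_codes hσ1 hl (ok l))
  rw [hσ2, zero_add] at c2 c2' c3
  rw [IsDerivOn, aBr_am_ae F 0 hs hl, aBr_am_ae F 0 hs hσ1, aBr_am_am F 0 hσ1 hl (ok l)]
  simp only [← aBrₗ_apply, map_smul, map_add, LinearMap.smul_apply]
  simp only [aBrₗ_apply]
  rw [aBr_am_eval_ae F 0 hσ1 fun p hp => (c1 p hp).1,
    aBr_am_eval F 0 hσ1 fun p hp => ⟨(c1' p hp).1, ok _⟩,
    aBr_eval_ae F 0 hs fun p hp => (c3 p hp).1,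
    aBr_am_eval_ae F 0 hl fun p hp => (c2 p hp).1,
    aBr_am_eval F 0 hl fun p hp => ⟨(c2' p hp).1, (okPair_congr rfl (c2' p hp).2).trans hsl⟩,
    eval_leibniz (allPairs_spec nbM_scalar_vec hσ hl hs hsl),
    eval_leibniz (allPairs_spec rmM_scalar_vec hσ hl hs hsl),
    eval_leibniz (allPairs_spec smM_scalar_vec hσ hl hs hsl)]
  simp only [← smul_add]
  congr 2
  simp only [dir_smul_left, dir_mul, smul_smul, mul_comm h f]
  module

/-- Both vector fields may differentiate f. The terms are sorted by the five expressions f[u,w], (u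
f)w, (w f)u, u(w f), w(u f), and each group is settled by its own table identity. -/
theorem isDerivOn_am_ae_ae {F : FrameData R} (hF : F.IsFrame) {σ s t : ℕ} (hσ : σ ∈ sigmaCodes)
    (hs : s ∈ vecCodes) (ht : t ∈ vecCodes) (hst : okPair s t = true) (f : R)
    (u w : Fin 4 → R) : IsDerivOn F (f • am R 0 σ) (ae u s) (ae w t) := by
  obtain ⟨hσ1, hσ2⟩ := sigmaCodes_spec σ hσ
  have ok := okPair_zero hσ2
  have c1 := inCodes_spec (allOk_spec mlM_codes hs ht hst)
  have c2 := inCodes_spec (allOk_spec nbM_codes_right hσ1 hs (ok s))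
  have c2' := inCodes_spec (allOk_spec rmM_codes hσ1 hs (ok s))
  have c3 := inCodes_spec (allOk_spec nbM_codes_right hσ1 ht (ok t))
  have c3' := inCodes_spec (allOk_spec rmM_codes hσ1 ht (ok t))
  rw [IsDerivOn, aBr_ae_ae F hs ht, aBr_am_ae F 0 hs hσ1, aBr_am_ae F 0 ht hσ1]
  simp only [← aBrₗ_apply, map_smul, map_add, LinearMap.smul_apply, LinearMap.add_apply]
  simp only [aBrₗ_apply]
  have i1 := eval_leibniz (R := R) (allPairs_spec mlM_vec_vec hσ hs ht hst)
  have i2 := fun v : ℕ → A R => Comb.eval_eq_of_same (allPairs_spec mlM_nbM_vec hσ hs ht hst) v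
  have i3 := eval_leibniz (R := R) (allPairs_spec nbM_mlM_vec hσ hs ht hst)
  have i4 := fun v : ℕ → A R => Comb.eval_eq_of_same (allPairs_spec rmM_mlM_vec hσ hs ht hst) v
  have i5 := fun v : ℕ → A R => Comb.eval_eq_of_same (allPairs_spec mlM_rmM_vec hσ hs ht hst) v
  simp only [Comb.eval_append, Comb.eval_nil] at i5
  have i3' : ∀ v : ℕ → A R, ((nbM σ t).bind (mlM s)).eval v
      = - ((rmM σ s).bind fun c => nbM c t).eval v := by
    intro v
    have := i3 v
    rw [show ((noneM s t).bind (noneM σ)).eval v = 0 from rfl] at this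
    exact (neg_eq_of_add_eq_zero_right this.symm).symm
  have i5' : ∀ v : ℕ → A R, ((rmM σ s).bind fun c => rmM c t).eval v
      = - ((mlM s t).bind (rmM σ)).eval v := fun v =>
    (neg_eq_of_add_eq_zero_right (i5 v)).symm
  -- The product rules for the bracket of vector fields produce the terms with first derivatives of
  -- f, and the derivative along [u,w] those with second derivatives.
  rw [aBr_am_eval_ae F 0 hσ1 fun p hp => (c1 p hp).1,
    aBr_eval_ae_ae F ht fun p hp => (c2 p hp).1,
    aBr_eval_ae F 0 ht fun p hp => (c2' p hp).1,
    aBr_ae_eval_ae F hs fun p hp => (c3 p hp).1,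
    aBr_ae_eval F 0 hs fun p hp => (c3' p hp).1, vecBr_smul_left, vecBr_smul_right,
    dir_vecBr hF, i5', ← i4, eval_ae_sub, eval_ae_add, i1 (ae (f • vecBr F u w)), i3', i3',
    i2 (ae (dir F w f • u))]
  simp only [← smul_add]
  congr 2
  module

theorem aBr_vec_eval {F : FrameData R} (v : Fin 4 → R) {l : Comb}
    (hl : ∀ p ∈ l, p.2 ∈ scalarCodes) (h : R) :
    aBr F (ae v 48) (h • l.eval (am R 0)) = dir F v h • l.eval (am R 0) := by
  rw [Comb.eval_smul, ← aBrₗ_apply, Comb.map_eval, Comb.eval_smul]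
  refine Comb.eval_congr (E := A R) fun p hp => ?_
  obtain ⟨h1, h2⟩ := nbM_vec_empty p.2 (hl p hp)
  rw [aBrₗ_apply, aBr_ae_am F 0 (by decide) (hl p hp), h1, h2, Comb.eval_nil, zero_add,
    Comb.eval_cons, Comb.eval_nil, add_zero, smul_comm (dir F v h), smul_six]

theorem aBr_vec_eval_ae {F : FrameData R} (v w : Fin 4 → R) {l : Comb}
    (hl : ∀ p ∈ l, p.2 ∈ vecCodes) :
    aBr F (ae v 48) (l.eval (ae w)) = l.eval (ae (vecBr F v w)) := by
  rw [← aBrₗ_apply, Comb.map_eval]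
  refine Comb.eval_congr (E := A R) fun p hp => ?_
  rw [aBrₗ_apply, aBr_ae_ae F (by decide) (hl p hp), mlM_vec_empty p.2 (hl p hp), Comb.eval_cons,
    Comb.eval_nil, add_zero, smul_six]

theorem aBr_vec_am {F : FrameData R} (v : Fin 4 → R) {l : ℕ} (hl : l ∈ scalarCodes) (h : R) :
    aBr F (ae v 48) (h • am R 0 l) = dir F v h • am R 0 l := by
  have := aBr_vec_eval (F := F) v (l := [(1, l)]) (by simpa using hl) h
  simpa using this

theorem aBr_vec_ae {F : FrameData R} (v w : Fin 4 → R) {s : ℕ} (hs : s ∈ vecCodes) :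
    aBr F (ae v 48) (ae w s) = ae (vecBr F v w) s := by
  have := aBr_vec_eval_ae (F := F) v w (l := [(1, s)]) (by simpa using hs)
  simpa using this

/-- A vector field without factors θ only differentiates coefficients, and the structure constants
are constant. So this is the product rule for g h. -/
theorem isDerivOn_ae_am_am (F : FrameData R) {k l : ℕ}
    (hk : k ∈ scalarCodes) (hl : l ∈ scalarCodes) (hkl : okPair k l = true) (v : Fin 4 → R)
    (g h : R) : IsDerivOn F (ae v 48) (g • am R 0 k) (h • am R 0 l) := by
  have c1 := inCodes_spec (allOk_spec nbM_codes hk hl hkl)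
  rw [IsDerivOn, aBr_vec_am v hk, aBr_vec_am v hl, aBr_am_am F 0 hk hl hkl,
    aBr_am_am F 0 hk hl hkl, aBr_am_am F 0 hk hl hkl, ← aBrₗ_apply, map_smul, aBrₗ_apply,
    aBr_vec_eval v fun p hp => (c1 p hp).1, dir_mul, ← smul_add, ← add_smul, add_comm]

theorem isDerivOn_ae_ae_am {F : FrameData R} (hF : F.IsFrame) {s l : ℕ}
    (hs : s ∈ vecCodes) (hl : l ∈ scalarCodes) (hsl : okPair s l = true) (v u : Fin 4 → R)
    (h : R) : IsDerivOn F (ae v 48) (ae u s) (h • am R 0 l) := by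
  have c1 := inCodes_spec (allOk_spec nbM_codes_left hs hl hsl)
  have c2 := inCodes_spec (allOk_spec smM_codes hs hl hsl)
  rw [IsDerivOn, aBr_vec_am v hl, aBr_vec_ae v u hs, aBr_ae_am F 0 hs hl, aBr_ae_am F 0 hs hl,
    aBr_ae_am F 0 hs hl, ← aBrₗ_apply, map_smul, map_add, aBrₗ_apply, aBrₗ_apply,
    aBr_vec_eval v fun p hp => (c2 p hp).1, aBr_vec_eval_ae v _ fun p hp => (c1 p hp).1,
    dir_vecBr hF, vecBr_smul_right, eval_ae_add, ← smul_add]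
  congr 1
  module

theorem isDerivOn_ae_am_ae {F : FrameData R} (hF : F.IsFrame) {s l : ℕ}
    (hs : s ∈ vecCodes) (hl : l ∈ scalarCodes) (hsl : okPair l s = true) (v u : Fin 4 → R)
    (h : R) : IsDerivOn F (ae v 48) (h • am R 0 l) (ae u s) := by
  have c1 := inCodes_spec (allOk_spec nbM_codes_right hl hs hsl)
  have c2 := inCodes_spec (allOk_spec rmM_codes hl hs hsl)
  rw [IsDerivOn, aBr_vec_am v hl, aBr_vec_ae v u hs, aBr_am_ae F 0 hs hl, aBr_am_ae F 0 hs hl,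
    aBr_am_ae F 0 hs hl, ← aBrₗ_apply, map_smul, map_add, aBrₗ_apply, aBrₗ_apply,
    aBr_vec_eval v fun p hp => (c2 p hp).1, aBr_vec_eval_ae v _ fun p hp => (c1 p hp).1,
    dir_vecBr hF, vecBr_smul_right, eval_ae_add, ← smul_add]
  congr 1
  module

theorem isDerivOn_ae_ae_ae {F : FrameData R} (hF : F.IsFrame) {s t : ℕ}
    (hs : s ∈ vecCodes) (ht : t ∈ vecCodes) (hst : okPair s t = true) (v u w : Fin 4 → R) :
    IsDerivOn F (ae v 48) (ae u s) (ae w t) := by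
  have c1 := inCodes_spec (allOk_spec mlM_codes hs ht hst)
  rw [IsDerivOn, aBr_vec_ae v w ht, aBr_vec_ae v u hs, aBr_ae_ae F hs ht, aBr_ae_ae F hs ht,
    aBr_ae_ae F hs ht, ← aBrₗ_apply, map_smul, aBrₗ_apply,
    aBr_vec_eval_ae v _ fun p hp => (c1 p hp).1, vecBr_jacobi hF, eval_ae_add, smul_add]

theorem code_mem : ∀ r : Row, ∀ b : Bool, (r.code + bif b then 64 else 0) ∈ scalarCodes ∨
    (r.code + bif b then 64 else 0) ∈ vecCodes := by decide +kernel

/-- Induction over the elements of `𝓐` with components in a given set of homological degrees. -/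
theorem A_induction {H : ℕ → Prop} {P : A R → Prop} (h0 : P 0)
    (hadd : ∀ x y, P x → P y → P (x + y))
    (hs : ∀ c ∈ scalarCodes, H (hdegM c) → ∀ f : R, P (f • am R 0 c))
    (hv : ∀ c ∈ vecCodes, H (hdegM c) → ∀ u : Fin 4 → R, P (ae u c)) (x : A R)
    (hx : ∀ b : Idx, ¬ H b.hdeg → x b = 0) : P x := by
  have h1 : x = ∑ b : Idx, x b • (Pi.single b 1 : A R) := by
    funext b
    simp [Finset.sum_apply, Pi.single_apply]
  rw [h1]
  refine Finset.sum_induction _ P hadd h0 fun b _ => ?_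
  by_cases hb : H b.hdeg
  · obtain ⟨hc1, hc2⟩ := idx_code_lt b
    have h2 : (Pi.single b 1 : A R) = am R b.2.dirn b.code := by rw [am, idxOf_code]
    have h3 : H (hdegM b.code) := by
      rw [hdegM_eq b.2.dirn ⟨_, hc1⟩ hc2, idxOf_code]; exact hb
    rw [h2]
    have h5 : b.code ∈ scalarCodes ∨ b.code ∈ vecCodes := code_mem b.2 b.1
    rcases h5 with h | h
    · rw [am_lt b.2.dirn 0 (scalarCodes_lt _ h).2]
      exact hs _ h h3 _
    · have : x b • am R b.2.dirn b.code = ae (Pi.single b.2.dirn (x b)) b.code := by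
        rw [ae, Finset.sum_eq_single b.2.dirn]
        · rw [Pi.single_eq_same]
        · intro μ _ hμ; rw [Pi.single_eq_of_ne hμ, zero_smul]
        · simp
      rw [this]
      exact hv _ h h3 _
  · rw [hx b hb, zero_smul]
    exact h0

/-- Additivity in each argument reduces to basis elements. Those of homological degree zero are the
seven σ's and the four D_μ, for which the cases were settled one by one. -/
theorem isDerivOn {F : FrameData R} (hF : F.IsFrame) {a x y : A R} (ha : IsHomological 0 a)
    (hxy : IsHomological 0 x ∨ IsHomological 1 x ∧ IsHomological 1 y) : IsDerivOn F a x y := by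
  have key : ∀ H H' : ℕ → Prop, (∀ k l, H (hdegM k) → H' (hdegM l) → okPair k l = true) →
      ∀ a x y : A R, IsHomological 0 a → (∀ b : Idx, ¬ H b.hdeg → x b = 0) →
      (∀ b : Idx, ¬ H' b.hdeg → y b = 0) → IsDerivOn F a x y := by
    intro H H' hok a x y ha hx hy
    have ha' : ∀ b : Idx, ¬ (· = 0) b.hdeg → a b = 0 := ha
    have add1 : ∀ {a a' x y : A R}, IsDerivOn F a x y → IsDerivOn F a' x y →
        IsDerivOn F (a + a') x y := by
      intro a a' x y h h'
      simp only [IsDerivOn, ← aBrₗ_apply, map_add, LinearMap.add_apply] at h h' ⊢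
      rw [h, h']; abel
    have add2 : ∀ {a x x' y : A R}, IsDerivOn F a x y → IsDerivOn F a x' y →
        IsDerivOn F a (x + x') y := by
      intro a x x' y h h'
      simp only [IsDerivOn, ← aBrₗ_apply, map_add, LinearMap.add_apply] at h h' ⊢
      rw [h, h']; abel
    have add3 : ∀ {a x y y' : A R}, IsDerivOn F a x y → IsDerivOn F a x y' →
        IsDerivOn F a x (y + y') := by
      intro a x x' y h h'
      simp only [IsDerivOn, ← aBrₗ_apply, map_add] at h h' ⊢
      rw [h, h']; abel
    have z : ∀ {a x y : A R}, a = 0 ∨ x = 0 ∨ y = 0 → IsDerivOn F a x y := by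
      intro a x y h
      rcases h with rfl | rfl | rfl <;>
        simp only [IsDerivOn, ← aBrₗ_apply, map_zero, LinearMap.zero_apply, add_zero]
    refine A_induction (H := (· = 0)) (P := fun a => IsDerivOn F a x y) (z (.inl rfl)) (fun _ _ => add1) ?_ ?_ a ha'
    · intro σ hσ h0 f
      have hσ' := mem_sigmaCodes σ hσ h0
      refine A_induction (H := H) (P := fun x => IsDerivOn F _ x y) (z (.inr (.inl rfl)))
        (fun _ _ => add2) ?_ ?_ x hx
      · intro k hk hHk g
        refine A_induction (H := H') (P := fun y => IsDerivOn F _ _ y) (z (.inr (.inr rfl)))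
          (fun _ _ => add3) ?_ ?_ y hy
        · exact fun l hl hHl h => isDerivOn_am_am_am F hσ' hk hl (hok _ _ hHk hHl) f g h
        · exact fun s hs hHs u => isDerivOn_am_am_ae F hσ' hs hk (hok _ _ hHk hHs) f g u
      · intro s hs hHs u
        refine A_induction (H := H') (P := fun y => IsDerivOn F _ _ y) (z (.inr (.inr rfl)))
          (fun _ _ => add3) ?_ ?_ y hy
        · exact fun l hl hHl h => isDerivOn_am_ae_am F hσ' hs hl (hok _ _ hHs hHl) f h u
        · exact fun t ht hHt w => isDerivOn_am_ae_ae hF hσ' hs ht (hok _ _ hHs hHt) f u w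
    · intro c hc h0 v
      rw [vecCodes_zero c hc h0]
      refine A_induction (H := H) (P := fun x => IsDerivOn F _ x y) (z (.inr (.inl rfl)))
        (fun _ _ => add2) ?_ ?_ x hx
      · intro k hk hHk g
        refine A_induction (H := H') (P := fun y => IsDerivOn F _ _ y) (z (.inr (.inr rfl)))
          (fun _ _ => add3) ?_ ?_ y hy
        · exact fun l hl hHl h => isDerivOn_ae_am_am F hk hl (hok _ _ hHk hHl) v g h
        · exact fun s hs hHs u => isDerivOn_ae_am_ae hF hs hk (hok _ _ hHk hHs) v u g
      · intro s hs hHs u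
        refine A_induction (H := H') (P := fun y => IsDerivOn F _ _ y) (z (.inr (.inr rfl)))
          (fun _ _ => add3) ?_ ?_ y hy
        · exact fun l hl hHl h => isDerivOn_ae_ae_am hF hs hl (hok _ _ hHs hHl) v u h
        · exact fun t ht hHt w => isDerivOn_ae_ae_ae hF hs ht (hok _ _ hHs hHt) v u w
  -- If the first entry has degree zero, the second is unrestricted; if it has degree one, so must
  -- the second.
  rcases hxy with hx | ⟨hx, hy⟩
  · exact key (· = 0) (fun _ => True) (fun k l h _ => okPair_zero h l) a x y ha hx (by simp)
  · exact key (· = 1) (· = 1) (fun k l h h' => by simp [okPair, h, h']) a x y ha hx hy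

end

/-! ## Exponentials of nilpotent operators -/

section Exponential

variable {X Y Z : Type*} [AddCommGroup X] [Module ℝ X] [AddCommGroup Y] [Module ℝ Y]
  [AddCommGroup Z] [Module ℝ Z]

/-- The exponential series, truncated after the term of order `N`. -/
noncomputable def nexp (N : ℕ) (A : Module.End ℝ X) : Module.End ℝ X :=
  ∑ j ∈ Finset.range (N + 1), (j.factorial : ℝ)⁻¹ • A ^ j

theorem nexp_apply (N : ℕ) (A : Module.End ℝ X) (x : X) :
    nexp N A x = ∑ j ∈ Finset.range (N + 1), (j.factorial : ℝ)⁻¹ • (A ^ j) x := by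
  simp [nexp, LinearMap.sum_apply]

theorem nexp_eq_of_le {N K : ℕ} {A : Module.End ℝ X} (hA : A ^ (N + 1) = 0) (h : N ≤ K) :
    nexp K A = nexp N A := by
  rw [nexp, nexp]
  refine (Finset.sum_subset (Finset.range_mono (by omega)) fun j _ hj => ?_).symm
  rw [Finset.mem_range, not_lt] at hj
  rw [pow_eq_zero_of_le hj hA, smul_zero]

theorem divided_pow_succ (A : Module.End ℝ X) (i : ℕ) (x : X) :
    A (((i.factorial : ℝ)⁻¹) • (A ^ i) x)
      = ((i : ℝ) + 1) • (((i + 1).factorial : ℝ)⁻¹) • (A ^ (i + 1)) x := by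
  rw [map_smul, smul_smul, pow_succ', Module.End.mul_apply]
  congr 1
  rw [Nat.factorial_succ]
  push_cast
  have : (i.factorial : ℝ) ≠ 0 := by positivity
  field_simp

/-- Leibniz formula for iterated derivations. -/
theorem divided_pow_leibniz {A : Module.End ℝ X} {B : Module.End ℝ Y} {C : Module.End ℝ Z}
    (f : X →ₗ[ℝ] Y →ₗ[ℝ] Z) {X' : Submodule ℝ X} (hX' : ∀ x ∈ X', A x ∈ X')
    {Y' : Submodule ℝ Y} (hY' : ∀ y ∈ Y', B y ∈ Y')
    (h : ∀ x ∈ X', ∀ y ∈ Y', C (f x y) = f (A x) y + f x (B y)) {x : X} (hx : x ∈ X') {y : Y}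
    (hy : y ∈ Y') (n : ℕ) :
    ((n.factorial : ℝ)⁻¹) • (C ^ n) (f x y) = ∑ q ∈ Finset.HasAntidiagonal.antidiagonal n,
      f (((q.1.factorial : ℝ)⁻¹) • (A ^ q.1) x) (((q.2.factorial : ℝ)⁻¹) • (B ^ q.2) y) := by
  have hmem : ∀ i, ((i.factorial : ℝ)⁻¹) • (A ^ i) x ∈ X' := by
    intro i
    refine X'.smul_mem _ ?_
    induction i with
    | zero => simpa using hx
    | succ i ih => rw [pow_succ', Module.End.mul_apply]; exact hX' _ ih
  have hmem' : ∀ i, ((i.factorial : ℝ)⁻¹) • (B ^ i) y ∈ Y' := by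
    intro i
    refine Y'.smul_mem _ ?_
    induction i with
    | zero => simpa using hy
    | succ i ih => rw [pow_succ', Module.End.mul_apply]; exact hY' _ ih
  induction n with
  | zero => simp
  | succ n ih =>
    -- The identity is first multiplied by n + 1: this is the sum of the two exponents in each term,
    -- and it distributes over the two ways of raising one of them.
    have h1 : ((n : ℝ) + 1) • (((n + 1).factorial : ℝ)⁻¹) • (C ^ (n + 1)) (f x y)
        = ((n : ℝ) + 1) • ∑ q ∈ Finset.HasAntidiagonal.antidiagonal (n + 1),
      f (((q.1.factorial : ℝ)⁻¹) • (A ^ q.1) x) (((q.2.factorial : ℝ)⁻¹) • (B ^ q.2) y) := by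
      rw [← divided_pow_succ, ih, map_sum]
      simp only [h _ (hmem _) _ (hmem' _), divided_pow_succ]
      rw [Finset.sum_add_distrib]
      have e1 : ((n : ℝ) + 1) • ∑ q ∈ Finset.HasAntidiagonal.antidiagonal (n + 1),
          f (((q.1.factorial : ℝ)⁻¹) • (A ^ q.1) x) (((q.2.factorial : ℝ)⁻¹) • (B ^ q.2) y)
          = ∑ q ∈ Finset.HasAntidiagonal.antidiagonal (n + 1),
            ((q.1 : ℝ) • f (((q.1.factorial : ℝ)⁻¹) • (A ^ q.1) x)
              (((q.2.factorial : ℝ)⁻¹) • (B ^ q.2) y)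
            + (q.2 : ℝ) • f (((q.1.factorial : ℝ)⁻¹) • (A ^ q.1) x)
              (((q.2.factorial : ℝ)⁻¹) • (B ^ q.2) y)) := by
        rw [Finset.smul_sum]
        refine Finset.sum_congr rfl fun q hq => ?_
        rw [← add_smul]
        congr 1
        have := Finset.HasAntidiagonal.mem_antidiagonal.1 hq
        exact_mod_cast this.symm
      rw [e1, Finset.sum_add_distrib, Finset.Nat.sum_antidiagonal_succ]
      rw [Finset.Nat.sum_antidiagonal_succ' (f := fun q => (q.2 : ℝ) •
        f (((q.1.factorial : ℝ)⁻¹) • (A ^ q.1) x) (((q.2.factorial : ℝ)⁻¹) • (B ^ q.2) y))]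
      simp only [Nat.cast_zero, zero_smul, zero_add, map_smul, LinearMap.smul_apply,
        Nat.cast_add, Nat.cast_one]
      congr 1
      exact Finset.sum_congr rfl fun q _ => smul_comm _ _ _
    have h2 : ((n : ℝ) + 1) ≠ 0 := by positivity
    exact (smul_right_injective _ h2) h1

/-- The exponential of a derivation is compatible with the product. -/
theorem nexp_leibniz {A : Module.End ℝ X} {B : Module.End ℝ Y} {C : Module.End ℝ Z} {N : ℕ}
    (hA : A ^ (N + 1) = 0) (hB : B ^ (N + 1) = 0) (hC : C ^ (N + 1) = 0)
    (f : X →ₗ[ℝ] Y →ₗ[ℝ] Z) {X' : Submodule ℝ X} (hX' : ∀ x ∈ X', A x ∈ X')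
    {Y' : Submodule ℝ Y} (hY' : ∀ y ∈ Y', B y ∈ Y')
    (h : ∀ x ∈ X', ∀ y ∈ Y', C (f x y) = f (A x) y + f x (B y)) {x : X} (hx : x ∈ X') {y : Y}
    (hy : y ∈ Y') :
    nexp N C (f x y) = f (nexp N A x) (nexp N B y) := by
  -- Extending the exponential on the target to order 2N adds only zeros but makes room for all
  -- products of two terms of order at most N.
  rw [← nexp_eq_of_le hC (by omega : N ≤ 2 * N), nexp_apply, nexp_apply, nexp_apply]
  simp only [divided_pow_leibniz f hX' hY' h hx hy]
  simp only [map_sum, LinearMap.sum_apply]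
  rw [Finset.sum_comm]
  set g : ℕ × ℕ → Z := fun q =>
    f (((q.1.factorial : ℝ)⁻¹) • (A ^ q.1) x) (((q.2.factorial : ℝ)⁻¹) • (B ^ q.2) y) with hg
  have hz : ∀ q : ℕ × ℕ, ¬ (q.1 < N + 1 ∧ q.2 < N + 1) → g q = 0 := by
    intro q hq
    rw [hg]
    by_cases h1 : q.1 < N + 1
    · have h2 : N + 1 ≤ q.2 := by omega
      simp only [pow_eq_zero_of_le h2 hB, LinearMap.zero_apply, smul_zero, map_zero]
    · simp only [pow_eq_zero_of_le (not_lt.1 h1) hA, LinearMap.zero_apply, smul_zero, map_zero]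
  have e2 : ∑ n ∈ Finset.range (2 * N + 1), ∑ q ∈ Finset.HasAntidiagonal.antidiagonal n, g q
      = ∑ q ∈ Finset.range (N + 1) ×ˢ Finset.range (N + 1), g q := by
    rw [← Finset.sum_fiberwise_of_maps_to (t := Finset.range (2 * N + 1))
      (g := fun q : ℕ × ℕ => q.1 + q.2)]
    · refine Finset.sum_congr rfl fun n _ => ?_
      refine (Finset.sum_subset (fun q hq => ?_) fun q hq hq' => ?_).symm
      · exact Finset.HasAntidiagonal.mem_antidiagonal.2 (Finset.mem_filter.1 hq).2
      · refine hz q fun h => hq' ?_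
        rw [Finset.mem_filter, Finset.mem_product, Finset.mem_range, Finset.mem_range]
        exact ⟨h, Finset.HasAntidiagonal.mem_antidiagonal.1 hq⟩
    · intro q hq
      rw [Finset.mem_product, Finset.mem_range, Finset.mem_range] at hq
      rw [Finset.mem_range]
      omega
  rw [e2, Finset.sum_product, Finset.sum_comm]

/-- This is the compatibility of exponentials with products, applied to the evaluation pairing (P,
x) ↦ P x. Let −A act on P from the right and A act on x: the two terms cancel, so the derivation on
the target is zero and its exponential is the identity. -/
theorem nexp_neg_mul_nexp {N : ℕ} {A : Module.End ℝ X} (hA : A ^ (N + 1) = 0) :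
    nexp N (-A) * nexp N A = 1 := by
  let L : Module.End ℝ (Module.End ℝ X) := - LinearMap.mulRight ℝ A
  have hL : ∀ j, (L ^ j) 1 = (-A) ^ j := by
    intro j
    induction j with
    | zero => simp
    | succ j ih =>
      rw [pow_succ', Module.End.mul_apply, ih, pow_succ]
      simp [L]
  have hL' : L ^ (N + 1) = 0 := by
    have : ∀ j (x : Module.End ℝ X), (L ^ j) x = x * (-A) ^ j := by
      intro j x
      induction j with
      | zero => simp
      | succ j ih =>
        rw [pow_succ', Module.End.mul_apply, ih, pow_succ]
        simp [L, mul_assoc]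
    ext1 x
    rw [this, neg_pow, hA]
    simp
  have hz : (0 : Module.End ℝ X) ^ (N + 1) = 0 := by simp
  ext x
  have := nexp_leibniz (C := (0 : Module.End ℝ X)) (A := L) (B := A) hL' hA hz
    (LinearMap.id (R := ℝ) (M := Module.End ℝ X)) (X' := ⊤) (by simp) (Y' := ⊤) (by simp)
    (fun a _ y _ => by
      simp [L]) (x := 1) trivial (y := x) trivial
  have e0 : nexp N (0 : Module.End ℝ X) = 1 := by
    rw [nexp, Finset.sum_eq_single 0]
    · simp
    · intro j _ hj; simp [hj]
    · simp
  have e1 : nexp N L 1 = nexp N (-A) := by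
    rw [nexp_apply, nexp]
    simp only [hL]
  rw [e0, e1] at this
  exact this.symm

end Exponential

/-! ## The group of exponentials of a graded nilpotent Lie algebra -/

section Group

variable {J I M : Type*} [AddCommGroup M] [Module ℝ M]

/-- The elements with components of weight at least `l`. -/
def filt (w : J → I → ℕ) (l : ℕ) : Submodule ℝ (J → I → M) where
  carrier := {x | ∀ j i, w j i < l → x j i = 0}
  add_mem' hx hy j i hj := by rw [Pi.add_apply, Pi.add_apply, hx j i hj, hy j i hj, add_zero]
  zero_mem' _ _ _ := rfl
  smul_mem' r x hx j i hj := by rw [Pi.smul_apply, Pi.smul_apply, hx j i hj, smul_zero]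

/-- The operators that raise weights by at least `k`. -/
def raising (M : Type*) [AddCommGroup M] [Module ℝ M] (w : J → I → ℕ) (k : ℕ) :
    Submodule ℝ (Module.End ℝ (J → I → M)) where
  carrier := {P | ∀ l, ∀ x ∈ filt w l, P x ∈ filt w (l + k)}
  add_mem' hP hQ l x hx := add_mem (hP l x hx) (hQ l x hx)
  zero_mem' _ _ _ := zero_mem _
  smul_mem' r P hP l x hx := (filt w _).smul_mem r (hP l x hx)

/-- Multiplication by the weight. -/
noncomputable def euler (M : Type*) [AddCommGroup M] [Module ℝ M] (w : J → I → ℕ) :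
    Module.End ℝ (J → I → M) where
  toFun x j i := (w j i : ℝ) • x j i
  map_add' x y := by funext j i; simp
  map_smul' r x := by funext j i; exact smul_comm _ _ _

variable {w : J → I → ℕ}

theorem euler_apply (x : J → I → M) (j : J) (i : I) : euler M w x j i = (w j i : ℝ) • x j i := rfl

theorem filt_anti {l l' : ℕ} (h : l ≤ l') : filt (M := M) w l' ≤ filt w l :=
  fun _ hx j i hj => hx j i (hj.trans_le h)

theorem raising_anti {k k' : ℕ} (h : k ≤ k') : raising M w k' ≤ raising M w k :=
  fun _ hP l x hx => filt_anti (by omega) (hP l x hx)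

theorem raising_mul {k k' : ℕ} {P Q : Module.End ℝ (J → I → M)} (hP : P ∈ raising M w k)
    (hQ : Q ∈ raising M w k') : P * Q ∈ raising M w (k + k') := by
  intro l x hx
  have := hP _ _ (hQ l x hx)
  rwa [add_assoc, add_comm k'] at this

theorem one_mem_raising : (1 : Module.End ℝ (J → I → M)) ∈ raising M w 0 := fun _ _ hx => hx

theorem pow_mem_raising {P : Module.End ℝ (J → I → M)} (hP : P ∈ raising M w 1) (j : ℕ) :
    P ^ j ∈ raising M w j := by
  induction j with
  | zero => exact one_mem_raising
  | succ j ih => rw [pow_succ]; exact raising_mul ih hP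

theorem raising_eq_zero {N : ℕ} (hw : ∀ j i, w j i ≤ N) {P : Module.End ℝ (J → I → M)}
    (hP : P ∈ raising M w (N + 1)) : P = 0 := by
  ext x j i
  exact hP 0 x (fun j i hj => absurd hj (Nat.not_lt_zero _)) j i (by have := hw j i; omega)

theorem pow_eq_zero_of_raising {N : ℕ} (hw : ∀ j i, w j i ≤ N) {P : Module.End ℝ (J → I → M)}
    (hP : P ∈ raising M w 1) : P ^ (N + 1) = 0 := raising_eq_zero hw (pow_mem_raising hP _)

theorem nexp_sub_one_mem {N : ℕ} {P : Module.End ℝ (J → I → M)}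
    (hP : P ∈ raising M w 1) : nexp N P - 1 ∈ raising M w 1 := by
  rw [nexp, Finset.sum_range_succ']
  simp only [pow_zero, Nat.factorial_zero, Nat.cast_one, inv_one, one_smul, add_sub_cancel_right]
  exact Submodule.sum_mem _ fun j _ => Submodule.smul_mem _ _
    (raising_anti (by omega) (pow_mem_raising hP (j + 1)))

/-- In the expansion of exp(Y + Z) − exp(Y) every term contains Z. Apart from Z itself, each
contains a further factor Y or Z, which raises the weight by at least one more. -/
theorem nexp_add_sub_mem {N k : ℕ} (hk : 1 ≤ k) (hN : 1 ≤ N) {Y Z : Module.End ℝ (J → I → M)}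
    (hY : Y ∈ raising M w 1) (hZ : Z ∈ raising M w k) :
    nexp N (Y + Z) - nexp N Y - Z ∈ raising M w (k + 1) := by
  have hYZ : Y + Z ∈ raising M w 1 := add_mem hY (raising_anti hk hZ)
  have h0 : ∀ j, (Y + Z) ^ j - Y ^ j ∈ raising M w k := by
    intro j
    induction j with
    | zero => simp
    | succ j ih =>
      have e : (Y + Z) ^ (j + 1) - Y ^ (j + 1) = (Y + Z) * ((Y + Z) ^ j - Y ^ j) + Z * Y ^ j := by
        rw [pow_succ', pow_succ', mul_sub, add_mul Y Z (Y ^ j)]; abel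
      rw [e]
      refine add_mem (raising_anti (by omega) (raising_mul hYZ ih))
        (raising_anti (by omega) (raising_mul hZ (pow_mem_raising hY j)))
  have h1 : ∀ j, (Y + Z) ^ (j + 2) - Y ^ (j + 2) ∈ raising M w (k + 1) := by
    intro j
    have e : (Y + Z) ^ (j + 2) - Y ^ (j + 2)
        = (Y + Z) * ((Y + Z) ^ (j + 1) - Y ^ (j + 1)) + Z * Y ^ (j + 1) := by
      rw [pow_succ' _ (j + 1), pow_succ' _ (j + 1), mul_sub, add_mul Y Z (Y ^ (j + 1))]; abel
    rw [e]
    exact add_mem (raising_anti (by omega) (raising_mul hYZ (h0 _)))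
      (raising_anti (by omega) (raising_mul hZ (pow_mem_raising hY (j + 1))))
  obtain ⟨N, rfl⟩ := Nat.exists_eq_add_of_le' hN
  have e : nexp (N + 1) (Y + Z) - nexp (N + 1) Y - Z
      = ∑ j ∈ Finset.range N, ((j + 2).factorial : ℝ)⁻¹ • ((Y + Z) ^ (j + 2) - Y ^ (j + 2)) := by
    rw [nexp, nexp, ← Finset.sum_sub_distrib, Finset.sum_range_succ', Finset.sum_range_succ']
    simp [smul_sub]
  rw [e]
  exact Submodule.sum_mem _ fun j _ => Submodule.smul_mem _ _ (h1 j)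

/-- The component of a given weight. -/
def weightPart (w : J → I → ℕ) (l : ℕ) (x : J → I → M) : J → I → M := fun j i => if w j i = l then x j i else 0

/-- On the part of U from weight l to weight l', the commutator with multiplication by the weight is
multiplication by l' − l. This is nonzero because U strictly raises weights, so vanishing of the
commutator on such a part implies vanishing of U. -/
theorem mem_raising_of_euler {N k : ℕ} (hw : ∀ j i, w j i ≤ N) {U : Module.End ℝ (J → I → M)}
    (hU : U ∈ raising M w 1) (h : euler M w * U - U * euler M w ∈ raising M w (k + 1)) :
    U ∈ raising M w (k + 1) := by
  have h1 : ∀ l x, U (weightPart w l x) ∈ filt w (l + (k + 1)) := by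
    intro l x j i hj
    have hp : weightPart w l x ∈ filt w l := fun j i hj => if_neg hj.ne
    have h2 := h l _ hp j i hj
    have h3 : euler M w (weightPart w l x) = (l : ℝ) • weightPart w l x := by
      funext j i
      rw [euler_apply, Pi.smul_apply, Pi.smul_apply, weightPart]
      split_ifs with h
      · rw [h]
      · simp
    rw [LinearMap.sub_apply, Module.End.mul_apply, Module.End.mul_apply, h3, map_smul,
      Pi.sub_apply, Pi.sub_apply, euler_apply, Pi.smul_apply, Pi.smul_apply, ← sub_smul] at h2
    -- Target weights at most l are covered by U raising weights; for larger ones the factor w − l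
    -- is invertible.
    by_cases hl : w j i < l + 1
    · exact hU l _ hp j i hl
    · have : (w j i : ℝ) - l ≠ 0 := by
        have : (l : ℝ) < w j i := by exact_mod_cast (by omega : l < w j i)
        linarith
      exact (smul_eq_zero.1 h2).resolve_left this
  intro l x hx
  have h2 : x = ∑ l' ∈ Finset.range (N + 1), weightPart w l' x := by
    funext j i
    rw [Finset.sum_apply, Finset.sum_apply]
    simp only [weightPart]
    rw [Finset.sum_ite_eq, if_pos (Finset.mem_range.2 (Nat.lt_succ_of_le (hw j i)))]
  rw [h2, map_sum]
  refine Submodule.sum_mem _ fun l' _ => ?_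
  by_cases hl : l ≤ l'
  · exact filt_anti (by omega) (h1 l' x)
  · have : weightPart w l' x = 0 := by
      funext j i
      rw [weightPart]
      split_ifs with h
      · exact hx j i (by omega)
      · rfl
    rw [this, map_zero]
    exact zero_mem _

end Group

/-! ### Characterization of exponentials by the Euler operator -/

section NilpotentAction

variable {J I M : Type*} [AddCommGroup M] [Module ℝ M]

theorem nexp_zero {X : Type*} [AddCommGroup X] [Module ℝ X] (N : ℕ) :
    nexp N (0 : Module.End ℝ X) = 1 := by
  rw [nexp, Finset.sum_eq_single 0]
  · simp
  · intro j _ hj; simp [hj]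
  · simp

theorem nexp_mul_nexp_neg {X : Type*} [AddCommGroup X] [Module ℝ X] {N : ℕ} {A : Module.End ℝ X}
    (hA : A ^ (N + 1) = 0) : nexp N A * nexp N (-A) = 1 := by
  have h : (-A) ^ (N + 1) = 0 := by rw [neg_pow, hA, mul_zero]
  simpa using nexp_neg_mul_nexp h

theorem nexp_apply_mem {X : Type*} [AddCommGroup X] [Module ℝ X] {N : ℕ} {A : Module.End ℝ X}
    {X' : Submodule ℝ X} (h : ∀ x ∈ X', A x ∈ X') {x : X} (hx : x ∈ X') : nexp N A x ∈ X' := by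
  rw [nexp_apply]
  refine Submodule.sum_mem _ fun j hj => Submodule.smul_mem _ _ ?_
  clear hj
  induction j with
  | zero => simpa using hx
  | succ j ih => rw [pow_succ', Module.End.mul_apply]; exact h _ ih

/-- A Lie algebra `n` of elements that act by raising the weight, which is compatible with the
weights. -/
structure NilpotentAction (w : J → I → ℕ) (N : ℕ) (n : Submodule ℝ (J → I → M))
    (br : (J → I → M) →ₗ[ℝ] (J → I → M) →ₗ[ℝ] (J → I → M)) : Prop where
  pos : 1 ≤ N
  le : ∀ j i, w j i ≤ N
  raise : ∀ a ∈ n, br a ∈ raising M w 1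
  mem : ∀ a ∈ n, ∀ x ∈ n, br a x ∈ n
  leibniz : ∀ a ∈ n, ∀ x ∈ n, ∀ y, br a (br x y) = br (br a x) y + br x (br a y)
  euler_mem : ∀ a ∈ n, euler M w a ∈ n
  euler_surj : ∀ a ∈ n, ∃ c ∈ n, euler M w c = a
  euler_br : ∀ a ∈ n, ∀ y, euler M w (br a y) = br (euler M w a) y + br a (euler M w y)

/-- The properties that characterize the exponentials of elements of `n`. -/
structure IsExpLike (w : J → I → ℕ) (n : Submodule ℝ (J → I → M))
    (br : (J → I → M) →ₗ[ℝ] (J → I → M) →ₗ[ℝ] (J → I → M)) (P : Module.End ℝ (J → I → M)) :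
    Prop where
  sub_one : P - 1 ∈ raising M w 1
  map_mem : ∀ x ∈ n, P x ∈ n
  map_br : ∀ x ∈ n, ∀ y, P (br x y) = br (P x) (P y)
  euler : ∃ c ∈ n, P * euler M w = euler M w * P - br c * P

variable {w : J → I → ℕ} {N : ℕ} {n : Submodule ℝ (J → I → M)}
  {br : (J → I → M) →ₗ[ℝ] (J → I → M) →ₗ[ℝ] (J → I → M)}

/-- For the Euler relation, P ad(d) = ad(P d) P since P is an automorphism; so the element belonging
to the product is c + P d. -/
theorem IsExpLike.mul {P Q : Module.End ℝ (J → I → M)} (hP : IsExpLike w n br P)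
    (hQ : IsExpLike w n br Q) : IsExpLike w n br (P * Q) := by
  refine ⟨?_, fun x hx => hP.map_mem _ (hQ.map_mem _ hx), fun x hx y => ?_, ?_⟩
  · have e : P * Q - 1 = (P - 1) * (Q - 1) + (P - 1) + (Q - 1) := by
      rw [sub_mul, mul_sub, mul_one, one_mul]; abel
    rw [e]
    exact add_mem (add_mem (raising_anti (by omega) (raising_mul hP.sub_one hQ.sub_one))
      hP.sub_one) hQ.sub_one
  · rw [Module.End.mul_apply, hQ.map_br x hx, hP.map_br _ (hQ.map_mem x hx)]
    rfl
  · obtain ⟨c, hc, h1⟩ := hP.euler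
    obtain ⟨d, hd, h2⟩ := hQ.euler
    refine ⟨c + P d, add_mem hc (hP.map_mem d hd), ?_⟩
    have h3 : P * br d = br (P d) * P := LinearMap.ext fun y => hP.map_br d hd y
    rw [mul_assoc, h2, mul_sub, ← mul_assoc, h1, ← mul_assoc P, h3, map_add]
    simp only [sub_mul, add_mul, mul_assoc]
    abel

namespace NilpotentAction

variable (h : NilpotentAction w N n br)
include h

theorem pow_eq_zero {a : J → I → M} (ha : a ∈ n) : br a ^ (N + 1) = 0 :=
  pow_eq_zero_of_raising h.le (h.raise a ha)

/-- The Euler relation is the statement that exp(ad a) conjugates E to E plus ad of an element of n.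
To obtain it from compatibility with products, the space is enlarged by one dimension for E, with
[a, E] = −E a, and (x, s) acts as ad x + sE. -/
theorem isExpLike_nexp {a : J → I → M} (ha : a ∈ n) : IsExpLike w n br (nexp N (br a)) := by
  have hA := h.pow_eq_zero ha
  refine ⟨nexp_sub_one_mem (h.raise a ha), fun x hx => nexp_apply_mem (h.mem a ha) hx,
    fun x hx y => nexp_leibniz hA hA hA br (h.mem a ha) (Y' := ⊤) (by simp)
      (fun x hx y _ => h.leibniz a ha x hx y) hx trivial, ?_⟩
  let A' : Module.End ℝ ((J → I → M) × ℝ) :=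
    { toFun := fun q => (br a q.1 - q.2 • euler M w a, 0)
      map_add' := fun q r => by ext1 <;> simp [add_smul]; abel
      map_smul' := fun s q => by ext1 <;> simp [smul_sub, mul_smul] }
  let f : ((J → I → M) × ℝ) →ₗ[ℝ] (J → I → M) →ₗ[ℝ] (J → I → M) :=
    { toFun := fun q => br q.1 + q.2 • euler M w
      map_add' := fun q r => by simp [add_smul]; abel
      map_smul' := fun s q => by simp [mul_smul] }
  -- One extra power is needed: the first application moves the new direction into the original
  -- space, where the old bound applies.
  have hA' : A' ^ (N + 1 + 1) = 0 := by
    have : ∀ j q, (A' ^ (j + 1)) q = ((br a ^ j) (br a q.1 - q.2 • euler M w a), 0) := by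
      intro j q
      induction j with
      | zero => simp [A']
      | succ j ih =>
        rw [pow_succ', Module.End.mul_apply, ih, pow_succ' (br a), Module.End.mul_apply]
        simp [A']
    refine LinearMap.ext fun q => ?_
    rw [this, hA]
    rfl
  have hA2 : br a ^ (N + 1 + 1) = 0 := pow_eq_zero_of_le (by omega) hA
  have key := fun y => nexp_leibniz (N := N + 1) hA' hA2 hA2 f (X' := n.prod ⊤)
    (fun q hq => ⟨sub_mem (h.mem a ha _ hq.1) (n.smul_mem _ (h.euler_mem a ha)), trivial⟩)
    (Y' := ⊤) (by simp) (fun q hq y _ => by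
      simp only [f, A', LinearMap.coe_mk, AddHom.coe_mk, LinearMap.add_apply, LinearMap.smul_apply,
        map_add, map_smul, map_sub, LinearMap.sub_apply, zero_smul, add_zero]
      rw [h.leibniz a ha _ hq.1, h.euler_br a ha, smul_add]
      abel) (x := (0, 1)) ⟨zero_mem _, trivial⟩ (y := y) trivial
  have hc : nexp (N + 1) A' (0, 1) - (0, 1) ∈ n.prod ⊥ := by
    rw [nexp_apply, Finset.sum_range_succ']
    simp only [pow_zero, Nat.factorial_zero, Nat.cast_one, inv_one, one_smul, Module.End.one_apply,
      add_sub_cancel_right]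
    refine Submodule.sum_mem _ fun j hj => Submodule.smul_mem _ _ ?_
    clear hj
    induction j with
    | zero =>
      simp only [zero_add, pow_one, A', LinearMap.coe_mk, AddHom.coe_mk]
      exact ⟨sub_mem (h.mem a ha _ (zero_mem _)) (n.smul_mem _ (h.euler_mem a ha)), rfl⟩
    | succ j ih =>
      rw [pow_succ', Module.End.mul_apply]
      exact ⟨sub_mem (h.mem a ha _ ih.1) (n.smul_mem _ (h.euler_mem a ha)), rfl⟩
  refine ⟨-(nexp (N + 1) A' (0, 1)).1, neg_mem (by simpa using hc.1), ?_⟩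
  have h2 : (nexp (N + 1) A' (0, 1)).2 = 1 := by
    have := hc.2
    simpa [sub_eq_zero] using this
  ext1 y
  have h3 := key y
  rw [nexp_eq_of_le hA (by omega : N ≤ N + 1)] at h3
  simp only [f, LinearMap.coe_mk, AddHom.coe_mk, map_zero, zero_add, one_smul, h2,
    LinearMap.add_apply] at h3
  rw [Module.End.mul_apply, h3, map_neg, LinearMap.sub_apply, neg_mul (br _) (nexp N (br a)),
    LinearMap.neg_apply, sub_neg_eq_add, add_comm]
  rfl

/-- Suppose Q = exp(−ad y) P is 1 up to weight shift k. With c = E c', the Euler relation gives [E,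
Q − 1 − ad c'] = ad(c)(Q − 1), which raises weights by at least k + 2. Hence Q agrees with 1 + ad c'
one step further, and y is corrected by c'. -/
theorem exists_approx {P : Module.End ℝ (J → I → M)} (hP : IsExpLike w n br P) (k : ℕ) :
    ∃ y ∈ n, nexp N (br (-y)) * P - 1 ∈ raising M w (k + 1) := by
  induction k with
  | zero => exact ⟨0, zero_mem _, by simpa [nexp_zero] using hP.sub_one⟩
  | succ k ih =>
    obtain ⟨y, hy, hT⟩ := ih
    have hQ := (h.isExpLike_nexp (neg_mem hy)).mul hP
    set Q := nexp N (br (-y)) * P with hQdef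
    obtain ⟨c, hc, hcQ⟩ := hQ.euler
    obtain ⟨c', hc', rfl⟩ := h.euler_surj c hc
    have h1 : euler M w * br c' - br c' * euler M w = br (euler M w c') := by
      ext1 z
      rw [LinearMap.sub_apply, Module.End.mul_apply, Module.End.mul_apply, h.euler_br c' hc',
        add_sub_cancel_right]
    have h2 : euler M w * (Q - 1 - br c') - (Q - 1 - br c') * euler M w
        = br (euler M w c') * (Q - 1) := by
      have : euler M w * (Q - 1 - br c') - (Q - 1 - br c') * euler M w
        = euler M w * Q - Q * euler M w - (euler M w * br c' - br c' * euler M w) := by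
        simp only [mul_sub, sub_mul, mul_one, one_mul]; abel
      rw [this, h1, hcQ, mul_sub, mul_one]
      abel
    have hU : Q - 1 - br c' ∈ raising M w (k + 1 + 1) := by
      refine mem_raising_of_euler h.le
        (sub_mem (raising_anti (by omega) hT) (h.raise c' hc')) ?_
      rw [h2]
      exact raising_anti (by omega) (raising_mul (h.raise _ hc) hT)
    have hZ : br c' ∈ raising M w (k + 1) := by
      have := sub_mem hT (raising_anti (by omega : k + 1 ≤ k + 1 + 1) hU)
      simpa using this
    refine ⟨y + c', add_mem hy hc', ?_⟩
    have hR := nexp_add_sub_mem (by omega : 1 ≤ k + 1) h.pos (h.raise _ (neg_mem hy))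
      (neg_mem hZ : - br c' ∈ _)
    rw [← map_neg, ← map_add, ← neg_add] at hR
    -- Each of the three terms raises weights by at least k + 2: the error of linearizing the
    -- exponential, the error of Q, and a product of shifts k + 1 and 1.
    have e : nexp N (br (-(y + c'))) * P - 1 =
        (nexp N (br (-(y + c'))) - nexp N (br (-y)) - br (-c')) * P
          + (Q - 1 - br c') - br c' * (P - 1) := by
      rw [hQdef, map_neg br c']
      rw [sub_mul, sub_mul, neg_mul (br c') P, mul_sub, mul_one]
      abel
    rw [e]
    have hP0 : P ∈ raising M w 0 := by
      have := add_mem (raising_anti (Nat.zero_le 1) hP.sub_one) one_mem_raising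
      simpa using this
    exact sub_mem (add_mem (by simpa using raising_mul hR hP0) hU) (raising_mul hZ hP.sub_one)

/-- Weights are at most N, so an approximation up to a shift of N + 1 is exact. -/
theorem exists_nexp_eq {P : Module.End ℝ (J → I → M)} (hP : IsExpLike w n br P) :
    ∃ y ∈ n, P = nexp N (br y) := by
  obtain ⟨y, hy, hT⟩ := h.exists_approx hP N
  refine ⟨y, hy, ?_⟩
  have h1 := raising_eq_zero h.le hT
  rw [sub_eq_zero, map_neg] at h1
  rw [← one_mul P, ← nexp_mul_nexp_neg (h.pow_eq_zero hy), mul_assoc, h1, mul_one]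

/-- The exponential of `br a`, as a permutation. -/
theorem exists_perm {a : J → I → M} (ha : a ∈ n) :
    ∃ g : Equiv.Perm (J → I → M), ⇑g = nexp N (br a) ∧ ⇑g⁻¹ = nexp N (br (-a)) := by
  have h1 := nexp_neg_mul_nexp (h.pow_eq_zero ha)
  have h2 := nexp_mul_nexp_neg (h.pow_eq_zero ha)
  rw [← map_neg] at h1 h2
  exact ⟨⟨nexp N (br a), nexp N (br (-a)), fun x => LinearMap.congr_fun h1 x,
    fun x => LinearMap.congr_fun h2 x⟩, rfl, rfl⟩

/-- The exponentials of elements of `n` are a group. -/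
theorem exists_group : ∃ G : Subgroup (Equiv.Perm (J → I → M)),
    ∀ g, g ∈ G ↔ ∃ a ∈ n, ⇑g = nexp N (br a) := by
  refine ⟨⟨⟨⟨{g | ∃ a ∈ n, ⇑g = nexp N (br a)}, ?_⟩, ?_⟩, ?_⟩, fun g => Iff.rfl⟩
  · rintro g g' ⟨a, ha, hg⟩ ⟨a', ha', hg'⟩
    obtain ⟨y, hy, h1⟩ := h.exists_nexp_eq ((h.isExpLike_nexp ha).mul (h.isExpLike_nexp ha'))
    refine ⟨y, hy, ?_⟩
    rw [Equiv.Perm.coe_mul, hg, hg', ← h1]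
    rfl
  · exact ⟨0, zero_mem _, by rw [map_zero, nexp_zero]; rfl⟩
  · rintro g ⟨a, ha, hg⟩
    obtain ⟨g', h1, h2⟩ := h.exists_perm ha
    have : g = g' := DFunLike.coe_injective (hg.trans h1.symm)
    exact ⟨-a, neg_mem ha, by rw [this, h2]⟩

end NilpotentAction

end NilpotentAction

section
variable {R : Type*} [CommRing R] [Algebra ℝ R]

/-! ## Homological degree and weight of the bracket -/

theorem isHomological_smul_am {c : ℕ} (hc : c < 128 ∧ c % 64 < 56) (μ : Fin 4) (f : R) {d : ℕ}
    (h : hdegM c = d) : IsHomological d (f • am R μ c) := by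
  intro b hb
  rw [Pi.smul_apply, am, Pi.single_apply, if_neg, smul_zero]
  rintro rfl
  exact hb (by rw [← hdegM_eq μ ⟨c, hc.1⟩ hc.2, ← h])

theorem IsHomological.add {d : ℕ} {x y : A R} (hx : IsHomological d x) (hy : IsHomological d y) :
    IsHomological d (x + y) := fun b hb => by rw [Pi.add_apply, hx b hb, hy b hb, add_zero]

theorem IsHomological.smul {S : Type*} [SMulZeroClass S R] {d : ℕ} {x : A R}
    (hx : IsHomological d x) (r : S) : IsHomological d (r • x) :=
  fun b hb => by rw [Pi.smul_apply, hx b hb, smul_zero]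

theorem isHomological_zero {d : ℕ} : IsHomological d (0 : A R) := fun _ _ => rfl

theorem IsHomological.sum {ι : Type*} {d : ℕ} {s : Finset ι} {x : ι → A R}
    (hx : ∀ i ∈ s, IsHomological d (x i)) : IsHomological d (∑ i ∈ s, x i) :=
  Finset.sum_induction _ _ (fun _ _ => IsHomological.add) isHomological_zero hx

theorem isHomological_ae {c : ℕ} (hc : c < 128 ∧ c % 64 < 56) (u : Fin 4 → R) {d : ℕ}
    (h : hdegM c = d) : IsHomological d (ae u c) :=
  IsHomological.sum fun μ _ => isHomological_smul_am hc μ (u μ) h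

theorem isHomological_eval {v : ℕ → A R} {d : ℕ} {l : Comb}
    (h : ∀ p ∈ l, IsHomological d (v p.2)) : IsHomological d (l.eval v) := by
  induction l with
  | nil => exact isHomological_zero
  | cons p l ih =>
    rw [Comb.eval_cons]
    exact ((h p (by simp)).smul _).add (ih fun q hq => h q (by simp [hq]))

theorem vecCodes_lt {s : ℕ} (hs : s ∈ vecCodes) : s < 128 ∧ s % 64 < 56 := (eltM_vec s hs).2.2

theorem isHomological_eval_am {d : ℕ} {l : Comb} (h : ∀ p ∈ l, p.2 ∈ scalarCodes ∧ hdegM p.2 = d) :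
    IsHomological d (l.eval (am R 0)) := isHomological_eval fun p hp => by
  simpa using isHomological_smul_am (mod_lt_of_scalar (h p hp).1) 0 (1 : R) (h p hp).2

theorem isHomological_eval_ae {d : ℕ} {l : Comb} (h : ∀ p ∈ l, p.2 ∈ vecCodes ∧ hdegM p.2 = d)
    (u : Fin 4 → R) : IsHomological d (l.eval (ae u)) := isHomological_eval fun p hp =>
  isHomological_ae (vecCodes_lt (h p hp).1) u (h p hp).2

theorem isHomological_aBr (F : FrameData R) {i j : ℕ} (hij : i = 0 ∨ i = 1 ∧ j = 1) {x y : A R}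
    (hx : IsHomological i x) (hy : IsHomological j y) : IsHomological (i + j) (aBr F x y) := by
  have hok : ∀ k l, hdegM k = i → hdegM l = j → okPair k l = true := by
    intro k l hk hl
    rcases hij with rfl | ⟨rfl, rfl⟩
    · exact okPair_zero hk l
    · simp [okPair, hk, hl]
  refine A_induction (H := (· = i)) (P := fun x => IsHomological (i + j) (aBr F x y)) ?_ ?_ ?_ ?_ x hx
  · rw [← aBrₗ_apply, map_zero]; exact isHomological_zero
  · intro x x' h h'
    rw [← aBrₗ_apply, map_add]; exact h.add h'
  · intro c hc hci f
    refine A_induction (H := (· = j)) (P := fun y => IsHomological (i + j) (aBr F _ y))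
      ?_ ?_ ?_ ?_ y hy
    · rw [← aBrₗ_apply, map_zero]; exact isHomological_zero
    · intro x x' h h'
      rw [← aBrₗ_apply, map_add]; exact h.add h'
    · intro e he hej g
      have c1 := inCodes_spec (allOk_spec nbM_codes hc he (hok c e hci hej))
      rw [hci, hej] at c1
      rw [aBr_am_am F 0 hc he (hok c e hci hej)]
      exact ((isHomological_eval_am c1).smul _).smul _
    · intro s hs hsj u
      have c1 := inCodes_spec (allOk_spec nbM_codes_right hc hs (hok c s hci hsj))
      have c2 := inCodes_spec (allOk_spec rmM_codes hc hs (hok c s hci hsj))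
      rw [hci, hsj] at c1 c2
      rw [aBr_am_ae F 0 hs hc]
      exact ((isHomological_eval_ae c1 _).add ((isHomological_eval_am c2).smul _)).smul _
  · intro s hs hsi u
    refine A_induction (H := (· = j)) (P := fun y => IsHomological (i + j) (aBr F _ y))
      ?_ ?_ ?_ ?_ y hy
    · rw [← aBrₗ_apply, map_zero]; exact isHomological_zero
    · intro x x' h h'
      rw [← aBrₗ_apply, map_add]; exact h.add h'
    · intro e he hej g
      have c1 := inCodes_spec (allOk_spec nbM_codes_left hs he (hok s e hsi hej))
      have c2 := inCodes_spec (allOk_spec smM_codes hs he (hok s e hsi hej))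
      rw [hsi, hej] at c1 c2
      rw [aBr_ae_am F 0 hs he]
      exact ((isHomological_eval_ae c1 _).add ((isHomological_eval_am c2).smul _)).smul _
    · intro t ht htj w
      have c1 := inCodes_spec (allOk_spec mlM_codes hs ht (hok s t hsi htj))
      rw [hsi, htj] at c1
      rw [aBr_ae_ae F hs ht]
      exact (isHomological_eval_ae c1 _).smul _

/-- The sum of the components of the `ℕ³`-degree. -/
def Idx.weight (b : Idx) : ℕ := ∑ i, b.deg i

theorem weight_eq_zero_iff {b : Idx} : b.weight = 0 ↔ b.deg = 0 := by
  rw [Idx.weight, Finset.sum_eq_zero_iff]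
  exact ⟨fun h => funext fun i => h i (Finset.mem_univ i), fun h i _ => congrFun h i⟩

theorem weight_le : ∀ b : Idx, b.weight ≤ 6 := by decide +kernel

theorem weight_split {b : Idx} {α : Fin 3 → ℕ} (hα : α ≤ b.deg) :
    ∑ i, α i + ∑ i, (b.deg - α) i = b.weight := by
  rw [Idx.weight, ← Finset.sum_add_distrib]
  exact Finset.sum_congr rfl fun i _ => Nat.add_sub_of_le (hα i)

theorem degPart_eq_zero {x : A R} {l : ℕ} (hx : ∀ b : Idx, b.weight < l → x b = 0)
    {α : Fin 3 → ℕ} (hα : ∑ i, α i < l) : degPart α x = 0 := by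
  funext b
  rw [degPart_apply]
  split_ifs with h
  · exact hx b (by rw [Idx.weight, h]; exact hα)
  · rfl

theorem aBr_weight (F : FrameData R) {x y : A R} {l l' : ℕ}
    (hx : ∀ b : Idx, b.weight < l → x b = 0) (hy : ∀ b : Idx, b.weight < l' → y b = 0)
    {b : Idx} (hb : b.weight < l + l') : aBr F x y b = 0 := by
  rw [aBr_apply]
  refine Finset.sum_eq_zero fun α hα => ?_
  have h := weight_split (Finset.mem_Iic.1 hα)
  by_cases h1 : ∑ i, α i < l
  · rw [degPart_eq_zero hx h1]
    simp
  · rw [degPart_eq_zero (α := b.deg - α) hy (by omega)]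
    simp only [map_zero, smul_zero, Pi.zero_apply]

/-- Multiplication by the weight. -/
noncomputable def eulerA (x : A R) : A R := fun b => (b.weight : ℝ) • x b

theorem degPart_eulerA (α : Fin 3 → ℕ) (x : A R) :
    degPart α (eulerA x) = ((∑ i, α i : ℕ) : ℝ) • degPart α x := by
  funext b
  rw [Pi.smul_apply, degPart_apply, degPart_apply, eulerA]
  split_ifs with h
  · rw [Idx.weight, h]
  · rw [smul_zero]

/-- The bracket of 𝓐 respects the ℕ³-grading, so weights add: multiplication by the weight is a
derivation. -/
theorem eulerA_aBr (F : FrameData R) (x y : A R) (b : Idx) :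
    (b.weight : ℝ) • aBr F x y b = aBr F (eulerA x) y b + aBr F x (eulerA y) b := by
  rw [aBr_apply, aBr_apply, aBr_apply, Finset.smul_sum, ← Finset.sum_add_distrib]
  refine Finset.sum_congr rfl fun α hα => ?_
  rw [degPart_eulerA, degPart_eulerA, ← weight_split (Finset.mem_Iic.1 hα)]
  simp only [LinearMap.map_smul_of_tower, LinearMap.smul_apply, Pi.smul_apply]
  push_cast
  module

/-! ## The bracket of power series -/

variable {m n : ℕ}

theorem coeff_of_le (x : Ser R m n) {k : Fin m →₀ ℕ} (hk : k.degree ≤ n) :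
    x.coeff k = x ⟨k, hk⟩ := dif_pos hk

theorem coeff_val (x : Ser R m n) (k : {k : Fin m →₀ ℕ // k.degree ≤ n}) : x.coeff k.1 = x k :=
  coeff_of_le x k.2

theorem coeff_add (x y : Ser R m n) (k : Fin m →₀ ℕ) :
    (x + y).coeff k = x.coeff k + y.coeff k := by
  simp only [Ser.coeff]; split_ifs <;> simp

theorem coeff_smul (r : ℝ) (x : Ser R m n) (k : Fin m →₀ ℕ) :
    (r • x).coeff k = r • x.coeff k := by
  simp only [Ser.coeff]; split_ifs <;> simp

/-- The bracket of power series as a bilinear map. -/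
noncomputable def serBrₗ (F : FrameData R) (m n : ℕ) :
    Ser R m n →ₗ[ℝ] Ser R m n →ₗ[ℝ] Ser R m n :=
  LinearMap.mk₂ ℝ (serBr F)
    (fun x x' y => by
      funext k
      simp only [serBr, coeff_add, ← aBrₗ_apply, map_add, LinearMap.add_apply, Pi.add_apply,
        Finset.sum_add_distrib])
    (fun r x y => by
      funext k
      simp only [serBr, coeff_smul, ← aBrₗ_apply, map_smul, LinearMap.smul_apply, Pi.smul_apply,
        Finset.smul_sum])
    (fun x y y' => by
      funext k
      simp only [serBr, coeff_add, ← aBrₗ_apply, map_add, Pi.add_apply, Finset.sum_add_distrib])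
    (fun r x y => by
      funext k
      simp only [serBr, coeff_smul, ← aBrₗ_apply, map_smul, Pi.smul_apply, Finset.smul_sum])

@[simp] theorem serBrₗ_apply (F : FrameData R) (x y : Ser R m n) :
    serBrₗ F m n x y = serBr F x y := rfl

/-- The weight of a coefficient of a power series. -/
noncomputable def serWeight (m n : ℕ) (k : {k : Fin m →₀ ℕ // k.degree ≤ n}) (b : Idx) : ℕ :=
  k.1.degree + b.weight

theorem coeff_filt {x : Ser R m n} {l : ℕ} (hx : x ∈ filt (serWeight m n) l) (k : Fin m →₀ ℕ)
    (b : Idx) (h : b.weight < l - k.degree) : x.coeff k b = 0 := by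
  rw [Ser.coeff]
  split_ifs with hk
  · exact hx ⟨k, hk⟩ b (show k.degree + b.weight < l by omega)
  · rfl

theorem degree_of_mem {k : Fin m →₀ ℕ} {q : (Fin m →₀ ℕ) × (Fin m →₀ ℕ)}
    (hq : q ∈ Finset.HasAntidiagonal.antidiagonal k) : q.1.degree + q.2.degree = k.degree := by
  rw [← Finset.HasAntidiagonal.mem_antidiagonal.1 hq, map_add]

theorem serBr_mem_filt (F : FrameData R) {x y : Ser R m n} {l l' : ℕ}
    (hx : x ∈ filt (serWeight m n) l) (hy : y ∈ filt (serWeight m n) l') :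
    serBr F x y ∈ filt (serWeight m n) (l + l') := by
  intro k b hb
  rw [serBr, Finset.sum_apply]
  refine Finset.sum_eq_zero fun q hq => ?_
  have h := degree_of_mem hq
  have hb' : k.1.degree + b.weight < l + l' := hb
  exact aBr_weight F (coeff_filt hx q.1) (coeff_filt hy q.2) (by omega)

theorem coeff_euler (x : Ser R m n) (k : Fin m →₀ ℕ) :
    Ser.coeff (n := n) (euler R (serWeight m n) x) k = (k.degree : ℝ) • x.coeff k + eulerA (x.coeff k) := by
  simp only [Ser.coeff]
  split_ifs with hk
  · funext b
    rw [euler_apply, serWeight]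
    simp only [Pi.add_apply, Pi.smul_apply, eulerA]
    push_cast
    rw [add_smul]
  · funext b
    simp [eulerA]

theorem euler_serBr (F : FrameData R) (x y : Ser R m n) :
    euler R (serWeight m n) (serBr F x y)
      = serBr F (euler R (serWeight m n) x) y + serBr F x (euler R (serWeight m n) y) := by
  funext k b
  simp only [euler_apply, serBr, coeff_euler, Finset.sum_apply, Pi.add_apply, Finset.smul_sum,
    ← Finset.sum_add_distrib]
  refine Finset.sum_congr rfl fun q hq => ?_
  have h1 := eulerA_aBr F (x.coeff q.1) (y.coeff q.2) b
  rw [serWeight, ← degree_of_mem hq]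
  simp only [← aBrₗ_apply, map_add, LinearMap.add_apply, map_smul, LinearMap.smul_apply,
    Pi.add_apply, Pi.smul_apply] at h1 ⊢
  push_cast
  rw [add_smul, h1, add_smul]
  abel

theorem sum_antidiagonal_assoc {B E : Type*} [AddCommMonoid B] [Finset.HasAntidiagonal B]
    [AddCommMonoid E] (k : B) (f : B → B → B → E) :
    ∑ q ∈ Finset.HasAntidiagonal.antidiagonal k,
      ∑ r ∈ Finset.HasAntidiagonal.antidiagonal q.2, f q.1 r.1 r.2
    = ∑ q ∈ Finset.HasAntidiagonal.antidiagonal k,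
      ∑ r ∈ Finset.HasAntidiagonal.antidiagonal q.1, f r.1 r.2 q.2 := by
  rw [Finset.sum_sigma', Finset.sum_sigma']
  refine Finset.sum_nbij' (fun s => ⟨(s.1.1 + s.2.1, s.2.2), (s.1.1, s.2.1)⟩)
    (fun s => ⟨(s.2.1, s.2.2 + s.1.2), (s.2.2, s.1.2)⟩) ?_ ?_ ?_ ?_ ?_
  all_goals
    rintro ⟨⟨a, b⟩, ⟨c, d⟩⟩ h
    simp only [Finset.mem_sigma, Finset.HasAntidiagonal.mem_antidiagonal] at h
    obtain ⟨h1, h2⟩ := h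
    subst h2
  · simp only [Finset.mem_sigma, Finset.HasAntidiagonal.mem_antidiagonal, and_true, ← h1, add_assoc]
  · simp only [Finset.mem_sigma, Finset.HasAntidiagonal.mem_antidiagonal, and_true, ← h1, add_assoc]
  · rfl
  · rfl
  · rfl

theorem sum_antidiagonal_swap {B E : Type*} [AddCommMonoid B] [Finset.HasAntidiagonal B]
    [AddCommMonoid E] (k : B) (f : B → B → B → E) :
    ∑ q ∈ Finset.HasAntidiagonal.antidiagonal k,
      ∑ r ∈ Finset.HasAntidiagonal.antidiagonal q.2, f q.1 r.1 r.2
    = ∑ q ∈ Finset.HasAntidiagonal.antidiagonal k,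
      ∑ r ∈ Finset.HasAntidiagonal.antidiagonal q.2, f r.1 q.1 r.2 := by
  rw [Finset.sum_sigma', Finset.sum_sigma']
  refine Finset.sum_nbij' (fun s => ⟨(s.2.1, s.1.1 + s.2.2), (s.1.1, s.2.2)⟩)
    (fun s => ⟨(s.2.1, s.1.1 + s.2.2), (s.1.1, s.2.2)⟩) ?_ ?_ ?_ ?_ ?_
  all_goals
    rintro ⟨⟨a, b⟩, ⟨c, d⟩⟩ h
    simp only [Finset.mem_sigma, Finset.HasAntidiagonal.mem_antidiagonal] at h
    obtain ⟨h1, h2⟩ := h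
    subst h2
  · simp only [Finset.mem_sigma, Finset.HasAntidiagonal.mem_antidiagonal, and_true, ← h1,
      add_left_comm]
  · simp only [Finset.mem_sigma, Finset.HasAntidiagonal.mem_antidiagonal, and_true, ← h1,
      add_left_comm]
  · rfl
  · rfl
  · rfl

theorem serBr_leibniz {F : FrameData R} {a x y : Ser R m n}
    (h : ∀ i j k, IsDerivOn F (a.coeff i) (x.coeff j) (y.coeff k)) :
    serBr F a (serBr F x y) = serBr F (serBr F a x) y + serBr F x (serBr F a y) := by
  have hc : ∀ (u v : Ser R m n) {k : Fin m →₀ ℕ}, k.degree ≤ n → (serBr F u v).coeff k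
      = ∑ q ∈ Finset.HasAntidiagonal.antidiagonal k, aBr F (u.coeff q.1) (v.coeff q.2) :=
    fun u v k hk => coeff_of_le _ hk
  funext k
  have hk := k.2
  rw [Pi.add_apply, serBr, serBr, serBr]
  have e1 : ∀ u v : Ser R m n, ∀ z : Ser R m n, 
      ∑ q ∈ Finset.HasAntidiagonal.antidiagonal k.1, aBr F (z.coeff q.1) ((serBr F u v).coeff q.2)
      = ∑ q ∈ Finset.HasAntidiagonal.antidiagonal k.1,
        ∑ r ∈ Finset.HasAntidiagonal.antidiagonal q.2,
          aBr F (z.coeff q.1) (aBr F (u.coeff r.1) (v.coeff r.2)) := by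
    intro u v z
    refine Finset.sum_congr rfl fun q hq => ?_
    rw [hc _ _ (by have := degree_of_mem hq; omega), ← aBrₗ_apply, map_sum]
    rfl
  have e2 : ∑ q ∈ Finset.HasAntidiagonal.antidiagonal k.1,
        aBr F ((serBr F a x).coeff q.1) (y.coeff q.2)
      = ∑ q ∈ Finset.HasAntidiagonal.antidiagonal k.1,
        ∑ r ∈ Finset.HasAntidiagonal.antidiagonal q.1,
          aBr F (aBr F (a.coeff r.1) (x.coeff r.2)) (y.coeff q.2) := by
    refine Finset.sum_congr rfl fun q hq => ?_
    rw [hc _ _ (by have := degree_of_mem hq; omega), ← aBrₗ_apply, map_sum, LinearMap.sum_apply]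
    rfl
  rw [e1, e2, e1, ← sum_antidiagonal_assoc k.1 (fun i j l =>
    aBr F (aBr F (a.coeff i) (x.coeff j)) (y.coeff l)), sum_antidiagonal_swap k.1 (fun i j l =>
    aBr F (x.coeff i) (aBr F (a.coeff j) (y.coeff l))), ← Finset.sum_add_distrib]
  refine Finset.sum_congr rfl fun q _ => ?_
  rw [← Finset.sum_add_distrib]
  exact Finset.sum_congr rfl fun r _ => h _ _ _

end

section
variable {R : Type*} [CommRing R] [Algebra ℝ R] {m n : ℕ}

/-! ## The group of gauge transformations -/

variable (R m n) in
/-- The power series with coefficients of a given homological degree. -/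
noncomputable def serHom (d : ℕ) : Submodule ℝ (Ser R m n) where
  carrier := {x | ∀ k, IsHomological d (x k)}
  add_mem' hx hy k := (hx k).add (hy k)
  zero_mem' _ := isHomological_zero
  smul_mem' r _ hx k := (hx k).smul r

theorem isHomological_coeff {d : ℕ} {x : Ser R m n} (hx : x ∈ serHom R m n d)
    (k : Fin m →₀ ℕ) : IsHomological d (x.coeff k) := by
  rw [Ser.coeff]
  split_ifs with h
  · exact hx _
  · exact isHomological_zero

theorem serBr_mem_serHom (F : FrameData R) {d : ℕ} {a x : Ser R m n} (ha : a ∈ serHom R m n 0)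
    (hx : x ∈ serHom R m n d) : serBr F a x ∈ serHom R m n d := by
  intro k
  have := IsHomological.sum (s := Finset.HasAntidiagonal.antidiagonal k.1) fun q _ =>
    isHomological_aBr F (.inl rfl) (isHomological_coeff ha q.1) (isHomological_coeff hx q.2)
  rwa [zero_add] at this

/-- Weight zero means order zero in t and ℕ³-degree zero; these are exactly the components excluded
from 𝓐[[t]]^×. -/
theorem isNil_iff {x : Ser R m n} : x.IsNil ↔ x ∈ filt (serWeight m n) 1 := by
  have h0 : (0 : Fin m →₀ ℕ).degree ≤ n := by simp
  constructor
  · intro h k b hb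
    have hb' : k.1.degree + b.weight < 1 := hb
    have hk : k = ⟨0, h0⟩ := Subtype.ext ((Finsupp.degree_eq_zero_iff _).1 (by omega))
    have := h b (weight_eq_zero_iff.1 (by omega))
    rwa [coeff_of_le x h0, ← hk] at this
  · intro h b hb
    rw [coeff_of_le x h0]
    refine h _ b ?_
    rw [serWeight, weight_eq_zero_iff.2 hb]
    simp

variable (R m n) in
/-- The gauge parameters. -/
noncomputable def gaugeParameters : Submodule ℝ (Ser R m n) :=
  serHom R m n 0 ⊓ filt (serWeight m n) 1

theorem mem_gaugeParameters {a : Ser R m n} :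
    a ∈ gaugeParameters R m n ↔ a.IsGaugeParameter := and_congr Iff.rfl isNil_iff.symm

/-- The bound n + 6 is the maximal order in t plus the sum of the largest degree 222. -/
theorem nilpotentAction {F : FrameData R} (hF : F.IsFrame) (m n : ℕ) :
    NilpotentAction (serWeight m n) (n + 6) (gaugeParameters R m n) (serBrₗ F m n) where
  pos := by omega
  le k b := add_le_add k.2 (weight_le b)
  raise a ha l x hx := by
    rw [add_comm]
    exact serBr_mem_filt F ha.2 hx
  mem a ha x hx := ⟨serBr_mem_serHom F ha.1 hx.1,
    filt_anti (by omega) (serBr_mem_filt F ha.2 hx.2)⟩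
  leibniz a ha x hx y := serBr_leibniz fun i j _ =>
    isDerivOn hF (isHomological_coeff ha.1 i) (.inl (isHomological_coeff hx.1 j))
  euler_mem a ha := ⟨fun k b hb => by rw [euler_apply, ha.1 k b hb, smul_zero],
    fun k b hb => by rw [euler_apply, ha.2 k b hb, smul_zero]⟩
  -- Division by the weight is possible because gauge parameters have no component of weight zero.
  euler_surj a ha := by
    refine ⟨fun k b => ((serWeight m n k b : ℝ))⁻¹ • a k b,
      ⟨fun k b hb => by simp only [ha.1 k b hb, smul_zero],
        fun k b hb => by simp only [ha.2 k b hb, smul_zero]⟩, ?_⟩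
    funext k b
    rw [euler_apply]
    by_cases h : serWeight m n k b = 0
    · rw [ha.2 k b (by omega), h, Nat.cast_zero, zero_smul]
    · rw [smul_smul, mul_inv_cancel₀ (by exact_mod_cast h), one_smul]
  euler_br a _ y := euler_serBr F a y

theorem serExp_eq {F : FrameData R} (hF : F.IsFrame) {a : Ser R m n} (ha : a.IsGaugeParameter) :
    serExp F a = nexp (n + 6) (serBrₗ F m n a) := by
  funext x
  have hp := (nilpotentAction hF m n).pow_eq_zero (mem_gaugeParameters.2 ha)
  have h : ∀ j, (serBr F a)^[j] x = (serBrₗ F m n a ^ j) x := fun j =>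
    (Module.End.pow_apply (serBrₗ F m n a) j x).symm
  rw [nexp_apply, serExp, finsum_eq_sum_of_support_subset]
  · exact Finset.sum_congr rfl fun j _ => by rw [h]
  · intro j hj
    by_contra hj'
    rw [Finset.mem_coe, Finset.mem_range, not_lt] at hj'
    refine hj ?_
    simp only
    rw [h, pow_eq_zero_of_le hj' hp, LinearMap.zero_apply, smul_zero]

theorem serExp_sub_mem_filt {F : FrameData R} (hF : F.IsFrame) {a : Ser R m n}
    (ha : a.IsGaugeParameter) (x : Ser R m n) :
    serExp F a x - x ∈ filt (serWeight m n) 1 := by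
  rw [serExp_eq hF ha]
  have := nexp_sub_one_mem (N := n + 6)
    ((nilpotentAction hF m n).raise a (mem_gaugeParameters.2 ha)) 0 x
    fun k b hb => absurd hb (Nat.not_lt_zero _)
  rwa [zero_add] at this

/-- Since ad a is a derivation on brackets of elements of degree one, exp(a) maps [x, x] to the
bracket of exp(a)x with itself. The condition relative to γ₀ persists because exp(a)x − x has
positive weight. -/
theorem serExp_mem_mcSet {F : FrameData R} (hF : F.IsFrame) {γ₀ : A R} {a x : Ser R m n}
    (ha : a.IsGaugeParameter) (hx : x ∈ mcSet F γ₀ m n) : serExp F a x ∈ mcSet F γ₀ m n := by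
  have ha' := mem_gaugeParameters.2 ha
  obtain ⟨⟨h1, h2⟩, h3⟩ := hx
  refine ⟨⟨?_, ?_⟩, ?_⟩
  · rw [serExp_eq hF ha]
    exact nexp_apply_mem (X' := serHom R m n 1) (fun y hy => serBr_mem_serHom F ha'.1 hy) h1
  · rw [serExp_eq hF ha, ← serBrₗ_apply]
    have hp := (nilpotentAction hF m n).pow_eq_zero ha'
    have hs : ∀ y ∈ serHom R m n 1, serBrₗ F m n a y ∈ serHom R m n 1 :=
      fun y hy => serBr_mem_serHom F ha'.1 hy
    have := nexp_leibniz hp hp hp (serBrₗ F m n) hs hs (fun x hx y hy => serBr_leibniz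
      fun i j k => isDerivOn hF (isHomological_coeff ha'.1 i)
        (.inr ⟨isHomological_coeff hx j, isHomological_coeff hy k⟩)) h1 h1
    refine this.symm.trans ?_
    rw [serBrₗ_apply, h2, map_zero]
  · rw [isNil_iff] at h3 ⊢
    have := add_mem (serExp_sub_mem_filt hF ha x) h3
    rwa [sub_add_sub_cancel] at this

/-- The gauge transformations form a group. -/
theorem exists_gaugeGroup {F : FrameData R} (hF : F.IsFrame) (m n : ℕ) :
    ∃ G : Subgroup (Equiv.Perm (Ser R m n)),
      (∀ g ∈ G, ∃ a : Ser R m n, a.IsGaugeParameter ∧ ⇑g = serExp F a) ∧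
      (∀ a : Ser R m n, a.IsGaugeParameter → ∃ g ∈ G, ⇑g = serExp F a) := by
  obtain ⟨G, hG⟩ := (nilpotentAction hF m n).exists_group
  refine ⟨G, fun g hg => ?_, fun a ha => ?_⟩
  · obtain ⟨a, ha, h⟩ := (hG g).1 hg
    have ha' := mem_gaugeParameters.1 ha
    exact ⟨a, ha', by rw [serExp_eq hF ha', h]⟩
  · obtain ⟨g, h1, -⟩ := (nilpotentAction hF m n).exists_perm (mem_gaugeParameters.2 ha)
    exact ⟨g, (hG g).2 ⟨a, mem_gaugeParameters.2 ha, h1⟩, by rw [serExp_eq hF ha, h1]⟩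

end

/-! ## Components of brackets -/

/-- The coefficient of a symbol in a combination. -/
def Comb.coeff (d : ℕ) (l : Comb) : ℤ := (l.map fun p => if p.2 = d then p.1 else 0).sum

theorem Comb.coeff_cons (d : ℕ) (p : ℤ × ℕ) (l : Comb) :
    Comb.coeff d (p :: l) = (if p.2 = d then p.1 else 0) + Comb.coeff d l := by
  simp [Comb.coeff]

theorem code_idxOf : ∀ μ : Fin 4, ∀ c : Fin 128, c.1 % 64 < 56 → (idxOf μ c).code = c := by
  decide +kernel

theorem dirn_idxOf : ∀ μ : Fin 4, ∀ c ∈ vecCodes, (idxOf μ c).2.dirn = μ := by decide +kernel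

theorem vecCodes_mod : ∀ c ∈ vecCodes, 48 ≤ c % 64 := by decide +kernel

theorem idxOf_scalar {c : ℕ} (hc : c ∈ scalarCodes) (μ : Fin 4) : idxOf μ c = idxOf 0 c := by
  rw [idxOf, idxOf, rowOf_lt μ 0 ⟨_, (scalarCodes_lt c hc).2⟩]

theorem code_idxOf_scalar {c : ℕ} (hc : c ∈ scalarCodes) (μ : Fin 4) : (idxOf μ c).code = c :=
  code_idxOf μ ⟨c, (mod_lt_of_scalar hc).1⟩ (mod_lt_of_scalar hc).2

theorem code_idxOf_vec {c : ℕ} (hc : c ∈ vecCodes) (μ : Fin 4) : (idxOf μ c).code = c :=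
  code_idxOf μ ⟨c, (vecCodes_lt hc).1⟩ (vecCodes_lt hc).2

theorem scalar_ne_vec {c d : ℕ} (hc : c ∈ scalarCodes) (hd : d ∈ vecCodes) : c ≠ d := by
  rintro rfl
  have := vecCodes_mod c hd
  have := (scalarCodes_lt c hc).2
  omega

section
variable {R : Type*} [CommRing R] [Algebra ℝ R]

theorem am_scalar_apply {c : ℕ} (hc : c ∈ scalarCodes) (b : Idx) :
    am R 0 c b = if c = b.code then 1 else 0 := by
  rw [am, Pi.single_apply]
  by_cases h : c = b.code
  · rw [if_pos h, if_pos]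
    rw [h] at hc ⊢
    rw [← idxOf_scalar hc b.2.dirn, idxOf_code]
  · rw [if_neg h, if_neg]
    rintro rfl
    exact h (code_idxOf_scalar hc 0).symm

theorem ae_apply (u : Fin 4 → R) {c : ℕ} (hc : c ∈ vecCodes) (b : Idx) :
    ae u c b = if c = b.code then u b.2.dirn else 0 := by
  rw [ae, Finset.sum_apply]
  simp only [Pi.smul_apply, am, Pi.single_apply, smul_eq_mul, mul_ite, mul_one, mul_zero]
  by_cases h : c = b.code
  · rw [if_pos h, Finset.sum_eq_single b.2.dirn, if_pos]
    · rw [h, idxOf_code]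
    · intro μ _ hμ
      rw [if_neg]
      rintro rfl
      exact hμ (dirn_idxOf μ c hc).symm
    · simp
  · rw [if_neg h]
    refine Finset.sum_eq_zero fun μ _ => if_neg ?_
    rintro rfl
    exact h (code_idxOf_vec hc μ).symm

theorem eval_am_apply {l : Comb} (hl : ∀ p ∈ l, p.2 ∈ scalarCodes) (b : Idx) :
    l.eval (am R 0) b = (l.coeff b.code : R) := by
  induction l with
  | nil => simp [Comb.coeff]
  | cons p l ih =>
    rw [Comb.eval_cons, Pi.add_apply, Pi.smul_apply, am_scalar_apply (hl p (by simp)),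
      ih fun q hq => hl q (by simp [hq]), Comb.coeff_cons]
    split_ifs <;> simp

theorem eval_ae_apply {l : Comb} (hl : ∀ p ∈ l, p.2 ∈ vecCodes) (u : Fin 4 → R) (b : Idx) :
    l.eval (ae u) b = (l.coeff b.code : R) * u b.2.dirn := by
  induction l with
  | nil => simp [Comb.coeff]
  | cons p l ih =>
    rw [Comb.eval_cons, Pi.add_apply, Pi.smul_apply, ae_apply _ (hl p (by simp)),
      ih fun q hq => hl q (by simp [hq]), Comb.coeff_cons]
    split_ifs <;> simp [add_mul]

theorem coeff_eq_zero {l : Comb} {d : ℕ} (h : ∀ p ∈ l, p.2 ≠ d) : l.coeff d = 0 := by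
  rw [Comb.coeff, List.sum_eq_zero]
  intro z hz
  obtain ⟨p, hp, rfl⟩ := List.mem_map.1 hz
  exact if_neg (h p hp)

/-- The component of an element of `𝓐` for a basis element without vector fields. -/
def sc (x : A R) (c : ℕ) : R := x (idxOf 0 c)

/-- The components of an element of `𝓐` for the basis elements `θ_S D_μ`, for a given `S`. -/
def vc (x : A R) (c : ℕ) : Fin 4 → R := fun μ => x (idxOf μ c)

/-- Only the components with given codes can be nonzero. -/
structure Supported (x : A R) (Ls Lv : Finset ℕ) : Prop where
  scalar : ∀ c ∈ Ls, c ∈ scalarCodes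
  vec : ∀ c ∈ Lv, c ∈ vecCodes
  zero : ∀ b : Idx, b.code ∉ Ls → b.code ∉ Lv → x b = 0

theorem Supported.eq_sum {x : A R} {Ls Lv : Finset ℕ} (h : Supported x Ls Lv) :
    x = ∑ c ∈ Ls, sc x c • am R 0 c + ∑ s ∈ Lv, ae (vc x s) s := by
  funext b
  rw [Pi.add_apply, Finset.sum_apply, Finset.sum_apply]
  have e1 : ∀ c ∈ Ls, (sc x c • am R 0 c) b = if c = b.code then sc x c else 0 := by
    intro c hc
    rw [Pi.smul_apply, am_scalar_apply (h.scalar c hc)]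
    split_ifs <;> simp
  rw [Finset.sum_congr rfl e1, Finset.sum_congr rfl fun s hs => ae_apply (vc x s) (h.vec s hs) b,
    Finset.sum_ite_eq', Finset.sum_ite_eq']
  by_cases hs : b.code ∈ Ls
  · rw [if_pos hs, if_neg fun hv => scalar_ne_vec (h.scalar _ hs) (h.vec _ hv) rfl, add_zero, sc,
      ← idxOf_scalar (h.scalar _ hs) b.2.dirn, idxOf_code]
  · rw [if_neg hs, zero_add]
    split_ifs with hv
    · rw [vc, idxOf_code]
    · exact h.zero b hs hv

/-- The sum of `f c e`, with the coefficients of `d` in `k c e`. -/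
def tableSum (k : ℕ → ℕ → Comb) (d : ℕ) (L L' : Finset ℕ) (f : ℕ → ℕ → R) : R :=
  ∑ c ∈ L, ∑ e ∈ L', ((k c e).coeff d : R) * f c e

variable (F : FrameData R) {x y : A R} {Ls Lv Ls' Lv' : Finset ℕ}

/-- The three sums are the undifferentiated products, the terms where a vector field in x
differentiates a coefficient of y, and those with the roles exchanged. Brackets of two vector fields
have no component of this kind. -/
theorem component_scalar (hx : Supported x Ls Lv) (hy : Supported y Ls' Lv')
    (hok : ∀ c ∈ Ls ∪ Lv, ∀ e ∈ Ls' ∪ Lv', okPair c e = true) {d : ℕ} (hd : d ∈ scalarCodes) :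
    sc (aBr F x y) d = (6⁻¹ : ℝ) • (tableSum nbM d Ls Ls' (fun c e => sc x c * sc y e)
      + tableSum smM d Lv Ls' (fun s e => dir F (vc x s) (sc y e))
      + tableSum rmM d Ls Lv' (fun c s => dir F (vc y s) (sc x c))) := by
  have hcode := code_idxOf_scalar hd 0
  have hv : ∀ {l : Comb}, (∀ p ∈ l, p.2 ∈ vecCodes) → l.coeff d = 0 := fun h =>
    coeff_eq_zero fun p hp => (scalar_ne_vec hd (h p hp)).symm
  have okss := fun {c e} (hc : c ∈ Ls) (he : e ∈ Ls') =>
    hok c (Finset.mem_union_left _ hc) e (Finset.mem_union_left _ he)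
  have oksv := fun {c e} (hc : c ∈ Ls) (he : e ∈ Lv') =>
    hok c (Finset.mem_union_left _ hc) e (Finset.mem_union_right _ he)
  have okvs := fun {c e} (hc : c ∈ Lv) (he : e ∈ Ls') =>
    hok c (Finset.mem_union_right _ hc) e (Finset.mem_union_left _ he)
  have okvv := fun {c e} (hc : c ∈ Lv) (he : e ∈ Lv') =>
    hok c (Finset.mem_union_right _ hc) e (Finset.mem_union_right _ he)
  have e1 : ∀ c ∈ Ls, ∀ e ∈ Ls', aBrₗ F (sc x c • am R 0 c) (sc y e • am R 0 e) (idxOf 0 d)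
      = (6⁻¹ : ℝ) • (((nbM c e).coeff d : R) * (sc x c * sc y e)) := by
    intro c hc e he
    have c1 := inCodes_spec (allOk_spec nbM_codes (hx.scalar c hc) (hy.scalar e he) (okss hc he))
    rw [aBrₗ_apply, aBr_am_am F 0 (hx.scalar c hc) (hy.scalar e he) (okss hc he), Pi.smul_apply,
      Pi.smul_apply, eval_am_apply fun p hp => (c1 p hp).1, hcode, smul_eq_mul, mul_comm]
  have e2 : ∀ s ∈ Lv, ∀ e ∈ Ls', aBrₗ F (ae (vc x s) s) (sc y e • am R 0 e) (idxOf 0 d)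
      = (6⁻¹ : ℝ) • (((smM s e).coeff d : R) * dir F (vc x s) (sc y e)) := by
    intro s hs e he
    have c1 := inCodes_spec (allOk_spec nbM_codes_left (hx.vec s hs) (hy.scalar e he) (okvs hs he))
    have c2 := inCodes_spec (allOk_spec smM_codes (hx.vec s hs) (hy.scalar e he) (okvs hs he))
    rw [aBrₗ_apply, aBr_ae_am F 0 (hx.vec s hs) (hy.scalar e he), Pi.smul_apply, Pi.add_apply,
      Pi.smul_apply, eval_am_apply fun p hp => (c2 p hp).1, eval_ae_apply fun p hp => (c1 p hp).1,
      hcode, hv fun p hp => (c1 p hp).1, Int.cast_zero, zero_mul, zero_add, smul_eq_mul, mul_comm]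
  have e3 : ∀ c ∈ Ls, ∀ s ∈ Lv', aBrₗ F (sc x c • am R 0 c) (ae (vc y s) s) (idxOf 0 d)
      = (6⁻¹ : ℝ) • (((rmM c s).coeff d : R) * dir F (vc y s) (sc x c)) := by
    intro c hc s hs
    have c1 := inCodes_spec (allOk_spec nbM_codes_right (hx.scalar c hc) (hy.vec s hs) (oksv hc hs))
    have c2 := inCodes_spec (allOk_spec rmM_codes (hx.scalar c hc) (hy.vec s hs) (oksv hc hs))
    rw [aBrₗ_apply, aBr_am_ae F 0 (hy.vec s hs) (hx.scalar c hc), Pi.smul_apply, Pi.add_apply,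
      Pi.smul_apply, eval_am_apply fun p hp => (c2 p hp).1, eval_ae_apply fun p hp => (c1 p hp).1,
      hcode, hv fun p hp => (c1 p hp).1, Int.cast_zero, zero_mul, zero_add, smul_eq_mul, mul_comm]
  have e4 : ∀ s ∈ Lv, ∀ t ∈ Lv', aBrₗ F (ae (vc x s) s) (ae (vc y t) t) (idxOf 0 d) = 0 := by
    intro s hs t ht
    have c1 := inCodes_spec (allOk_spec mlM_codes (hx.vec s hs) (hy.vec t ht) (okvv hs ht))
    rw [aBrₗ_apply, aBr_ae_ae F (hx.vec s hs) (hy.vec t ht), Pi.smul_apply,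
      eval_ae_apply fun p hp => (c1 p hp).1, hcode, hv fun p hp => (c1 p hp).1, Int.cast_zero,
      zero_mul, smul_zero]
  rw [sc]
  nth_rewrite 1 [hx.eq_sum]
  nth_rewrite 1 [hy.eq_sum]
  rw [← aBrₗ_apply]
  simp only [map_add, map_sum, LinearMap.add_apply, LinearMap.sum_apply, Pi.add_apply,
    Finset.sum_apply, Finset.sum_add_distrib]
  rw [Finset.sum_comm (s := Ls'), Finset.sum_comm (s := Ls'), Finset.sum_comm (s := Lv'),
    Finset.sum_comm (s := Lv'),
    Finset.sum_congr rfl fun c hc => Finset.sum_congr rfl (e1 c hc),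
    Finset.sum_congr rfl fun c hc => Finset.sum_congr rfl (e2 c hc),
    Finset.sum_congr rfl fun c hc => Finset.sum_congr rfl (e3 c hc),
    Finset.sum_congr rfl fun c hc => Finset.sum_congr rfl (e4 c hc)]
  simp only [Finset.sum_const_zero, add_zero, tableSum, Finset.smul_sum, smul_add]

/-- Derivatives of coefficients of basis elements without vector fields do not show up along vector
fields; derivatives enter only through the bracket of vector fields in the third sum. -/
theorem component_vec (hx : Supported x Ls Lv) (hy : Supported y Ls' Lv')
    (hok : ∀ c ∈ Ls ∪ Lv, ∀ e ∈ Ls' ∪ Lv', okPair c e = true) {d : ℕ} (hd : d ∈ vecCodes)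
    (μ : Fin 4) :
    vc (aBr F x y) d μ = (6⁻¹ : ℝ) • (tableSum nbM d Ls Lv' (fun c t => sc x c * vc y t μ)
      + tableSum nbM d Lv Ls' (fun s e => sc y e * vc x s μ)
      + tableSum mlM d Lv Lv' (fun s t => vecBr F (vc x s) (vc y t) μ)) := by
  have hcode := code_idxOf_vec hd μ
  have hdirn := dirn_idxOf μ d hd
  have hv : ∀ {l : Comb}, (∀ p ∈ l, p.2 ∈ scalarCodes) → l.coeff d = 0 := fun h =>
    coeff_eq_zero fun p hp => scalar_ne_vec (h p hp) hd
  have okss := fun {c e} (hc : c ∈ Ls) (he : e ∈ Ls') =>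
    hok c (Finset.mem_union_left _ hc) e (Finset.mem_union_left _ he)
  have oksv := fun {c e} (hc : c ∈ Ls) (he : e ∈ Lv') =>
    hok c (Finset.mem_union_left _ hc) e (Finset.mem_union_right _ he)
  have okvs := fun {c e} (hc : c ∈ Lv) (he : e ∈ Ls') =>
    hok c (Finset.mem_union_right _ hc) e (Finset.mem_union_left _ he)
  have okvv := fun {c e} (hc : c ∈ Lv) (he : e ∈ Lv') =>
    hok c (Finset.mem_union_right _ hc) e (Finset.mem_union_right _ he)
  have e1 : ∀ c ∈ Ls, ∀ e ∈ Ls', aBrₗ F (sc x c • am R 0 c) (sc y e • am R 0 e) (idxOf μ d)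
      = 0 := by
    intro c hc e he
    have c1 := inCodes_spec (allOk_spec nbM_codes (hx.scalar c hc) (hy.scalar e he) (okss hc he))
    rw [aBrₗ_apply, aBr_am_am F 0 (hx.scalar c hc) (hy.scalar e he) (okss hc he), Pi.smul_apply,
      Pi.smul_apply, eval_am_apply fun p hp => (c1 p hp).1, hcode, hv fun p hp => (c1 p hp).1,
      Int.cast_zero, smul_zero, smul_zero]
  have e2 : ∀ s ∈ Lv, ∀ e ∈ Ls', aBrₗ F (ae (vc x s) s) (sc y e • am R 0 e) (idxOf μ d)
      = (6⁻¹ : ℝ) • (((nbM s e).coeff d : R) * (sc y e * vc x s μ)) := by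
    intro s hs e he
    have c1 := inCodes_spec (allOk_spec nbM_codes_left (hx.vec s hs) (hy.scalar e he) (okvs hs he))
    have c2 := inCodes_spec (allOk_spec smM_codes (hx.vec s hs) (hy.scalar e he) (okvs hs he))
    rw [aBrₗ_apply, aBr_ae_am F 0 (hx.vec s hs) (hy.scalar e he), Pi.smul_apply, Pi.add_apply,
      Pi.smul_apply, eval_am_apply fun p hp => (c2 p hp).1, eval_ae_apply fun p hp => (c1 p hp).1,
      hcode, hdirn, hv fun p hp => (c2 p hp).1, Int.cast_zero, smul_zero, add_zero]
    rfl
  have e3 : ∀ c ∈ Ls, ∀ s ∈ Lv', aBrₗ F (sc x c • am R 0 c) (ae (vc y s) s) (idxOf μ d)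
      = (6⁻¹ : ℝ) • (((nbM c s).coeff d : R) * (sc x c * vc y s μ)) := by
    intro c hc s hs
    have c1 := inCodes_spec (allOk_spec nbM_codes_right (hx.scalar c hc) (hy.vec s hs) (oksv hc hs))
    have c2 := inCodes_spec (allOk_spec rmM_codes (hx.scalar c hc) (hy.vec s hs) (oksv hc hs))
    rw [aBrₗ_apply, aBr_am_ae F 0 (hy.vec s hs) (hx.scalar c hc), Pi.smul_apply, Pi.add_apply,
      Pi.smul_apply, eval_am_apply fun p hp => (c2 p hp).1, eval_ae_apply fun p hp => (c1 p hp).1,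
      hcode, hdirn, hv fun p hp => (c2 p hp).1, Int.cast_zero, smul_zero, add_zero]
    rfl
  have e4 : ∀ s ∈ Lv, ∀ t ∈ Lv', aBrₗ F (ae (vc x s) s) (ae (vc y t) t) (idxOf μ d)
      = (6⁻¹ : ℝ) • (((mlM s t).coeff d : R) * vecBr F (vc x s) (vc y t) μ) := by
    intro s hs t ht
    have c1 := inCodes_spec (allOk_spec mlM_codes (hx.vec s hs) (hy.vec t ht) (okvv hs ht))
    rw [aBrₗ_apply, aBr_ae_ae F (hx.vec s hs) (hy.vec t ht), Pi.smul_apply,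
      eval_ae_apply fun p hp => (c1 p hp).1, hcode, hdirn]
  rw [vc]
  nth_rewrite 1 [hx.eq_sum]
  nth_rewrite 1 [hy.eq_sum]
  rw [← aBrₗ_apply]
  simp only [map_add, map_sum, LinearMap.add_apply, LinearMap.sum_apply, Pi.add_apply,
    Finset.sum_apply, Finset.sum_add_distrib]
  rw [Finset.sum_comm (s := Ls'), Finset.sum_comm (s := Ls'), Finset.sum_comm (s := Lv'),
    Finset.sum_comm (s := Lv'),
    Finset.sum_congr rfl fun c hc => Finset.sum_congr rfl (e1 c hc),
    Finset.sum_congr rfl fun c hc => Finset.sum_congr rfl (e2 c hc),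
    Finset.sum_congr rfl fun c hc => Finset.sum_congr rfl (e3 c hc),
    Finset.sum_congr rfl fun c hc => Finset.sum_congr rfl (e4 c hc)]
  simp only [Finset.sum_const_zero, zero_add, tableSum, Finset.smul_sum, smul_add]
  abel

/-- The coefficients of `d` in `k c e` are listed in `T`. -/
def isTable (k : ℕ → ℕ → Comb) (d : ℕ) (L L' : Finset ℕ) (T : List ((ℕ × ℕ) × ℤ)) : Prop :=
  (∀ t ∈ T, t.1.1 ∈ L ∧ t.1.2 ∈ L') ∧
  ∀ c ∈ L, ∀ e ∈ L', (k c e).coeff d = (T.map fun t => if t.1 = (c, e) then t.2 else 0).sum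

instance (k : ℕ → ℕ → Comb) (d : ℕ) (L L' : Finset ℕ) (T : List ((ℕ × ℕ) × ℤ)) :
    Decidable (isTable k d L L' T) := inferInstanceAs (Decidable (_ ∧ _))

/-- Reduces a sum over all pairs of basis elements to the few pairs that contribute, the list of
which is confirmed by a finite check. -/
theorem tableSum_eq {k : ℕ → ℕ → Comb} {d : ℕ} {L L' : Finset ℕ} {T : List ((ℕ × ℕ) × ℤ)}
    (h : isTable k d L L' T) (f : ℕ → ℕ → R) :
    tableSum k d L L' f = (T.map fun t => (t.2 : R) * f t.1.1 t.1.2).sum := by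
  have e1 : tableSum k d L L' f = ∑ c ∈ L, ∑ e ∈ L',
      (T.map fun t => if t.1 = (c, e) then (t.2 : R) * f t.1.1 t.1.2 else 0).sum := by
    refine Finset.sum_congr rfl fun c hc => Finset.sum_congr rfl fun e he => ?_
    rw [h.2 c hc e he]
    generalize T = T
    induction T with
    | nil => simp
    | cons t T ih =>
      simp only [List.map_cons, List.sum_cons, Int.cast_add, add_mul, ih]
      split_ifs with h
      · rw [h]
      · simp
  rw [e1]
  have hT := h.1
  clear h e1
  induction T with
  | nil => simp
  | cons t T ih =>
    simp only [List.map_cons, List.sum_cons, Finset.sum_add_distrib,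
      ih fun t ht => hT t (by simp [ht])]
    congr 1
    obtain ⟨h1, h2⟩ := hT t (by simp)
    rw [Finset.sum_eq_single t.1.1, Finset.sum_eq_single t.1.2, if_pos rfl]
    · intro e _ he
      rw [if_neg fun h => he (by rw [h])]
    · exact fun h => absurd h2 h
    · intro c _ hc
      exact Finset.sum_eq_zero fun e _ => if_neg fun h => hc (by rw [h])
    · exact fun h => absurd h1 h

end

/-! ## The brackets with elements of homological degree one -/

/-- The codes of the basis elements of homological degree one without vector fields. -/
def oneCodes : Finset ℕ := {0, 1, 2, 3, 4, 5, 12, 13, 14, 15, 16, 17, 18, 19, 20, 21, 22, 23, 27, 28,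
  29, 40, 41, 42, 44, 70, 71, 72, 73, 74, 75, 100}

/-- The codes of the elements `θ_i D_μ` and `θ₀ D_μ`. -/
def oneVecCodes : Finset ℕ := {49, 50, 52, 112}

/-- The codes of the gauge elements without vector fields, and of `θ₀ σ_{jk}`. -/
def gaugeRotCodes : Finset ℕ :=
  {0, 1, 2, 3, 4, 5, 12, 13, 14, 18, 19, 20, 21, 22, 23, 40, 41, 42, 44, 73, 74, 75}

/-- The codes of `σ_i` and `σ_{jk}`. -/
def lorentzCodes : Finset ℕ := {6, 7, 8, 9, 10, 11}

theorem one_of_hdegM : ∀ c : Fin 128, c.1 % 64 < 56 → hdegM c = 1 →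
    c.1 ∈ oneCodes ∨ c.1 ∈ oneVecCodes := by decide +kernel

theorem oneCodes_scalar : ∀ c ∈ oneCodes, c ∈ scalarCodes ∧ hdegM c = 1 := by decide +kernel

theorem oneVecCodes_vec : ∀ c ∈ oneVecCodes, c ∈ vecCodes ∧ hdegM c = 1 := by decide +kernel

theorem gaugeRot_or : ∀ c ∈ oneCodes, c ∈ gaugeRotCodes ∨ c = 100 ∨ ∃ i : Fin 3,
    c = 70 + i.1 ∨ c = 15 + i.1 ∨ c = 27 + i.1 := by decide +kernel

theorem gaugeRotCodes_one : ∀ c ∈ gaugeRotCodes, c ∈ oneCodes := by decide +kernel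

theorem lorentzCodes_spec : ∀ c ∈ lorentzCodes, c ∈ scalarCodes ∧ hdegM c = 0 := by decide +kernel

/-- Here 70 + i is θ₀σ_i, 112 is θ₀D_μ and 112 + 2^i is θ₀θ_iD_μ. The boost in the first factor
turns the θ₀ of the second into θ_i. As in all these lists, the entries carry the common factor 6.
-/
theorem table_boost : ∀ i : Fin 3,
    isTable nbM (112 + 2 ^ i.1) oneCodes {112} [((70 + i.1, 112), 6)] ∧
    isTable nbM (112 + 2 ^ i.1) {112} oneCodes [((112, 70 + i.1), 6)] := by decide +kernel

/-- Here 27 + i is θ_jσ_k − θ_kσ_j and 55 − 2^i is the product of θ_j and θ_k in increasing order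
times D_μ; the sign appears because θ₃θ₁ is not in increasing order. -/
theorem table_asym : ∀ i : Fin 3,
    isTable nbM (55 - 2 ^ i.1) oneCodes {112} [((27 + i.1, 112), 12 * (-1) ^ i.1)] ∧
    isTable nbM (55 - 2 ^ i.1) {112} oneCodes [((112, 27 + i.1), 12 * (-1) ^ i.1)] := by
  decide +kernel

/-- Here 73 + i is θ₀σ_{jk}, 79 + i is θ₀(θ_jσ_k + θ_kσ_j), and the codes 0, 1, 2 are the elements
θ₀σ₀ + θ_iσ_i with coefficients p_i in γ₀. A rotation mixes directions j and k, so it sees the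
difference of the two coefficients. -/
theorem table_rot : ∀ i : Fin 3, isTable nbM (79 + i.1) gaugeRotCodes gaugeRotCodes
    [(((i + 1).1, 73 + i.1), -6), (((i + 2).1, 73 + i.1), 6),
      ((73 + i.1, (i + 1).1), -6), ((73 + i.1, (i + 2).1), 6)] := by decide +kernel

theorem table_rot_left : ∀ i : Fin 3, isTable smM (79 + i.1) oneVecCodes gaugeRotCodes [] := by
  decide +kernel

theorem table_rot_right : ∀ i : Fin 3, isTable rmM (79 + i.1) gaugeRotCodes oneVecCodes [] := by
  decide +kernel

/-- The linearized action of the rotation σ_{jk}, code 9 + i, on the symmetric component with code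
15 + i; again only a difference of two Kasner coefficients occurs. -/
theorem table_lorentz : ∀ i : Fin 3, isTable nbM (15 + i.1) lorentzCodes oneCodes
    [((9 + i.1, (i + 1).1), -6), ((9 + i.1, (i + 2).1), 6)] := by decide +kernel

theorem table_lorentz_right : ∀ i : Fin 3, isTable rmM (15 + i.1) lorentzCodes oneVecCodes [] := by
  decide +kernel

theorem table_lorentz_vec : ∀ i : Fin 3, isTable nbM (48 + 2 ^ i.1) lorentzCodes oneVecCodes
    [((6 + i.1, 112), 6)] := by decide +kernel

/-- Codes 36 and 48 are σ₀ and D_μ, codes 100 and 112 are θ₀ times these. The entry −6 is the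
derivative of the coefficient of σ₀ along the vector field in the second factor. -/
theorem table_scale : isTable nbM 100 {36} oneCodes [((36, 100), 6)] ∧
    isTable smM 100 {48} oneCodes [((48, 100), 6)] ∧
    isTable rmM 100 {36} oneVecCodes [((36, 112), -6)] ∧
    isTable nbM 112 {36} oneVecCodes [((36, 112), 6)] ∧
    isTable nbM 112 {48} oneCodes [] ∧
    isTable mlM 112 {48} oneVecCodes [((48, 112), 6)] := by decide +kernel

section
variable {R : Type*} [CommRing R] [Algebra ℝ R]

theorem smul_six_mul (x : R) : (6⁻¹ : ℝ) • (6 * x) = x := by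
  rw [show (6 * x : R) = (6 : ℝ) • x by rw [Algebra.smul_def, map_ofNat], smul_smul]
  norm_num

theorem IsHomological.supported {x : A R} (hx : IsHomological 1 x) :
    Supported x oneCodes oneVecCodes where
  scalar c hc := (oneCodes_scalar c hc).1
  vec c hc := (oneVecCodes_vec c hc).1
  zero b h h' := hx b fun hb => by
    obtain ⟨h1, h2⟩ := idx_code_lt b
    have := one_of_hdegM ⟨b.code, h1⟩ h2 (by rw [hdegM_eq b.2.dirn ⟨_, h1⟩ h2, idxOf_code, hb])
    exact this.elim h h'

theorem tableSum_subset_right {k : ℕ → ℕ → Comb} {d : ℕ} {L L' L'' : Finset ℕ} {f : ℕ → ℕ → R}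
    (hL : L'' ⊆ L') (h : ∀ e ∈ L', e ∉ L'' → ∀ c, f c e = 0) :
    tableSum k d L L' f = tableSum k d L L'' f :=
  Finset.sum_congr rfl fun c _ => (Finset.sum_subset hL fun e he he' => by
    rw [h e he he', mul_zero]).symm

theorem tableSum_subset_left {k : ℕ → ℕ → Comb} {d : ℕ} {L L' L'' : Finset ℕ} {f : ℕ → ℕ → R}
    (hL : L'' ⊆ L) (h : ∀ c ∈ L, c ∉ L'' → ∀ e, f c e = 0) :
    tableSum k d L L' f = tableSum k d L'' L' f :=
  (Finset.sum_subset hL fun c hc hc' => Finset.sum_eq_zero fun e _ => by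
    rw [h c hc hc', mul_zero]).symm

theorem okPair_one {c e : ℕ} (hc : hdegM c = 1) (he : hdegM e = 1) : okPair c e = true := by
  simp [okPair, beq_eq_decide, hc, he]

theorem okPair_of_one : ∀ c ∈ oneCodes ∪ oneVecCodes, ∀ e ∈ oneCodes ∪ oneVecCodes,
    okPair c e = true := by
  have h : ∀ c ∈ oneCodes ∪ oneVecCodes, hdegM c = 1 := fun c hc =>
    (Finset.mem_union.1 hc).elim (fun h => (oneCodes_scalar c h).2) fun h => (oneVecCodes_vec c h).2
  exact fun c hc e he => okPair_one (h c hc) (h e he)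

/-- The only component along `D₀` is a constant multiple of `θ₀ D₀`. -/
structure IsTimeConst (F : FrameData R) (x : A R) : Prop where
  hom : IsHomological 1 x
  space : ∀ i : Fin 3, vc x (48 + 2 ^ i.1) 0 = 0
  const : ∀ ν, F.D ν (vc x 112 0) = 0

theorem oneVecCodes_cases : ∀ c ∈ oneVecCodes, c ≠ 112 → ∃ i : Fin 3, c = 48 + 2 ^ i.1 := by
  decide +kernel

variable {F : FrameData R} {x y : A R}

theorem IsTimeConst.vc_zero (hx : IsTimeConst F x) {c : ℕ} (hc : c ∈ oneVecCodes) (h : c ≠ 112) :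
    vc x c 0 = 0 := by
  obtain ⟨i, rfl⟩ := oneVecCodes_cases c hc h
  exact hx.space i

theorem IsTimeConst.derivation (hx : IsTimeConst F x) {c : ℕ} (hc : c ∈ oneVecCodes) (ν : Fin 4) :
    F.D ν (vc x c 0) = 0 := by
  by_cases h : c = 112
  · rw [h]; exact hx.const ν
  · rw [hx.vc_zero hc h, map_zero]

/-- The coefficients along D₀ are constants and commutators of the frame have no D₀ part, so
brackets of vector fields contribute nothing along D₀. Among the tensorial terms only the
coefficient of θ₀D₀ is left. -/
theorem component_time (hc : ∀ μ ν, F.c μ ν 0 = 0) (hx : IsTimeConst F x) (hy : IsTimeConst F y)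
    {d l : ℕ} {z : ℤ} (hd : d ∈ vecCodes)
    (h1 : isTable nbM d oneCodes {112} [((l, 112), 6 * z)])
    (h2 : isTable nbM d {112} oneCodes [((112, l), 6 * z)]) :
    vc (aBr F x y) d 0 = (z : R) * (sc x l * vc y 112 0 + sc y l * vc x 112 0) := by
  have hsub : ({112} : Finset ℕ) ⊆ oneVecCodes := by decide
  rw [component_vec F hx.hom.supported hy.hom.supported okPair_of_one hd 0,
    tableSum_subset_right (L'' := {112}) hsub, tableSum_subset_left (L'' := {112}) hsub,
    tableSum_eq h1, tableSum_eq h2]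
  · have : tableSum mlM d oneVecCodes oneVecCodes (fun s t => vecBr F (vc x s) (vc y t) 0) = 0 := by
      refine Finset.sum_eq_zero fun s hs => Finset.sum_eq_zero fun t ht => ?_
      have : vecBr F (vc x s) (vc y t) 0 = 0 := by
        simp only [vecBr, dir, hx.derivation hs, hy.derivation ht, hc, mul_zero, zero_mul,
          Finset.sum_const_zero, sub_zero, add_zero]
      simp only [this, mul_zero]
    rw [this, add_zero]
    simp only [List.map_cons, List.map_nil, List.sum_cons, List.sum_nil, add_zero]
    push_cast
    rw [← smul_six_mul ((z : R) * _)]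
    congr 1
    ring
  · intro s hs hs' e
    rw [hx.vc_zero hs (by simpa using hs'), mul_zero]
  · intro s hs hs' e
    rw [hy.vc_zero hs (by simpa using hs'), mul_zero]

theorem component_boost (hc : ∀ μ ν, F.c μ ν 0 = 0) (hx : IsTimeConst F x) (hy : IsTimeConst F y)
    (i : Fin 3) : vc (aBr F x y) (112 + 2 ^ i.1) 0
      = sc x (70 + i.1) * vc y 112 0 + sc y (70 + i.1) * vc x 112 0 := by
  have hd : ∀ i : Fin 3, 112 + 2 ^ i.1 ∈ vecCodes := by decide +kernel
  obtain ⟨h1, h2⟩ := table_boost i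
  rw [component_time (z := 1) hc hx hy (hd i) h1 h2, Int.cast_one, one_mul]

theorem component_asym (hc : ∀ μ ν, F.c μ ν 0 = 0) (hx : IsTimeConst F x) (hy : IsTimeConst F y)
    (i : Fin 3) : vc (aBr F x y) (55 - 2 ^ i.1) 0 = ((2 * (-1) ^ i.1 : ℤ) : R)
      * (sc x (27 + i.1) * vc y 112 0 + sc y (27 + i.1) * vc x 112 0) := by
  have hd : ∀ i : Fin 3, 55 - 2 ^ i.1 ∈ vecCodes := by decide +kernel
  have e : (12 * (-1) ^ i.1 : ℤ) = 6 * (2 * (-1) ^ i.1) := by ring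
  obtain ⟨h1, h2⟩ := table_asym i
  rw [e] at h1 h2
  rw [component_time hc hx hy (hd i) h1 h2]

theorem component_rot (hx : Supported x gaugeRotCodes oneVecCodes)
    (hy : Supported y gaugeRotCodes oneVecCodes) (i : Fin 3) : sc (aBr F x y) (79 + i.1)
      = (sc x (i + 2).1 - sc x (i + 1).1) * sc y (73 + i.1)
        + (sc y (i + 2).1 - sc y (i + 1).1) * sc x (73 + i.1) := by
  have hd : ∀ i : Fin 3, 79 + i.1 ∈ scalarCodes := by decide +kernel
  have hu : gaugeRotCodes ∪ oneVecCodes ⊆ oneCodes ∪ oneVecCodes :=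
    Finset.union_subset_union_left gaugeRotCodes_one
  rw [component_scalar F hx hy (fun c hc e he => okPair_of_one c (hu hc) e (hu he)) (hd i),
    tableSum_eq (table_rot i), tableSum_eq (table_rot_left i), tableSum_eq (table_rot_right i)]
  simp only [List.map_cons, List.map_nil, List.sum_cons, List.sum_nil, add_zero]
  rw [← smul_six_mul ((sc x (i + 2).1 - sc x (i + 1).1) * _ + _)]
  push_cast
  congr 1
  ring

variable {a : A R}

theorem okPair_of_zero {L L' : Finset ℕ} (h : ∀ c ∈ L, hdegM c = 0) :
    ∀ c ∈ L, ∀ e ∈ L', okPair c e = true := fun c hc e _ => okPair_zero (h c hc) e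

theorem lorentz_hdegM : ∀ c ∈ lorentzCodes ∪ ∅, hdegM c = 0 := by decide +kernel

theorem component_lorentz (ha : Supported a lorentzCodes ∅) (hx : IsHomological 1 x) (i : Fin 3) :
    sc (aBr F a x) (15 + i.1) = (sc x (i + 2).1 - sc x (i + 1).1) * sc a (9 + i.1) := by
  have hd : ∀ i : Fin 3, 15 + i.1 ∈ scalarCodes := by decide +kernel
  have hs : tableSum smM (15 + i.1) ∅ oneCodes (fun s e => dir F (vc a s) (sc x e)) = 0 :=
    Finset.sum_empty
  rw [component_scalar F ha hx.supported (okPair_of_zero lorentz_hdegM) (hd i),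
    tableSum_eq (table_lorentz i), hs, tableSum_eq (table_lorentz_right i)]
  simp only [List.map_cons, List.map_nil, List.sum_cons, List.sum_nil, add_zero]
  rw [← smul_six_mul ((sc x (i + 2).1 - sc x (i + 1).1) * _)]
  push_cast
  congr 1
  ring

theorem component_lorentz_vec (ha : Supported a lorentzCodes ∅) (hx : IsHomological 1 x)
    (i : Fin 3) : vc (aBr F a x) (48 + 2 ^ i.1) 0 = sc a (6 + i.1) * vc x 112 0 := by
  have hd : ∀ i : Fin 3, 48 + 2 ^ i.1 ∈ vecCodes := by decide +kernel
  have h1 : tableSum nbM (48 + 2 ^ i.1) ∅ oneCodes (fun s e => sc x e * vc a s 0) = 0 :=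
    Finset.sum_empty
  have h2 : tableSum mlM (48 + 2 ^ i.1) ∅ oneVecCodes
    (fun s t => vecBr F (vc a s) (vc x t) 0) = 0 := Finset.sum_empty
  rw [component_vec F ha hx.supported (okPair_of_zero lorentz_hdegM) (hd i),
    tableSum_eq (table_lorentz_vec i), h1, h2]
  simp only [List.map_cons, List.map_nil, List.sum_cons, List.sum_nil, add_zero]
  push_cast
  exact smul_six_mul _

theorem scale_hdegM : ∀ c ∈ ({36} : Finset ℕ) ∪ {48}, hdegM c = 0 := by decide +kernel

theorem component_scale (ha : Supported a {36} {48}) (hx : IsHomological 1 x) :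
    sc (aBr F a x) 100 = sc a 36 * sc x 100 + dir F (vc a 48) (sc x 100)
      - dir F (vc x 112) (sc a 36) := by
  obtain ⟨h1, h2, h3, -⟩ := table_scale
  rw [component_scalar F ha hx.supported (okPair_of_zero scale_hdegM) (by decide +kernel),
    tableSum_eq h1, tableSum_eq h2, tableSum_eq h3]
  simp only [List.map_cons, List.map_nil, List.sum_cons, List.sum_nil, add_zero]
  rw [← smul_six_mul (_ - _)]
  push_cast
  congr 1
  ring

/-- The scaling σ₀ multiplies θ₀D_μ by its coefficient, and the vector field of the parameter acts
by the bracket of vector fields. -/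
theorem component_scale_vec (ha : Supported a {36} {48}) (hx : IsHomological 1 x) (μ : Fin 4) :
    vc (aBr F a x) 112 μ = sc a 36 * vc x 112 μ + vecBr F (vc a 48) (vc x 112) μ := by
  obtain ⟨-, -, -, h1, h2, h3⟩ := table_scale
  rw [component_vec F ha hx.supported (okPair_of_zero scale_hdegM) (by decide +kernel),
    tableSum_eq h1, tableSum_eq h2, tableSum_eq h3]
  simp only [List.map_cons, List.map_nil, List.sum_cons, List.sum_nil, add_zero]
  rw [← smul_six_mul (sc a 36 * vc x 112 μ + _)]
  push_cast
  congr 1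
  ring

end

/-! ### Gauge conditions and solution of the linearized problem -/

theorem hdeg_eq_hdegM (b : Idx) : b.hdeg = hdegM b.code := by
  obtain ⟨h1, h2⟩ := idx_code_lt b
  rw [hdegM_eq b.2.dirn ⟨_, h1⟩ h2, idxOf_code]

theorem weight_lorentz : ∀ μ : Fin 4, ∀ c ∈ lorentzCodes, (idxOf μ c).weight = 2 := by decide +kernel

instance : DecidablePred Row.IsGauge := fun r => by
  cases r <;> unfold Row.IsGauge <;> infer_instance

/-- Apart from the gauge elements, this lists the twenty basis elements of 𝓐¹ whose components have
to be controlled. -/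
theorem isGauge_or : ∀ μ : Fin 4, ∀ c : Fin 128, c.1 % 64 < 56 → hdegM c = 1 →
    ((idxOf μ c).1 = false ∧ (idxOf μ c).2.IsGauge) ∨ c.1 = 100 ∨ c.1 = 112 ∨ ∃ i : Fin 3,
      c.1 = 70 + i.1 ∨ c.1 = 73 + i.1 ∨ c.1 = 15 + i.1 ∨ c.1 = 27 + i.1 ∨
      c.1 = 48 + 2 ^ i.1 ∧ μ = 0 := by decide +kernel

section
variable {R : Type*} [CommRing R] [Algebra ℝ R]

/-- The algebraic gauge conditions. -/
structure IsReduced (r : R) (x : A R) : Prop where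
  hom : IsHomological 1 x
  scale : sc x 100 = 0
  time : ∀ μ, vc x 112 μ = if μ = 0 then r else 0
  space : ∀ i : Fin 3, vc x (48 + 2 ^ i.1) 0 = 0
  sym : ∀ i : Fin 3, sc x (15 + i.1) = 0

/-- The element is the sum of a multiple of `θ₀ D₀` and an element of `𝓐_gauge`. -/
structure IsNormal (r : R) (x : A R) : Prop extends IsReduced r x where
  boost : ∀ i : Fin 3, sc x (70 + i.1) = 0
  rot : ∀ i : Fin 3, sc x (73 + i.1) = 0
  asym : ∀ i : Fin 3, sc x (27 + i.1) = 0

variable {r r' : R} {x y : A R}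

theorem vc_add (x y : A R) (c : ℕ) (μ : Fin 4) : vc (x + y) c μ = vc x c μ + vc y c μ := rfl

theorem sc_add (x y : A R) (c : ℕ) : sc (x + y) c = sc x c + sc y c := rfl

theorem IsNormal.add (hx : IsNormal r x) (hy : IsNormal r' y) : IsNormal (r + r') (x + y) where
  hom := hx.hom.add hy.hom
  scale := by rw [sc_add, hx.scale, hy.scale, add_zero]
  time μ := by rw [vc_add, hx.time, hy.time]; split_ifs <;> simp
  space i := by rw [vc_add, hx.space, hy.space, add_zero]
  sym i := by rw [sc_add, hx.sym, hy.sym, add_zero]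
  boost i := by rw [sc_add, hx.boost, hy.boost, add_zero]
  rot i := by rw [sc_add, hx.rot, hy.rot, add_zero]
  asym i := by rw [sc_add, hx.asym, hy.asym, add_zero]

theorem sc_neg (x : A R) (c : ℕ) : sc (-x) c = -sc x c := rfl

theorem vc_neg (x : A R) (c : ℕ) (μ : Fin 4) : vc (-x) c μ = -vc x c μ := rfl

theorem IsNormal.neg (hx : IsNormal r x) : IsNormal (-r) (-x) where
  hom b hb := by rw [Pi.neg_apply, hx.hom b hb, neg_zero]
  scale := by rw [sc_neg, hx.scale, neg_zero]
  time μ := by rw [vc_neg, hx.time]; split_ifs <;> simp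
  space i := by rw [vc_neg, hx.space, neg_zero]
  sym i := by rw [sc_neg, hx.sym, neg_zero]
  boost i := by rw [sc_neg, hx.boost, neg_zero]
  rot i := by rw [sc_neg, hx.rot, neg_zero]
  asym i := by rw [sc_neg, hx.asym, neg_zero]

theorem IsNormal.isGauge (hx : IsNormal 0 x) : IsGauge x := by
  intro b hb
  by_cases h : b.hdeg = 1
  · obtain ⟨h1, h2⟩ := idx_code_lt b
    have hs : ∀ {c}, c ∈ scalarCodes → b.code = c → sc x c = x b := by
      rintro c hc rfl
      rw [sc, ← idxOf_scalar hc b.2.dirn, idxOf_code]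
    have hv : ∀ {c}, b.code = c → vc x c b.2.dirn = x b := by
      rintro c rfl
      rw [vc, idxOf_code]
    have m1 : ∀ i : Fin 3, 70 + i.1 ∈ scalarCodes ∧ 73 + i.1 ∈ scalarCodes ∧
      15 + i.1 ∈ scalarCodes ∧ 27 + i.1 ∈ scalarCodes := by decide +kernel
    have := isGauge_or b.2.dirn ⟨b.code, h1⟩ h2 ((hdeg_eq_hdegM b).symm.trans h)
    rw [idxOf_code] at this
    rcases this with h | h | h | ⟨i, h | h | h | h | ⟨h, hμ⟩⟩
    · exact absurd h hb
    · rw [← hs (by decide +kernel) h, hx.scale]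
    · rw [← hv h, hx.time, ite_self]
    · rw [← hs (m1 i).1 h, hx.boost]
    · rw [← hs (m1 i).2.1 h, hx.rot]
    · rw [← hs (m1 i).2.2.1 h, hx.sym]
    · rw [← hs (m1 i).2.2.2 h, hx.asym]
    · rw [← hv h, hμ, hx.space]
  · exact hx.hom b h

theorem IsGauge.isNormal (hx : IsGauge x) (h : IsHomological 1 x) : IsNormal 0 x where
  hom := h
  scale := hx _ (by decide +kernel)
  time μ := by rw [ite_self]; exact hx _ (by revert μ; decide +kernel)
  space i := hx _ (by revert i; decide +kernel)
  sym i := hx _ (by revert i; decide +kernel)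
  boost i := hx _ (by revert i; decide +kernel)
  rot i := hx _ (by revert i; decide +kernel)
  asym i := hx _ (by revert i; decide +kernel)

variable (p₀ : R) (p : Fin 3 → R)

theorem gamma0_isNormal : IsNormal 1 (gamma0 p₀ p) where
  hom := by
    rintro ⟨b, r⟩ hb
    cases b <;> cases r <;> simp [gamma0, Idx.hdeg, Row.hdeg] at hb ⊢
    · exact fun h => absurd h hb.1
    · rintro rfl; simp at hb
  scale := rfl
  time μ := by fin_cases μ <;> rfl
  space i := by fin_cases i <;> rfl
  sym i := by fin_cases i <;> rfl
  boost i := by fin_cases i <;> rfl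
  rot i := by fin_cases i <;> rfl
  asym i := by fin_cases i <;> rfl

theorem gamma0_kasner (i : Fin 3) : sc (gamma0 p₀ p) i.1 = p i := by fin_cases i <;> rfl

/-- The element of `𝓐` with given components. -/
def ofComponents (s : ℕ → R) (v : ℕ → Fin 4 → R) (Ls Lv : Finset ℕ) : A R := fun b =>
  if b.code ∈ Ls then s b.code else if b.code ∈ Lv then v b.code b.2.dirn else 0

variable {s : ℕ → R} {v : ℕ → Fin 4 → R} {Ls Lv : Finset ℕ}

theorem ofComponents_supported (hs : ∀ c ∈ Ls, c ∈ scalarCodes) (hv : ∀ c ∈ Lv, c ∈ vecCodes) :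
    Supported (ofComponents s v Ls Lv) Ls Lv where
  scalar := hs
  vec := hv
  zero b h h' := by rw [ofComponents, if_neg h, if_neg h']

theorem sc_ofComponents (hs : ∀ c ∈ Ls, c ∈ scalarCodes) {c : ℕ} (hc : c ∈ Ls) :
    sc (ofComponents s v Ls Lv) c = s c := by
  rw [sc, ofComponents, code_idxOf_scalar (hs c hc), if_pos hc]

theorem vc_ofComponents (hs : ∀ c ∈ Ls, c ∈ scalarCodes) (hv : ∀ c ∈ Lv, c ∈ vecCodes) {c : ℕ}
    (hc : c ∈ Lv) : vc (ofComponents s v Ls Lv) c = v c := by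
  funext μ
  rw [vc, ofComponents, code_idxOf_vec (hv c hc), if_neg fun h => scalar_ne_vec (hs c h) (hv c hc) rfl,
    if_pos hc, dirn_idxOf μ c (hv c hc)]

theorem Supported.isHomological (hx : Supported x Ls Lv) {d : ℕ} (h : ∀ c ∈ Ls ∪ Lv, hdegM c = d) :
    IsHomological d x := fun b hb => hx.zero b
  (fun hc => hb (by rw [hdeg_eq_hdegM, h _ (Finset.mem_union_left _ hc)]))
  (fun hc => hb (by rw [hdeg_eq_hdegM, h _ (Finset.mem_union_right _ hc)]))

theorem Supported.weight_lorentz (hx : Supported x lorentzCodes ∅) {b : Idx} (hb : b.weight < 2) :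
    x b = 0 := hx.zero b (fun hc => by
  have := BKL.weight_lorentz b.2.dirn b.code hc
  rw [idxOf_code] at this
  omega) (by simp)

/-- The properties of the frame and of the coefficients `p` that are used for gauge fixing. -/
structure GaugeFixable (F : FrameData R) (p : Fin 3 → R) : Prop where
  frame : F.IsFrame
  c_mid : ∀ μ ρ, F.c μ 0 ρ = 0
  c_right : ∀ μ ν, F.c μ ν 0 = 0
  surj : ∀ f, ∃ g, F.D 0 g = f
  unit : ∀ i : Fin 3, IsUnit (p (i + 2) - p (i + 1))

/-- The properties of the constant term of a power series that are used for gauge fixing. -/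
structure IsBase (p : Fin 3 → R) (x : A R) : Prop where
  hom : IsHomological 1 x
  scale : sc x 100 = 0
  time : ∀ μ, vc x 112 μ = if μ = 0 then 1 else 0
  kasner : ∀ i : Fin 3, sc x i.1 = p i

variable {F : FrameData R} {p : Fin 3 → R} {z : A R}

/-- The boost coefficients are read off directly, because θ₀D₀ has coefficient 1 in x. The rotation
coefficients are obtained by dividing by p_k − p_j. -/
theorem exists_lorentz (h : GaugeFixable F p) (hx : IsBase p x) (z : A R) :
    ∃ a : A R, Supported a lorentzCodes ∅ ∧ ∀ i : Fin 3,
      vc (z + aBr F a x) (48 + 2 ^ i.1) 0 = 0 ∧ sc (z + aBr F a x) (15 + i.1) = 0 := by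
  choose w hw using fun i => (h.unit i).exists_right_inv
  have hs := fun c hc => (lorentzCodes_spec c hc).1
  -- Codes 6, 7, 8 are the boosts and 9, 10, 11 the rotations; subtracting 6 or 9 recovers the
  -- spatial index.
  let a : A R := ofComponents (fun c => if c < 9 then -vc z (48 + 2 ^ (c - 6)) 0
    else - (w (Fin.ofNat 3 (c - 9)) * sc z (15 + (c - 9)))) 0 lorentzCodes ∅
  have ha : Supported a lorentzCodes ∅ := ofComponents_supported hs (by simp)
  have m1 : ∀ i : Fin 3, 6 + i.1 ∈ lorentzCodes ∧ 9 + i.1 ∈ lorentzCodes ∧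
    Fin.ofNat 3 (9 + i.1 - 9) = i := by decide +kernel
  refine ⟨a, ha, fun i => ⟨?_, ?_⟩⟩
  · rw [vc_add, component_lorentz_vec ha hx.hom, sc_ofComponents hs (m1 i).1, hx.time, if_pos rfl,
      if_pos (by omega), add_tsub_cancel_left, mul_one, add_neg_cancel]
  · rw [sc_add, component_lorentz ha hx.hom, sc_ofComponents hs (m1 i).2.1, hx.kasner, hx.kasner,
      if_neg (by omega), (m1 i).2.2, add_tsub_cancel_left, mul_neg, ← mul_assoc, hw, one_mul,
      add_neg_cancel]

/-- The equations are triangular. The component along θ₀σ₀ fixes σ₀, those along θ₀D_μ then fix the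
vector field, and Lorentz parameters are chosen last, for what the first two have left. Lorentz
parameters have weight two and do not disturb the earlier components, which have weight zero. -/
theorem exists_reduced (h : GaugeFixable F p) (hx : IsBase p x) (hz : IsHomological 1 z) :
    ∃ a : A R, IsHomological 0 a ∧ IsReduced 0 (z + aBr F a x) := by
  obtain ⟨s, hs⟩ := h.surj (sc z 100)
  -- The extra s compensates for the effect of sσ₀ on θ₀D₀.
  choose u hu using fun μ : Fin 4 => h.surj (vc z 112 μ + if μ = 0 then s else 0)
  have m1 : ∀ c ∈ ({36} : Finset ℕ), c ∈ scalarCodes := by decide +kernel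
  have m2 : ∀ c ∈ ({48} : Finset ℕ), c ∈ vecCodes := by decide +kernel
  let a : A R := ofComponents (fun _ => s) (fun _ => u) {36} {48}
  have ha : Supported a {36} {48} := ofComponents_supported m1 m2
  have hsc : sc a 36 = s := sc_ofComponents m1 (by simp)
  have hvc : vc a 48 = u := vc_ofComponents m1 m2 (by simp)
  obtain ⟨b, hb, hb'⟩ := exists_lorentz h hx (z + aBr F a x)
  have ha0 := ha.isHomological scale_hdegM
  have hb0 := hb.isHomological lorentz_hdegM
  have hw : ∀ b' : Idx, b'.weight < 2 → aBr F b x b' = 0 := fun b' hb' =>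
    aBr_weight F (l := 2) (l' := 0) (fun _ h => hb.weight_lorentz h)
      (fun _ h => absurd h (Nat.not_lt_zero _)) hb'
  have hdir : ∀ f, dir F (vc x 112) f = F.D 0 f := by
    intro f
    simp [dir, hx.time]
  have w1 : (idxOf 0 100).weight < 2 := by decide +kernel
  have w2 : ∀ μ : Fin 4, (idxOf μ 112).weight < 2 := by decide +kernel
  have e : z + aBr F (a + b) x = z + aBr F a x + aBr F b x := by
    rw [← aBrₗ_apply, map_add, LinearMap.add_apply, aBrₗ_apply, aBrₗ_apply, add_assoc]
  refine ⟨a + b, ha0.add hb0, ?_⟩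
  rw [e]
  refine ⟨?_, ?_, fun μ => ?_, fun i => (hb' i).1, fun i => (hb' i).2⟩
  · have h1 := isHomological_aBr F (.inl rfl) ha0 hx.hom
    have h2 := isHomological_aBr F (.inl rfl) hb0 hx.hom
    rw [zero_add] at h1 h2
    exact (hz.add h1).add h2
  · rw [sc_add, sc_add, show sc (aBr F b x) 100 = 0 from hw _ w1, component_scale ha hx.hom,
      hx.scale, hdir, hsc, hs, hvc]
    simp [dir]
  · rw [vc_add, vc_add, show vc (aBr F b x) 112 μ = 0 from hw _ (w2 μ),
      component_scale_vec ha hx.hom, vecBr, hdir, hvc, hsc, hu, hx.time]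
    have h1 : dir F u (if μ = 0 then 1 else 0) = 0 := by
      split_ifs <;> simp [dir]
    -- The vector field in x is ∂₀, which commutes with the frame.
    have h2 : ∑ μ', ∑ ν, F.c μ' ν μ * (u μ' * vc x 112 ν) = 0 := by
      refine Finset.sum_eq_zero fun μ' _ => Finset.sum_eq_zero fun ν _ => ?_
      rw [hx.time]
      split_ifs with h3
      · rw [h3, h.c_mid, zero_mul]
      · rw [mul_zero, mul_zero]
    rw [h1, h2]
    split_ifs <;> ring

end

section
variable {R : Type*} [CommRing R] [Algebra ℝ R]
  {F : FrameData R} {p₀ : R} {p : Fin 3 → R} {m n : ℕ}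

/-! ## Consequences of the Maurer-Cartan equation -/

/-- The coefficient of `θ₀ D₀` in the coefficient of `t^k`. -/
noncomputable def timeCoeff (R : Type*) [CommRing R] (k : Fin m →₀ ℕ) : R := if k = 0 then 1 else 0

theorem sum_antidiagonal_left {j : Fin m →₀ ℕ} (f g : (Fin m →₀ ℕ) → R)
    (h : ∀ q ∈ Finset.HasAntidiagonal.antidiagonal j, q.2 ≠ j → f q.1 * g q.2 = 0) :
    ∑ q ∈ Finset.HasAntidiagonal.antidiagonal j, f q.1 * g q.2 = f 0 * g j := by
  have h0 : ((0 : Fin m →₀ ℕ), j) ∈ Finset.HasAntidiagonal.antidiagonal j :=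
    Finset.HasAntidiagonal.mem_antidiagonal.2 (zero_add j)
  refine (Finset.sum_eq_single (0, j) (fun q hq hne => h q hq fun h2 => hne ?_)
    fun h => absurd h0 h)
  have := Finset.HasAntidiagonal.mem_antidiagonal.1 hq
  rw [h2] at this
  exact Prod.ext (by simpa using this) h2

theorem sum_antidiagonal_right {j : Fin m →₀ ℕ} (f g : (Fin m →₀ ℕ) → R)
    (h : ∀ q ∈ Finset.HasAntidiagonal.antidiagonal j, q.2 ≠ j → f q.1 * g q.2 = 0) :
    ∑ q ∈ Finset.HasAntidiagonal.antidiagonal j, f q.2 * g q.1 = f 0 * g j := by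
  rw [← sum_antidiagonal_left f g h]
  exact Finset.sum_equiv (Equiv.prodComm _ _) (fun q => by
    simp [Finset.HasAntidiagonal.mem_antidiagonal, add_comm]) fun q _ => rfl

theorem smul_two_eq_zero {z : R} (h : z + z = 0) : z = 0 := by
  rw [← two_smul ℝ] at h
  exact (smul_eq_zero.1 h).resolve_left two_ne_zero

theorem IsReduced.isTimeConst {r : R} {x : A R} (hx : IsReduced r x) (hr : ∀ ν, F.D ν r = 0) :
    IsTimeConst F x := ⟨hx.hom, hx.space, fun ν => by rw [hx.time, if_pos rfl, hr]⟩

/-- All these components have ℕ³-degree zero, where the constant term agrees with γ₀. -/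
theorem isBase_of_mem {x : Ser R m n} (hx : x ∈ mcSet F (gamma0 p₀ p) m n) :
    IsBase p (x.coeff 0) := by
  have h0 : (0 : Fin m →₀ ℕ).degree ≤ n := by simp
  have hγ := gamma0_isNormal p₀ p
  have e : ∀ b : Idx, b.deg = 0 → x.coeff 0 b = gamma0 p₀ p b := by
    intro b hb
    have := hx.2 b hb
    rw [coeff_of_le _ h0, Pi.sub_apply, Pi.sub_apply, Ser.const, if_pos rfl, sub_eq_zero] at this
    rw [coeff_of_le _ h0, this]
  refine ⟨isHomological_coeff hx.1.1 0, ?_, fun μ => ?_, fun i => ?_⟩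
  · rw [← hγ.scale]; exact e _ (by decide +kernel)
  · rw [← hγ.time]; exact e _ (by revert μ; decide +kernel)
  · rw [← gamma0_kasner p₀ p]; exact e _ (by revert i; decide +kernel)

/-- The Maurer-Cartan equation implies that a reduced coefficient is in the gauge subspace. -/
theorem isNormal_of_mem (h : GaugeFixable F p) {x : Ser R m n}
    (hx : x ∈ mcSet F (gamma0 p₀ p) m n) {j : Fin m →₀ ℕ} (hjn : j.degree ≤ n)
    (hlow : ∀ k : Fin m →₀ ℕ, k.degree < j.degree → IsNormal (timeCoeff R k) (x.coeff k))
    (hj : IsReduced (timeCoeff R j) (x.coeff j)) : IsNormal (timeCoeff R j) (x.coeff j) := by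
  have hD : ∀ (k : Fin m →₀ ℕ) ν, F.D ν (timeCoeff R k) = 0 := by
    intro k ν
    rw [timeCoeff]
    split_ifs <;> simp
  have hq : ∀ q ∈ Finset.HasAntidiagonal.antidiagonal j,
      (q.1 = j ∨ q.1.degree < j.degree) ∧ (q.2 = j ∨ q.2.degree < j.degree) := by
    intro q hq
    have h1 := degree_of_mem hq
    have h2 := Finset.HasAntidiagonal.mem_antidiagonal.1 hq
    constructor
    · by_cases h3 : q.2 = 0
      · left; rw [← h2, h3, add_zero]
      · right; have := (Finsupp.degree_eq_zero_iff q.2).not.2 h3; omega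
    · by_cases h3 : q.1 = 0
      · left; rw [← h2, h3, zero_add]
      · right; have := (Finsupp.degree_eq_zero_iff q.1).not.2 h3; omega
  have hred : ∀ k : Fin m →₀ ℕ, k = j ∨ k.degree < j.degree →
      IsReduced (timeCoeff R k) (x.coeff k) := by
    rintro k (rfl | hk)
    · exact hj
    · exact (hlow k hk).toIsReduced
  have hmc : ∑ q ∈ Finset.HasAntidiagonal.antidiagonal j, aBr F (x.coeff q.1) (x.coeff q.2) = 0 :=
    congrFun hx.1.2 ⟨j, hjn⟩
  have hsum : ∀ (b : Idx), ∑ q ∈ Finset.HasAntidiagonal.antidiagonal j,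
      aBr F (x.coeff q.1) (x.coeff q.2) b = 0 := by
    intro b
    rw [← Finset.sum_apply, hmc, Pi.zero_apply]
  have htime : ∀ k : Fin m →₀ ℕ, k = j ∨ k.degree < j.degree →
      vc (x.coeff k) 112 0 = timeCoeff R k := fun k hk => by rw [(hred k hk).time, if_pos rfl]
  have hconst : ∀ k : Fin m →₀ ℕ, k = j ∨ k.degree < j.degree → IsTimeConst F (x.coeff k) :=
    fun k hk => (hred k hk).isTimeConst (hD k)
  -- The coefficient of θ₀D₀ is 1 in order zero and 0 otherwise, so the convolution leaves twice the
  -- component of the coefficient of t^j.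
  have key : ∀ l : ℕ, (∑ q ∈ Finset.HasAntidiagonal.antidiagonal j,
      (sc (x.coeff q.1) l * vc (x.coeff q.2) 112 0 + sc (x.coeff q.2) l * vc (x.coeff q.1) 112 0)
      = 0) → sc (x.coeff j) l = 0 := by
    intro l hl
    have e1 : ∑ q ∈ Finset.HasAntidiagonal.antidiagonal j,
      (sc (x.coeff q.1) l * vc (x.coeff q.2) 112 0 + sc (x.coeff q.2) l * vc (x.coeff q.1) 112 0)
      = ∑ q ∈ Finset.HasAntidiagonal.antidiagonal j, timeCoeff R q.2 * sc (x.coeff q.1) l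
        + ∑ q ∈ Finset.HasAntidiagonal.antidiagonal j, timeCoeff R q.1 * sc (x.coeff q.2) l := by
      rw [← Finset.sum_add_distrib]
      refine Finset.sum_congr rfl fun q hq' => ?_
      rw [htime _ (hq q hq').1, htime _ (hq q hq').2]
      ring
    have h0 : ∀ q ∈ Finset.HasAntidiagonal.antidiagonal j, q.2 ≠ j →
        timeCoeff R q.1 * sc (x.coeff q.2) l = 0 := by
      intro q hq' hne
      rw [timeCoeff, if_neg, zero_mul]
      intro h1
      have := Finset.HasAntidiagonal.mem_antidiagonal.1 hq'
      rw [h1, zero_add] at this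
      exact hne this
    rw [e1, sum_antidiagonal_left _ (fun k => sc (x.coeff k) l) h0,
      sum_antidiagonal_right _ (fun k => sc (x.coeff k) l) h0] at hl
    have := smul_two_eq_zero hl
    rwa [timeCoeff, if_pos rfl, one_mul] at this
  have hboost : ∀ i : Fin 3, sc (x.coeff j) (70 + i.1) = 0 := by
    intro i
    refine key _ ?_
    rw [← hsum (idxOf 0 (112 + 2 ^ i.1))]
    exact Finset.sum_congr rfl fun q hq' =>
      (component_boost h.c_right (hconst _ (hq q hq').1) (hconst _ (hq q hq').2) i).symm
  have hasym : ∀ i : Fin 3, sc (x.coeff j) (27 + i.1) = 0 := by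
    intro i
    refine key _ ?_
    have h1 : ∑ q ∈ Finset.HasAntidiagonal.antidiagonal j,
        vc (aBr F (x.coeff q.1) (x.coeff q.2)) (55 - 2 ^ i.1) 0 = 0 := hsum _
    rw [Finset.sum_congr rfl fun q hq' =>
      component_asym h.c_right (hconst _ (hq q hq').1) (hconst _ (hq q hq').2) i,
      ← Finset.mul_sum] at h1
    have h2 : ((2 * (-1) ^ i.1 : ℤ) : ℝ) ≠ 0 := by
      push_cast
      exact mul_ne_zero two_ne_zero (pow_ne_zero _ (by norm_num))
    have h3 : ∀ w : R, ((2 * (-1) ^ i.1 : ℤ) : R) * w = ((2 * (-1) ^ i.1 : ℤ) : ℝ) • w := by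
      intro w
      rw [Algebra.smul_def, map_intCast]
    rw [h3] at h1
    exact (smul_eq_zero.1 h1).resolve_left h2
  -- Only now, with the boost and antisymmetric components gone, does the equation for the rotations
  -- lose all other contributions.
  have hsupp : ∀ k : Fin m →₀ ℕ, k = j ∨ k.degree < j.degree →
      Supported (x.coeff k) gaugeRotCodes oneVecCodes := by
    intro k hk
    have hs := (hred k hk).hom.supported
    have hb : ∀ i : Fin 3, sc (x.coeff k) (70 + i.1) = 0 := by
      rcases hk with rfl | hk
      · exact hboost
      · exact (hlow k hk).boost
    have ha : ∀ i : Fin 3, sc (x.coeff k) (27 + i.1) = 0 := by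
      rcases hk with rfl | hk
      · exact hasym
      · exact (hlow k hk).asym
    refine ⟨fun c hc => hs.scalar c (gaugeRotCodes_one c hc), hs.vec, fun b h1 h2 => ?_⟩
    by_cases h3 : b.code ∈ oneCodes
    · have e : ∀ {c}, b.code = c → sc (x.coeff k) c = x.coeff k b := by
        rintro c rfl
        rw [sc, ← idxOf_scalar (hs.scalar _ h3) b.2.dirn, idxOf_code]
      rcases gaugeRot_or _ h3 with h4 | h4 | ⟨i, h4 | h4 | h4⟩
      · exact absurd h4 h1
      · rw [← e h4, (hred k hk).scale]
      · rw [← e h4, hb]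
      · rw [← e h4, (hred k hk).sym]
      · rw [← e h4, ha]
    · exact hs.zero b h3 h2
  have hrot : ∀ i : Fin 3, sc (x.coeff j) (73 + i.1) = 0 := by
    intro i
    have h1 := hsum (idxOf 0 (79 + i.1))
    have e1 : ∑ q ∈ Finset.HasAntidiagonal.antidiagonal j,
        aBr F (x.coeff q.1) (x.coeff q.2) (idxOf 0 (79 + i.1))
      = ∑ q ∈ Finset.HasAntidiagonal.antidiagonal j,
          (sc (x.coeff q.1) (i + 2).1 - sc (x.coeff q.1) (i + 1).1) * sc (x.coeff q.2) (73 + i.1)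
        + ∑ q ∈ Finset.HasAntidiagonal.antidiagonal j,
          (sc (x.coeff q.2) (i + 2).1 - sc (x.coeff q.2) (i + 1).1)
            * sc (x.coeff q.1) (73 + i.1) := by
      rw [← Finset.sum_add_distrib]
      exact Finset.sum_congr rfl fun q hq' =>
        component_rot (hsupp _ (hq q hq').1) (hsupp _ (hq q hq').2) i
    -- Components along θ₀σ_{jk} vanish in lower orders, so the other factor is taken in order zero
    -- and equals p_k − p_j.
    have h0 : ∀ q ∈ Finset.HasAntidiagonal.antidiagonal j, q.2 ≠ j →
        (sc (x.coeff q.1) (i + 2).1 - sc (x.coeff q.1) (i + 1).1) * sc (x.coeff q.2) (73 + i.1)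
          = 0 := by
      intro q hq' hne
      rw [(hlow _ ((hq q hq').2.resolve_left hne)).rot, mul_zero]
    rw [e1, sum_antidiagonal_left (fun k => sc (x.coeff k) (i + 2).1 - sc (x.coeff k) (i + 1).1)
      (fun k => sc (x.coeff k) (73 + i.1)) h0,
      sum_antidiagonal_right (fun k => sc (x.coeff k) (i + 2).1 - sc (x.coeff k) (i + 1).1)
      (fun k => sc (x.coeff k) (73 + i.1)) h0] at h1
    have h2 := smul_two_eq_zero h1
    have hb := isBase_of_mem hx
    rw [hb.kasner, hb.kasner] at h2
    exact (h.unit i).mul_right_eq_zero.1 h2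
  exact ⟨hj, hboost, hrot, hasym⟩

end

section
variable {R : Type*} [CommRing R] [Algebra ℝ R]
  {F : FrameData R} {p₀ : R} {p : Fin 3 → R} {m n : ℕ}

/-! ## Gauge fixing -/

/-- The order of a coefficient of a power series. -/
noncomputable def orderWeight (m n : ℕ) (k : {k : Fin m →₀ ℕ // k.degree ≤ n}) (_ : Idx) : ℕ :=
  k.1.degree

/-- Terms that are at least quadratic in Z raise the weight by more than k. -/
theorem nexp_approx {J I M : Type*} [AddCommGroup M] [Module ℝ M] {w : J → I → ℕ} {N k : ℕ}
    (hk : 1 ≤ k) (hN : 1 ≤ N) {Z : Module.End ℝ (J → I → M)} (hZ : Z ∈ raising M w k)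
    (x : J → I → M) {j : J} {i : I} (h : w j i ≤ k) : nexp N Z x j i = x j i + Z x j i := by
  have h1 := nexp_add_sub_mem hk hN (zero_mem _) hZ
  rw [zero_add, nexp_zero] at h1
  have h2 := h1 0 x (fun j i hj => absurd hj (Nat.not_lt_zero _)) j i (by omega)
  rw [LinearMap.sub_apply, LinearMap.sub_apply, Module.End.one_apply, Pi.sub_apply, Pi.sub_apply,
    Pi.sub_apply, Pi.sub_apply, sub_sub, sub_eq_zero] at h2
  exact h2

/-- A power series whose coefficients are concentrated in one order. -/
noncomputable def homogeneous (k : ℕ) (α : {k : Fin m →₀ ℕ // k.degree ≤ n} → A R) : Ser R m n :=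
  fun j => if j.1.degree = k then α j else 0

variable {k : ℕ} {α : {k : Fin m →₀ ℕ // k.degree ≤ n} → A R}

theorem coeff_homogeneous_of_ne {q : Fin m →₀ ℕ} (hq : q.degree ≠ k) :
    (homogeneous k α).coeff q = 0 := by
  rw [Ser.coeff]
  split_ifs
  · exact if_neg hq
  · rfl

theorem serBr_homogeneous (x : Ser R m n) (j : {k : Fin m →₀ ℕ // k.degree ≤ n}) :
    (j.1.degree < k → serBr F (homogeneous k α) x j = 0) ∧
    (j.1.degree = k → serBr F (homogeneous k α) x j = aBr F (α j) (x.coeff 0)) := by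
  constructor
  · intro hj
    refine Finset.sum_eq_zero fun q hq => ?_
    have := degree_of_mem hq
    rw [coeff_homogeneous_of_ne (by omega), ← aBrₗ_apply, map_zero, LinearMap.zero_apply]
  · intro hj
    rw [serBr, Finset.sum_eq_single (j.1, 0)]
    · simp only
      rw [coeff_val, homogeneous, if_pos hj]
    · intro q hq hne
      have h1 := degree_of_mem hq
      have h2 : q.1.degree ≠ k := by
        intro h3
        refine hne (Prod.ext ?_ ((Finsupp.degree_eq_zero_iff q.2).1 (by omega)))
        have h4 := Finset.HasAntidiagonal.mem_antidiagonal.1 hq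
        rwa [(Finsupp.degree_eq_zero_iff q.2).1 (by omega), add_zero] at h4
      rw [coeff_homogeneous_of_ne h2, ← aBrₗ_apply, map_zero, LinearMap.zero_apply]
    · intro h
      exact absurd (Finset.HasAntidiagonal.mem_antidiagonal.2 (add_zero _)) h

/-- Measured by the order in t alone, rather than by the full weight, a parameter concentrated in
order k shifts by k. This makes the gauge transformation linear through order k when k is positive.
-/
theorem homogeneous_raising : serBrₗ F m n (homogeneous k α) ∈ raising R (orderWeight m n) k := by
  intro l x hx j b hj
  have hj' : j.1.degree < l + k := hj
  have : serBr F (homogeneous k α) x j = 0 := by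
    refine Finset.sum_eq_zero fun q hq => ?_
    have h1 := degree_of_mem hq
    by_cases h2 : q.1.degree = k
    · have h3 : Ser.coeff (n := n) x q.2 = 0 := by
        rw [Ser.coeff]
        split_ifs with h
        · funext b
          exact hx ⟨q.2, h⟩ b (show q.2.degree < l by omega)
        · rfl
      rw [h3, ← aBrₗ_apply, map_zero]
    · rw [coeff_homogeneous_of_ne h2, ← aBrₗ_apply, map_zero, LinearMap.zero_apply]
  rw [serBrₗ_apply, this, Pi.zero_apply]

theorem homogeneous_isGaugeParameter (hα : ∀ j, IsHomological 0 (α j))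
    (h0 : k = 0 → ∀ j, IsPositive (α j)) : (homogeneous k α).IsGaugeParameter := by
  refine ⟨fun j => ?_, fun b hb => ?_⟩
  · rw [homogeneous]
    split_ifs
    · exact hα j
    · exact isHomological_zero
  · rw [coeff_of_le _ (by simp), homogeneous]
    split_ifs with h
    · exact h0 (by simpa using h.symm) _ b hb
    · rfl

theorem timeCoeff_of_pos {j : Fin m →₀ ℕ} (hj : 1 ≤ j.degree) : timeCoeff R j = 0 := by
  rw [timeCoeff, if_neg]
  rintro rfl
  simp at hj

/-- Gauge fixing of the terms of one order. -/
theorem exists_gauge_step (h : GaugeFixable F p) {x : Ser R m n}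
    (hx : x ∈ mcSet F (gamma0 p₀ p) m n)
    (hlow : ∀ j : Fin m →₀ ℕ, j.degree < k → j.degree ≤ n → IsNormal (timeCoeff R j) (x.coeff j)) :
    ∃ a : Ser R m n, a.IsGaugeParameter ∧ (∀ j, j.1.degree ≠ k → a j = 0) ∧
      ∀ j : Fin m →₀ ℕ, j.degree ≤ k → j.degree ≤ n →
        IsNormal (timeCoeff R j) ((serExp F a x).coeff j) := by
  have hbase := isBase_of_mem hx
  have hN : 1 ≤ n + 6 := by omega
  -- it suffices to reduce the terms of order `k`
  suffices ∃ α : {k : Fin m →₀ ℕ // k.degree ≤ n} → A R,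
      (homogeneous k α).IsGaugeParameter ∧
      (∀ j : {k : Fin m →₀ ℕ // k.degree ≤ n}, j.1.degree < k →
        serExp F (homogeneous k α) x j = x j) ∧
      (∀ j : {k : Fin m →₀ ℕ // k.degree ≤ n}, j.1.degree = k →
        serExp F (homogeneous k α) x ∈ mcSet F (gamma0 p₀ p) m n →
        IsReduced (timeCoeff R j.1) (serExp F (homogeneous k α) x j)) by
    obtain ⟨α, h1, h2, h3⟩ := this
    have hx' := serExp_mem_mcSet h.frame h1 hx
    have hlow' : ∀ j : Fin m →₀ ℕ, j.degree < k → j.degree ≤ n →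
        IsNormal (timeCoeff R j) ((serExp F (homogeneous k α) x).coeff j) := by
      intro j hj hjn
      rw [coeff_of_le _ hjn, h2 ⟨j, hjn⟩ hj, ← coeff_of_le x hjn]
      exact hlow j hj hjn
    refine ⟨_, h1, fun j hj => if_neg hj, fun j hj hjn => ?_⟩
    rcases hj.lt_or_eq with hj | hj
    · exact hlow' j hj hjn
    · refine isNormal_of_mem h hx' hjn (fun k hk => hlow' k (by omega) (by omega)) ?_
      rw [coeff_of_le _ hjn]
      exact h3 ⟨j, hjn⟩ hj hx'
  -- In order zero the parameter does not raise the order in t. There the ℕ³-degree is used instead: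
  -- boosts and rotations have weight two, so the exponential is linear in the components of weight
  -- at most two, which include all those to be removed.
  rcases Nat.eq_zero_or_pos k with rfl | hk
  · obtain ⟨a, ha, ha'⟩ := exists_lorentz h hbase (x.coeff 0)
    have hg : (homogeneous 0 fun _ => a : Ser R m n).IsGaugeParameter :=
      homogeneous_isGaugeParameter (fun _ => ha.isHomological lorentz_hdegM)
        fun _ _ b hb => ha.weight_lorentz (by rw [weight_eq_zero_iff.2 hb]; omega)
    refine ⟨fun _ => a, hg, fun j hj => absurd hj (Nat.not_lt_zero _), fun j hj hx' => ?_⟩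
    have hj0 : j.1 = 0 := (Finsupp.degree_eq_zero_iff _).1 hj
    have hbase' := isBase_of_mem hx'
    have hra : serBrₗ F m n (homogeneous 0 fun _ => a) ∈ raising R (serWeight m n) 2 := by
      intro l y hy
      rw [add_comm]
      refine serBr_mem_filt F (fun j b hb => ?_) hy
      rw [homogeneous]
      split_ifs
      · exact ha.weight_lorentz (by have : j.1.degree + b.weight < 2 := hb; omega)
      · rfl
    have happ : ∀ b : Idx, b.weight ≤ 2 → serExp F (homogeneous 0 fun _ => a) x j b
        = (x.coeff 0 + aBr F a (x.coeff 0)) b := by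
      intro b hb
      rw [serExp_eq h.frame hg, nexp_approx (by omega) hN hra x
        (show j.1.degree + b.weight ≤ 2 by omega), serBrₗ_apply, (serBr_homogeneous x j).2 hj,
        Pi.add_apply, ← hj0, coeff_val]
    have hc : serExp F (homogeneous 0 fun _ => a) x j
        = (serExp F (homogeneous 0 fun _ => a) x).coeff 0 := by rw [← hj0, coeff_val]
    have w1 : ∀ i : Fin 3, (idxOf 0 (48 + 2 ^ i.1)).weight ≤ 2 := by decide +kernel
    have w2 : ∀ i : Fin 3, (idxOf 0 (15 + i.1)).weight ≤ 2 := by decide +kernel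
    refine ⟨hx'.1.1 j, ?_, fun μ => ?_, fun i => ?_, fun i => ?_⟩
    · rw [hc, hbase'.scale]
    · rw [hc, hbase'.time, hj0, timeCoeff, if_pos rfl]
    · rw [← (ha' i).1]; exact happ _ (w1 i)
    · rw [← (ha' i).2]; exact happ _ (w2 i)
  -- For positive order each coefficient of total degree k is treated separately: it only sees the
  -- constant term of x.
  · choose α hα hα' using fun j => exists_reduced h hbase (hx.1.1 j)
    have hg : (homogeneous k α).IsGaugeParameter :=
      homogeneous_isGaugeParameter hα fun h0 => absurd h0 (by omega)
    have happ : ∀ j : {k : Fin m →₀ ℕ // k.degree ≤ n}, j.1.degree ≤ k →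
        serExp F (homogeneous k α) x j = x j + serBr F (homogeneous k α) x j := by
      intro j hj
      funext b
      rw [serExp_eq h.frame hg, nexp_approx hk hN homogeneous_raising x (show j.1.degree ≤ k from hj)]
      rfl
    refine ⟨α, hg, fun j hj => ?_, fun j hj _ => ?_⟩
    · rw [happ j hj.le, (serBr_homogeneous x j).1 hj, add_zero]
    · rw [happ j hj.le, (serBr_homogeneous x j).2 hj, timeCoeff_of_pos (by omega)]
      exact hα' j

theorem sub_const_apply (x : Ser R m n) (γ : A R) (j : {k : Fin m →₀ ℕ // k.degree ≤ n}) :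
    (x - Ser.const γ : Ser R m n) j = x j - if j.1 = 0 then γ else 0 := rfl

theorem isGauge_sub_iff {x : Ser R m n} {j : {k : Fin m →₀ ℕ // k.degree ≤ n}}
    (hx : IsHomological 1 (x j)) : IsGauge ((x - Ser.const (gamma0 p₀ p) : Ser R m n) j) ↔
      IsNormal (timeCoeff R j.1) (x j) := by
  have hγ : IsNormal (timeCoeff R j.1) (if j.1 = 0 then gamma0 p₀ p else 0) := by
    rw [timeCoeff]
    split_ifs
    · exact gamma0_isNormal p₀ p
    · exact IsGauge.isNormal (fun _ _ => rfl) isHomological_zero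
  rw [sub_const_apply]
  constructor
  · intro h
    have hh : IsHomological 1 (x j - if j.1 = 0 then gamma0 p₀ p else 0) := by
      rw [sub_eq_add_neg]
      exact hx.add hγ.neg.hom
    have := (h.isNormal hh).add hγ
    rwa [zero_add, sub_add_cancel] at this
  · intro h
    have := h.add hγ.neg
    rw [add_neg_cancel, ← sub_eq_add_neg] at this
    exact this.isGauge

theorem mem_gaugedSet_of {x : Ser R m n} (hx : x ∈ mcSet F (gamma0 p₀ p) m n)
    (h : ∀ j : Fin m →₀ ℕ, j.degree ≤ n → IsNormal (timeCoeff R j) (x.coeff j)) :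
    x ∈ gaugedSet F (gamma0 p₀ p) m n := by
  refine ⟨hx, fun j => (isGauge_sub_iff (hx.1.1 j)).2 ?_⟩
  rw [← coeff_val x j]
  exact h j.1 j.2

/-- If the terms of lower order are gauged, then the terms of top order can be gauged. -/
theorem exists_top_gauge (h : GaugeFixable F p) (hn : 1 ≤ n) {x : Ser R m n}
    (hx : x ∈ mcSet F (gamma0 p₀ p) m n) (hlow : ∀ k, k.1.degree < n →
      IsGauge ((x - Ser.const (gamma0 p₀ p) : Ser R m n) k)) :
    ∃ a : Ser R m n, a.IsTopGaugeParameter ∧ serExp F a x ∈ gaugedSet F (gamma0 p₀ p) m n := by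
  obtain ⟨a, h1, h2, h3⟩ := exists_gauge_step (k := n) h hx fun j hj hjn => by
    rw [coeff_of_le x hjn]
    exact (isGauge_sub_iff (hx.1.1 ⟨j, hjn⟩)).1 (hlow ⟨j, hjn⟩ hj)
  exact ⟨a, ⟨h1.1, fun k hk => h2 k hk.ne⟩,
    mem_gaugedSet_of (serExp_mem_mcSet h.frame h1 hx) fun j hj => h3 j hj hj⟩

/-- Every orbit of the group of gauge transformations contains a gauged element. -/
theorem exists_gauged (h : GaugeFixable F p) {G : Subgroup (Equiv.Perm (Ser R m n))}
    (hG : ∀ g ∈ G, ∃ a : Ser R m n, a.IsGaugeParameter ∧ ⇑g = serExp F a)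
    (hG' : ∀ a : Ser R m n, a.IsGaugeParameter → ∃ g ∈ G, ⇑g = serExp F a)
    {x : Ser R m n} (hx : x ∈ mcSet F (gamma0 p₀ p) m n) :
    ∃ y ∈ gaugedSet F (gamma0 p₀ p) m n, ∃ g ∈ G, g y = x := by
  -- Induction on the number of orders that are already gauged, composing the corrections inside the
  -- group; the orbit statement uses the inverse of the result.
  have key : ∀ k, ∃ g ∈ G, ∀ j : Fin m →₀ ℕ, j.degree < k → j.degree ≤ n →
      IsNormal (timeCoeff R j) ((g x).coeff j) := by
    intro k
    induction k with
    | zero => exact ⟨1, one_mem _, fun j hj => absurd hj (Nat.not_lt_zero _)⟩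
    | succ k ih =>
      obtain ⟨g, hg, h1⟩ := ih
      obtain ⟨a, ha, hga⟩ := hG g hg
      obtain ⟨b, hb, -, h2⟩ := exists_gauge_step (k := k) h
        (show g x ∈ mcSet F (gamma0 p₀ p) m n by rw [hga]; exact serExp_mem_mcSet h.frame ha hx) h1
      obtain ⟨g', hg', hgb⟩ := hG' b hb
      refine ⟨g' * g, mul_mem hg' hg, fun j hj hjn => ?_⟩
      rw [Equiv.Perm.mul_apply, hgb]
      exact h2 j (by omega) hjn
  obtain ⟨g, hg, h1⟩ := key (n + 1)
  obtain ⟨a, ha, hga⟩ := hG g hg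
  have hgx : g x ∈ mcSet F (gamma0 p₀ p) m n := by
    rw [hga]
    exact serExp_mem_mcSet h.frame ha hx
  exact ⟨g x, mem_gaugedSet_of hgx fun j hj => h1 j (by omega) hj, g⁻¹, inv_mem hg, by simp⟩

end

/-! ## Integrals depending on a parameter in a convex set -/

section ParametricIntegral
open Set MeasureTheory Topology
variable {E F : Type} [NormedAddCommGroup E] [NormedSpace ℝ E]
  [NormedAddCommGroup F] [NormedSpace ℝ F]

theorem intervalIntegrable_slice {G : E × ℝ → F} {s : Set E}
    (hG : ContinuousOn G (s ×ˢ Icc 0 1)) {x : E} (hx : x ∈ s) :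
    IntervalIntegrable (fun u => G (x, u)) volume 0 1 := by
  refine ContinuousOn.intervalIntegrable ?_
  rw [uIcc_of_le zero_le_one]
  exact hG.comp (by fun_prop) fun u hu => ⟨hx, hu⟩

/-- Since [0,1] is compact, the derivative of the integrand at y is close to that at x uniformly in
the integration variable. The mean value inequality on the convex set near x then bounds the
remainder of the integrand. No openness of s is used, so boundary points are included. -/
theorem hasFDerivWithinAt_integral_of_convex [CompleteSpace F] {G : E × ℝ → F}
    {G' : E × ℝ → E →L[ℝ] F} {s : Set E} (hs : Convex ℝ s)
    (hG : ContinuousOn G (s ×ˢ Icc 0 1)) (hG' : ContinuousOn G' (s ×ˢ Icc 0 1))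
    (hd : ∀ x ∈ s, ∀ u ∈ Icc (0 : ℝ) 1, HasFDerivWithinAt (fun y => G (y, u)) (G' (x, u)) s x)
    {x : E} (hx : x ∈ s) :
    HasFDerivWithinAt (fun y => ∫ u in (0 : ℝ)..1, G (y, u))
      (∫ u in (0 : ℝ)..1, G' (x, u)) s x := by
  rw [hasFDerivWithinAt_iff_isLittleO, Asymptotics.isLittleO_iff]
  intro c hc
  obtain ⟨v, hv, hvc⟩ := IsCompact.mem_uniformity_of_prod (f := fun y u => G' (y, u)) isCompact_Icc
    hG' hx (Metric.dist_mem_uniformity hc)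
  obtain ⟨r, hr, hrv⟩ := Metric.mem_nhdsWithin_iff.1 hv
  filter_upwards [Metric.mem_nhdsWithin_iff.2 ⟨r, hr, subset_rfl⟩] with y hy
  have hys : y ∈ s := hy.2
  have hI : (∫ u in (0 : ℝ)..1, G' (x, u)) (y - x) = ∫ u in (0 : ℝ)..1, G' (x, u) (y - x) :=
    ContinuousLinearMap.intervalIntegral_apply (intervalIntegrable_slice hG' hx) _
  have hcont : ContinuousOn (fun q : E × ℝ => G' q (y - x)) (s ×ˢ Icc 0 1) :=
    hG'.clm_apply continuousOn_const
  rw [hI, ← intervalIntegral.integral_sub (intervalIntegrable_slice hG hys)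
    (intervalIntegrable_slice hG hx), ← intervalIntegral.integral_sub
    ((intervalIntegrable_slice hG hys).sub (intervalIntegrable_slice hG hx))
    (intervalIntegrable_slice hcont hx)]
  refine (intervalIntegral.norm_integral_le_of_norm_le_const (C := c * ‖y - x‖) fun u hu => ?_).trans
    (by simp)
  rw [uIoc_of_le zero_le_one] at hu
  have hu' : u ∈ Icc (0 : ℝ) 1 := ⟨hu.1.le, hu.2⟩
  -- Intersecting with a ball keeps convexity and makes the uniform bound available along the whole
  -- segment.
  refine Convex.norm_image_sub_le_of_norm_hasFDerivWithin_le' (s := Metric.ball x r ∩ s)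
    (f := fun z => G (z, u)) (f' := fun z => G' (z, u))
    (fun z hz => (hd z hz.2 u hu').mono inter_subset_right) (fun z hz => ?_)
    ((convex_ball x r).inter hs) ⟨Metric.mem_ball_self hr, hx⟩ hy
  have := hvc z (hrv hz) u hu'
  simp only [mem_ofPred_eq, dist_eq_norm] at this
  exact this.le

/-- Induction on the order: the derivative is again a parametric integral, of the partial derivative
of the integrand. The target space changes, hence the generalization over it. -/
theorem contDiffOn_integral_of_convex [CompleteSpace F] {G : E × ℝ → F} {s : Set E}
    (hs : Convex ℝ s) (hu : UniqueDiffOn ℝ s) (n : ℕ)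
    (hG : ContDiffOn ℝ n G (s ×ˢ Icc 0 1)) :
    ContDiffOn ℝ n (fun y => ∫ u in (0 : ℝ)..1, G (y, u)) s := by
  induction n generalizing F with
  | zero =>
    have hG' : ContinuousOn G (s ×ˢ Icc 0 1) := hG.continuousOn
    rw [Nat.cast_zero, contDiffOn_zero]
    intro x hx
    rw [ContinuousWithinAt, Metric.tendsto_nhds]
    intro c hc
    obtain ⟨v, hv, hvc⟩ := IsCompact.mem_uniformity_of_prod (f := fun y u => G (y, u))
      isCompact_Icc hG' hx (Metric.dist_mem_uniformity (half_pos hc))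
    filter_upwards [hv, self_mem_nhdsWithin] with y hy hys
    rw [dist_eq_norm, ← intervalIntegral.integral_sub (intervalIntegrable_slice hG' hys)
      (intervalIntegrable_slice hG' hx)]
    refine (intervalIntegral.norm_integral_le_of_norm_le_const (C := c / 2)
      fun u hu => ?_).trans_lt (by simpa using by linarith)
    rw [uIoc_of_le zero_le_one] at hu
    have := hvc y hy u ⟨hu.1.le, hu.2⟩
    simp only [mem_ofPred_eq, dist_eq_norm] at this
    exact this.le
  | succ n ih =>
    have hI : UniqueDiffOn ℝ (s ×ˢ Icc (0 : ℝ) 1) := hu.prod (uniqueDiffOn_Icc zero_lt_one)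
    have hD := (contDiffOn_succ_iff_fderivWithin (n := (n : ℕ∞ω)) hI).1 (by exact_mod_cast hG)
    set G' : E × ℝ → E →L[ℝ] F := fun q =>
      (fderivWithin ℝ G (s ×ˢ Icc 0 1) q).comp (ContinuousLinearMap.inl ℝ E ℝ) with hG'
    have hc : ContDiffOn ℝ n G' (s ×ˢ Icc 0 1) := hD.2.2.clm_comp contDiffOn_const
    have := (contDiffOn_succ_iff_hasFDerivWithinAt_of_uniqueDiffOn (n := (n : ℕ∞ω))
      (f := fun y => ∫ u in (0 : ℝ)..1, G (y, u)) hu).2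
      ⟨by simp, _, ih hc, fun x hx => hasFDerivWithinAt_integral_of_convex hs hG.continuousOn
        hc.continuousOn (fun y hy u hu => ?_) hx⟩
    · exact_mod_cast this
    · exact ((hD.1 (y, u) ⟨hy, hu⟩).hasFDerivWithinAt).comp y
        (hasFDerivAt_prodMk_left y u).hasFDerivWithinAt fun z (hz : z ∈ s) => (⟨hz, hu⟩ : (z, u) ∈ s ×ˢ Icc (0 : ℝ) 1)

end ParametricIntegral

/-! ## Vector fields as differential operators -/

section VectorField
open Set Topology VectorField

variable {E : Type*} [NormedAddCommGroup E] [NormedSpace ℝ E] {H : Type*} [TopologicalSpace H]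
  {I : ModelWithCorners ℝ E H} {M : Type*} [TopologicalSpace M] [ChartedSpace H M]

/-- Chain rule in a chart: differentiating the coordinate expression along the pulled back vector
field is differentiating the function along the vector field. -/
theorem fderivWithin_comp_extChartAt_symm [IsManifold I 1 M] {g : M → ℝ} (x : M) {z : E}
    (hz : z ∈ (extChartAt I x).target)
    (hg : MDifferentiableAt I 𝓘(ℝ, ℝ) g ((extChartAt I x).symm z)) (V : Π y : M, TangentSpace I y) :
    fderivWithin ℝ (g ∘ (extChartAt I x).symm) (range I) z
      (mpullbackWithin 𝓘(ℝ, E) I (extChartAt I x).symm V (range I) z) =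
    mvfderiv I g ((extChartAt I x).symm z) (V ((extChartAt I x).symm z)) := by
  have hzr : z ∈ range I := extChartAt_target_subset_range x hz
  have h1 := mfderivWithin_comp (I := 𝓘(ℝ, E)) (I' := I) (I'' := 𝓘(ℝ, ℝ)) (s := range I) (u := univ) z
    (g := g) (f := (extChartAt I x).symm) hg.mdifferentiableWithinAt
    (mdifferentiableWithinAt_extChartAt_symm hz) (fun _ _ => mem_univ _)
    (I.uniqueMDiffOn z hzr)
  rw [mfderivWithin_univ, mfderivWithin_eq_fderivWithin] at h1
  rw [h1, mpullbackWithin_apply]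
  have h2 := (isInvertible_mfderivWithin_extChartAt_symm hz).self_comp_inverse
  have h3 := congrArg (fun T => T (V ((extChartAt I x).symm z))) h2
  exact congrArg (mfderiv I 𝓘(ℝ, ℝ) g ((extChartAt I x).symm z)) h3

/-- In a chart this is the commutator formula for derivatives within the range of the model, which
rests on the symmetry of second derivatives. The range has unique differentials and lies in the
closure of its interior, so points on the boundary are allowed. -/
theorem mvfderiv_mlieBracket [CompleteSpace E] [IsManifold I ∞ M] {f : M → ℝ}
    (hf : ContMDiff I 𝓘(ℝ, ℝ) ∞ f) {V W : Π y : M, TangentSpace I y}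
    (hV : ContMDiff I I.tangent ∞ fun y => (⟨y, V y⟩ : TangentBundle I M))
    (hW : ContMDiff I I.tangent ∞ fun y => (⟨y, W y⟩ : TangentBundle I M))
    (hVf : ContMDiff I 𝓘(ℝ, ℝ) ∞ fun y => mvfderiv I f y (V y))
    (hWf : ContMDiff I 𝓘(ℝ, ℝ) ∞ fun y => mvfderiv I f y (W y)) (x : M) :
    mvfderiv I f x (mlieBracket I V W x) =
      mvfderiv I (fun y => mvfderiv I f y (W y)) x (V x)
        - mvfderiv I (fun y => mvfderiv I f y (V y)) x (W x) := by
  have : IsManifold I 1 M := IsManifold.of_le (n := ∞) (by simp)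
  have : IsManifold I 2 M :=
    IsManifold.of_le (n := ∞) (by simpa using (WithTop.coe_le_coe.2 (le_top : (2 : ℕ∞) ≤ ⊤)))
  set φ := extChartAt I x with hφ
  have hx : φ x ∈ φ.target := mem_extChartAt_target x
  have hsx : φ.symm (φ x) = x := extChartAt_to_inv x
  have hd : ∀ {g : M → ℝ}, ContMDiff I 𝓘(ℝ, ℝ) ∞ g → ∀ y, MDifferentiableAt I 𝓘(ℝ, ℝ) g y :=
    fun h y => h.contMDiffAt.mdifferentiableAt (by simp)
  have key : ∀ {g : M → ℝ}, ContMDiff I 𝓘(ℝ, ℝ) ∞ g → ∀ U : Π y : M, TangentSpace I y,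
      mvfderiv I g x (U x) = fderivWithin ℝ (g ∘ φ.symm) (range I) (φ x)
        (mpullbackWithin 𝓘(ℝ, E) I φ.symm U (range I) (φ x)) := by
    intro g hg U
    rw [fderivWithin_comp_extChartAt_symm x hx (hd hg _) U]
    rw [← hφ, hsx]
  have key' : ∀ U : Π y : M, TangentSpace I y,
      (fun y => mvfderiv I f y (U y)) ∘ φ.symm =ᶠ[𝓝[range I] (φ x)] fun z =>
        fderivWithin ℝ (f ∘ φ.symm) (range I) z
          (mpullbackWithin 𝓘(ℝ, E) I φ.symm U (range I) z) := by
    intro U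
    filter_upwards [extChartAt_target_mem_nhdsWithin (I := I) x] with z hz
    exact (fderivWithin_comp_extChartAt_symm x hz (hd hf _) U).symm
  have hxr : φ x ∈ range I := mem_range_self _
  have hdiff : ∀ {U : Π y : M, TangentSpace I y},
      (ContMDiff I I.tangent ∞ fun y => (⟨y, U y⟩ : TangentBundle I M)) →
      DifferentiableWithinAt ℝ (mpullbackWithin 𝓘(ℝ, E) I φ.symm U (range I)) (range I) (φ x) := by
    intro U hU
    have := (hU.contMDiffAt (x := x)).mdifferentiableAt (by simp)
    have := (mdifferentiableWithinAt_univ.2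
      this).differentiableWithinAt_mpullbackWithin_vectorField
    rwa [preimage_univ, univ_inter] at this
  have hcd : ContDiffWithinAt ℝ ∞ (f ∘ φ.symm) (range I) (φ x) :=
    (contMDiffAt_iff.1 (hf.contMDiffAt (x := x))).2
  rw [key hWf V, key hVf W, (key' W).fderivWithin_eq ((key' W).self_of_nhdsWithin hxr),
    (key' V).fderivWithin_eq ((key' V).self_of_nhdsWithin hxr),
    ← VectorField.fderivWithin_apply_lieBracket hcd
      (by simpa using (WithTop.coe_le_coe.2 (le_top : (2 : ℕ∞) ≤ ⊤)))
      I.uniqueDiffOn (I.range_subset_closure_interior hxr) hxr (hdiff hW) (hdiff hV)]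
  -- At its base point the derivative of the preferred chart is the identity, so no transformation
  -- of the bracket remains.
  have hbr : mlieBracket I V W x = lieBracketWithin ℝ
      (mpullbackWithin 𝓘(ℝ, E) I φ.symm V (range I))
      (mpullbackWithin 𝓘(ℝ, E) I φ.symm W (range I)) (range I) (φ x) := by
    rw [← mlieBracketWithin_univ, mlieBracketWithin_apply, preimage_univ, univ_inter,
      mfderiv_extChartAt_self]
    exact congrArg (fun T : E →L[ℝ] E => T _) ContinuousLinearMap.inverse_id
  rw [hbr, MDifferentiableAt.mvfderiv (hd hf x)]
  rfl

end VectorField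

section Geometry
open Set Topology VectorField

variable {M : Type*} [TopologicalSpace M] [ChartedSpace E3 M] [IsManifold (𝓡 3) ∞ M]

/-! ## Tangent vectors are determined by the derivatives of smooth functions -/

/-- A bump function times a chart coordinate is a globally smooth function that agrees with the
coordinate near x; its derivative is the corresponding component of the vector. -/
theorem eq_zero_of_mvfderiv_eq_zero [T2Space M] {x : M} {v : TangentSpace (𝓡 3) x}
    (h : ∀ f : SmoothM M, mvfderiv (𝓡 3) f x v = 0) : v = 0 := by
  have : IsManifold (𝓡 3) 1 M := IsManifold.of_le (n := ∞) (by simp)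
  obtain ⟨b⟩ : Nonempty (SmoothBumpFunction (𝓡 3) x) := inferInstance
  have key : ∀ i : Fin 3, (show E3 from v) i = 0 := by
    intro i
    let ℓ : E3 →L[ℝ] ℝ := EuclideanSpace.proj i
    have hs : ContMDiff (𝓡 3) 𝓘(ℝ, ℝ) ∞ fun y => b y • ℓ (extChartAt (𝓡 3) x y) :=
      b.contMDiff_smul (ℓ.contMDiff.comp_contMDiffOn contMDiffOn_extChartAt)
    have h1 := h ⟨_, hs⟩
    have he : (fun y => b y • ℓ (extChartAt (𝓡 3) x y)) =ᶠ[𝓝 x] ℓ ∘ extChartAt (𝓡 3) x := by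
      filter_upwards [b.eventuallyEq_one] with y hy
      simp [hy]
    have h2 : mfderiv (𝓡 3) 𝓘(ℝ, ℝ) (fun y => b y • ℓ (extChartAt (𝓡 3) x y)) x v = 0 := h1
    rw [he.mfderiv_eq, mfderiv_comp (I' := 𝓘(ℝ, E3)) x ℓ.mdifferentiableAt
      (mdifferentiableAt_extChartAt (mem_chart_source E3 x)), mfderiv_extChartAt_self] at h2
    rw [ContinuousLinearMap.mfderiv_eq] at h2
    exact h2
  exact PiLp.ext key

/-- The coordinate `τ` of `Ω = [0,∞) × M`. -/
noncomputable def tauFun : SmoothΩ M :=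
  ⟨fun q => q.1.1 0, ((EuclideanSpace.proj (𝕜 := ℝ) (0 : Fin 1)).contMDiff.comp
    ((𝓡∂ 1).contMDiff (n := ∞))).comp contMDiff_fst⟩

theorem mvfderiv_tauFun (q : HalfLine × M) (z : TangentSpace IΩ q) :
    mvfderiv IΩ (tauFun (M := M)) q z = (show EuclideanSpace ℝ (Fin 1) × E3 from z).1 0 := by
  let ℓ : EuclideanSpace ℝ (Fin 1) →L[ℝ] ℝ := EuclideanSpace.proj (0 : Fin 1)
  have h := (((ℓ.hasMFDerivAt (x := (𝓡∂ 1) q.1)).comp q.1 ((𝓡∂ 1).hasMFDerivAt)).comp q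
    (hasMFDerivAt_fst (I := 𝓡∂ 1) (I' := 𝓡 3) q)).mfderiv
  exact congrArg (fun T => T z) h

theorem mvfderiv_pullback (f : SmoothM M) (q : HalfLine × M) (z : TangentSpace IΩ q) :
    mvfderiv IΩ (pullback f) q z =
      mvfderiv (𝓡 3) f q.2 (show EuclideanSpace ℝ (Fin 1) × E3 from z).2 := by
  have h := ((f.contMDiff.contMDiffAt (x := q.2)).mdifferentiableAt (by simp)).hasMFDerivAt.comp q
    (hasMFDerivAt_snd (I := 𝓡∂ 1) (I' := 𝓡 3) q)
  exact congrArg (fun T => T z) h.mfderiv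

theorem eq_zero_of_mvfderiv_prod_eq_zero [T2Space M] {q : HalfLine × M} {z : TangentSpace IΩ q}
    (hτ : mvfderiv IΩ (tauFun (M := M)) q z = 0)
    (h : ∀ f : SmoothM M, mvfderiv IΩ (pullback f) q z = 0) : z = 0 := by
  have h1 : (show EuclideanSpace ℝ (Fin 1) × E3 from z).2 = 0 :=
    eq_zero_of_mvfderiv_eq_zero (x := q.2) fun f => by rw [← mvfderiv_pullback]; exact h f
  have h2 : (show EuclideanSpace ℝ (Fin 1) × E3 from z).1 = 0 := by
    refine PiLp.ext fun i => ?_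
    rw [Subsingleton.elim i 0, ← mvfderiv_tauFun]
    exact hτ
  exact Prod.ext h2 h1

/-! ## The frame of `Ω` -/

/-- The vector fields `∂₀, L₁, L₂, L₃` on `Ω`. -/
noncomputable def Frame.field (L : Frame M) (μ : Fin 4) : (q : HalfLine × M) → TangentSpace IΩ q :=
  Fin.cases timeField (fun i => spaceField (L.L i)) μ

theorem Frame.contMDiff_field (L : Frame M) (μ : Fin 4) :
    ContMDiff IΩ IΩ.tangent ∞ fun q => (⟨q, L.field μ q⟩ : TangentBundle IΩ (HalfLine × M)) := by
  cases μ using Fin.cases with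
  | zero => exact contMDiff_timeField
  | succ i => exact contMDiff_spaceField (L.smooth i)

theorem frame4_D_apply (L : Frame M) (μ : Fin 4) (f : SmoothΩ M) (q : HalfLine × M) :
    (frame4 L).D μ f q = mvfderiv IΩ f q (L.field μ q) := by
  cases μ using Fin.cases <;> rfl

theorem frame4_D_zero_tauFun (L : Frame M) : (frame4 L).D 0 tauFun = 1 := by
  ext q
  rw [frame4_D_apply, mvfderiv_tauFun]
  simp [Frame.field, timeField]

theorem frame4_D_succ_tauFun (L : Frame M) (i : Fin 3) : (frame4 L).D i.succ tauFun = 0 := by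
  ext q
  rw [frame4_D_apply, mvfderiv_tauFun]
  rfl

theorem frame4_D_zero_pullback (L : Frame M) (f : SmoothM M) :
    (frame4 L).D 0 (pullback f) = 0 := by
  ext q
  rw [frame4_D_apply, mvfderiv_pullback]
  exact map_zero _

/-- The derivative of a smooth function on `M` along one of the vector fields of the frame. -/
noncomputable def Frame.deriv (L : Frame M) (i : Fin 3) (f : SmoothM M) : SmoothM M :=
  ⟨fun x => mvfderiv (𝓡 3) f x (L.L i x), by
    have h := (f.contMDiff.contMDiff_tangentMap (m := ∞) (by simp)).comp (L.smooth i)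
    exact (contMDiff_snd_tangentBundle_modelSpace ℝ 𝓘(ℝ, ℝ)).comp h⟩

theorem frame4_D_succ_pullback (L : Frame M) (i : Fin 3) (f : SmoothM M) :
    (frame4 L).D i.succ (pullback f) = pullback (L.deriv i f) := by
  ext q
  rw [frame4_D_apply, mvfderiv_pullback]
  rfl

theorem frame4_dir_apply (L : Frame M) (u : Fin 4 → SmoothΩ M) (f : SmoothΩ M)
    (q : HalfLine × M) :
    dir (frame4 L) u f q = mvfderiv IΩ f q (∑ μ, u μ q • L.field μ q) := by
  rw [dir, Fin.sum_univ_four, Fin.sum_univ_four]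
  simp only [map_add, map_smul, ← frame4_D_apply]
  rfl

theorem dir_zero {R : Type*} [CommRing R] [Algebra ℝ R] (F : FrameData R) (f : R) :
    dir F 0 f = 0 :=
  Finset.sum_eq_zero fun _ _ => zero_mul _

/-- Testing on τ isolates the component along ∂₀; testing on functions from M leaves a combination
of the L_i, which are linearly independent at each point. -/
theorem frame4_indep [T2Space M] (L : Frame M) (u : Fin 4 → SmoothΩ M)
    (h : ∀ f, dir (frame4 L) u f = 0) : u = 0 := by
  have h0 : u 0 = 0 := by
    have := h tauFun
    rwa [dir, Fin.sum_univ_succ, frame4_D_zero_tauFun, mul_one, Finset.sum_eq_zero, add_zero]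
      at this
    intro i _
    rw [frame4_D_succ_tauFun, mul_zero]
  have h1 : ∀ q : HalfLine × M, ∑ i : Fin 3, u i.succ q • L.L i q.2 = 0 := by
    refine fun q => eq_zero_of_mvfderiv_eq_zero fun f => ?_
    have := congrArg (fun g : SmoothΩ M => g q) (h (pullback f))
    rw [dir, Fin.sum_univ_succ, h0, zero_mul, zero_add, Fin.sum_univ_three] at this
    simp only [frame4_D_succ_pullback] at this
    rw [Fin.sum_univ_three]
    simp only [map_add, map_smul]
    refine Eq.trans ?_ this
    rfl
  funext μ
  ext q
  cases μ using Fin.cases with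
  | zero => rw [h0]; rfl
  | succ i => exact Fintype.linearIndependent_iff.1 (L.linearIndependent q.2) _ (h1 q) i

theorem Frame.deriv_comm (L : Frame M) (i j : Fin 3) (f : SmoothM M) :
    L.deriv i (L.deriv j f) - L.deriv j (L.deriv i f) =
      ∑ k, L.structureFun i j k * L.deriv k f := by
  ext x
  have h := mvfderiv_mlieBracket f.contMDiff (L.smooth i) (L.smooth j) (L.deriv i f).contMDiff
    (L.deriv j f).contMDiff x
  refine h.symm.trans ?_
  nth_rewrite 1 [← (L.basis x).sum_repr (mlieBracket (𝓡 3) (L.L i) (L.L j) x)]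
  rw [map_sum, Fin.sum_univ_three, Fin.sum_univ_three]
  simp only [map_smul, show ∀ k, L.basis x k = L.L k x by simp [Frame.basis]]
  rfl

theorem frame4_c_left (L : Frame M) (ν ρ : Fin 4) : (frame4 L).c 0 ν ρ = 0 := rfl

theorem frame4_c_mid (L : Frame M) (μ ρ : Fin 4) : (frame4 L).c μ 0 ρ = 0 := by
  cases μ using Fin.cases <;> rfl

theorem frame4_c_right (L : Frame M) (μ ν : Fin 4) : (frame4 L).c μ ν 0 = 0 := by
  cases μ using Fin.cases
  · rfl
  · cases ν using Fin.cases <;> rfl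

/-- The difference of the two sides is the derivative of f along a tangent vector that does not
depend on f. This vector vanishes if it annihilates τ and all functions pulled back from M, and for
these the commutators are computed directly from the relations on M. -/
theorem frame4_comm [T2Space M] (L : Frame M) (μ ν : Fin 4) (f : SmoothΩ M) :
    (frame4 L).D μ ((frame4 L).D ν f) - (frame4 L).D ν ((frame4 L).D μ f) =
      ∑ ρ, (frame4 L).c μ ν ρ * (frame4 L).D ρ f := by
  have key : ∀ g : SmoothΩ M, ∀ q,
      ((frame4 L).D μ ((frame4 L).D ν g) - (frame4 L).D ν ((frame4 L).D μ g)
        - dir (frame4 L) ((frame4 L).c μ ν) g) q = mvfderiv IΩ g q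
          (mlieBracket IΩ (L.field μ) (L.field ν) q - ∑ ρ, (frame4 L).c μ ν ρ q • L.field ρ q) := by
    intro g q
    have hD : ∀ κ, ((frame4 L).D κ g : HalfLine × M → ℝ) = fun y => mvfderiv IΩ g y (L.field κ y) :=
      fun κ => funext fun y => frame4_D_apply L κ g y
    have h := mvfderiv_mlieBracket g.contMDiff (L.contMDiff_field μ) (L.contMDiff_field ν)
      (by rw [← hD]; exact ContMDiffMap.contMDiff _) (by rw [← hD]; exact ContMDiffMap.contMDiff _) q
    rw [map_sub, h, ← frame4_dir_apply, ← hD, ← hD, ← frame4_D_apply, ← frame4_D_apply]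
    rfl
  have hz : ∀ q, mlieBracket IΩ (L.field μ) (L.field ν) q
      - ∑ ρ, (frame4 L).c μ ν ρ q • L.field ρ q = 0 := by
    intro q
    refine eq_zero_of_mvfderiv_prod_eq_zero ?_ fun φ => ?_
    · rw [← key]
      have h1 : ∀ κ ρ : Fin 4, (frame4 L).D κ ((frame4 L).D ρ (tauFun (M := M))) = 0 := by
        intro κ ρ
        cases ρ using Fin.cases with
        | zero => rw [frame4_D_zero_tauFun, Derivation.map_one_eq_zero]
        | succ i => rw [frame4_D_succ_tauFun, map_zero]
      have h2 : dir (frame4 L) ((frame4 L).c μ ν) tauFun = 0 := by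
        rw [dir, Fin.sum_univ_succ, frame4_c_right, zero_mul, zero_add]
        exact Finset.sum_eq_zero fun i _ => by rw [frame4_D_succ_tauFun, mul_zero]
      rw [h1, h1, h2, sub_zero, sub_zero]
      rfl
    · rw [← key]
      suffices h : (frame4 L).D μ ((frame4 L).D ν (pullback φ))
          - (frame4 L).D ν ((frame4 L).D μ (pullback φ))
          - dir (frame4 L) ((frame4 L).c μ ν) (pullback φ) = 0 by rw [h]; rfl
      cases μ using Fin.cases with
      | zero =>
        have : (frame4 L).c 0 ν = 0 := funext fun ρ => frame4_c_left L ν ρ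
        rw [this, dir_zero, frame4_D_zero_pullback, map_zero, sub_zero, sub_zero]
        cases ν using Fin.cases with
        | zero => rw [frame4_D_zero_pullback, map_zero]
        | succ i => rw [frame4_D_succ_pullback, frame4_D_zero_pullback]
      | succ i =>
        cases ν using Fin.cases with
        | zero =>
          have : (frame4 L).c i.succ 0 = 0 := funext fun ρ => frame4_c_mid L i.succ ρ
          rw [this, dir_zero, frame4_D_zero_pullback, map_zero, frame4_D_succ_pullback,
            frame4_D_zero_pullback, sub_zero, sub_zero]
        | succ j =>
          simp only [frame4_D_succ_pullback, dir]
          rw [Fin.sum_univ_succ, frame4_D_zero_pullback, mul_zero, zero_add, sub_eq_zero]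
          simp only [frame4_D_succ_pullback]
          refine (congrArg pullback (L.deriv_comm i j φ)).trans ?_
          rw [Fin.sum_univ_three, Fin.sum_univ_three]
          rfl
  rw [← sub_eq_zero]
  ext q
  refine (key f q).trans ?_
  rw [hz, map_zero]
  rfl

end Geometry

section Geometry
open Set Topology MeasureTheory

variable {M : Type*} [TopologicalSpace M] [ChartedSpace E3 M]

/-! ## Integration in the direction of `τ` -/

/-- The coordinate axis of the Euclidean line. -/
noncomputable def timeAxis : ℝ →L[ℝ] EuclideanSpace ℝ (Fin 1) :=
  ContinuousLinearMap.toSpanSingleton ℝ (EuclideanSpace.single 0 1)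

theorem timeAxis_apply_zero (t : ℝ) : timeAxis t 0 = t := by simp [timeAxis]

theorem timeAxis_coord (v : EuclideanSpace ℝ (Fin 1)) : timeAxis (v 0) = v := by
  refine PiLp.ext fun i => ?_
  rw [Subsingleton.elim i 0, timeAxis_apply_zero]

theorem timeAxis_mem_range {t : ℝ} (ht : 0 ≤ t) : timeAxis t ∈ range (𝓡∂ 1) := by
  rw [range_modelWithCornersEuclideanHalfSpace, mem_ofPred_eq, timeAxis_apply_zero]
  exact ht

/-- The point of `[0,∞)` with coordinate `max t 0`. -/
noncomputable def halfLinePoint (t : ℝ) : HalfLine := (𝓡∂ 1).symm (timeAxis t)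

theorem halfLinePoint_coord (s : HalfLine) : halfLinePoint (s.1 0) = s := by
  rw [halfLinePoint, timeAxis_coord]
  exact (𝓡∂ 1).left_inv s

theorem coord_halfLinePoint {t : ℝ} (ht : 0 ≤ t) : (halfLinePoint t).1 0 = t := by
  refine Eq.trans ?_ (timeAxis_apply_zero t)
  exact congrArg (fun v : EuclideanSpace ℝ (Fin 1) => v 0)
    ((𝓡∂ 1).right_inv (timeAxis_mem_range ht))

theorem continuous_halfLinePoint : Continuous halfLinePoint :=
  (𝓡∂ 1).continuous_symm.comp timeAxis.continuous

theorem contMDiffOn_halfLinePoint : ContMDiffOn 𝓘(ℝ, ℝ) (𝓡∂ 1) ∞ halfLinePoint (Ici 0) :=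
  ((𝓡∂ 1).contMDiffOn_symm (n := ∞)).comp timeAxis.contMDiff.contMDiffOn
    fun _ ht => timeAxis_mem_range ht

/-- The integral of a function on `Ω` from `0` to `τ`. -/
noncomputable def timeIntegral (g : SmoothΩ M) (q : HalfLine × M) : ℝ :=
  ∫ v in (0 : ℝ)..q.1.1 0, g (halfLinePoint v, q.2)

/-- Rescaling to the fixed interval [0,1] puts τ into the integrand, so smoothness in τ and in the
point of M follows from one statement about parametric integrals. -/
theorem timeIntegral_eq (g : SmoothΩ M) (q : HalfLine × M) :
    timeIntegral g q = q.1.1 0 * ∫ u in (0 : ℝ)..1, g (halfLinePoint (u * q.1.1 0), q.2) := by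
  have := intervalIntegral.mul_integral_comp_mul_right (a := 0) (b := 1)
    (f := fun v => g (halfLinePoint v, q.2)) (q.1.1 0)
  rw [this, zero_mul, one_mul, timeIntegral]

theorem contMDiff_timeIntegral [IsManifold (𝓡 3) ∞ M] (g : SmoothΩ M) :
    ContMDiff IΩ 𝓘(ℝ, ℝ) ∞ (timeIntegral g) := by
  intro q₀
  set φ := extChartAt (𝓡 3) q₀.2 with hφ
  obtain ⟨r, hr, hrt⟩ := Metric.isOpen_iff.1 (isOpen_extChartAt_target (I := 𝓡 3) q₀.2) _
    (mem_extChartAt_target (I := 𝓡 3) q₀.2)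
  -- A convex coordinate domain which contains the boundary τ = 0; rescaling τ by u in [0,1] keeps
  -- it nonnegative.
  set S : Set (ℝ × E3) := Ici 0 ×ˢ Metric.ball (φ q₀.2) r with hS
  have hSc : Convex ℝ S := (convex_Ici 0).prod (convex_ball _ _)
  have hSu : UniqueDiffOn ℝ S := (uniqueDiffOn_Ici 0).prod Metric.isOpen_ball.uniqueDiffOn
  set G : (ℝ × E3) × ℝ → ℝ := fun w => g (halfLinePoint (w.2 * w.1.1), φ.symm w.1.2) with hG
  have hGd : ContDiffOn ℝ ∞ G (S ×ˢ Icc 0 1) := by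
    rw [← contMDiffOn_iff_contDiffOn]
    refine g.contMDiff.comp_contMDiffOn (ContMDiffOn.prodMk ?_ ?_)
    · refine contMDiffOn_halfLinePoint.comp (ContDiff.contMDiff (by fun_prop)).contMDiffOn ?_
      rintro w ⟨⟨h1, -⟩, h2, -⟩
      exact mul_nonneg h2 h1
    · refine (contMDiffOn_extChartAt_symm q₀.2).comp
        (ContDiff.contMDiff (by fun_prop)).contMDiffOn ?_
      rintro w ⟨⟨-, h1⟩, -⟩
      exact hrt h1
  have hI : ContDiffOn ℝ ∞ (fun y : ℝ × E3 => y.1 * ∫ u in (0 : ℝ)..1, G (y, u)) S :=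
    contDiffOn_fst.mul (contDiffOn_infty.2 fun n =>
      contDiffOn_integral_of_convex hSc hSu n (hGd.of_le (by exact_mod_cast le_top)))
  set U : Set (HalfLine × M) := Prod.snd ⁻¹' (φ.source ∩ φ ⁻¹' Metric.ball (φ q₀.2) r) with hU
  have hUn : U ∈ 𝓝 q₀ := by
    refine continuous_snd.continuousAt.preimage_mem_nhds ?_
    refine Filter.inter_mem (extChartAt_source_mem_nhds q₀.2)
      ((continuousAt_extChartAt q₀.2).preimage_mem_nhds (Metric.ball_mem_nhds _ hr))
  have hc : ContMDiffOn IΩ 𝓘(ℝ, ℝ × E3) ∞ (fun q : HalfLine × M => (q.1.1 0, φ q.2)) U := by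
    refine ContMDiffOn.prodMk_space (tauFun (M := M)).contMDiff.contMDiffOn ?_
    refine contMDiffOn_extChartAt.comp contMDiffOn_snd fun q hq => ?_
    rw [← extChartAt_source (𝓡 3)]
    exact hq.1
  have hcomp := hI.contMDiffOn.comp hc fun q hq => ⟨q.1.2, hq.2⟩
  refine (hcomp.contMDiffAt hUn).congr_of_eventuallyEq ?_
  filter_upwards [hUn] with q hq
  rw [timeIntegral_eq]
  simp only [Function.comp_apply, hG, φ.left_inv hq.1]

/-- The fundamental theorem of calculus, with one-sided derivatives at τ = 0. -/
theorem frame4_D_zero_surjective [IsManifold (𝓡 3) ∞ M] (L : Frame M) (g : SmoothΩ M) :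
    ∃ f, (frame4 L).D 0 f = g := by
  refine ⟨⟨timeIntegral g, contMDiff_timeIntegral g⟩, ?_⟩
  ext q
  refine (frame4_D_apply L 0 _ q).trans ?_
  have hd : MDifferentiableAt IΩ 𝓘(ℝ, ℝ) (timeIntegral g) q :=
    (contMDiff_timeIntegral g).contMDiffAt.mdifferentiableAt (by simp)
  have hd1 : MDifferentiableAt (𝓡∂ 1) 𝓘(ℝ, ℝ) (fun s => timeIntegral g (s, q.2)) q.1 :=
    MDifferentiableAt.comp (I' := IΩ) q.1 hd
      (mdifferentiableAt_id.prodMk mdifferentiableAt_const)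
  have h1 : mvfderiv IΩ (timeIntegral g) q (L.field 0 q) =
      mfderiv (𝓡∂ 1) 𝓘(ℝ, ℝ) (fun s => timeIntegral g (s, q.2)) q.1
        (EuclideanSpace.single 0 1 : EuclideanSpace ℝ (Fin 1)) := by
    refine (mfderiv_prod_eq_add_apply hd).trans ?_
    exact (congrArg _ (map_zero _)).trans (add_zero _)
  refine h1.trans ?_
  -- The manifold derivative on [0,∞) is a derivative within the range of the model; composing with
  -- the coordinate axis makes it a derivative of a function of one real variable within [0,∞).
  have h2 := hd1.hasMFDerivAt.2
  rw [show extChartAt (𝓡∂ 1) q.1 q.1 = timeAxis (q.1.1 0) from (timeAxis_coord _).symm] at h2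
  have h3 := h2.comp_hasDerivWithinAt (q.1.1 0)
    (timeAxis.hasDerivAt.hasDerivWithinAt (s := Ici 0)) fun t ht => timeAxis_mem_range ht
  have hcont : Continuous fun v : ℝ => g (halfLinePoint v, q.2) :=
    g.contMDiff.continuous.comp (continuous_halfLinePoint.prodMk continuous_const)
  have h4 := (hcont.integral_hasStrictDerivAt 0 (q.1.1 0)).hasDerivAt.hasDerivWithinAt (s := Ici 0)
  rw [halfLinePoint_coord] at h4
  have h5 : ∀ t ∈ Ici (0 : ℝ), timeIntegral g (halfLinePoint t, q.2) =
      ∫ v in (0 : ℝ)..t, g (halfLinePoint v, q.2) := by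
    intro t ht
    rw [timeIntegral, coord_halfLinePoint ht]
  have h6 := h4.congr h5 (h5 _ q.1.2)
  -- Derivatives within [0,∞) are unique also at 0, so the two computations agree.
  have h7 := (uniqueDiffOn_Ici (0 : ℝ) _ q.1.2).eq_deriv _ h3 h6
  rw [show timeAxis 1 = EuclideanSpace.single 0 1 by simp [timeAxis]] at h7
  exact h7

end Geometry

/-! ### Verification of the hypotheses of gauge fixing and the theorem -/

section Geometry

variable {M : Type*} [TopologicalSpace M] [ChartedSpace E3 M]

theorem isUnit_pullback {f : SmoothM M} (hf : ∀ x, f x ≠ 0) : IsUnit (pullback f) := by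
  refine IsUnit.of_mul_eq_one (pullback ⟨fun x => (f x)⁻¹, f.contMDiff.inv₀ hf⟩) ?_
  ext q
  exact mul_inv_cancel₀ (hf q.2)

theorem gaugeFixable_frame4 [IsManifold (𝓡 3) ∞ M] [T2Space M] (L : Frame M)
    (p : Fin 3 → SmoothM M)
    (hp : ∀ x : M, p 0 x ≠ p 1 x ∧ p 1 x ≠ p 2 x ∧ p 2 x ≠ p 0 x) :
    GaugeFixable (frame4 L) fun i => pullback (p i) where
  frame := ⟨frame4_comm L, frame4_indep L⟩
  c_mid := frame4_c_mid L
  c_right := frame4_c_right L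
  surj := frame4_D_zero_surjective L
  unit i := by
    have h : ∀ x, p (i + 2) x - p (i + 1) x ≠ 0 := by
      intro x
      obtain ⟨h1, h2, h3⟩ := hp x
      rw [sub_ne_zero]
      fin_cases i
      exacts [h2.symm, h3.symm, h1.symm]
    exact isUnit_pullback (f := p (i + 2) - p (i + 1)) h

end Geometry

end BKL

theorem lemma3 (M : Type*) [TopologicalSpace M] [ChartedSpace (EuclideanSpace ℝ (Fin 3)) M]
    [IsManifold (𝓡 3) ∞ M] [CompactSpace M] [T2Space M] (L : BKL.Frame M)
    (p₀ : C^∞⟮𝓡 3, M; ℝ⟯) (p : Fin 3 → C^∞⟮𝓡 3, M; ℝ⟯)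
    (hp : 3 * p₀ ^ 2 = p 1 * p 2 + p 2 * p 0 + p 0 * p 1)
    (hanisotropic : ∀ x : M, p 0 x ≠ p 1 x ∧ p 1 x ≠ p 2 x ∧ p 2 x ≠ p 0 x)
    (γ₀ : BKL.A (BKL.SmoothΩ M))
    (hγ₀ : γ₀ = BKL.gamma0 (BKL.pullback p₀) fun i => BKL.pullback (p i))
    (m n : ℕ) :
    -- the automorphisms `exp(a)`, `a ∈ 𝓐⁰[[t]]^×/I_n`, are a group `G` acting on the set of
    -- Maurer-Cartan elements `x ∈ (γ₀ + 𝓐[[t]]^×)/I_n`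
    (∃ G : Subgroup (Equiv.Perm (BKL.Ser (BKL.SmoothΩ M) m n)),
      (∀ g ∈ G, ∃ a : BKL.Ser (BKL.SmoothΩ M) m n,
        a.IsGaugeParameter ∧ ⇑g = BKL.serExp (BKL.frame4 L) a) ∧
      (∀ a : BKL.Ser (BKL.SmoothΩ M) m n, a.IsGaugeParameter →
        ∃ g ∈ G, ⇑g = BKL.serExp (BKL.frame4 L) a) ∧
      (∀ g ∈ G, ∀ x ∈ BKL.mcSet (BKL.frame4 L) γ₀ m n,
        g x ∈ BKL.mcSet (BKL.frame4 L) γ₀ m n) ∧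
      -- every `G`-orbit contains an element of the affine gauge subspace
      (∀ x ∈ BKL.mcSet (BKL.frame4 L) γ₀ m n,
        ∃ y ∈ BKL.gaugedSet (BKL.frame4 L) γ₀ m n, ∃ g ∈ G, g y = x)) ∧
    -- if the lower orders are gauged, then an element of `exp((t)^n 𝓐⁰[[t]]/I_n)` suffices
    (1 ≤ n → ∀ x ∈ BKL.mcSet (BKL.frame4 L) γ₀ m n,
      (∀ k, k.1.degree < n →
        BKL.IsGauge ((x - BKL.Ser.const γ₀ : BKL.Ser (BKL.SmoothΩ M) m n) k)) →
      ∃ a : BKL.Ser (BKL.SmoothΩ M) m n, a.IsTopGaugeParameter ∧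
        BKL.serExp (BKL.frame4 L) a x ∈ BKL.gaugedSet (BKL.frame4 L) γ₀ m n) := by
  subst hγ₀
  have hF := BKL.gaugeFixable_frame4 L p hanisotropic
  obtain ⟨G, hG, hG'⟩ := BKL.exists_gaugeGroup hF.frame m n
  refine ⟨⟨G, hG, hG', fun g hg x hx => ?_, fun x hx => BKL.exists_gauged hF hG hG' hx⟩,
    fun hn x hx hlow => BKL.exists_top_gauge hF hn hx hlow⟩
  obtain ⟨a, ha, h⟩ := hG g hg
  rw [h]
  exact BKL.serExp_mem_mcSet hF.frame ha hx
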